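/- Let $d=2$ or $d=3$. Fix a Littlewood--Paley function $\varphi\in C_c^\infty(\mathbb R^d)$ supported in $\{1/2\le|\xi|\le 2\}$ with $\sum_{j\in\mathbb Z}\varphi(2^{-j}\xi)=1$ for $\xi\neq0$, let $\dot\Delta_j f=\varphi(2^{-j}D)f$ be the homogeneous dyadic blocks, and let $\dot B^s_{2,1}$ be the space of tempered distributions $f$ on $\mathbb R^d$ with $f=\sum_{j\in\mathbb Z}\dot\Delta_j f$ in $\mathcal S'$ and $\|f\|_{\dot B^s_{2,1}}=\sum_{j}2^{js}\|\dot\Delta_jf\|_{L^2}<\infty$. For $T\in(0,\infty]$ (with $[0,T]$ read as $[0,\infty)$ if $T=\infty$) put $$F^{\sigma}_T=\mathcal C_b\big([0,T];\dot B^{\sigma-1}_{2,1}\big)^{2d}\cap L^1\big(0,T;\dot B^{\sigma+1}_{2,1}\big)^{2d}.$$ There exist two constants $c,C>0$ depending only on $d$ such that the following holds. Let $\alpha\ge0$ and let $u_0,b_0$ be two real divergence-free vector fields with coefficients in $\dot B^{\frac d2-1}_{2,1}\cap\dot B^{\frac d2+\alpha-1}_{2,1}$. Then there exist a time $T\in(0,\infty]$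 with $$T\ \ge\ \sup\Big\{T'>0\ \Big|\ \sum_{j\in\mathbb Z}2^{j(\frac d2-1)}\big(1-e^{-c2^{2j}T'}\big)^{\frac12}\big(\|\dot\Delta_ju_0\|_{L^2}+\|\dot\Delta_jb_0\|_{L^2}\big)\le C\Big\}$$ and a solution $(u,b)\in F^{\frac d2}_T\cap F^{\frac d2+\alpha}_T$, consisting of real vector fields, of $$\begin{cases}\partial_tu-\Delta u+u\cdot\nabla u-b\cdot\nabla b-\nabla P=0,\\ \partial_tb-\Delta b+u\cdot\nabla b-b\cdot\nabla u=0,\\ \operatorname{div}u=0,\quad\operatorname{div}b=0,\\ (u,b)|_{t=0}=(u_0,b_0),\end{cases}$$ on $[0,T]\times\mathbb R^d$, in the sense of distributions on $(0,T)\times\mathbb R^d$ and for some distribution $P$ on $(0,T)\times\mathbb R^d$. This solution is unique: for every $T_1\in(0,T]$, every solution on $[0,T_1]$ with the same data that belongs to $F^{\frac d2}_{T_1}\cap F^{\frac d2+\alpha}_{T_1}$ coincides with $(u,b)$ on $[0,T_1]$. -/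

import Mathlib

open MeasureTheory Filter Topology Set
open scoped ENNReal NNReal SchwartzMap Distributions ContDiff LineDeriv

noncomputable section

namespace MHD

/-- The space `ℝ^d` with its Euclidean norm. -/
abbrev Space (d : ℕ) := EuclideanSpace ℝ (Fin d)

/-- The vectors in which distributional vector fields take their values. -/
abbrev Vec (d : ℕ) := EuclideanSpace ℂ (Fin d)

/-- Tempered distributions on `ℝ^d` with `d` components. -/
abbrev TField (d : ℕ) := 𝓢'(Space d, Vec d)

/-- The `i`-th vector of the canonical basis of `ℝ^d`. -/
abbrev e {d : ℕ} (i : Fin d) : Space d := EuclideanSpace.single i (1 : ℝ)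

/-! ### Littlewood-Paley decomposition and homogeneous Besov spaces -/

/-- `φ` (playing the role of the Fourier transform of the Littlewood-Paley kernel) is smooth,
supported in the annulus `1/2 ≤ |ξ| ≤ 2`, and its dyadic dilations form a partition of unity
away from the origin. -/
structure IsLittlewoodPaley {d : ℕ} (φ : Space d → ℂ) : Prop where
  smooth : ContDiff ℝ ∞ φ
  support : tsupport φ ⊆ {ξ | 1 / 2 ≤ ‖ξ‖ ∧ ‖ξ‖ ≤ 2}
  partition : ∀ ξ : Space d, ξ ≠ 0 → HasSum (fun j : ℤ => φ ((2 : ℝ) ^ (-j) • ξ)) 1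

/-- The homogeneous dyadic block `Δ_j f`, the Fourier multiplier with symbol `φ(2^{-j} ξ)`. -/
def block {d : ℕ} (φ : Space d → ℂ) (j : ℤ) (f : TField d) : TField d :=
  TemperedDistribution.fourierMultiplierCLM (Vec d) (fun ξ => φ ((2 : ℝ) ^ (-j) • ξ)) f

/-- The `L²` norm of a tempered distribution; it is `∞` if the distribution is not given by a
function of `L²`. -/
def l2Norm {d : ℕ} (f : TField d) : ℝ≥0∞ :=
  ⨅ (g : Lp (Vec d) 2 (volume : Measure (Space d))) (_ : (g : TField d) = f), ‖g‖ₑ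

/-- The norm of the homogeneous Besov space of regularity `s`, with Lebesgue exponent `2` and
summation exponent `1`, namely `∑_j 2^{js} ‖Δ_j f‖_{L²}`. -/
def besovNorm {d : ℕ} (φ : Space d → ℂ) (s : ℝ) (f : TField d) : ℝ≥0∞ :=
  ∑' j : ℤ, (2 : ℝ≥0∞) ^ ((j : ℝ) * s) * l2Norm (block φ j f)

/-- `f` is the sum of its dyadic blocks in the sense of tempered distributions (equivalently, its
low frequency cut-offs `S_j f` tend to `0` as `j → -∞`). This selects one representative in a
class of distributions modulo polynomials. -/
def IsRealized {d : ℕ} (φ : Space d → ℂ) (f : TField d) : Prop :=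
  Tendsto (fun N : ℕ => ∑ j ∈ Finset.Icc (-(N : ℤ)) (N : ℤ), block φ j f) atTop (𝓝 f)

/-- Membership in the homogeneous Besov space of regularity `s`. -/
def MemBesov {d : ℕ} (φ : Space d → ℂ) (s : ℝ) (f : TField d) : Prop :=
  IsRealized φ f ∧ besovNorm φ s f < ⊤

/-! ### Spaces of time-dependent fields -/

/-- The time interval `[0,T]` (which is `[0,∞)` if `T = ∞`). -/
def timeInterval (T : ℝ≥0∞) : Set ℝ := {t | 0 ≤ t ∧ ENNReal.ofReal t ≤ T}

/-- Bounded and continuous functions on `[0,T]` with values in the Besov space of regularity `s`. -/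
structure MemCb {d : ℕ} (φ : Space d → ℂ) (T : ℝ≥0∞) (s : ℝ) (u : ℝ → TField d) : Prop where
  mem : ∀ t ∈ timeInterval T, MemBesov φ s (u t)
  bounded : ∃ M : ℝ≥0, ∀ t ∈ timeInterval T, besovNorm φ s (u t) ≤ M
  continuous : ∀ t₀ ∈ timeInterval T,
    Tendsto (fun t => besovNorm φ s (u t - u t₀)) (𝓝[timeInterval T] t₀) (𝓝 0)

/-- Integrable functions on `[0,T]` with values in the Besov space of regularity `s`. That space
is a separable metric space, so that measurability amounts to the measurability of the distances
to its points. -/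
structure MemL1 {d : ℕ} (φ : Space d → ℂ) (T : ℝ≥0∞) (s : ℝ) (u : ℝ → TField d) : Prop where
  mem : ∀ᵐ t ∂(volume.restrict (timeInterval T)), MemBesov φ s (u t)
  measurable : ∀ v : TField d, MemBesov φ s v →
    AEMeasurable (fun t => besovNorm φ s (u t - v)) (volume.restrict (timeInterval T))
  integrable : ∫⁻ t in timeInterval T, besovNorm φ s (u t) < ⊤

/-- The pair `(u,b)` belongs to
`F^σ_T = C_b([0,T]; B^{σ-1}_{2,1}) ∩ L¹(0,T; B^{σ+1}_{2,1})`. -/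
def MemF {d : ℕ} (φ : Space d → ℂ) (T : ℝ≥0∞) (σ : ℝ) (u b : ℝ → TField d) : Prop :=
  (MemCb φ T (σ - 1) u ∧ MemL1 φ T (σ + 1) u) ∧ (MemCb φ T (σ - 1) b ∧ MemL1 φ T (σ + 1) b)

/-! ### The incompressible MHD system -/

/-- The distribution `f` is real: its components are real on real test functions. -/
def IsRealField {d : ℕ} (f : TField d) : Prop :=
  ∀ g : 𝓢(Space d, ℂ), (∀ x, (g x).im = 0) → ∀ i, (f g i).im = 0

/-- `div f = 0` in the sense of tempered distributions. -/
def IsDivFree {d : ℕ} (f : TField d) : Prop :=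
  ∀ g : 𝓢(Space d, ℂ), ∑ i, ((∂_{(e i : Space d)} f : TField d) g) i = 0

/-- The tempered distribution `f` is given by the locally square integrable real vector field
`U`. -/
structure IsGivenBy {d : ℕ} (f : TField d) (U : Space d → Space d) : Prop where
  measurable : AEStronglyMeasurable U
  locallySqIntegrable : LocallyIntegrable (fun x => ‖U x‖ ^ 2)
  integrable : ∀ (g : 𝓢(Space d, ℂ)) (i : Fin d), Integrable (fun x => g x * (U x i : ℂ))
  eq_integral : ∀ (g : 𝓢(Space d, ℂ)) (i : Fin d), f g i = ∫ x, g x * (U x i : ℂ)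

/-- The open set `(0,T) × ℝ^d` of space-time. -/
def slab (d : ℕ) (T : ℝ≥0∞) : TopologicalSpace.Opens (ℝ × Space d) where
  carrier := {z | 0 < z.1 ∧ ENNReal.ofReal z.1 < T}
  is_open' := by
    refine (isOpen_lt continuous_const continuous_fst).inter
      (isOpen_lt (ENNReal.continuous_ofReal.comp continuous_fst) continuous_const)

/-- The time derivative of a test function. -/
def dt {d : ℕ} {T : ℝ≥0∞} (ψ : 𝓓(slab d T, ℝ)) : 𝓓(slab d T, ℝ) :=
  ∂_{((1, 0) : ℝ × Space d)} ψ

/-- The derivative of a test function in the space variable `x_i`. -/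
def dx {d : ℕ} {T : ℝ≥0∞} (i : Fin d) (ψ : 𝓓(slab d T, ℝ)) : 𝓓(slab d T, ℝ) :=
  ∂_{((0, e i) : ℝ × Space d)} ψ

/-- The Laplacian of a test function in the space variables. -/
def lap {d : ℕ} {T : ℝ≥0∞} (ψ : 𝓓(slab d T, ℝ)) : 𝓓(slab d T, ℝ) :=
  ∑ i, dx i (dx i ψ)

/-- The pairing of the `i`-th component of `∂_t w - Δ w + ∑_j ∂_j (v_j w - a_j c)` with the test
function `ψ` on `(0,T) × ℝ^d`. If `div v = div a = 0`, then the sum in this expression is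
`v·∇w - a·∇c`. For fields bounded and continuous in time with values in the Besov space of
regularity `d/2 - 1` (which is contained in `L^d`), both integrals converge absolutely. -/
def weakForm {d : ℕ} {T : ℝ≥0∞} (w v a c : ℝ → Space d → Space d) (i : Fin d)
    (ψ : 𝓓(slab d T, ℝ)) : ℝ :=
  ∫ t : ℝ, ∫ x : Space d,
    (- (w t x i * (dt ψ (t, x) + lap ψ (t, x)))
      - ∑ j, (v t x j * w t x i - a t x j * c t x i) * dx j ψ (t, x))

/-- `(u,b)` solves, on the time interval `[0,T]`, the incompressible MHD system
`∂_t u - Δ u + u·∇u - b·∇b - ∇P = 0`, `∂_t b - Δ b + u·∇b - b·∇u = 0`, `div u = div b = 0`,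
`(u,b)|_{t=0} = (u₀,b₀)`, for some pressure `P`. The two evolution equations
hold in the sense of distributions on `(0,T) × ℝ^d`, and the pressure is a distribution there. -/
structure IsSolution {d : ℕ} (T : ℝ≥0∞) (u₀ b₀ : TField d) (u b : ℝ → TField d) : Prop where
  initial_u : u 0 = u₀
  initial_b : b 0 = b₀
  div_u : ∀ t ∈ timeInterval T, IsDivFree (u t)
  div_b : ∀ t ∈ timeInterval T, IsDivFree (b t)
  equations : ∃ U B : ℝ → Space d → Space d,
    (∀ t ∈ timeInterval T, IsGivenBy (u t) (U t) ∧ IsGivenBy (b t) (B t)) ∧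
    (∃ P : 𝓓'(slab d T, ℝ), ∀ (i : Fin d) (ψ : 𝓓(slab d T, ℝ)),
      weakForm U U B B i ψ - (∂_{((0, e i) : ℝ × Space d)} P : 𝓓'(slab d T, ℝ)) ψ = 0) ∧
    (∀ (i : Fin d) (ψ : 𝓓(slab d T, ℝ)), weakForm B U B U i ψ = 0)

/-- The sum
`∑_j 2^{j(d/2-1)} (1 - e^{-c 2^{2j} T'})^{1/2} (‖Δ_j u₀‖_{L²} + ‖Δ_j b₀‖_{L²})`. -/
def lifespanSum {d : ℕ} (φ : Space d → ℂ) (c T' : ℝ) (u₀ b₀ : TField d) : ℝ≥0∞ :=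
  ∑' j : ℤ, (2 : ℝ≥0∞) ^ ((j : ℝ) * ((d : ℝ) / 2 - 1)) *
    ENNReal.ofReal (Real.sqrt (1 - Real.exp (-(c * (2 : ℝ) ^ (2 * j) * T')))) *
    (l2Norm (block φ j u₀) + l2Norm (block φ j b₀))

end MHD

end

/-!
The system is solved on the Fourier side. After elimination of the pressure by the projection
`leray` onto the vectors orthogonal to the frequency, the Fourier transform `z = (û, b̂)` satisfies
`z(t) = e^{-ν|ξ|²t} z₀ + duh(z, z)(t)`, where `ν = 4π²` and `duh` is the Duhamel integral of a
bilinear convolution with a symbol of size `O(|ξ|)` (`isSymbol_mhdSym`).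

*Existence.* For `h ≥ 0`, integration in time against `e^{-ν|ξ|²(t-s)}` maps `L¹` to `L²` with norm
`(2ν)^{-1/2}|ξ|^{-1}`, which compensates the factor `|ξ|` of the symbol. Hence the `L²` norm in time
`timeNorm` of `duh(f, g)` at the frequency `ξ` is at most a constant `κ` times the convolution of
the `L²` norms in time of `f` and `g` (`timeNorm_duh_le`). The iterates of the integral equation are
therefore bounded by the solution `Ω` of the stationary scalar equation `Ω = F + κ Ω * Ω`, where `F`
is the `L²` norm in time of the heat flow of the data. This equation is solved by an explicit power
series (`maj`) as soon as `8 κ ∫ F ≤ 1`, with `∫ Ω ≤ 2 ∫ F` (`lintegral_maj_le`), and the iterates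
converge (`exists_mild`). The smallness condition is critical: `L¹` in frequency of `L²` in time is
controlled by the Besov norm of regularity `d/2 - 1` of the data.

*Regularity.* The `n`-th term of the power series consists of convolutions of `n + 1` factors; its
frequencies beyond `r` come from the frequencies beyond `r/(n+1)` of one factor (`tail_majTerm_le`).
The loss is polynomial in `n`, and is absorbed by the geometric decay of the series. So every Besov
regularity of the data is inherited by `Ω` without any further smallness (`tailNorm_maj_lt_top`),
and the constants in the lifespan do not depend on `α`. Continuity in time and integrability with
two more derivatives follow from Duhamel's formula (`exists_regular_mild`). The inverse Fourier
transform of `z` is then a solution of the system, whose pressure is the part of the nonlinearity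
removed by the projection (`exists_solution`).

*Uniqueness.* Interpolation shows that the Fourier transform of any solution in the critical space
is square integrable in time with values in `L¹` (`MemF.exists_isRep`). Such a solution is mild: the
curl of the curl of the velocity equation eliminates the pressure, test functions with separated
variables give an ordinary differential equation at almost every frequency, and its solution is
Duhamel's formula (`IsSolution.mild`). The norm over `(0, τ]` of the difference `v` from the
solution constructed before is continuous in `τ`, vanishes at `τ = 0`, and satisfies `‖v‖ ≤ κ (‖v‖²
+ 2 N ‖v‖)` with `4 κ N ≤ 1`. It cannot leave the value zero (`mild_unique`).

*Lifespan.* On the block of frequencies `|ξ| ~ 2^j`, the `L²` norm of `e^{-ν|ξ|²t}` over `[0, T]` is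
at most a constant times `2^{-j} (1 - e^{-c 2^{2j} T})^{1/2}`. By the Cauchy-Schwarz inequality on
every block, `∫ F` is bounded by the sum in the statement (`lintegral_timeNorm_heat_le`), and the
bound passes to the supremum of the admissible times (`lintegral_timeNorm_le_of_sSup`). By dominated
convergence the sum tends to zero with the time (`tendsto_lifespanSum`), so that there are
admissible times.
-/

noncomputable section

open scoped FourierTransform ComplexConjugate

set_option linter.unusedSectionVars false

namespace MHD

section

/-! ### `L²` norms of functions with values in `[0,∞]` -/

section n2

variable {α β : Type*} [MeasurableSpace α] [MeasurableSpace β]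

/-- The `L²` norm of a function with values in `[0,∞]`. -/
def n2 (μ : Measure α) (F : α → ℝ≥0∞) : ℝ≥0∞ := (∫⁻ x, F x ^ 2 ∂μ) ^ (1 / 2 : ℝ)

lemma n2_sq (μ : Measure α) (F : α → ℝ≥0∞) : n2 μ F ^ 2 = ∫⁻ x, F x ^ 2 ∂μ := by
  rw [n2, ← ENNReal.rpow_natCast, ← ENNReal.rpow_mul]; norm_num

lemma n2_le_iff {μ : Measure α} {F : α → ℝ≥0∞} {a : ℝ≥0∞} :
    n2 μ F ≤ a ↔ ∫⁻ x, F x ^ 2 ∂μ ≤ a ^ 2 := by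
  rw [← n2_sq]
  exact (ENNReal.pow_le_pow_left_iff two_ne_zero).symm

lemma n2_mono_ae {μ : Measure α} {F G : α → ℝ≥0∞} (h : ∀ᵐ x ∂μ, F x ≤ G x) : n2 μ F ≤ n2 μ G := by
  rw [n2_le_iff, n2_sq]
  exact lintegral_mono_ae (h.mono fun x hx => pow_le_pow_left' hx 2)

lemma n2_mono {μ : Measure α} {F G : α → ℝ≥0∞} (h : ∀ x, F x ≤ G x) : n2 μ F ≤ n2 μ G :=
  n2_mono_ae (Eventually.of_forall h)

lemma n2_congr_ae {μ : Measure α} {F G : α → ℝ≥0∞} (h : ∀ᵐ x ∂μ, F x = G x) : n2 μ F = n2 μ G :=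
  le_antisymm (n2_mono_ae (h.mono fun _ h => h.le)) (n2_mono_ae (h.mono fun _ h => h.ge))

lemma n2_const_mul {μ : Measure α} {F : α → ℝ≥0∞} (c : ℝ≥0∞) (hc : c ≠ ⊤) :
    n2 μ (fun x => c * F x) = c * n2 μ F := by
  simp only [n2, mul_pow]
  rw [lintegral_const_mul' _ _ (by finiteness), ENNReal.mul_rpow_of_nonneg _ _ (by norm_num)]
  congr 1
  rw [← ENNReal.rpow_natCast, ← ENNReal.rpow_mul]; norm_num

lemma lintegral_mul_le_n2 {μ : Measure α} {F G : α → ℝ≥0∞} (hF : AEMeasurable F μ)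
    (hG : AEMeasurable G μ) : ∫⁻ x, F x * G x ∂μ ≤ n2 μ F * n2 μ G := by
  simpa [n2] using ENNReal.lintegral_mul_le_Lp_mul_Lq μ Real.HolderConjugate.two_two hF hG

lemma n2_add_le {μ : Measure α} {F G : α → ℝ≥0∞} (hF : AEMeasurable F μ)
    (hG : AEMeasurable G μ) : n2 μ (fun x => F x + G x) ≤ n2 μ F + n2 μ G := by
  simpa [n2] using ENNReal.lintegral_Lp_add_le hF hG (p := 2) (by norm_num)

/-- Minkowski's integral inequality in `L²`. -/
lemma n2_lintegral_le {μ : Measure α} {ν : Measure β} [SFinite μ] [SFinite ν]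
    {f : α → β → ℝ≥0∞} (hf : Measurable (Function.uncurry f)) :
    n2 μ (fun x => ∫⁻ y, f x y ∂ν) ≤ ∫⁻ y, n2 μ (fun x => f x y) ∂ν := by
  have m1 : ∀ x, Measurable (f x) := fun x => hf.comp measurable_prodMk_left
  have m2 : ∀ y, Measurable (fun x => f x y) := fun y => hf.comp measurable_prodMk_right
  have mn : Measurable fun y => n2 μ (fun x => f x y) := by
    unfold n2
    refine Measurable.pow_const ?_ _
    exact Measurable.lintegral_prod_left' (f := fun p : α × β => f p.1 p.2 ^ 2)
      ((hf.pow_const 2))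
  -- the square of the inner integral is a double integral, to which Cauchy-Schwarz in `x` applies
  rw [n2_le_iff]
  calc ∫⁻ x, (∫⁻ y, f x y ∂ν) ^ 2 ∂μ = ∫⁻ x, ∫⁻ y, ∫⁻ y', f x y * f x y' ∂ν ∂ν ∂μ := by
        refine lintegral_congr fun x => ?_
        rw [sq, ← lintegral_mul_const _ (m1 x)]
        exact lintegral_congr fun y => (lintegral_const_mul _ (m1 x)).symm
    _ = ∫⁻ y, ∫⁻ y', ∫⁻ x, f x y * f x y' ∂μ ∂ν ∂ν := by
        have h3 : Measurable fun p : (α × β) × β => f p.1.1 p.1.2 * f p.1.1 p.2 := by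
          apply Measurable.mul
          · exact hf.comp (measurable_fst.fst.prodMk measurable_fst.snd)
          · exact hf.comp (measurable_fst.fst.prodMk measurable_snd)
        rw [lintegral_lintegral_swap]
        · refine lintegral_congr fun y => ?_
          rw [lintegral_lintegral_swap]
          exact (((m2 y).comp measurable_fst).mul hf).aemeasurable
        · exact (Measurable.lintegral_prod_right' h3).aemeasurable
    _ ≤ ∫⁻ y, ∫⁻ y', n2 μ (fun x => f x y) * n2 μ (fun x => f x y') ∂ν ∂ν := by
        refine lintegral_mono fun y => lintegral_mono fun y' => ?_
        exact lintegral_mul_le_n2 (m2 y).aemeasurable (m2 y').aemeasurable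
    _ = (∫⁻ y, n2 μ (fun x => f x y) ∂ν) ^ 2 := by
        rw [sq, ← lintegral_mul_const _ mn]
        exact lintegral_congr fun y => lintegral_const_mul _ mn

lemma n2_tsum_le {μ : Measure α} [SFinite μ] {ι : Type*} [Countable ι]
    {f : ι → α → ℝ≥0∞} (hf : ∀ i, Measurable (f i)) :
    n2 μ (fun x => ∑' i, f i x) ≤ ∑' i, n2 μ (f i) := by
  let _ : MeasurableSpace ι := ⊤
  have : MeasurableSingletonClass ι := ⟨fun _ => trivial⟩
  have h := n2_lintegral_le (μ := μ) (ν := (Measure.count : Measure ι)) (f := fun x i => f i x)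
    (measurable_from_prod_countable_left (fun i => hf i))
  simpa [lintegral_count] using h

end n2

/-! ### Convolution of functions with values in `[0,∞]` -/

section conv

variable {d : ℕ}

/-- The convolution of two functions with values in `[0,∞]`. -/
def cv (F G : Space d → ℝ≥0∞) (ξ : Space d) : ℝ≥0∞ := ∫⁻ η, F (ξ - η) * G η

lemma measurable_cv {F G : Space d → ℝ≥0∞} (hF : Measurable F) (hG : Measurable G) :
    Measurable (cv F G) := by
  refine Measurable.lintegral_prod_right' (f := fun p : Space d × Space d => F (p.1 - p.2) * G p.2)
      ?_
  fun_prop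

lemma cv_comm (F G : Space d → ℝ≥0∞) : cv F G = cv G F := by
  ext ξ
  unfold cv
  rw [← lintegral_sub_left_eq_self _ ξ]
  simp [mul_comm]

lemma cv_tsum_right {ι : Type*} [Countable ι] {F : Space d → ℝ≥0∞} {G : ι → Space d → ℝ≥0∞}
    (hF : Measurable F) (hG : ∀ i, Measurable (G i)) (ξ : Space d) :
    cv F (fun η => ∑' i, G i η) ξ = ∑' i, cv F (G i) ξ := by
  unfold cv
  simp_rw [← ENNReal.tsum_mul_left]
  exact lintegral_tsum fun i => by have := hG i; fun_prop

lemma cv_tsum_left {ι : Type*} [Countable ι] {F : ι → Space d → ℝ≥0∞} {G : Space d → ℝ≥0∞}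
    (hF : ∀ i, Measurable (F i)) (hG : Measurable G) (ξ : Space d) :
    cv (fun η => ∑' i, F i η) G ξ = ∑' i, cv (F i) G ξ := by
  rw [cv_comm, cv_tsum_right hG hF]
  simp_rw [cv_comm]

lemma lintegral_cv {F G : Space d → ℝ≥0∞} (hF : Measurable F) (hG : Measurable G) :
    ∫⁻ ξ, cv F G ξ = (∫⁻ ξ, F ξ) * ∫⁻ ξ, G ξ := by
  unfold cv
  rw [lintegral_lintegral_swap (by fun_prop)]
  calc ∫⁻ η, ∫⁻ ξ, F (ξ - η) * G η = ∫⁻ η : Space d, (∫⁻ ξ, F ξ) * G η := by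
        refine lintegral_congr fun η => ?_
        rw [lintegral_mul_const _ (by fun_prop), lintegral_sub_right_eq_self F]
    _ = _ := lintegral_const_mul _ hG

lemma n2_cv_le {F G : Space d → ℝ≥0∞} (hF : Measurable F) (hG : Measurable G) :
    n2 volume (cv F G) ≤ (∫⁻ ξ, F ξ) * n2 volume G := by
  have h1 : cv F G = fun ξ => ∫⁻ η, F η * G (ξ - η) := by
    rw [cv_comm]; ext ξ; simp [cv, mul_comm]
  rw [h1]
  refine (n2_lintegral_le (f := fun ξ η => F η * G (ξ - η)) (by fun_prop)).trans ?_
  rw [← lintegral_mul_const _ hF]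
  refine lintegral_mono fun η => ?_
  rw [n2_le_iff, mul_pow, n2_sq, ← lintegral_sub_right_eq_self (fun ξ => G ξ ^ 2) η,
    ← lintegral_const_mul _ (by fun_prop)]
  simp [mul_pow]

/-- The `L²` norm of `f` over the frequencies `r ≤ |ξ|`. -/
def tail (f : Space d → ℝ≥0∞) (r : ℝ) : ℝ≥0∞ := n2 volume ({ξ | r ≤ ‖ξ‖}.indicator f)

lemma measurableSet_le_norm (r : ℝ) : MeasurableSet {ξ : Space d | r ≤ ‖ξ‖} :=
  measurableSet_le measurable_const measurable_norm

lemma tail_anti (f : Space d → ℝ≥0∞) {r r' : ℝ} (h : r ≤ r') : tail f r' ≤ tail f r :=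
  n2_mono fun ξ => indicator_le_indicator_of_subset (fun _ hx => h.trans hx) (fun _ => zero_le) ξ

lemma tail_mono_ae {f g : Space d → ℝ≥0∞} (h : ∀ᵐ ξ, f ξ ≤ g ξ) (r : ℝ) : tail f r ≤ tail g r :=
  n2_mono_ae (h.mono fun _ h => indicator_le_indicator h)

lemma tail_const_mul {f : Space d → ℝ≥0∞} (c : ℝ≥0∞) (hc : c ≠ ⊤) (r : ℝ) :
    tail (fun ξ => c * f ξ) r = c * tail f r := by
  unfold tail
  rw [← n2_const_mul c hc]
  congr 1
  ext ξ
  by_cases h : r ≤ ‖ξ‖ <;> simp [indicator, h]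

lemma tail_tsum_le {ι : Type*} [Countable ι] {f : ι → Space d → ℝ≥0∞} (hf : ∀ i, Measurable (f i))
    (r : ℝ) : tail (fun ξ => ∑' i, f i ξ) r ≤ ∑' i, tail (f i) r := by
  refine le_trans (le_of_eq ?_) (n2_tsum_le fun i => (hf i).indicator (measurableSet_le_norm r))
  unfold tail
  congr 1
  ext ξ
  by_cases h : r ≤ ‖ξ‖ <;> simp [indicator, h]

/-- If `|ξ| ≥ a + b`, then one of `ξ - η` and `η` has size at least `a`, respectively `b`: the high
frequencies of a convolution come from the high frequencies of one of the factors. -/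
lemma tail_cv_le {F G : Space d → ℝ≥0∞} (hF : Measurable F) (hG : Measurable G) (a b : ℝ) :
    tail (cv F G) (a + b) ≤ (∫⁻ ξ, F ξ) * tail G b + (∫⁻ ξ, G ξ) * tail F a := by
  have mF := hF.indicator (measurableSet_le_norm (d := d) a)
  have mG := hG.indicator (measurableSet_le_norm (d := d) b)
  calc tail (cv F G) (a + b)
      ≤ n2 volume (fun ξ => cv F ({ξ | b ≤ ‖ξ‖}.indicator G) ξ
          + cv ({ξ | a ≤ ‖ξ‖}.indicator F) G ξ) := by
        refine n2_mono fun ξ => ?_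
        by_cases h : a + b ≤ ‖ξ‖
        · rw [indicator_of_mem (by exact h)]
          unfold cv
          rw [← lintegral_add_left (by fun_prop)]
          refine lintegral_mono fun η => ?_
          by_cases h1 : b ≤ ‖η‖
          · simp [indicator, h1]
          · have h2 : a ≤ ‖ξ - η‖ := by
              have := norm_sub_norm_le ξ η
              push Not at h1
              linarith
            simp [indicator, h2]
        · simp [indicator, h]
    _ ≤ n2 volume (cv F ({ξ | b ≤ ‖ξ‖}.indicator G))
          + n2 volume (cv ({ξ | a ≤ ‖ξ‖}.indicator F) G) :=
        n2_add_le (measurable_cv hF mG).aemeasurable (measurable_cv mF hG).aemeasurable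
    _ ≤ _ := by
        gcongr
        · exact n2_cv_le hF mG
        · rw [cv_comm]; exact n2_cv_le hG mF

end conv

end

section

/-! ### Besov norms on the Fourier side and the stationary majorant -/

section majorant

variable {d : ℕ}

/-- The sum over `j` of `2^{jσ}` times the `L²` norm of `f` over the frequencies `2^j ≤ |ξ|`. For
`σ > 0` it is equivalent to the sum over dyadic shells; its advantage is that the tails of a
convolution are controlled without any loss, see `tail_cv_le`. -/
def tailNorm (σ : ℝ) (f : Space d → ℝ≥0∞) : ℝ≥0∞ :=
  ∑' j : ℤ, (2 : ℝ≥0∞) ^ ((j : ℝ) * σ) * tail f ((2 : ℝ) ^ j)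

lemma two_rpow_add (a b : ℝ) : (2 : ℝ≥0∞) ^ (a + b) = 2 ^ a * 2 ^ b :=
  ENNReal.rpow_add _ _ (by norm_num) (by norm_num)

lemma tsum_tail_shift (σ : ℝ) (f : Space d → ℝ≥0∞) (m : ℤ) :
    ∑' j : ℤ, (2 : ℝ≥0∞) ^ ((j : ℝ) * σ) * tail f ((2 : ℝ) ^ (j - m))
      = 2 ^ ((m : ℝ) * σ) * tailNorm σ f := by
  rw [tailNorm, ← ENNReal.tsum_mul_left, ← (Equiv.addRight m).tsum_eq]
  refine tsum_congr fun j => ?_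
  simp only [Equiv.coe_addRight, add_sub_cancel_right]
  rw [← mul_assoc, ← two_rpow_add]
  push_cast
  ring_nf

lemma tsum_tail_div_le {σ : ℝ} (hσ : 0 ≤ σ) (f : Space d → ℝ≥0∞) (n : ℕ) :
    ∑' j : ℤ, (2 : ℝ≥0∞) ^ ((j : ℝ) * σ) * tail f ((2 : ℝ) ^ j / (n + 1))
      ≤ (2 * (n + 1)) ^ σ * tailNorm σ f := by
  -- replace `n + 1` by the next power of two, which shifts the dyadic index
  set l := Nat.log 2 (n + 1)
  have h1 : n + 1 < 2 ^ (l + 1) := Nat.lt_pow_succ_log_self (by norm_num) _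
  have h2 : 2 ^ l ≤ n + 1 := Nat.pow_log_le_self 2 (by omega)
  calc _ ≤ ∑' j : ℤ, (2 : ℝ≥0∞) ^ ((j : ℝ) * σ) * tail f ((2 : ℝ) ^ (j - ((l + 1 : ℕ) : ℤ))) := by
        refine ENNReal.tsum_le_tsum fun j => ?_
        gcongr
        refine tail_anti f ?_
        rw [zpow_sub₀ (by norm_num)]
        gcongr
        rw [zpow_natCast]
        exact_mod_cast h1.le
    _ = 2 ^ ((((l + 1 : ℕ) : ℤ) : ℝ) * σ) * tailNorm σ f := tsum_tail_shift _ _ _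
    _ ≤ _ := by
        gcongr
        rw [ENNReal.rpow_mul]
        gcongr
        have : ((2 ^ (l + 1) : ℕ) : ℝ≥0∞) ≤ ((2 * (n + 1) : ℕ) : ℝ≥0∞) := by
          exact_mod_cast by rw [pow_succ]; omega
        rw [Int.cast_natCast, ENNReal.rpow_natCast]
        simpa using this

/-- The `n`-th term of the power series solution of `Ω = f + κ Ω * Ω`. -/
def majTerm (κ : ℝ≥0∞) (f : Space d → ℝ≥0∞) : ℕ → Space d → ℝ≥0∞
  | 0 => f
  | n + 1 => fun ξ => κ * ∑ i : Fin n.succ, cv (majTerm κ f i) (majTerm κ f (n - i)) ξ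

/-- The solution `Ω` of `Ω = f + κ Ω * Ω` given by its power series in `f`. -/
def maj (κ : ℝ≥0∞) (f : Space d → ℝ≥0∞) (ξ : Space d) : ℝ≥0∞ := ∑' n, majTerm κ f n ξ

variable {κ : ℝ≥0∞} {f : Space d → ℝ≥0∞}

lemma majTerm_succ (κ : ℝ≥0∞) (f : Space d → ℝ≥0∞) (n : ℕ) (ξ : Space d) :
    majTerm κ f (n + 1) ξ
      = κ * ∑ i : Fin n.succ, cv (majTerm κ f i) (majTerm κ f (n - i)) ξ := by
  rw [majTerm]

lemma measurable_majTerm (hf : Measurable f) (n : ℕ) : Measurable (majTerm κ f n) := by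
  induction n using Nat.strong_induction_on with
  | _ n ih =>
    cases n with
    | zero => rwa [majTerm]
    | succ n =>
      have : majTerm κ f (n + 1)
          = fun ξ => κ * ∑ i : Fin n.succ, cv (majTerm κ f i) (majTerm κ f (n - i)) ξ := by
        ext ξ; exact majTerm_succ κ f n ξ
      rw [this]
      refine Measurable.const_mul (Finset.measurable_sum _ fun i _ => ?_) _
      exact measurable_cv (ih _ (by omega)) (ih _ (by omega))

lemma measurable_maj (hf : Measurable f) : Measurable (maj κ f) :=
  Measurable.tsum fun n => measurable_majTerm hf n

/-- Cauchy product of the power series: the majorant solves the quadratic equation. -/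
lemma maj_eq (hf : Measurable f) (ξ : Space d) :
    maj κ f ξ = f ξ + κ * cv (maj κ f) (maj κ f) ξ := by
  have h0 : majTerm κ f 0 = f := by rw [majTerm]
  rw [maj, tsum_eq_zero_add' ENNReal.summable, h0]
  congr 1
  have e1 : cv (maj κ f) (maj κ f) ξ = ∑' a, ∑' b, cv (majTerm κ f a) (majTerm κ f b) ξ := by
    have e2 := cv_tsum_left (fun i => measurable_majTerm (κ := κ) hf i)
      (measurable_maj (κ := κ) hf) ξ
    refine e2.trans (tsum_congr fun a => ?_)
    exact cv_tsum_right (measurable_majTerm hf a) (fun i => measurable_majTerm hf i) ξ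
  -- sum over the antidiagonals `a + b = n`
  rw [e1, ← ENNReal.tsum_prod,
    ← Finset.HasAntidiagonal.sigmaAntidiagonalEquivProd.tsum_eq
      (fun p : ℕ × ℕ => cv (majTerm κ f p.1) (majTerm κ f p.2) ξ),
    ENNReal.tsum_sigma', ← ENNReal.tsum_mul_left]
  refine tsum_congr fun n => ?_
  rw [majTerm_succ]
  congr 1
  rw [tsum_fintype, Finset.univ_eq_attach]
  refine Eq.trans ?_ (Finset.sum_attach (Finset.HasAntidiagonal.antidiagonal n)
    (fun p : ℕ × ℕ => cv (majTerm κ f p.1) (majTerm κ f p.2) ξ)).symm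
  rw [Finset.Nat.sum_antidiagonal_eq_sum_range_succ_mk]
  exact Fin.sum_univ_eq_sum_range (fun i => cv (majTerm κ f i) (majTerm κ f (n - i)) ξ) n.succ

/-- The recursion of the terms is that of the Catalan numbers, since the integral of a convolution
is the product of the integrals. -/
lemma lintegral_majTerm_le (hf : Measurable f) (n : ℕ) :
    ∫⁻ ξ, majTerm κ f n ξ ≤ catalan n * κ ^ n * (∫⁻ ξ, f ξ) ^ (n + 1) := by
  induction n using Nat.strong_induction_on with
  | _ n ih =>
    cases n with
    | zero => simp [majTerm]
    | succ n =>
      have hm := fun i => measurable_majTerm (κ := κ) hf i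
      simp_rw [majTerm_succ]
      rw [lintegral_const_mul _
        (Finset.measurable_sum _ fun i _ => measurable_cv (hm _) (hm _)),
        lintegral_finsetSum _ (fun i _ => measurable_cv (hm _) (hm _))]
      calc _ ≤ κ * ∑ i : Fin n.succ, (catalan i * catalan (n - i) : ℝ≥0∞) *
            (κ ^ n * (∫⁻ ξ, f ξ) ^ (n + 2)) := by
            gcongr with i
            rw [lintegral_cv (hm _) (hm _)]
            refine (mul_le_mul' (ih i (by omega)) (ih (n - i) (by omega))).trans (le_of_eq ?_)
            obtain ⟨k, hk⟩ : ∃ k, n = i + k := ⟨n - i, by omega⟩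
            have hk' : n - i = k := by omega
            have hp : κ ^ n = κ ^ (i : ℕ) * κ ^ k := by rw [← pow_add, ← hk]
            have hq : (∫⁻ ξ, f ξ) ^ (n + 2)
                = (∫⁻ ξ, f ξ) ^ ((i : ℕ) + 1) * (∫⁻ ξ, f ξ) ^ (k + 1) := by
              rw [← pow_add]; congr 1; omega
            rw [hk', hp, hq]
            ring
        _ = _ := by
            rw [← Finset.sum_mul, catalan_succ]
            push_cast
            ring

/-- The `n`-th term is a combination of `(n+1)`-fold convolutions, so that its frequencies of size
`r` come from the frequencies of size `r/(n+1)` of one of the `n+1` factors. -/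
lemma tail_majTerm_le (hκ : κ ≠ ⊤) (hf : Measurable f) (n : ℕ) (r : ℝ) :
    tail (majTerm κ f n) r
      ≤ catalan n * κ ^ n * (n + 1) * (∫⁻ ξ, f ξ) ^ n * tail f (r / (n + 1)) := by
  induction n using Nat.strong_induction_on generalizing r with
  | _ n ih =>
    cases n with
    | zero => simp [majTerm]
    | succ n =>
      have hm := fun i => measurable_majTerm (κ := κ) hf i
      have e : majTerm κ f (n + 1) = fun ξ => ∑' i : Fin n.succ,
          κ * cv (majTerm κ f i) (majTerm κ f (n - i)) ξ := by
        ext ξ; rw [majTerm_succ, tsum_fintype, Finset.mul_sum]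
      rw [e]
      refine (tail_tsum_le (fun i => (measurable_cv (hm _) (hm _)).const_mul κ) r).trans ?_
      rw [tsum_fintype]
      simp_rw [tail_const_mul κ hκ]
      calc _ ≤ ∑ i : Fin n.succ, κ * ((catalan i * catalan (n - i) : ℝ≥0∞) *
            (κ ^ n * (n + 2) * (∫⁻ ξ, f ξ) ^ (n + 1) * tail f (r / (n + 2)))) := by
            gcongr with i
            obtain ⟨k, hk⟩ : ∃ k, n = i + k := ⟨n - i, by omega⟩
            have hk' : n - i = k := by omega
            have hkn : k < n + 1 := by omega
            have hn : (n : ℝ) = i + k := by exact_mod_cast hk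
            -- split the threshold in proportion to the numbers `i + 1` and `k + 1` of factors
            have hr : r = r * (i + 1) / (n + 2) + r * (k + 1) / (n + 2) := by
              rw [hn]; field_simp; ring
            rw [hk']
            conv_lhs => rw [hr]
            refine (tail_cv_le (hm _) (hm _) _ _).trans ?_
            refine (add_le_add (mul_le_mul' (lintegral_majTerm_le hf i) (ih k hkn _))
              (mul_le_mul' (lintegral_majTerm_le hf k) (ih i (by omega) _))).trans ?_
            have r1 : r * (k + 1) / (n + 2) / (k + 1) = r / (n + 2) := by field_simp
            have r2 : r * (i + 1) / (n + 2) / (i + 1) = r / (n + 2) := by field_simp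
            rw [r1, r2]
            have hn' : (n : ℝ≥0∞) = i + k := by exact_mod_cast hk
            have hp : κ ^ n = κ ^ (i : ℕ) * κ ^ k := by rw [← pow_add, ← hk]
            have hq : (∫⁻ ξ, f ξ) ^ (n + 1)
                = (∫⁻ ξ, f ξ) ^ (i : ℕ) * (∫⁻ ξ, f ξ) ^ (k + 1) := by
              rw [← pow_add]; congr 1; omega
            rw [hp, hq, hn']
            exact le_of_eq (by ring)
        _ = _ := by
            rw [← Finset.mul_sum, ← Finset.sum_mul, catalan_succ]
            push_cast
            have : (n : ℝ) + 1 + 1 = n + 2 := by ring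
            have : (n : ℝ≥0∞) + 1 + 1 = n + 2 := by ring
            simp only [*]
            ring

/-- Growth of the Catalan numbers: the power series converges when `4 κ ∫ f < 1`. -/
lemma catalan_le (n : ℕ) : (catalan n : ℝ≥0∞) ≤ 4 ^ n := by
  have h : catalan n ≤ 4 ^ n := by
    have h1 := succ_mul_catalan_eq_centralBinom n
    have h2 : n.centralBinom ≤ 4 ^ n := by
      rw [Nat.centralBinom]
      have := Nat.choose_le_two_pow (2 * n) n
      rwa [pow_mul] at this
    nlinarith [Nat.zero_le (n * catalan n)]
  exact_mod_cast h

end majorant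

end

section

section besov

variable {d : ℕ} {κ : ℝ≥0∞} {f : Space d → ℝ≥0∞}

lemma ofReal_two_zpow (j : ℤ) : ENNReal.ofReal (2 ^ j) = 2 ^ (j : ℝ) := by
  rw [← Real.rpow_intCast, ← ENNReal.ofReal_rpow_of_pos (by norm_num)]
  simp

lemma lintegral_maj_le (hf : Measurable f) (h : 4 * κ * (∫⁻ ξ, f ξ) ≤ 2⁻¹) :
    ∫⁻ ξ, maj κ f ξ ≤ 2 * ∫⁻ ξ, f ξ := by
  unfold maj
  rw [lintegral_tsum fun n => (measurable_majTerm hf n).aemeasurable]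
  calc _ ≤ ∑' n : ℕ, (∫⁻ ξ, f ξ) * 2⁻¹ ^ n := by
        refine ENNReal.tsum_le_tsum fun n => (lintegral_majTerm_le hf n).trans ?_
        calc _ ≤ 4 ^ n * κ ^ n * (∫⁻ ξ, f ξ) ^ (n + 1) := by gcongr; exact catalan_le n
          _ = (∫⁻ ξ, f ξ) * (4 * κ * (∫⁻ ξ, f ξ)) ^ n := by ring
          _ ≤ _ := by gcongr
    _ = _ := by
        rw [ENNReal.tsum_mul_left, ENNReal.tsum_geometric, ENNReal.one_sub_inv_two, inv_inv,
          mul_comm]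

lemma tsum_poly_geometric_lt_top (σ : ℝ) :
    ∑' n : ℕ, (2⁻¹ : ℝ≥0∞) ^ n * (n + 1) * (2 * (n + 1)) ^ σ < ⊤ := by
  obtain ⟨k, hk⟩ := exists_nat_ge σ
  have hs : Summable fun n : ℕ => ((2 * 2 ^ k : ℝ)) * (((n + 1 : ℕ) : ℝ) ^ (k + 1) * (1 / 2) ^ (n +
      1)) := by
    refine Summable.mul_left _ ?_
    exact (summable_nat_add_iff 1).2 (summable_pow_mul_geometric_of_norm_lt_one (k + 1)
      (r := (1 / 2 : ℝ)) (by norm_num))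
  refine lt_of_le_of_lt (ENNReal.tsum_le_tsum fun n => ?_) hs.tsum_ofReal_lt_top
  have h1 : (2 * (n + 1) : ℝ≥0∞) ^ σ ≤ (2 * (n + 1)) ^ k := by
    rw [← ENNReal.rpow_natCast]
    refine ENNReal.rpow_le_rpow_of_exponent_le ?_ hk
    exact_mod_cast (show 1 ≤ 2 * (n + 1) by omega)
  calc _ ≤ (2⁻¹ : ℝ≥0∞) ^ n * (n + 1) * (2 * (n + 1)) ^ k := by gcongr
    _ = _ := by
      have e1 : (2⁻¹ : ℝ≥0∞) = ENNReal.ofReal (1 / 2) := by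
        rw [ENNReal.ofReal_div_of_pos (by norm_num)]; simp
      have e2 : (n + 1 : ℝ≥0∞) = ENNReal.ofReal (n + 1) := by
        rw [ENNReal.ofReal_add (by positivity) (by positivity)]; simp
      have e3 : (2 : ℝ≥0∞) = ENNReal.ofReal 2 := by simp
      rw [e1, e2, e3, ← ENNReal.ofReal_mul (by positivity), ← ENNReal.ofReal_pow (by positivity),
        ← ENNReal.ofReal_mul (by positivity), ← ENNReal.ofReal_pow (by positivity),
        ← ENNReal.ofReal_mul (by positivity)]
      congr 1
      push_cast
      rw [mul_pow]
      ring

/-- All Besov norms of `f` are inherited by `Ω`, under a smallness condition which does not depend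
on the regularity: the constants in the bounds of the `n`-th term grow only polynomially. -/
lemma tailNorm_maj_lt_top (hκ : κ ≠ ⊤) (hf : Measurable f) (h : 4 * κ * (∫⁻ ξ, f ξ) ≤ 2⁻¹)
    {σ : ℝ} (hσ : 0 ≤ σ) (hD : tailNorm σ f < ⊤) : tailNorm σ (maj κ f) < ⊤ := by
  calc tailNorm σ (maj κ f)
      ≤ ∑' j : ℤ, (2 : ℝ≥0∞) ^ ((j : ℝ) * σ) * ∑' n, tail (majTerm κ f n) ((2 : ℝ) ^ j) := by
        refine ENNReal.tsum_le_tsum fun j => ?_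
        gcongr
        exact tail_tsum_le (fun n => measurable_majTerm hf n) _
    _ = ∑' n, ∑' j : ℤ, (2 : ℝ≥0∞) ^ ((j : ℝ) * σ) * tail (majTerm κ f n) ((2 : ℝ) ^ j) := by
        simp_rw [← ENNReal.tsum_mul_left]
        exact ENNReal.tsum_comm
    _ ≤ ∑' n : ℕ, ((2⁻¹ : ℝ≥0∞) ^ n * (n + 1) * (2 * (n + 1)) ^ σ) * tailNorm σ f := by
        refine ENNReal.tsum_le_tsum fun n => ?_
        calc _ ≤ ∑' j : ℤ, ((2⁻¹ : ℝ≥0∞) ^ n * (n + 1)) *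
              ((2 : ℝ≥0∞) ^ ((j : ℝ) * σ) * tail f ((2 : ℝ) ^ j / (n + 1))) := by
              refine ENNReal.tsum_le_tsum fun j => ?_
              rw [mul_left_comm]
              gcongr
              -- Catalan numbers and powers of `κ ∫ f` together give at most `2⁻ⁿ`
              refine (tail_majTerm_le hκ hf n _).trans ?_
              refine mul_le_mul' ?_ le_rfl
              calc _ ≤ 4 ^ n * κ ^ n * (n + 1 : ℝ≥0∞) * (∫⁻ ξ, f ξ) ^ n := by
                    gcongr; exact catalan_le n
                _ = (4 * κ * (∫⁻ ξ, f ξ)) ^ n * (n + 1) := by ring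
                _ ≤ 2⁻¹ ^ n * (n + 1) := by gcongr
          _ ≤ _ := by
              rw [ENNReal.tsum_mul_left, mul_assoc ((2⁻¹ : ℝ≥0∞) ^ n * (n + 1))]
              gcongr
              exact tsum_tail_div_le hσ f n
    _ < ⊤ := by
        rw [ENNReal.tsum_mul_right]
        exact ENNReal.mul_lt_top (tsum_poly_geometric_lt_top σ) hD

/-- The dyadic shell `2^j ≤ |ξ| < 2^{j+1}`. -/
def shell (d : ℕ) (j : ℤ) : Set (Space d) := {ξ | (2 : ℝ) ^ j ≤ ‖ξ‖ ∧ ‖ξ‖ < (2 : ℝ) ^ (j + 1)}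

lemma measurableSet_shell (j : ℤ) : MeasurableSet (shell d j) :=
  (measurableSet_le measurable_const measurable_norm).inter
    (measurableSet_lt measurable_norm measurable_const)

lemma exists_mem_shell {ξ : Space d} (h : ξ ≠ 0) : ∃ j, ξ ∈ shell d j :=
  exists_mem_Ico_zpow (norm_pos_iff.2 h) (by norm_num : (1 : ℝ) < 2)

/-- The homogeneous Besov norm with sharp dyadic cut-offs of a function on the Fourier side. -/
def bs (s : ℝ) (F : Space d → ℝ≥0∞) : ℝ≥0∞ :=
  ∑' j : ℤ, (2 : ℝ≥0∞) ^ ((j : ℝ) * s) * n2 volume ((shell d j).indicator F)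

lemma bs_le_tailNorm (s : ℝ) (F : Space d → ℝ≥0∞) : bs s F ≤ tailNorm s F := by
  refine ENNReal.tsum_le_tsum fun j => ?_
  gcongr
  exact n2_mono fun ξ => indicator_le_indicator_of_subset (fun _ h => h.1) (fun _ => zero_le) ξ

lemma bs_le_of_shell_ae {F G : Space d → ℝ≥0∞} {c : ℝ≥0∞} (hc : c ≠ ⊤) (s a : ℝ)
    (h : ∀ j : ℤ, ∀ᵐ ξ, ξ ∈ shell d j → F ξ ≤ c * 2 ^ ((j : ℝ) * a) * G ξ) :
    bs s F ≤ c * bs (s + a) G := by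
  rw [bs, bs, ← ENNReal.tsum_mul_left]
  refine ENNReal.tsum_le_tsum fun j => ?_
  have hc' : c * 2 ^ ((j : ℝ) * a) ≠ ⊤ :=
    ENNReal.mul_ne_top hc (ENNReal.rpow_ne_top_of_ne_zero (by norm_num) (by norm_num))
  calc _ ≤ (2 : ℝ≥0∞) ^ ((j : ℝ) * s) *
        n2 volume (fun ξ => (c * 2 ^ ((j : ℝ) * a)) * (shell d j).indicator G ξ) := by
        gcongr
        refine n2_mono_ae ((h j).mono fun ξ h => ?_)
        by_cases hξ : ξ ∈ shell d j
        · simpa [hξ] using h hξ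
        · simp [hξ]
    _ = _ := by
        rw [n2_const_mul _ hc', mul_add, two_rpow_add]
        ring

lemma bs_mono_ae {F G : Space d → ℝ≥0∞} (h : ∀ᵐ ξ, F ξ ≤ G ξ) (s : ℝ) : bs s F ≤ bs s G := by
  have := bs_le_of_shell_ae (F := F) (G := G) (c := 1) (by simp) s 0
    (fun j => h.mono fun ξ h _ => by simpa using h)
  simpa using this

lemma bs_add_le {F G : Space d → ℝ≥0∞} (hF : Measurable F) (hG : Measurable G) (s : ℝ) :
    bs s (fun ξ => F ξ + G ξ) ≤ bs s F + bs s G := by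
  rw [bs, bs, bs, ← ENNReal.tsum_add]
  refine ENNReal.tsum_le_tsum fun j => ?_
  rw [← mul_add]
  gcongr
  refine le_trans (le_of_eq ?_) (n2_add_le (hF.indicator (measurableSet_shell j)).aemeasurable
    (hG.indicator (measurableSet_shell j)).aemeasurable)
  congr 1
  ext ξ
  by_cases h : ξ ∈ shell d j <;> simp [h]

/-- A tail is a union of shells; for `σ > 0` the sum over the larger shells is geometric. -/
lemma tailNorm_le_bs {σ : ℝ} (hσ : 0 < σ) : ∃ C : ℝ≥0∞, C ≠ ⊤ ∧ ∀ F : Space d → ℝ≥0∞,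
    Measurable F → tailNorm σ F ≤ C * bs σ F := by
  have hlt : (2 : ℝ≥0∞) ^ (-σ) < 1 := ENNReal.rpow_lt_one_of_one_lt_of_neg (by norm_num) (by simpa)
  refine ⟨(1 - 2 ^ (-σ))⁻¹, by simpa [tsub_eq_zero_iff_le] using hlt, fun F hF => ?_⟩
  -- the tail beyond `2 ^ j` is made of the shells `j + i`, `i ≥ 0`
  have key : ∀ j : ℤ, tail F ((2 : ℝ) ^ j) ≤ ∑' i : ℕ, n2 volume ((shell d (j + i)).indicator F) :=
      by
    intro j
    refine le_trans (n2_mono fun ξ => ?_) (n2_tsum_le fun i => hF.indicator (measurableSet_shell _))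
    by_cases h : (2 : ℝ) ^ j ≤ ‖ξ‖
    · rw [indicator_of_mem (by exact h)]
      have h0 : ξ ≠ 0 := by
        rintro rfl
        have : (0 : ℝ) < 2 ^ j := by positivity
        simp at h; linarith
      obtain ⟨k, hk⟩ := exists_mem_shell h0
      have hjk : j ≤ k := by
        have : (2 : ℝ) ^ j < 2 ^ (k + 1) := h.trans_lt hk.2
        have := (zpow_lt_zpow_iff_right₀ (by norm_num : (1 : ℝ) < 2)).1 this
        omega
      have hi : j + ((k - j).toNat : ℕ) = k := by omega
      refine le_trans (le_of_eq ?_) (ENNReal.le_tsum (k - j).toNat)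
      rw [hi, indicator_of_mem hk]
    · simp [indicator, h]
  calc tailNorm σ F
      ≤ ∑' j : ℤ, ∑' i : ℕ, (2 : ℝ≥0∞) ^ ((j : ℝ) * σ) * n2 volume ((shell d (j + i)).indicator F)
          := by
        refine ENNReal.tsum_le_tsum fun j => ?_
        rw [ENNReal.tsum_mul_left]
        gcongr
        exact key j
    _ = ∑' i : ℕ, ∑' j : ℤ, (2 : ℝ≥0∞) ^ ((j : ℝ) * σ) * n2 volume ((shell d (j + i)).indicator F)
        :=
        ENNReal.tsum_comm
    _ = ∑' i : ℕ, (2 ^ (-σ)) ^ i * bs σ F := by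
        refine tsum_congr fun i => ?_
        rw [bs, ← ENNReal.tsum_mul_left, ← (Equiv.addRight (i : ℤ)).tsum_eq (fun j : ℤ =>
          ((2 : ℝ≥0∞) ^ (-σ)) ^ i * (2 ^ ((j : ℝ) * σ) * n2 volume ((shell d j).indicator F)))]
        refine tsum_congr fun j => ?_
        simp only [Equiv.coe_addRight]
        rw [← mul_assoc, ← ENNReal.rpow_natCast, ← ENNReal.rpow_mul, ← two_rpow_add]
        push_cast
        ring_nf
    _ = _ := by rw [ENNReal.tsum_mul_right, ENNReal.tsum_geometric]

lemma bs_norm_mul_le (s : ℝ) (F : Space d → ℝ≥0∞) :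
    bs s (fun ξ => ‖ξ‖ₑ * F ξ) ≤ 2 * bs (s + 1) F := by
  refine bs_le_of_shell_ae (by norm_num) s 1 fun j => Eventually.of_forall fun ξ h => ?_
  gcongr
  have h2 : ‖ξ‖ₑ ≤ ENNReal.ofReal (2 ^ (j + 1)) := by
    rw [← ofReal_norm]; exact ENNReal.ofReal_le_ofReal h.2.le
  refine h2.trans (le_of_eq ?_)
  rw [ofReal_two_zpow]
  push_cast
  rw [two_rpow_add, mul_comm, ENNReal.rpow_one, mul_one]

/-- The Cauchy-Schwarz inequality for functions supported in a dyadic ball. -/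
lemma lintegral_le_of_support (d : ℕ) : ∃ C : ℝ≥0∞, C ≠ ⊤ ∧ ∀ (j : ℤ) (F : Space d → ℝ≥0∞),
    AEMeasurable F → (∀ ξ, F ξ ≠ 0 → ‖ξ‖ ≤ 2 ^ (j + 1)) →
      ∫⁻ ξ, F ξ ≤ C * 2 ^ ((j : ℝ) * (d / 2)) * n2 volume F := by
  refine ⟨volume (Metric.closedBall (0 : Space d) 2) ^ (1 / 2 : ℝ),
    ENNReal.rpow_ne_top_of_nonneg (by norm_num) measure_closedBall_lt_top.ne, fun j F hF h => ?_⟩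
  set B := Metric.closedBall (0 : Space d) (2 ^ (j + 1))
  have hB : MeasurableSet B := Metric.isClosed_closedBall.measurableSet
  have e1 : F = fun ξ => B.indicator (fun _ => (1 : ℝ≥0∞)) ξ * F ξ := by
    ext ξ
    by_cases hξ : F ξ = 0
    · simp [hξ]
    · rw [indicator_of_mem (by simpa [B] using h ξ hξ), one_mul]
  -- the square root of the volume of the ball, by scaling
  have e2 : n2 volume (B.indicator (fun _ => (1 : ℝ≥0∞)))
      = volume (Metric.closedBall (0 : Space d) 2) ^ (1 / 2 : ℝ) * 2 ^ ((j : ℝ) * (d / 2)) := by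
    have e3 : ∀ ξ, B.indicator (fun _ => (1 : ℝ≥0∞)) ξ ^ 2 = B.indicator 1 ξ := fun ξ => by
      by_cases hξ : ξ ∈ B <;> simp [hξ]
    simp_rw [n2, e3]
    rw [lintegral_indicator_one hB]
    have e4 : volume B = ENNReal.ofReal ((2 ^ j) ^ d) * volume (Metric.closedBall (0 : Space d) 2)
        := by
      have := Measure.addHaar_closedBall_mul_of_pos (volume : Measure (Space d)) 0
        (show (0 : ℝ) < 2 ^ j by positivity) 2
      simpa [B, zpow_add₀] using this
    rw [e4, ENNReal.mul_rpow_of_nonneg _ _ (by norm_num), mul_comm, ENNReal.ofReal_pow (by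
        positivity),
      ofReal_two_zpow]
    congr 1
    rw [← ENNReal.rpow_natCast, ← ENNReal.rpow_mul, ← ENNReal.rpow_mul]
    ring_nf
  calc ∫⁻ ξ, F ξ = ∫⁻ ξ, B.indicator (fun _ => (1 : ℝ≥0∞)) ξ * F ξ := by rw [← e1]
    _ ≤ _ := by
      rw [← e2]
      exact lintegral_mul_le_n2 ((measurable_const.indicator hB).aemeasurable) hF

lemma lintegral_eq_tsum_shell [NeZero d] {F : Space d → ℝ≥0∞} (hF : Measurable F) :
    ∫⁻ ξ, F ξ = ∑' j : ℤ, ∫⁻ ξ, (shell d j).indicator F ξ := by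
  rw [← lintegral_tsum fun j => (hF.indicator (measurableSet_shell j)).aemeasurable]
  refine lintegral_congr_ae ?_
  filter_upwards [compl_mem_ae_iff.2 (measure_singleton (0 : Space d))] with ξ hξ
  obtain ⟨k, hk⟩ := exists_mem_shell hξ
  rw [tsum_eq_single k, indicator_of_mem hk]
  intro j hj
  refine indicator_of_notMem (fun h => hj ?_) _
  have h1 := (zpow_lt_zpow_iff_right₀ (by norm_num : (1 : ℝ) < 2)).1 (hk.1.trans_lt h.2)
  have h2 := (zpow_lt_zpow_iff_right₀ (by norm_num : (1 : ℝ) < 2)).1 (h.1.trans_lt hk.2)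
  omega

/-- The space of regularity `d/2` on the Fourier side embeds in `L¹`. -/
lemma lintegral_le_bs (d : ℕ) [NeZero d] : ∃ C : ℝ≥0∞, C ≠ ⊤ ∧ ∀ F : Space d → ℝ≥0∞,
    Measurable F → ∫⁻ ξ, F ξ ≤ C * bs (d / 2) F := by
  obtain ⟨C, hC, h⟩ := lintegral_le_of_support d
  refine ⟨C, hC, fun F hF => ?_⟩
  rw [lintegral_eq_tsum_shell hF, bs, ← ENNReal.tsum_mul_left]
  refine ENNReal.tsum_le_tsum fun j => ?_
  rw [← mul_assoc]
  refine h j _ (hF.indicator (measurableSet_shell j)).aemeasurable fun ξ hξ => ?_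
  by_contra hc
  refine hξ (indicator_of_notMem (fun hm => hc hm.2.le) _)

end besov

end

section

/-! ### Duhamel integrals -/

section volterra

lemma lintegral_exp_Ici {b : ℝ} (hb : 0 < b) (s : ℝ) :
    ∫⁻ t in Ici s, ENNReal.ofReal (Real.exp (-(b * (t - s)))) = ENNReal.ofReal b⁻¹ := by
  have h : ∀ t, Real.exp (-(b * (t - s))) = Real.exp (b * s) * Real.exp ((-b) * t) := fun t => by
    rw [← Real.exp_add]; ring_nf
  have hb' : -b < 0 := by linarith
  rw [setLIntegral_congr Ioi_ae_eq_Ici.symm, ← ofReal_integral_eq_lintegral_ofReal]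
  · simp_rw [h]
    rw [integral_const_mul, integral_exp_mul_Ioi hb']
    congr 1
    have : Real.exp (b * s) * Real.exp (-b * s) = 1 := by rw [← Real.exp_add]; simp
    rw [neg_mul] at this ⊢
    field_simp
    linarith
  · simp_rw [h]
    exact (integrableOn_exp_mul_Ioi hb' s).const_mul _
  · exact Eventually.of_forall fun t => (Real.exp_pos _).le

/-- The Duhamel integral `∫_0^t e^{-a(t-s)} h(s) ds` of a function with values in `[0,∞]`. -/
def vol (a : ℝ) (h : ℝ → ℝ≥0∞) (t : ℝ) : ℝ≥0∞ :=
  ∫⁻ s in Ioc 0 t, ENNReal.ofReal (Real.exp (-(a * (t - s)))) * h s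

variable {A : Set ℝ} {a : ℝ} {h : ℝ → ℝ≥0∞}

lemma vol_le (hA : ∀ t ∈ A, Ioc 0 t ⊆ A) (ha : 0 ≤ a) {t : ℝ} (ht : t ∈ A) :
    vol a h t ≤ ∫⁻ s in A, h s := by
  calc vol a h t ≤ ∫⁻ s in Ioc 0 t, h s := by
        refine setLIntegral_mono' measurableSet_Ioc fun s hs => ?_
        refine mul_le_of_le_one_left' ?_
        rw [← ENNReal.ofReal_one]
        refine ENNReal.ofReal_le_ofReal (Real.exp_le_one_iff.2 ?_)
        have := mul_nonneg ha (sub_nonneg.2 hs.2)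
        linarith
    _ ≤ _ := lintegral_mono_set (hA t ht)

lemma vol_eq_indicator (hA : ∀ t ∈ A, Ioc 0 t ⊆ A) {t : ℝ} (ht : t ∈ A) :
    vol a h t = ∫⁻ s in A, (Ioc 0 t).indicator
      (fun s => ENNReal.ofReal (Real.exp (-(a * (t - s)))) * h s) s := by
  rw [setLIntegral_indicator measurableSet_Ioc, inter_eq_left.2 (hA t ht), vol]

lemma measurable_vol_kernel (hh : Measurable h) :
    Measurable fun p : ℝ × ℝ => (Ioc 0 p.1).indicator
      (fun s => ENNReal.ofReal (Real.exp (-(a * (p.1 - s)))) * h s) p.2 := by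
  have : (fun p : ℝ × ℝ => (Ioc 0 p.1).indicator
      (fun s => ENNReal.ofReal (Real.exp (-(a * (p.1 - s)))) * h s) p.2)
      = {p : ℝ × ℝ | 0 < p.2 ∧ p.2 ≤ p.1}.indicator
        (fun p => ENNReal.ofReal (Real.exp (-(a * (p.1 - p.2)))) * h p.2) := by
    ext p
    simp [indicator, mem_Ioc]
  rw [this]
  refine Measurable.indicator (by fun_prop) ?_
  exact (measurableSet_lt measurable_const measurable_snd).inter
    (measurableSet_le measurable_snd measurable_fst)

lemma lintegral_vol_le (hAm : MeasurableSet A) (hA : ∀ t ∈ A, Ioc 0 t ⊆ A) (ha : 0 < a)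
    (hh : Measurable h) :
    ∫⁻ t in A, vol a h t ≤ ENNReal.ofReal a⁻¹ * ∫⁻ s in A, h s := by
  rw [setLIntegral_congr_fun hAm fun t ht => vol_eq_indicator (a := a) (h := h) hA ht]
  rw [lintegral_lintegral_swap (measurable_vol_kernel hh).aemeasurable, ← lintegral_const_mul _ hh]
  refine lintegral_mono fun s => ?_
  calc _ ≤ ∫⁻ t, (Ici s).indicator
        (fun t => ENNReal.ofReal (Real.exp (-(a * (t - s)))) * h s) t := by
        refine (setLIntegral_le_lintegral _ _).trans (lintegral_mono fun t => ?_)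
        by_cases h1 : s ∈ Ioc 0 t
        · simp [h1, show s ≤ t from h1.2]
        · simp [h1]
    _ = _ := by
        rw [lintegral_indicator measurableSet_Ici, lintegral_mul_const _ (by fun_prop),
          lintegral_exp_Ici ha]

/-- Smoothing of the heat flow: integration against `e^{-a(t-s)}` maps `L¹` to `L²` with norm
`(2a)^{-1/2}`. -/
lemma n2_vol_le (hAm : MeasurableSet A) (hA : ∀ t ∈ A, Ioc 0 t ⊆ A) (ha : 0 < a)
    (hh : Measurable h) :
    n2 (volume.restrict A) (vol a h) ≤ ENNReal.ofReal (√(2 * a))⁻¹ * ∫⁻ s in A, h s := by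
  have e : ∀ᵐ t ∂(volume.restrict A), vol a h t = ∫⁻ s in A, (Ioc 0 t).indicator
      (fun s => ENNReal.ofReal (Real.exp (-(a * (t - s)))) * h s) s :=
    (ae_restrict_iff' hAm).2 (Eventually.of_forall fun t ht => vol_eq_indicator hA ht)
  rw [n2_congr_ae e]
  refine (n2_lintegral_le (f := fun t s => (Ioc 0 t).indicator
      (fun s => ENNReal.ofReal (Real.exp (-(a * (t - s)))) * h s) s)
      (measurable_vol_kernel hh)).trans ?_
  rw [← lintegral_const_mul _ hh]
  refine lintegral_mono fun s => ?_
  rw [n2_le_iff]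
  have h2 : ENNReal.ofReal (√(2 * a))⁻¹ ^ 2 = ENNReal.ofReal (2 * a)⁻¹ := by
    rw [← ENNReal.ofReal_pow (by positivity), inv_pow, Real.sq_sqrt (by positivity)]
  -- the kernel has `L²` norm `(2a)^{-1/2}` in `t`, for every `s`
  calc _ ≤ ∫⁻ t, (Ici s).indicator
        (fun t => ENNReal.ofReal (Real.exp (-(2 * a * (t - s)))) * h s ^ 2) t := by
        refine (setLIntegral_le_lintegral _ _).trans (lintegral_mono fun t => ?_)
        by_cases h1 : s ∈ Ioc 0 t
        · simp only [h1, indicator_of_mem, mem_Ici.2 h1.2, mul_pow]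
          rw [← ENNReal.ofReal_pow (Real.exp_pos _).le, ← Real.exp_nat_mul]
          refine le_of_eq ?_
          congr 3
          push_cast
          ring
        · simp [h1]
    _ = _ := by
        rw [lintegral_indicator measurableSet_Ici, lintegral_mul_const _ (by fun_prop),
          lintegral_exp_Ici (by positivity), mul_pow, h2]

end volterra

section duhamel

variable {d : ℕ} {E : Type*} [NormedAddCommGroup E] [NormedSpace ℝ E] [CompleteSpace E]
  [MeasurableSpace E] [BorelSpace E] [SecondCountableTopology E]

/-- A family of bilinear maps depending on the frequency `ξ`, of size `O(|ξ|)`. -/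
structure IsSymbol (M : Space d → E → E → E) (K : ℝ≥0) : Prop where
  meas : Measurable fun p : Space d × E × E => M p.1 p.2.1 p.2.2
  sub_left : ∀ ξ a a' b, M ξ (a - a') b = M ξ a b - M ξ a' b
  sub_right : ∀ ξ a b b', M ξ a (b - b') = M ξ a b - M ξ a b'
  bound : ∀ ξ a b, ‖M ξ a b‖ₑ ≤ K * ‖ξ‖ₑ * ‖a‖ₑ * ‖b‖ₑ

/-- The bilinear convolution `∫ M_ξ(f(ξ-η), g(η)) dη`. -/
def bconv (M : Space d → E → E → E) (f g : Space d → E) (ξ : Space d) : E :=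
  ∫ η, M ξ (f (ξ - η)) (g η)

/-- The Duhamel integral `∫_0^t e^{-ν|ξ|²(t-s)} ∫ M_ξ(f(s,ξ-η), g(s,η)) dη ds`. -/
def duh (ν : ℝ) (M : Space d → E → E → E) (f g : ℝ → Space d → E) (t : ℝ) (ξ : Space d) : E :=
  ∫ s in Ioc 0 t, Real.exp (-(ν * ‖ξ‖ ^ 2 * (t - s))) • bconv M (f s) (g s) ξ

/-- The `L²` norm in time, over the set `A`, at a given frequency. -/
def timeNorm (A : Set ℝ) (f : ℝ → Space d → E) (ξ : Space d) : ℝ≥0∞ :=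
  n2 (volume.restrict A) (fun t => ‖f t ξ‖ₑ)

variable {M : Space d → E → E → E} {K : ℝ≥0} {A : Set ℝ} {f g f' g' : ℝ → Space d → E}
  {F G F' G' : Space d → ℝ≥0∞} {ν : ℝ}

lemma measurable_timeNorm (A : Set ℝ) (hf : Measurable (Function.uncurry f)) :
    Measurable (timeNorm A f) := by
  unfold timeNorm n2
  refine Measurable.pow_const ?_ _
  exact Measurable.lintegral_prod_left' (f := fun p : ℝ × Space d => ‖f p.1 p.2‖ₑ ^ 2)
    (hf.enorm.pow_const 2)

lemma enorm_bconv_le (hM : IsSymbol M K) (f g : Space d → E) (ξ : Space d) :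
    ‖bconv M f g ξ‖ₑ ≤ K * ‖ξ‖ₑ * cv (fun η => ‖f η‖ₑ) (fun η => ‖g η‖ₑ) ξ := by
  refine (enorm_integral_le_lintegral_enorm _).trans ?_
  rw [cv, ← lintegral_const_mul' _ _ (by finiteness)]
  refine lintegral_mono fun η => (hM.bound _ _ _).trans (le_of_eq (by ring))

lemma measurable_bconv (hM : IsSymbol M K) (hf : Measurable (Function.uncurry f))
    (hg : Measurable (Function.uncurry g)) :
    Measurable (Function.uncurry fun s ξ => bconv M (f s) (g s) ξ) := by
  refine StronglyMeasurable.measurable ?_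
  refine StronglyMeasurable.integral_prod_right'
    (f := fun p : (ℝ × Space d) × Space d => M p.1.2 (f p.1.1 (p.1.2 - p.2)) (g p.1.1 p.2)) ?_
  refine Measurable.stronglyMeasurable ?_
  refine hM.meas.comp (measurable_fst.snd.prodMk (Measurable.prodMk ?_ ?_))
  · exact hf.comp (measurable_fst.fst.prodMk (measurable_fst.snd.sub measurable_snd))
  · exact hg.comp (measurable_fst.fst.prodMk measurable_snd)

lemma measurable_duh (ν : ℝ) (hM : IsSymbol M K) (hf : Measurable (Function.uncurry f))
    (hg : Measurable (Function.uncurry g)) : Measurable (Function.uncurry (duh ν M f g)) := by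
  have e : Function.uncurry (duh ν M f g) = fun p : ℝ × Space d =>
      ∫ s, {q : (ℝ × Space d) × ℝ | 0 < q.2 ∧ q.2 ≤ q.1.1}.indicator (fun q =>
        Real.exp (-(ν * ‖q.1.2‖ ^ 2 * (q.1.1 - q.2))) • bconv M (f q.2) (g q.2) q.1.2) (p, s) := by
    ext ⟨t, ξ⟩
    simp only [Function.uncurry, duh]
    rw [← integral_indicator measurableSet_Ioc]
    refine integral_congr_ae (Eventually.of_forall fun s => ?_)
    simp [indicator, mem_Ioc]
  rw [e]
  refine StronglyMeasurable.measurable ?_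
  refine StronglyMeasurable.integral_prod_right' (Measurable.stronglyMeasurable ?_)
  refine Measurable.indicator ?_ ?_
  · refine Measurable.smul (by fun_prop) ?_
    exact (measurable_bconv hM hf hg).comp (measurable_snd.prodMk measurable_fst.snd)
  · exact (measurableSet_lt measurable_const measurable_snd).inter
      (measurableSet_le measurable_snd measurable_fst.fst)

lemma measurable_cv_enorm (hf : Measurable (Function.uncurry f))
    (hg : Measurable (Function.uncurry g)) :
    Measurable (Function.uncurry fun s ξ => cv (fun η => ‖f s η‖ₑ) (fun η => ‖g s η‖ₑ) ξ) := by
  refine Measurable.lintegral_prod_right' (f := fun p : (ℝ × Space d) × Space d =>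
    ‖f p.1.1 (p.1.2 - p.2)‖ₑ * ‖g p.1.1 p.2‖ₑ) ?_
  refine Measurable.mul (Measurable.enorm ?_) (Measurable.enorm ?_)
  · exact hf.comp (measurable_fst.fst.prodMk (measurable_fst.snd.sub measurable_snd))
  · exact hg.comp (measurable_fst.fst.prodMk measurable_snd)

/-- The Cauchy-Schwarz inequality in time reduces the convolution of two time-dependent functions
to the convolution of their `L²` norms in time. -/
lemma lintegral_cv_le (μ : Measure ℝ) [SFinite μ] (hf : Measurable (Function.uncurry f))
    (hg : Measurable (Function.uncurry g)) (hF : ∀ᵐ ξ, n2 μ (fun t => ‖f t ξ‖ₑ) ≤ F ξ)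
    (hG : ∀ᵐ ξ, n2 μ (fun t => ‖g t ξ‖ₑ) ≤ G ξ) (ξ : Space d) :
    ∫⁻ s, cv (fun η => ‖f s η‖ₑ) (fun η => ‖g s η‖ₑ) ξ ∂μ ≤ cv F G ξ := by
  have m1 : Measurable fun p : ℝ × Space d => ‖f p.1 (ξ - p.2)‖ₑ :=
    (hf.comp (measurable_fst.prodMk (measurable_const.sub measurable_snd))).enorm
  have m2 : Measurable fun p : ℝ × Space d => ‖g p.1 p.2‖ₑ := hg.enorm
  unfold cv
  rw [lintegral_lintegral_swap (m1.mul m2).aemeasurable]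
  have hF' : ∀ᵐ η : Space d, n2 μ (fun t => ‖f t (ξ - η)‖ₑ) ≤ F (ξ - η) :=
    (quasiMeasurePreserving_sub_left volume ξ).ae hF
  refine lintegral_mono_ae ?_
  filter_upwards [hF', hG] with η h1 h2
  refine (lintegral_mul_le_n2 ?_ ?_).trans (mul_le_mul' h1 h2)
  · exact (m1.comp measurable_prodMk_right).aemeasurable
  · exact (m2.comp measurable_prodMk_right).aemeasurable

lemma enorm_duh_le_vol (hM : IsSymbol M K) (f g : ℝ → Space d → E) (t : ℝ) (ξ : Space d) :
    ‖duh ν M f g t ξ‖ₑ ≤ K * ‖ξ‖ₑ *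
      vol (ν * ‖ξ‖ ^ 2) (fun s => cv (fun η => ‖f s η‖ₑ) (fun η => ‖g s η‖ₑ) ξ) t := by
  refine (enorm_integral_le_lintegral_enorm _).trans ?_
  rw [vol, ← lintegral_const_mul' _ _ (by finiteness)]
  refine lintegral_mono fun s => ?_
  rw [enorm_smul, Real.enorm_eq_ofReal (Real.exp_pos _).le]
  calc _ ≤ ENNReal.ofReal (Real.exp (-(ν * ‖ξ‖ ^ 2 * (t - s)))) *
        (K * ‖ξ‖ₑ * cv (fun η => ‖f s η‖ₑ) (fun η => ‖g s η‖ₑ) ξ) := by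
        gcongr; exact enorm_bconv_le hM _ _ _
    _ = _ := by ring

/-- A bound of the Duhamel integral which is uniform in time. -/
lemma enorm_duh_le (hM : IsSymbol M K) (hν : 0 ≤ ν) (hA : ∀ t ∈ A, Ioc 0 t ⊆ A)
    (hf : Measurable (Function.uncurry f)) (hg : Measurable (Function.uncurry g))
    (hF : ∀ᵐ ξ, timeNorm A f ξ ≤ F ξ) (hG : ∀ᵐ ξ, timeNorm A g ξ ≤ G ξ) {t : ℝ} (ht : t ∈ A)
    (ξ : Space d) : ‖duh ν M f g t ξ‖ₑ ≤ K * ‖ξ‖ₑ * cv F G ξ := by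
  refine (enorm_duh_le_vol hM f g t ξ).trans ?_
  gcongr
  exact (vol_le hA (by positivity) ht).trans (lintegral_cv_le _ hf hg hF hG ξ)

/-- The norm of the bilinear map `duh` on functions which are integrable in frequency with values
in `L²` in time. -/
def kap (ν : ℝ) (K : ℝ≥0) : ℝ≥0∞ := K * ENNReal.ofReal (√(2 * ν))⁻¹

lemma kap_ne_top : kap ν K ≠ ⊤ := by unfold kap; finiteness

/-- The factor `|ξ|` of the symbol is exactly compensated by the smoothing of the heat kernel. -/
lemma timeNorm_duh_le_lintegral (hM : IsSymbol M K) (hν : 0 < ν) (hAm : MeasurableSet A)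
    (hA : ∀ t ∈ A, Ioc 0 t ⊆ A)
    (hf : Measurable (Function.uncurry f)) (hg : Measurable (Function.uncurry g)) (ξ : Space d) :
    timeNorm A (duh ν M f g) ξ
      ≤ kap ν K * ∫⁻ s in A, cv (fun η => ‖f s η‖ₑ) (fun η => ‖g s η‖ₑ) ξ := by
  rw [timeNorm]
  have hcv : Measurable fun s => cv (fun η => ‖f s η‖ₑ) (fun η => ‖g s η‖ₑ) ξ :=
    (measurable_cv_enorm hf hg).comp measurable_prodMk_right
  refine (n2_mono fun t => enorm_duh_le_vol hM f g t ξ).trans ?_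
  rw [n2_const_mul _ (by finiteness)]
  by_cases hξ : ξ = 0
  · simp [hξ]
  have hξ' : 0 < ‖ξ‖ := norm_pos_iff.2 hξ
  set I := ∫⁻ s in A, cv (fun η => ‖f s η‖ₑ) (fun η => ‖g s η‖ₑ) ξ
  calc _ ≤ K * ‖ξ‖ₑ * (ENNReal.ofReal (√(2 * (ν * ‖ξ‖ ^ 2)))⁻¹ * I) := by
        gcongr
        exact n2_vol_le hAm hA (by positivity) hcv
    _ = _ := by
        have : √(2 * (ν * ‖ξ‖ ^ 2)) = √(2 * ν) * ‖ξ‖ := by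
          rw [← mul_assoc, Real.sqrt_mul (by positivity), Real.sqrt_sq hξ'.le]
        rw [this, mul_inv, ENNReal.ofReal_mul (by positivity), kap, ENNReal.ofReal_inv_of_pos hξ',
          ofReal_norm]
        have h1 : ‖ξ‖ₑ * ‖ξ‖ₑ⁻¹ = 1 := ENNReal.mul_inv_cancel (by simpa using hξ) (by simp)
        calc _ = K * ENNReal.ofReal (√(2 * ν))⁻¹ * I * (‖ξ‖ₑ * ‖ξ‖ₑ⁻¹) := by ring
          _ = _ := by rw [h1, mul_one]

lemma timeNorm_duh_le (hM : IsSymbol M K) (hν : 0 < ν) (hAm : MeasurableSet A)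
    (hA : ∀ t ∈ A, Ioc 0 t ⊆ A)
    (hf : Measurable (Function.uncurry f)) (hg : Measurable (Function.uncurry g))
    (hF : ∀ᵐ ξ, timeNorm A f ξ ≤ F ξ) (hG : ∀ᵐ ξ, timeNorm A g ξ ≤ G ξ)
    (ξ : Space d) : timeNorm A (duh ν M f g) ξ ≤ kap ν K * cv F G ξ :=
  (timeNorm_duh_le_lintegral hM hν hAm hA hf hg ξ).trans
    (mul_le_mul_right (lintegral_cv_le _ hf hg hF hG ξ) _)

lemma integrable_bconv (hM : IsSymbol M K)
    (hf : Measurable (Function.uncurry f)) (hg : Measurable (Function.uncurry g))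
    (hF : ∀ᵐ ξ, timeNorm A f ξ ≤ F ξ) (hG : ∀ᵐ ξ, timeNorm A g ξ ≤ G ξ)
    {ξ : Space d} (hξ : cv F G ξ ≠ ⊤) :
    (∀ᵐ s ∂(volume.restrict A), Integrable fun η => M ξ (f s (ξ - η)) (g s η)) ∧
      IntegrableOn (fun s => bconv M (f s) (g s) ξ) A := by
  have hcv : Measurable fun s => cv (fun η => ‖f s η‖ₑ) (fun η => ‖g s η‖ₑ) ξ :=
    (measurable_cv_enorm hf hg).comp measurable_prodMk_right
  have hfin : ∫⁻ s in A, cv (fun η => ‖f s η‖ₑ) (fun η => ‖g s η‖ₑ) ξ ≠ ⊤ :=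
    ne_top_of_le_ne_top hξ (lintegral_cv_le _ hf hg hF hG ξ)
  constructor
  · filter_upwards [ae_lt_top hcv hfin] with s hs
    refine ⟨?_, ?_⟩
    · refine Measurable.aestronglyMeasurable ?_
      refine hM.meas.comp (measurable_const.prodMk (Measurable.prodMk ?_ ?_))
      · exact hf.comp (measurable_const.prodMk (measurable_const.sub measurable_id))
      · exact hg.comp (measurable_const.prodMk measurable_id)
    · have : ∫⁻ η, ‖M ξ (f s (ξ - η)) (g s η)‖ₑ
          ≤ K * ‖ξ‖ₑ * cv (fun η => ‖f s η‖ₑ) (fun η => ‖g s η‖ₑ) ξ := by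
        rw [cv, ← lintegral_const_mul' _ _ (by finiteness)]
        exact lintegral_mono fun η => (hM.bound _ _ _).trans (le_of_eq (by ring))
      exact this.trans_lt (by finiteness)
  · refine ⟨((measurable_bconv hM hf hg).comp measurable_prodMk_right).aestronglyMeasurable, ?_⟩
    have : ∫⁻ s in A, ‖bconv M (f s) (g s) ξ‖ₑ
        ≤ K * ‖ξ‖ₑ * ∫⁻ s in A, cv (fun η => ‖f s η‖ₑ) (fun η => ‖g s η‖ₑ) ξ := by
      rw [← lintegral_const_mul' _ _ (by finiteness)]
      exact lintegral_mono fun s => enorm_bconv_le hM _ _ _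
    exact this.trans_lt (by finiteness)

lemma integrableOn_duh (hν : 0 ≤ ν) (hA : ∀ t ∈ A, Ioc 0 t ⊆ A) {ξ : Space d}
    {h : ℝ → E} (hh : IntegrableOn h A) {t : ℝ} (ht : t ∈ A) :
    IntegrableOn (fun s => Real.exp (-(ν * ‖ξ‖ ^ 2 * (t - s))) • h s) (Ioc 0 t) := by
  refine Integrable.bdd_smul (C := 1) (hh.mono_set (hA t ht)) ?_ ?_
  · exact (by fun_prop : Measurable fun s => Real.exp (-(ν * ‖ξ‖ ^ 2 * (t -
      s)))).aestronglyMeasurable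
  · refine (ae_restrict_iff' measurableSet_Ioc).2 (Eventually.of_forall fun s hs => ?_)
    rw [Real.norm_of_nonneg (Real.exp_pos _).le]
    refine Real.exp_le_one_iff.2 ?_
    have := mul_nonneg (by positivity : 0 ≤ ν * ‖ξ‖ ^ 2) (sub_nonneg.2 hs.2)
    linarith

/-- Finiteness of the majorants is needed, since the integrals which are not convergent are zero. -/
lemma duh_sub_left (hM : IsSymbol M K) (hν : 0 ≤ ν) (hA : ∀ t ∈ A, Ioc 0 t ⊆ A)
    (hf : Measurable (Function.uncurry f)) (hf' : Measurable (Function.uncurry f'))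
    (hg : Measurable (Function.uncurry g))
    (hF : ∀ᵐ ξ, timeNorm A f ξ ≤ F ξ) (hF' : ∀ᵐ ξ, timeNorm A f' ξ ≤ F' ξ)
    (hG : ∀ᵐ ξ, timeNorm A g ξ ≤ G ξ)
    {ξ : Space d} (hξ : cv F G ξ ≠ ⊤) (hξ' : cv F' G ξ ≠ ⊤) {t : ℝ} (ht : t ∈ A) :
    duh ν M (fun s η => f s η - f' s η) g t ξ = duh ν M f g t ξ - duh ν M f' g t ξ := by
  obtain ⟨i1, j1⟩ := integrable_bconv hM hf hg hF hG hξ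
  obtain ⟨i2, j2⟩ := integrable_bconv hM hf' hg hF' hG hξ'
  rw [duh, duh, duh, ← integral_sub (integrableOn_duh hν hA j1 ht) (integrableOn_duh hν hA j2 ht)]
  refine integral_congr_ae ?_
  filter_upwards [ae_restrict_of_ae_restrict_of_subset (hA t ht) i1,
    ae_restrict_of_ae_restrict_of_subset (hA t ht) i2] with s h1 h2
  rw [← smul_sub]
  congr 1
  rw [bconv, bconv, bconv, ← integral_sub h1 h2]
  simp_rw [hM.sub_left]

lemma duh_sub_right (hM : IsSymbol M K) (hν : 0 ≤ ν) (hA : ∀ t ∈ A, Ioc 0 t ⊆ A)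
    (hf : Measurable (Function.uncurry f)) (hg : Measurable (Function.uncurry g))
    (hg' : Measurable (Function.uncurry g'))
    (hF : ∀ᵐ ξ, timeNorm A f ξ ≤ F ξ) (hG : ∀ᵐ ξ, timeNorm A g ξ ≤ G ξ)
    (hG' : ∀ᵐ ξ, timeNorm A g' ξ ≤ G' ξ)
    {ξ : Space d} (hξ : cv F G ξ ≠ ⊤) (hξ' : cv F G' ξ ≠ ⊤) {t : ℝ} (ht : t ∈ A) :
    duh ν M f (fun s η => g s η - g' s η) t ξ = duh ν M f g t ξ - duh ν M f g' t ξ := by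
  obtain ⟨i1, j1⟩ := integrable_bconv hM hf hg hF hG hξ
  obtain ⟨i2, j2⟩ := integrable_bconv hM hf hg' hF hG' hξ'
  rw [duh, duh, duh, ← integral_sub (integrableOn_duh hν hA j1 ht) (integrableOn_duh hν hA j2 ht)]
  refine integral_congr_ae ?_
  filter_upwards [ae_restrict_of_ae_restrict_of_subset (hA t ht) i1,
    ae_restrict_of_ae_restrict_of_subset (hA t ht) i2] with s h1 h2
  rw [← smul_sub]
  congr 1
  rw [bconv, bconv, bconv, ← integral_sub h1 h2]
  simp_rw [hM.sub_right]

/-- The difference of the quadratic terms of two functions, which are both bounded by `F`. -/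
lemma duh_self_sub (hM : IsSymbol M K) (hν : 0 ≤ ν) (hA : ∀ t ∈ A, Ioc 0 t ⊆ A)
    (hf : Measurable (Function.uncurry f)) (hg : Measurable (Function.uncurry g))
    (hF : ∀ᵐ ξ, timeNorm A f ξ ≤ F ξ) (hG : ∀ᵐ ξ, timeNorm A g ξ ≤ F ξ)
    {ξ : Space d} (hξ : cv F F ξ ≠ ⊤) {t : ℝ} (ht : t ∈ A) :
    duh ν M f f t ξ - duh ν M g g t ξ = duh ν M (fun s η => f s η - g s η) f t ξ
      + duh ν M g (fun s η => f s η - g s η) t ξ := by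
  rw [duh_sub_left hM hν hA hf hg hf hF hG hF hξ hξ ht,
    duh_sub_right hM hν hA hg hf hg hG hF hG hξ hξ ht]
  abel

end duhamel

end

section

/-! ### Global mild solutions by iteration -/

section picard

variable {d : ℕ} {E : Type*} [NormedAddCommGroup E] [NormedSpace ℝ E] [CompleteSpace E]
  [MeasurableSpace E] [BorelSpace E] [SecondCountableTopology E]

/-- The heat flow on the Fourier side. -/
def heat (ν : ℝ) (z₀ : Space d → E) (t : ℝ) (ξ : Space d) : E :=
  Real.exp (-(ν * ‖ξ‖ ^ 2 * t)) • z₀ ξ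

/-- The iterates which converge to the solution of the integral equation. -/
def picard (ν : ℝ) (M : Space d → E → E → E) (z₀ : Space d → E) : ℕ → ℝ → Space d → E
  | 0 => heat ν z₀
  | n + 1 => fun t ξ => heat ν z₀ t ξ + duh ν M (picard ν M z₀ n) (picard ν M z₀ n) t ξ

variable {M : Space d → E → E → E} {K : ℝ≥0} {A : Set ℝ} {ν : ℝ} {z₀ : Space d → E}
  {Ω : Space d → ℝ≥0∞}

lemma measurable_heat (hz : Measurable z₀) : Measurable (Function.uncurry (heat ν z₀)) := by
  unfold heat Function.uncurry
  exact Measurable.smul (by fun_prop) (hz.comp measurable_snd)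

lemma measurable_picard (hM : IsSymbol M K) (hz : Measurable z₀) (n : ℕ) :
    Measurable (Function.uncurry (picard ν M z₀ n)) := by
  induction n with
  | zero => exact measurable_heat hz
  | succ n ih => exact (measurable_heat hz).add (measurable_duh ν hM ih ih)

lemma timeNorm_add_le {f g : ℝ → Space d → E} (A : Set ℝ) (hf : Measurable (Function.uncurry f))
    (hg : Measurable (Function.uncurry g)) (ξ : Space d) :
    timeNorm A (fun t ξ => f t ξ + g t ξ) ξ ≤ timeNorm A f ξ + timeNorm A g ξ := by
  refine (n2_mono fun t => enorm_add_le _ _).trans (n2_add_le ?_ ?_)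
  · exact (hf.comp measurable_prodMk_right).enorm.aemeasurable
  · exact (hg.comp measurable_prodMk_right).enorm.aemeasurable

/-- The hypotheses under which the iteration converges: `Ω` is integrable, it is a supersolution of
the stationary majorant equation, and the bilinear map is a contraction in the ball defined by it.
-/
structure IsMajorant (A : Set ℝ) (ν : ℝ) (K : ℝ≥0) (z₀ : Space d → E) (Ω : Space d → ℝ≥0∞) :
    Prop where
  meas : Measurable Ω
  ge : ∀ ξ, timeNorm A (heat ν z₀) ξ + kap ν K * cv Ω Ω ξ ≤ Ω ξ
  integrable : ∫⁻ ξ, Ω ξ ≠ ⊤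
  contract : 2 * kap ν K * ∫⁻ ξ, Ω ξ ≤ 2⁻¹

lemma timeNorm_picard_le (hM : IsSymbol M K) (hν : 0 < ν) (hAm : MeasurableSet A)
    (hA : ∀ t ∈ A, Ioc 0 t ⊆ A) (hz : Measurable z₀) (hΩ : IsMajorant A ν K z₀ Ω) (n : ℕ)
    (ξ : Space d) : timeNorm A (picard ν M z₀ n) ξ ≤ Ω ξ := by
  induction n generalizing ξ with
  | zero => exact le_self_add.trans (hΩ.ge ξ)
  | succ n ih =>
    have hm := measurable_picard (ν := ν) hM hz n
    refine (timeNorm_add_le A (measurable_heat hz) (measurable_duh ν hM hm hm) ξ).trans ?_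
    refine le_trans ?_ (hΩ.ge ξ)
    gcongr
    exact timeNorm_duh_le hM hν hAm hA hm hm (Eventually.of_forall ih) (Eventually.of_forall ih) ξ

/-- Bounds of the successive differences of the iterates. -/
def diffBound (k : ℝ≥0∞) (Ω : Space d → ℝ≥0∞) : ℕ → Space d → ℝ≥0∞
  | 0 => cv Ω Ω
  | n + 1 => fun ξ => cv (fun η => k * diffBound k Ω n η) Ω ξ
      + cv Ω (fun η => k * diffBound k Ω n η) ξ

lemma measurable_diffBound (k : ℝ≥0∞) (hΩ : Measurable Ω) (n : ℕ) :
    Measurable (diffBound k Ω n) := by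
  induction n with
  | zero => exact measurable_cv hΩ hΩ
  | succ n ih => exact (measurable_cv (ih.const_mul k) hΩ).add (measurable_cv hΩ (ih.const_mul k))

lemma lintegral_diffBound_lt_top {k : ℝ≥0∞} (hΩ : Measurable Ω) (h1 : ∫⁻ ξ, Ω ξ ≠ ⊤)
    (h2 : 2 * k * ∫⁻ ξ, Ω ξ ≤ 2⁻¹) : ∫⁻ ξ, ∑' n, diffBound k Ω n ξ < ⊤ := by
  have hm := measurable_diffBound k hΩ
  rw [lintegral_tsum fun n => (hm n).aemeasurable]
  have hb : ∀ n, ∫⁻ ξ, diffBound k Ω n ξ ≤ (∫⁻ ξ, Ω ξ) ^ 2 * 2⁻¹ ^ n := by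
    intro n
    induction n with
    | zero => simp [diffBound, lintegral_cv hΩ hΩ, sq]
    | succ n ih =>
      simp only [diffBound]
      rw [lintegral_add_left (measurable_cv ((hm n).const_mul k) hΩ),
        lintegral_cv ((hm n).const_mul k) hΩ, lintegral_cv hΩ ((hm n).const_mul k),
        lintegral_const_mul _ (hm n)]
      calc _ = (2 * k * ∫⁻ ξ, Ω ξ) * ∫⁻ ξ, diffBound k Ω n ξ := by ring
        _ ≤ 2⁻¹ * ((∫⁻ ξ, Ω ξ) ^ 2 * 2⁻¹ ^ n) := by gcongr
        _ = _ := by ring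
  refine (ENNReal.tsum_le_tsum hb).trans_lt ?_
  rw [ENNReal.tsum_mul_left, ENNReal.tsum_geometric, ENNReal.one_sub_inv_two, inv_inv]
  finiteness

/-- Successive iterates differ by at most `diffBound`, both in `L²` in time and, at the frequencies
where the majorant is finite, uniformly in time. -/
lemma diffBound_spec (hM : IsSymbol M K) (hν : 0 < ν) (hAm : MeasurableSet A)
    (hA : ∀ t ∈ A, Ioc 0 t ⊆ A) (hz : Measurable z₀) (hΩ : IsMajorant A ν K z₀ Ω) (n : ℕ) :
    (∀ᵐ ξ, timeNorm A (fun s η => picard ν M z₀ (n + 1) s η - picard ν M z₀ n s η) ξ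
        ≤ kap ν K * diffBound (kap ν K) Ω n ξ) ∧
    ∀ ξ, cv Ω Ω ξ ≠ ⊤ → ∀ t ∈ A, ‖picard ν M z₀ (n + 1) t ξ - picard ν M z₀ n t ξ‖ₑ
        ≤ K * ‖ξ‖ₑ * diffBound (kap ν K) Ω n ξ := by
  have hp := measurable_picard (ν := ν) hM hz
  have hb := fun n => Eventually.of_forall (f := ae volume)
    (timeNorm_picard_le hM hν hAm hA hz hΩ n)
  have hfin : ∀ᵐ ξ, cv Ω Ω ξ ≠ ⊤ := by
    have : ∫⁻ ξ, cv Ω Ω ξ ≠ ⊤ := by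
      rw [lintegral_cv hΩ.meas hΩ.meas]; exact ENNReal.mul_ne_top hΩ.integrable hΩ.integrable
    exact (ae_lt_top (measurable_cv hΩ.meas hΩ.meas) this).mono fun _ h => h.ne
  induction n with
  | zero =>
    have e : ∀ t ξ, picard ν M z₀ 1 t ξ - picard ν M z₀ 0 t ξ
        = duh ν M (picard ν M z₀ 0) (picard ν M z₀ 0) t ξ := fun t ξ => by simp [picard]
    simp only [zero_add, e]
    exact ⟨Eventually.of_forall fun ξ => timeNorm_duh_le hM hν hAm hA (hp 0) (hp 0) (hb 0) (hb 0) ξ,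
      fun ξ _ t ht => enorm_duh_le hM hν.le hA (hp 0) (hp 0) (hb 0) (hb 0) ht ξ⟩
  | succ n ih =>
    have hd : Measurable (Function.uncurry fun s η => picard ν M z₀ (n + 1) s η
      - picard ν M z₀ n s η) := (hp (n + 1)).sub (hp n)
    have e : ∀ ξ, cv Ω Ω ξ ≠ ⊤ → ∀ t ∈ A,
        picard ν M z₀ (n + 1 + 1) t ξ - picard ν M z₀ (n + 1) t ξ
        = duh ν M (fun s η => picard ν M z₀ (n + 1) s η - picard ν M z₀ n s η)
            (picard ν M z₀ (n + 1)) t ξ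
          + duh ν M (picard ν M z₀ n)
            (fun s η => picard ν M z₀ (n + 1) s η - picard ν M z₀ n s η) t ξ := by
      intro ξ hξ t ht
      rw [← duh_self_sub hM hν.le hA (hp _) (hp _) (hb _) (hb _) hξ ht]
      simp [picard]
    constructor
    · filter_upwards [hfin] with ξ hξ
      have e1 : timeNorm A (fun s η => picard ν M z₀ (n + 1 + 1) s η - picard ν M z₀ (n + 1) s η) ξ
          = timeNorm A (fun t ξ => duh ν M (fun s η => picard ν M z₀ (n + 1) s η
              - picard ν M z₀ n s η) (picard ν M z₀ (n + 1)) t ξ + duh ν M (picard ν M z₀ n)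
            (fun s η => picard ν M z₀ (n + 1) s η - picard ν M z₀ n s η) t ξ) ξ := by
        refine n2_congr_ae ((ae_restrict_iff' hAm).2 (Eventually.of_forall fun t ht => ?_))
        beta_reduce
        rw [e ξ hξ t ht]
      rw [e1]
      refine (timeNorm_add_le A (measurable_duh ν hM hd (hp _)) (measurable_duh ν hM (hp _) hd)
        ξ).trans ?_
      rw [diffBound, mul_add]
      exact add_le_add (timeNorm_duh_le hM hν hAm hA hd (hp _) ih.1 (hb _) ξ)
        (timeNorm_duh_le hM hν hAm hA (hp _) hd (hb _) ih.1 ξ)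
    · intro ξ hξ t ht
      rw [e ξ hξ t ht, diffBound, mul_add]
      exact (enorm_add_le _ _).trans (add_le_add
        (enorm_duh_le hM hν.le hA hd (hp _) ih.1 (hb _) ht ξ)
        (enorm_duh_le hM hν.le hA (hp _) hd (hb _) ih.1 ht ξ))

/-- Existence of a solution of the integral equation, at almost every frequency and all times. -/
theorem exists_mild (hM : IsSymbol M K) (hν : 0 < ν) (hAm : MeasurableSet A)
    (hA : ∀ t ∈ A, Ioc 0 t ⊆ A) (hz : Measurable z₀) (hΩ : IsMajorant A ν K z₀ Ω) :
    ∃ z : ℝ → Space d → E, Measurable (Function.uncurry z) ∧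
      (∀ᵐ ξ, timeNorm A z ξ ≤ Ω ξ) ∧
      (∀ᵐ ξ, ∀ t ∈ A, Tendsto (fun n => picard ν M z₀ n t ξ) atTop (𝓝 (z t ξ))) ∧
      (∀ᵐ ξ, ∀ t ∈ A, z t ξ = heat ν z₀ t ξ + duh ν M z z t ξ) := by
  classical
  set k := kap ν K with hk
  have hk' : k ≠ ⊤ := kap_ne_top
  have hp := measurable_picard (ν := ν) hM hz
  have hb := timeNorm_picard_le hM hν hAm hA hz hΩ
  have hspec := diffBound_spec hM hν hAm hA hz hΩ
  have hdm := measurable_diffBound k hΩ.meas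
  -- the good frequencies, at which the iterates converge uniformly in time
  set S : Set (Space d) := {ξ | cv Ω Ω ξ ≠ ⊤ ∧ ∑' n, diffBound k Ω n ξ ≠ ⊤} with hS
  have hSm : MeasurableSet S :=
    ((measurable_cv hΩ.meas hΩ.meas) (measurableSet_singleton ⊤).compl).inter
      ((Measurable.tsum hdm) (measurableSet_singleton ⊤).compl)
  have hSae : ∀ᵐ ξ, ξ ∈ S := by
    filter_upwards [ae_lt_top (Measurable.tsum hdm)
      (lintegral_diffBound_lt_top hΩ.meas hΩ.integrable hΩ.contract).ne] with ξ hξ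
    refine ⟨?_, hξ.ne⟩
    exact ne_top_of_le_ne_top hξ.ne (ENNReal.le_tsum 0)
  -- the iterates, set to zero away from the good frequencies and times
  let y : ℕ → ℝ × Space d → E := fun n => (A ×ˢ S).indicator (Function.uncurry (picard ν M z₀ n))
  have hym : ∀ n, Measurable (y n) := fun n => (hp n).indicator (hAm.prod hSm)
  have hstep : ∀ ξ ∈ S, ∀ t ∈ A, ∀ n,
      edist (picard ν M z₀ n t ξ) (picard ν M z₀ n.succ t ξ) ≤ K * ‖ξ‖ₑ * diffBound k Ω n ξ := by
    intro ξ hξ t ht n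
    rw [edist_comm, edist_eq_enorm_sub]
    exact (hspec n).2 ξ hξ.1 t ht
  have hlim : ∀ ξ ∈ S, ∀ t ∈ A, ∃ a, Tendsto (fun n => picard ν M z₀ n t ξ) atTop (𝓝 a) := by
    intro ξ hξ t ht
    refine cauchySeq_tendsto_of_complete
      (cauchySeq_of_edist_le_of_tsum_ne_top _ (hstep ξ hξ t ht) ?_)
    rw [ENNReal.tsum_mul_left]
    exact ENNReal.mul_ne_top (by finiteness) hξ.2
  have hylim : ∀ p, ∃ a, Tendsto (fun n => y n p) atTop (𝓝 a) := by
    rintro ⟨t, ξ⟩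
    by_cases h : (t, ξ) ∈ A ×ˢ S
    · obtain ⟨a, ha⟩ := hlim ξ h.2 t h.1
      exact ⟨a, by simpa [y, indicator_of_mem h] using ha⟩
    · exact ⟨0, by simp [y, indicator_of_notMem h]⟩
  choose y' hy' using hylim
  have hy'm : Measurable y' := measurable_of_tendsto_metrizable hym (tendsto_pi_nhds.2 hy')
  let z : ℝ → Space d → E := fun t ξ => y' (t, ξ)
  have hzm : Measurable (Function.uncurry z) := hy'm
  have hzlim : ∀ ξ ∈ S, ∀ t ∈ A, Tendsto (fun n => picard ν M z₀ n t ξ) atTop (𝓝 (z t ξ)) := by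
    intro ξ hξ t ht
    have := hy' (t, ξ)
    simpa [y, indicator_of_mem (show (t, ξ) ∈ A ×ˢ S from ⟨ht, hξ⟩)] using this
  -- the distance of the limit to the iterates
  have hpξ : ∀ n ξ, Measurable fun t => picard ν M z₀ n t ξ :=
    fun n ξ => (hp n).comp measurable_prodMk_right
  let ε : ℕ → Space d → ℝ≥0∞ := fun n ξ => ∑' m, k * diffBound k Ω (n + m) ξ
  have hεm : ∀ n, Measurable (ε n) := fun n => Measurable.tsum fun m => (hdm _).const_mul k
  have hdist : ∀ ξ ∈ S, ∀ t ∈ A, ∀ n, ‖z t ξ - picard ν M z₀ n t ξ‖ₑ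
      ≤ ∑' m, ‖picard ν M z₀ (n + m + 1) t ξ - picard ν M z₀ (n + m) t ξ‖ₑ := by
    intro ξ hξ t ht n
    rw [← edist_eq_enorm_sub, edist_comm]
    refine edist_le_tsum_of_edist_le_of_tendsto
      (fun n => ‖picard ν M z₀ (n + 1) t ξ - picard ν M z₀ n t ξ‖ₑ) (fun n => ?_)
      (hzlim ξ hξ t ht) n
    rw [edist_comm, edist_eq_enorm_sub]
  have hdistT : ∀ n, ∀ᵐ ξ, timeNorm A (fun s η => z s η - picard ν M z₀ n s η) ξ ≤ ε n ξ := by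
    intro n
    filter_upwards [hSae, ae_all_iff.2 fun n => (hspec n).1] with ξ hξ h1
    calc _ ≤ n2 (volume.restrict A) (fun t => ∑' m,
          ‖picard ν M z₀ (n + m + 1) t ξ - picard ν M z₀ (n + m) t ξ‖ₑ) :=
          n2_mono_ae ((ae_restrict_iff' hAm).2 (Eventually.of_forall fun t ht => hdist ξ hξ t ht n))
      _ ≤ ∑' m, n2 (volume.restrict A) (fun t =>
          ‖picard ν M z₀ (n + m + 1) t ξ - picard ν M z₀ (n + m) t ξ‖ₑ) :=
          n2_tsum_le fun m => ((hpξ (n + m + 1) ξ).sub (hpξ (n + m) ξ)).enorm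
      _ ≤ ε n ξ := ENNReal.tsum_le_tsum fun m => h1 (n + m)
  have hε0 : ∀ ξ ∈ S, Tendsto (fun n => ε n ξ) atTop (𝓝 0) := by
    intro ξ hξ
    have := ENNReal.tendsto_sum_nat_add (fun n => k * diffBound k Ω n ξ)
      (by rw [ENNReal.tsum_mul_left]; exact ENNReal.mul_ne_top hk' hξ.2)
    simpa [ε, add_comm] using this
  -- the limit inherits the bound of the iterates
  have hzΩ : ∀ᵐ ξ, timeNorm A z ξ ≤ Ω ξ := by
    filter_upwards [hSae, ae_all_iff.2 hdistT] with ξ hξ h1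
    have h2 : ∀ n, timeNorm A z ξ ≤ Ω ξ + ε n ξ := by
      intro n
      have hmz : Measurable (Function.uncurry fun s η => z s η - picard ν M z₀ n s η) :=
        hzm.sub (hp n)
      have := timeNorm_add_le A (hp n) hmz ξ
      simp only [add_sub_cancel] at this
      exact this.trans (add_le_add (hb n ξ) (h1 n))
    have h3 : Tendsto (fun n => Ω ξ + ε n ξ) atTop (𝓝 (Ω ξ + 0)) :=
      tendsto_const_nhds.add (hε0 ξ hξ)
    rw [add_zero] at h3
    exact ge_of_tendsto' h3 h2
  refine ⟨z, hzm, hzΩ, hSae.mono fun ξ hξ => hzlim ξ hξ, ?_⟩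
  filter_upwards [hSae] with ξ hξ t ht
  -- passage to the limit in the integral equation
  have hbound : ∀ n, ‖duh ν M z z t ξ - duh ν M (picard ν M z₀ n) (picard ν M z₀ n) t ξ‖ₑ
      ≤ K * ‖ξ‖ₑ * ∑' m, diffBound k Ω (n + m + 1) ξ := by
    intro n
    have hmz : Measurable (Function.uncurry fun s η => z s η - picard ν M z₀ n s η) :=
      hzm.sub (hp n)
    rw [duh_self_sub hM hν.le hA hzm (hp n) hzΩ (Eventually.of_forall (hb n)) hξ.1 ht]
    refine (enorm_add_le _ _).trans ?_
    refine (add_le_add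
      (enorm_duh_le hM hν.le hA hmz hzm (hdistT n) hzΩ ht ξ)
      (enorm_duh_le hM hν.le hA (hp n) hmz (Eventually.of_forall (hb n)) (hdistT n) ht ξ)).trans ?_
    rw [← mul_add]
    gcongr
    refine le_of_eq ?_
    have e1 := cv_tsum_left (fun m => (hdm (n + m)).const_mul k) hΩ.meas ξ
    have e2 := cv_tsum_right hΩ.meas (fun m => (hdm (n + m)).const_mul k) ξ
    simp only [ε]
    rw [e1, e2, ← ENNReal.tsum_add]
    rfl
  have hlim2 : Tendsto (fun n => duh ν M (picard ν M z₀ n) (picard ν M z₀ n) t ξ) atTop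
      (𝓝 (duh ν M z z t ξ)) := by
    rw [tendsto_iff_edist_tendsto_0]
    have h0 : Tendsto (fun n => (K * ‖ξ‖ₑ) * ∑' m, diffBound k Ω (n + m + 1) ξ) atTop
        (𝓝 ((K * ‖ξ‖ₑ) * 0)) := by
      refine ENNReal.Tendsto.const_mul ?_ (Or.inr (by finiteness))
      have h1 := (ENNReal.tendsto_sum_nat_add (fun n => diffBound k Ω n ξ) hξ.2).comp
        (tendsto_add_atTop_nat 1)
      refine h1.congr fun n => tsum_congr fun m => ?_
      change diffBound k Ω (m + (n + 1)) ξ = _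
      congr 1
      omega
    rw [mul_zero] at h0
    refine tendsto_of_tendsto_of_tendsto_of_le_of_le tendsto_const_nhds h0 (fun _ => zero_le)
      fun n => ?_
    simp only
    rw [edist_comm, edist_eq_enorm_sub]
    exact hbound n
  have h3 : Tendsto (fun n => picard ν M z₀ (n + 1) t ξ) atTop
      (𝓝 (heat ν z₀ t ξ + duh ν M z z t ξ)) := tendsto_const_nhds.add hlim2
  exact tendsto_nhds_unique ((hzlim ξ hξ t ht).comp (tendsto_add_atTop_nat 1)) h3

end picard

end

section

/-! ### Regularity of mild solutions -/

section regularity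

variable {d : ℕ} {E : Type*} [NormedAddCommGroup E] [NormedSpace ℝ E] [CompleteSpace E]
  [MeasurableSpace E] [BorelSpace E] [SecondCountableTopology E]
  {M : Space d → E → E → E} {K : ℝ≥0} {A : Set ℝ} {ν : ℝ} {z₀ : Space d → E}
  {Ω : Space d → ℝ≥0∞} {z : ℝ → Space d → E}

/-- Duhamel integrals are continuous in time. -/
lemma continuousOn_volterra (hA : ∀ t ∈ A, Ioc 0 t ⊆ A) {a : ℝ}
    (ha : 0 ≤ a) {h : ℝ → E} (hh : IntegrableOn h A) :
    ContinuousOn (fun t => ∫ s in Ioc 0 t, Real.exp (-(a * (t - s))) • h s) A := by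
  have e : ∀ t ∈ A, ∫ s in Ioc 0 t, Real.exp (-(a * (t - s))) • h s
      = ∫ s in A, (Ioc 0 t).indicator (fun s => Real.exp (-(a * (t - s))) • h s) s := by
    intro t ht
    rw [setIntegral_indicator measurableSet_Ioc, inter_eq_self_of_subset_right (hA t ht)]
  refine ContinuousOn.congr ?_ e
  intro t₀ ht₀
  refine continuousWithinAt_of_dominated (bound := fun s => ‖h s‖) ?_ ?_ hh.norm ?_
  · refine Eventually.of_forall fun t => AEStronglyMeasurable.indicator ?_ measurableSet_Ioc
    exact (by fun_prop : Measurable fun s : ℝ => Real.exp (-(a * (t -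
        s)))).aestronglyMeasurable.smul
      hh.aestronglyMeasurable
  · refine Eventually.of_forall fun t => Eventually.of_forall fun s => ?_
    by_cases hs : s ∈ Ioc 0 t
    · rw [indicator_of_mem hs, norm_smul, Real.norm_eq_abs, Real.abs_exp]
      refine mul_le_of_le_one_left (norm_nonneg _) (Real.exp_le_one_iff.2 ?_)
      have := mul_nonneg ha (sub_nonneg.2 hs.2)
      linarith
    · rw [indicator_of_notMem hs, norm_zero]; exact norm_nonneg _
  -- the integrand jumps in `t` only at `t = s`
  · have h1 : ∀ᵐ s ∂(volume.restrict A), s ≠ t₀ :=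
      ae_restrict_of_ae (compl_mem_ae_iff.2 (measure_singleton t₀))
    filter_upwards [h1] with s hs
    refine ContinuousAt.continuousWithinAt ?_
    have hc : ContinuousAt (fun t => Real.exp (-(a * (t - s))) • h s) t₀ := by fun_prop
    by_cases h0 : 0 < s
    · rcases lt_or_gt_of_ne hs with h2 | h2
      · refine hc.congr ?_
        filter_upwards [lt_mem_nhds h2] with t ht
        rw [indicator_of_mem (show s ∈ Ioc 0 t from ⟨h0, ht.le⟩)]
      · refine (continuousAt_const (y := (0 : E))).congr ?_
        filter_upwards [gt_mem_nhds h2] with t ht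
        rw [indicator_of_notMem fun h' => absurd h'.2 (not_le.2 ht)]
    · refine (continuousAt_const (y := (0 : E))).congr (Eventually.of_forall fun t => ?_)
      beta_reduce
      rw [indicator_of_notMem fun h' : s ∈ Ioc 0 t => h0 h'.1]

lemma enorm_heat_le (hν : 0 ≤ ν) {t : ℝ} (ht : 0 ≤ t) (ξ : Space d) :
    ‖heat ν z₀ t ξ‖ₑ ≤ ‖z₀ ξ‖ₑ := by
  rw [heat, enorm_smul, Real.enorm_of_nonneg (Real.exp_pos _).le]
  refine mul_le_of_le_one_left' ?_
  rw [ENNReal.ofReal_le_one, Real.exp_le_one_iff]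
  have : 0 ≤ ν * ‖ξ‖ ^ 2 * t := by positivity
  linarith

/-- The heat flow is square integrable in time, with a gain of one derivative. -/
lemma timeNorm_heat_le (hν : 0 < ν) (hA0 : A ⊆ Ici 0) {ξ : Space d} (hξ : ξ ≠ 0) :
    timeNorm A (heat ν z₀) ξ ≤ ENNReal.ofReal (√(2 * (ν * ‖ξ‖ ^ 2)))⁻¹ * ‖z₀ ξ‖ₑ := by
  have hpos : 0 < 2 * (ν * ‖ξ‖ ^ 2) := by have := norm_pos_iff.2 hξ; positivity
  have e : ∀ t, ‖heat ν z₀ t ξ‖ₑ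
      = ‖z₀ ξ‖ₑ * ENNReal.ofReal (Real.exp (-(ν * ‖ξ‖ ^ 2 * t))) := by
    intro t
    rw [heat, enorm_smul, Real.enorm_of_nonneg (Real.exp_pos _).le, mul_comm]
  simp only [timeNorm, e]
  rw [n2_const_mul _ (by finiteness), mul_comm]
  gcongr
  rw [n2_le_iff]
  have e2 : ∀ t, ENNReal.ofReal (Real.exp (-(ν * ‖ξ‖ ^ 2 * t))) ^ 2
      = ENNReal.ofReal (Real.exp (-(2 * (ν * ‖ξ‖ ^ 2) * (t - 0)))) := by
    intro t
    rw [← ENNReal.ofReal_pow (Real.exp_pos _).le, ← Real.exp_nat_mul]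
    congr 2; push_cast; ring
  simp only [e2]
  refine (lintegral_mono_set hA0).trans ?_
  rw [lintegral_exp_Ici hpos, ← ENNReal.ofReal_pow (by positivity), inv_pow,
    Real.sq_sqrt hpos.le]

lemma ofReal_inv_sqrt_shell_le (hν : 0 < ν) {j : ℤ} {ξ : Space d} (hξ : ξ ∈ shell d j) :
    ENNReal.ofReal (√(2 * (ν * ‖ξ‖ ^ 2)))⁻¹
      ≤ ENNReal.ofReal (√(2 * ν))⁻¹ * 2 ^ ((j : ℝ) * (-1)) := by
  have e : (2 : ℝ≥0∞) ^ ((j : ℝ) * (-1)) = ENNReal.ofReal ((2 : ℝ) ^ j)⁻¹ := by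
    rw [← zpow_neg, ofReal_two_zpow]; simp
  have h2 : (0 : ℝ) < 2 ^ j := by positivity
  have hn : 0 < ‖ξ‖ := h2.trans_le hξ.1
  rw [e, ← ENNReal.ofReal_mul (by positivity), ← mul_assoc, Real.sqrt_mul (by positivity),
    Real.sqrt_sq hn.le, mul_inv]
  have := hξ.1
  gcongr

/-- The norm in frequency of the `L²` norm in time of the heat flow gains one derivative. -/
lemma bs_timeNorm_heat_le (hν : 0 < ν) (hA0 : A ⊆ Ici 0) (s : ℝ) :
    bs (s + 1) (timeNorm A (heat ν z₀))
      ≤ ENNReal.ofReal (√(2 * ν))⁻¹ * bs s (fun ξ => ‖z₀ ξ‖ₑ) := by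
  have := bs_le_of_shell_ae (F := timeNorm A (heat ν z₀)) (G := fun ξ => ‖z₀ ξ‖ₑ)
    (c := ENNReal.ofReal (√(2 * ν))⁻¹) (by finiteness) (s + 1) (-1) fun j =>
      Eventually.of_forall fun ξ hξ => ?_
  · simpa using this
  have h0 : ξ ≠ 0 := by
    rintro rfl
    have : (0 : ℝ) < 2 ^ j := by positivity
    exact absurd hξ.1 (by simpa using this)
  refine (timeNorm_heat_le hν hA0 h0).trans ?_
  gcongr
  exact ofReal_inv_sqrt_shell_le hν hξ

/-- The bilinear estimate in the spaces of high frequency tails. -/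
lemma tailNorm_cv_self_le {f : Space d → ℝ≥0∞} (hf : Measurable f) (σ : ℝ) :
    tailNorm σ (cv f f) ≤ 2 * 2 ^ σ * ((∫⁻ ξ, f ξ) * tailNorm σ f) := by
  have h : ∀ j : ℤ, tail (cv f f) ((2 : ℝ) ^ j)
      ≤ 2 * (∫⁻ ξ, f ξ) * tail f ((2 : ℝ) ^ (j - 1)) := by
    intro j
    have e : (2 : ℝ) ^ j = 2 ^ (j - 1) + 2 ^ (j - 1) := by
      rw [← two_mul, ← zpow_one_add₀ (by norm_num)]; simp
    rw [e]
    refine (tail_cv_le hf hf _ _).trans (le_of_eq ?_)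
    ring
  calc _ ≤ ∑' j : ℤ, (2 * ∫⁻ ξ, f ξ) * ((2 : ℝ≥0∞) ^ ((j : ℝ) * σ) * tail f ((2 : ℝ) ^ (j - 1))) :=
      by
        refine ENNReal.tsum_le_tsum fun j => ?_
        refine (mul_le_mul_right (h j) _).trans (le_of_eq ?_)
        ring
    _ = _ := by
        rw [ENNReal.tsum_mul_left, tsum_tail_shift]
        simp only [Int.cast_one, one_mul]
        ring

lemma measurable_n2_right {α β : Type*} [MeasurableSpace α] [MeasurableSpace β] {μ : Measure β}
    [SFinite μ] {f : α → β → ℝ≥0∞} (hf : Measurable (Function.uncurry f)) :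
    Measurable fun x => n2 μ (f x) := by
  unfold n2
  have h : Measurable fun x => ∫⁻ y, f x y ^ 2 ∂μ :=
    Measurable.lintegral_prod_right' (f := fun p : α × β => f p.1 p.2 ^ 2) (hf.pow_const 2)
  exact h.pow_const _

lemma n2_swap {α β : Type*} [MeasurableSpace α] [MeasurableSpace β] {μ : Measure α} {ν : Measure β}
    [SFinite μ] [SFinite ν] {f : α → β → ℝ≥0∞} (hf : Measurable (Function.uncurry f)) :
    n2 μ (fun x => n2 ν (f x)) = n2 ν (fun y => n2 μ (fun x => f x y)) := by
  have h : ∀ a b : ℝ≥0∞, a ^ 2 = b ^ 2 → a = b := fun a b h =>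
    (ENNReal.pow_right_strictMono (n := 2) (by norm_num)).injective h
  apply h
  simp only [n2_sq]
  exact lintegral_lintegral_swap ((hf.pow_const 2).aemeasurable)

lemma two_rpow_ne_top (x : ℝ) : (2 : ℝ≥0∞) ^ x ≠ ⊤ :=
  ENNReal.rpow_ne_top_of_ne_zero (by norm_num) (by norm_num)

lemma measurable_indicator_time {h : ℝ → Space d → ℝ≥0∞} (hh : Measurable (Function.uncurry h)) {S :
    Set (Space d)}
    (hS : MeasurableSet S) :
    Measurable (Function.uncurry fun t => S.indicator fun ξ => h t ξ) := by
  have : (Function.uncurry fun t => S.indicator fun ξ => h t ξ)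
      = ((univ : Set ℝ) ×ˢ S).indicator fun p => h p.1 p.2 := by
    ext ⟨t, ξ⟩
    by_cases h' : ξ ∈ S
    · rw [indicator_of_mem (show (t, ξ) ∈ univ ×ˢ S from ⟨mem_univ _, h'⟩)]
      simp [Function.uncurry, indicator_of_mem h']
    · rw [indicator_of_notMem (show (t, ξ) ∉ univ ×ˢ S from fun h => h' h.2)]
      simp [Function.uncurry, indicator_of_notMem h']
  rw [this]
  exact (hh).indicator (MeasurableSet.univ.prod hS)

lemma n2_tail_time_le (hz : Measurable (Function.uncurry z)) (r : ℝ) :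
    n2 (volume.restrict A) (fun t => tail (fun ξ => ‖z t ξ‖ₑ) r) ≤ tail (timeNorm A z) r := by
  unfold tail
  rw [n2_swap (f := fun t => {ξ : Space d | r ≤ ‖ξ‖}.indicator fun ξ => ‖z t ξ‖ₑ)]
  · refine n2_mono fun ξ => ?_
    by_cases h : ξ ∈ {ξ : Space d | r ≤ ‖ξ‖}
    · simp only [indicator_of_mem h]; exact le_rfl
    · simp only [indicator_of_notMem h]
      simp [n2]
  · exact measurable_indicator_time hz.enorm (measurableSet_le_norm r)

lemma measurable_tail_time (hz : Measurable (Function.uncurry z)) (r : ℝ) :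
    Measurable fun t => tail (fun ξ => ‖z t ξ‖ₑ) r := by
  unfold tail
  exact measurable_n2_right (measurable_indicator_time hz.enorm (measurableSet_le_norm r))

/-- Minkowski's inequality: the norms in frequency and the `L²` norm in time are exchanged. -/
lemma n2_tailNorm_time_le (hz : Measurable (Function.uncurry z)) (σ : ℝ) :
    n2 (volume.restrict A) (fun t => tailNorm σ (fun ξ => ‖z t ξ‖ₑ))
      ≤ tailNorm σ (timeNorm A z) := by
  unfold tailNorm
  refine (n2_tsum_le fun j => (measurable_tail_time hz _).const_mul _).trans
    (ENNReal.tsum_le_tsum fun j => ?_)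
  rw [n2_const_mul _ (two_rpow_ne_top _)]
  gcongr
  exact n2_tail_time_le hz _

/-- The time integral of the quadratic term in a Besov space. -/
lemma lintegral_bs_cv_le (hz : Measurable (Function.uncurry z)) (σ : ℝ) :
    ∫⁻ t in A, bs σ (cv (fun ξ => ‖z t ξ‖ₑ) (fun ξ => ‖z t ξ‖ₑ))
      ≤ 2 * 2 ^ σ * ((∫⁻ ξ, timeNorm A z ξ) * tailNorm σ (timeNorm A z)) := by
  have hm : Measurable fun t => ∫⁻ ξ, ‖z t ξ‖ₑ := Measurable.lintegral_prod_right hz.enorm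
  have hm2 : Measurable fun t => tailNorm σ (fun ξ => ‖z t ξ‖ₑ) :=
    Measurable.tsum fun j => (measurable_tail_time hz _).const_mul _
  calc _ ≤ ∫⁻ t in A, 2 * 2 ^ σ * ((∫⁻ ξ, ‖z t ξ‖ₑ) * tailNorm σ (fun ξ => ‖z t ξ‖ₑ)) :=
        lintegral_mono fun t => (bs_le_tailNorm _ _).trans
          (tailNorm_cv_self_le (hz.comp measurable_prodMk_left).enorm σ)
    _ = 2 * 2 ^ σ * ∫⁻ t in A, (∫⁻ ξ, ‖z t ξ‖ₑ) * tailNorm σ (fun ξ => ‖z t ξ‖ₑ) :=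
        lintegral_const_mul _ (hm.mul hm2)
    _ ≤ _ := by
        gcongr
        -- each of the two factors is square integrable in time
        refine (lintegral_mul_le_n2 hm.aemeasurable hm2.aemeasurable).trans ?_
        gcongr
        · refine (n2_lintegral_le (f := fun t ξ => ‖z t ξ‖ₑ) hz.enorm).trans le_rfl
        · exact n2_tailNorm_time_le hz σ

lemma measurable_bs_time (hz : Measurable (Function.uncurry z)) (s : ℝ) :
    Measurable fun t => bs s (fun ξ => ‖z t ξ‖ₑ) :=
  Measurable.tsum fun j => (measurable_n2_right
    (measurable_indicator_time hz.enorm (measurableSet_shell j))).const_mul _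

lemma le_inv_mul_rpow (hν : 0 < ν) (j : ℤ) :
    ENNReal.ofReal (ν * ((2 : ℝ) ^ j) ^ 2)⁻¹ = ENNReal.ofReal ν⁻¹ * 2 ^ ((j : ℝ) * (-2)) := by
  have e : (2 : ℝ≥0∞) ^ ((j : ℝ) * (-2)) = ENNReal.ofReal (((2 : ℝ) ^ j) ^ 2)⁻¹ := by
    rw [← zpow_natCast, ← zpow_mul, ← zpow_neg, ofReal_two_zpow]
    push_cast
    ring_nf
  rw [e, mul_inv, ENNReal.ofReal_mul (by positivity)]

/-- On a dyadic shell the heat flow decays exponentially in time. -/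
lemma exp_le_of_mem_shell (hν : 0 ≤ ν) {j : ℤ} {ξ : Space d} (hξ : ξ ∈ shell d j) {t : ℝ}
    (ht : 0 ≤ t) : Real.exp (-(ν * ‖ξ‖ ^ 2 * t)) ≤ Real.exp (-(ν * ((2 : ℝ) ^ j) ^ 2 * t)) := by
  have := hξ.1
  have h2 : (0 : ℝ) < 2 ^ j := by positivity
  gcongr

lemma enorm_mild_le_of_mem_shell (hM : IsSymbol M K) (hν : 0 < ν) {j : ℤ} {ξ : Space d}
    (hs : ξ ∈ shell d j) {t : ℝ} (ht0 : 0 ≤ t)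
    (h : z t ξ = heat ν z₀ t ξ + duh ν M z z t ξ) :
    ‖z t ξ‖ₑ ≤ ENNReal.ofReal (Real.exp (-(ν * ((2 : ℝ) ^ j) ^ 2 * (t - 0)))) * ‖z₀ ξ‖ₑ
      + K * (2 * 2 ^ (j : ℝ)) * vol (ν * ((2 : ℝ) ^ j) ^ 2)
          (fun s => cv (fun η => ‖z s η‖ₑ) (fun η => ‖z s η‖ₑ) ξ) t := by
  rw [h]
  refine (enorm_add_le _ _).trans (add_le_add ?_ ?_)
  · rw [heat, enorm_smul, Real.enorm_of_nonneg (Real.exp_pos _).le]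
    rw [sub_zero]
    exact mul_le_mul_left (ENNReal.ofReal_le_ofReal (exp_le_of_mem_shell hν.le hs ht0)) _
  · refine (enorm_duh_le_vol hM z z t ξ).trans ?_
    gcongr
    · rw [← ofReal_norm]
      refine (ENNReal.ofReal_le_ofReal hs.2.le).trans (le_of_eq ?_)
      rw [ofReal_two_zpow]
      push_cast
      rw [two_rpow_add, ENNReal.rpow_one, mul_comm]
    · refine setLIntegral_mono' measurableSet_Ioc fun s hs' => ?_
      exact mul_le_mul_left (ENNReal.ofReal_le_ofReal
        (exp_le_of_mem_shell hν.le hs (sub_nonneg.2 hs'.2))) _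

lemma n2_vol_swap_le {a : ℝ} {h : ℝ → Space d → ℝ≥0∞} (hh : Measurable (Function.uncurry h))
    (t : ℝ) : n2 volume (fun ξ => vol a (fun s => h s ξ) t)
      ≤ vol a (fun s => n2 volume (h s)) t := by
  have hk : Measurable (Function.uncurry fun (ξ : Space d) (s : ℝ) =>
      ENNReal.ofReal (Real.exp (-(a * (t - s)))) * h s ξ) := by
    have h1 : Measurable fun p : Space d × ℝ => ENNReal.ofReal (Real.exp (-(a * (t - p.2)))) := by
      fun_prop
    exact h1.mul (hh.comp measurable_swap)
  refine (n2_lintegral_le hk).trans (le_of_eq ?_)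
  unfold vol
  refine lintegral_congr fun s => ?_
  rw [n2_const_mul _ (by finiteness)]

lemma measurable_vol_time {a : ℝ} {h : ℝ → Space d → ℝ≥0∞} (hh : Measurable (Function.uncurry h))
    (t : ℝ) : Measurable fun ξ => vol a (fun s => h s ξ) t := by
  have hk : Measurable (Function.uncurry fun (ξ : Space d) (s : ℝ) =>
      ENNReal.ofReal (Real.exp (-(a * (t - s)))) * h s ξ) := by
    have h1 : Measurable fun p : Space d × ℝ => ENNReal.ofReal (Real.exp (-(a * (t - p.2)))) := by
      fun_prop
    exact h1.mul (hh.comp measurable_swap)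
  exact Measurable.lintegral_prod_right' hk

/-- A dyadic piece of a mild solution. -/
lemma n2_shell_mild_le (hM : IsSymbol M K) (hν : 0 < ν) (hz₀ : Measurable z₀)
    (hz : Measurable (Function.uncurry z)) {t : ℝ} (ht0 : 0 ≤ t)
    (hmild : ∀ᵐ ξ, z t ξ = heat ν z₀ t ξ + duh ν M z z t ξ) (j : ℤ) :
    n2 volume ((shell d j).indicator fun ξ => ‖z t ξ‖ₑ)
      ≤ ENNReal.ofReal (Real.exp (-(ν * ((2 : ℝ) ^ j) ^ 2 * (t - 0)))) *
          n2 volume ((shell d j).indicator fun ξ => ‖z₀ ξ‖ₑ)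
        + K * (2 * 2 ^ (j : ℝ)) * vol (ν * ((2 : ℝ) ^ j) ^ 2) (fun s => n2 volume
          ((shell d j).indicator (cv (fun ξ => ‖z s ξ‖ₑ) (fun ξ => ‖z s ξ‖ₑ)))) t := by
  have hsh := measurableSet_shell (d := d) j
  have hhi := measurable_indicator_time (measurable_cv_enorm hz hz) hsh
  have hc : (K : ℝ≥0∞) * (2 * 2 ^ (j : ℝ)) ≠ ⊤ := ENNReal.mul_ne_top (by finiteness)
    (ENNReal.mul_ne_top (by norm_num) (two_rpow_ne_top _))
  refine le_trans (n2_mono_ae (G := fun ξ =>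
    ENNReal.ofReal (Real.exp (-(ν * ((2 : ℝ) ^ j) ^ 2 * (t - 0)))) *
      (shell d j).indicator (fun ξ => ‖z₀ ξ‖ₑ) ξ
    + K * (2 * 2 ^ (j : ℝ)) * vol (ν * ((2 : ℝ) ^ j) ^ 2) (fun s =>
      (shell d j).indicator (cv (fun ξ => ‖z s ξ‖ₑ) (fun ξ => ‖z s ξ‖ₑ)) ξ) t) ?_) ?_
  · filter_upwards [hmild] with ξ hξ
    by_cases hs : ξ ∈ shell d j
    · simp only [indicator_of_mem hs]
      exact enorm_mild_le_of_mem_shell hM hν hs ht0 hξ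
    · simp [indicator_of_notMem hs]
  · refine (n2_add_le ?_ ?_).trans (add_le_add ?_ ?_)
    · exact ((hz₀.enorm.indicator hsh).const_mul _).aemeasurable
    · exact ((measurable_vol_time hhi t).const_mul _).aemeasurable
    · rw [n2_const_mul _ (by finiteness)]
    · rw [n2_const_mul _ hc]
      gcongr
      exact n2_vol_swap_le hhi t

/-- The time integral of a dyadic piece of a mild solution. -/
lemma lintegral_n2_shell_mild_le (hM : IsSymbol M K) (hν : 0 < ν) (hAm : MeasurableSet A)
    (hA : ∀ t ∈ A, Ioc 0 t ⊆ A) (hA0 : A ⊆ Ici 0) (hz₀ : Measurable z₀)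
    (hz : Measurable (Function.uncurry z))
    (hmild : ∀ᵐ ξ, ∀ t ∈ A, z t ξ = heat ν z₀ t ξ + duh ν M z z t ξ) (j : ℤ) :
    ∫⁻ t in A, n2 volume ((shell d j).indicator fun ξ => ‖z t ξ‖ₑ)
      ≤ ENNReal.ofReal ν⁻¹ * 2 ^ ((j : ℝ) * (-2)) *
          n2 volume ((shell d j).indicator fun ξ => ‖z₀ ξ‖ₑ)
        + ENNReal.ofReal ν⁻¹ * 2 ^ ((j : ℝ) * (-2)) * (K * (2 * 2 ^ (j : ℝ)) *
          ∫⁻ t in A, n2 volume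
            ((shell d j).indicator (cv (fun ξ => ‖z t ξ‖ₑ) (fun ξ => ‖z t ξ‖ₑ)))) := by
  have hapos : 0 < ν * ((2 : ℝ) ^ j) ^ 2 := by positivity
  have hhi := measurable_indicator_time (measurable_cv_enorm hz hz)
    (measurableSet_shell (d := d) j)
  have hN : Measurable fun s => n2 volume
      ((shell d j).indicator (cv (fun ξ => ‖z s ξ‖ₑ) (fun ξ => ‖z s ξ‖ₑ))) :=
    measurable_n2_right hhi
  have hc : (K : ℝ≥0∞) * (2 * 2 ^ (j : ℝ)) ≠ ⊤ := ENNReal.mul_ne_top (by finiteness)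
    (ENNReal.mul_ne_top (by norm_num) (two_rpow_ne_top _))
  refine (setLIntegral_mono' hAm fun t ht => n2_shell_mild_le hM hν hz₀ hz (hA0 ht)
    (hmild.mono fun ξ h => h t ht) j).trans ?_
  rw [lintegral_add_left (by fun_prop), lintegral_mul_const _ (by fun_prop),
    lintegral_const_mul' _ _ hc, ← le_inv_mul_rpow hν]
  refine add_le_add ?_ ?_
  · gcongr
    exact (lintegral_mono_set hA0).trans (lintegral_exp_Ici hapos 0).le
  · refine (mul_le_mul_right (lintegral_vol_le hAm hA hapos hN) _).trans (le_of_eq ?_)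
    ring

/-- Parabolic smoothing: mild solutions gain two derivatives in `L¹` in time. -/
lemma lintegral_bs_mild_lt_top (hM : IsSymbol M K) (hν : 0 < ν) (hAm : MeasurableSet A)
    (hA : ∀ t ∈ A, Ioc 0 t ⊆ A) (hA0 : A ⊆ Ici 0) (hz₀ : Measurable z₀)
    (hz : Measurable (Function.uncurry z))
    (hmild : ∀ᵐ ξ, ∀ t ∈ A, z t ξ = heat ν z₀ t ξ + duh ν M z z t ξ) (s : ℝ)
    (h0 : bs s (fun ξ => ‖z₀ ξ‖ₑ) < ⊤) (h1 : ∫⁻ ξ, timeNorm A z ξ < ⊤)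
    (h2 : tailNorm (s + 1) (timeNorm A z) < ⊤) :
    ∫⁻ t in A, bs (s + 2) (fun ξ => ‖z t ξ‖ₑ) < ⊤ := by
  have hm1 := fun j => measurable_n2_right (μ := (volume : Measure (Space d)))
    (measurable_indicator_time (h := fun t ξ => ‖z t ξ‖ₑ) hz.enorm
      (measurableSet_shell (d := d) j))
  have hm2 := fun j => measurable_n2_right (μ := (volume : Measure (Space d)))
    (measurable_indicator_time (measurable_cv_enorm hz hz) (measurableSet_shell (d := d) j))
  simp only [bs] at h0 ⊢
  rw [lintegral_tsum fun j => ((hm1 j).const_mul _).aemeasurable]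
  set cc := ENNReal.ofReal ν⁻¹ with hcc
  -- the heat kernel gains `2 ^ (-2 j)`, the nonlinearity loses `2 ^ j`
  have hj : ∀ j : ℤ, ∫⁻ t in A, (2 : ℝ≥0∞) ^ ((j : ℝ) * (s + 2)) *
        n2 volume ((shell d j).indicator fun ξ => ‖z t ξ‖ₑ)
      ≤ cc * ((2 : ℝ≥0∞) ^ ((j : ℝ) * s) * n2 volume ((shell d j).indicator fun ξ => ‖z₀ ξ‖ₑ))
        + cc * K * 2 * ∫⁻ t in A, (2 : ℝ≥0∞) ^ ((j : ℝ) * (s + 1)) * n2 volume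
            ((shell d j).indicator (cv (fun ξ => ‖z t ξ‖ₑ) (fun ξ => ‖z t ξ‖ₑ))) := by
    intro j
    rw [lintegral_const_mul _ (hm1 j), lintegral_const_mul _ (hm2 j)]
    refine (mul_le_mul_right (lintegral_n2_shell_mild_le hM hν hAm hA hA0 hz₀ hz hmild j) _).trans
        ?_
    have e1 : (2 : ℝ≥0∞) ^ ((j : ℝ) * s)
        = 2 ^ ((j : ℝ) * (s + 2)) * 2 ^ ((j : ℝ) * (-2)) := by
      rw [← two_rpow_add]; ring_nf
    have e2 : (2 : ℝ≥0∞) ^ ((j : ℝ) * (s + 1))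
        = 2 ^ ((j : ℝ) * (s + 2)) * 2 ^ ((j : ℝ) * (-2)) * 2 ^ (j : ℝ) := by
      rw [← two_rpow_add, ← two_rpow_add]; ring_nf
    rw [e1, e2]
    refine le_of_eq ?_
    ring
  refine (ENNReal.tsum_le_tsum hj).trans_lt ?_
  rw [ENNReal.tsum_add, ENNReal.tsum_mul_left, ENNReal.tsum_mul_left,
    ← lintegral_tsum fun j => ((hm2 j).const_mul _).aemeasurable]
  refine ENNReal.add_lt_top.2 ⟨ENNReal.mul_lt_top (by finiteness) h0,
    ENNReal.mul_lt_top (by finiteness) ?_⟩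
  refine (lintegral_bs_cv_le (A := A) hz (s + 1)).trans_lt ?_
  exact ENNReal.mul_lt_top (ENNReal.mul_lt_top (by norm_num) (two_rpow_ne_top _).lt_top)
    (ENNReal.mul_lt_top h1 h2)

lemma tailNorm_mono_ae {f g : Space d → ℝ≥0∞} (h : ∀ᵐ ξ, f ξ ≤ g ξ) (σ : ℝ) :
    tailNorm σ f ≤ tailNorm σ g :=
  ENNReal.tsum_le_tsum fun _ => mul_le_mul_right (tail_mono_ae h _) _

/-- For data which are small in the scaling-invariant norm `∫ ‖e^{-ν|ξ|²t} z₀(ξ)‖_{L²_t} dξ`, there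
is a mild solution. Any further regularity of the data is propagated, without any smallness
condition. -/
theorem exists_regular_mild (hM : IsSymbol M K) (hν : 0 < ν) (hAm : MeasurableSet A)
    (hA : ∀ t ∈ A, Ioc 0 t ⊆ A) (hA0 : A ⊆ Ici 0) (hz₀ : Measurable z₀)
    (hfin : ∫⁻ ξ, timeNorm A (heat ν z₀) ξ ≠ ⊤)
    (hsmall : 4 * kap ν K * ∫⁻ ξ, timeNorm A (heat ν z₀) ξ ≤ 2⁻¹) :
    ∃ z : ℝ → Space d → E, Measurable (Function.uncurry z) ∧
      ∫⁻ ξ, timeNorm A z ξ ≤ 2 * ∫⁻ ξ, timeNorm A (heat ν z₀) ξ ∧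
      (∀ᵐ ξ, ∀ t ∈ A, Tendsto (fun n => picard ν M z₀ n t ξ) atTop (𝓝 (z t ξ))) ∧
      (∀ᵐ ξ, ∀ t ∈ A, z t ξ = heat ν z₀ t ξ + duh ν M z z t ξ) ∧
      (∀ᵐ ξ, ContinuousOn (fun t => z t ξ) A) ∧
      ∃ G : Space d → ℝ≥0∞, Measurable G ∧ (∀ᵐ ξ, ∀ t ∈ A, ‖z t ξ‖ₑ ≤ G ξ) ∧
        ∀ s, 0 ≤ s → bs s (fun ξ => ‖z₀ ξ‖ₑ) < ⊤ →
          bs s G < ⊤ ∧ ∫⁻ t in A, bs (s + 2) (fun ξ => ‖z t ξ‖ₑ) < ⊤ := by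
  set f := timeNorm A (heat ν z₀) with hf
  have hfm : Measurable f := measurable_timeNorm A (measurable_heat hz₀)
  set Ω := maj (kap ν K) f with hΩ
  have hΩm : Measurable Ω := measurable_maj hfm
  have hΩ1 : ∫⁻ ξ, Ω ξ ≤ 2 * ∫⁻ ξ, f ξ := lintegral_maj_le hfm hsmall
  have hΩt : ∫⁻ ξ, Ω ξ ≠ ⊤ := ne_top_of_le_ne_top (by finiteness) hΩ1
  -- the stationary majorant of the heat flow makes the iteration converge
  have hmaj : IsMajorant A ν K z₀ Ω :=
    { meas := hΩm
      ge := fun ξ => (maj_eq hfm ξ).ge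
      integrable := hΩt
      contract := by
        refine (mul_le_mul_right hΩ1 _).trans (le_trans (le_of_eq ?_) hsmall)
        ring }
  obtain ⟨z, hz, hzΩ, hlim, hmild⟩ := exists_mild hM hν hAm hA hz₀ hmaj
  -- the regularity of the data passes to the heat flow, with one more derivative, and from there to
  -- the majorant
  have hΩD : ∀ s, 0 ≤ s → bs s (fun ξ => ‖z₀ ξ‖ₑ) < ⊤ → tailNorm (s + 1) Ω < ⊤ := by
    intro s hs h
    refine tailNorm_maj_lt_top kap_ne_top hfm hsmall (by linarith) ?_
    obtain ⟨C, hC, h1⟩ := tailNorm_le_bs (d := d) (σ := s + 1) (by linarith)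
    refine (h1 f hfm).trans_lt (ENNReal.mul_lt_top hC.lt_top ?_)
    exact (bs_timeNorm_heat_le hν hA0 s).trans_lt (ENNReal.mul_lt_top (by finiteness) h)
  have hfin2 : ∀ᵐ ξ, cv Ω Ω ξ ≠ ⊤ := by
    have : ∫⁻ ξ, cv Ω Ω ξ ≠ ⊤ := by
      rw [lintegral_cv hΩm hΩm]; exact ENNReal.mul_ne_top hΩt hΩt
    exact (ae_lt_top (measurable_cv hΩm hΩm) this).mono fun _ h => h.ne
  -- the bound `G` is uniform in time: the heat flow is a contraction, and the Duhamel integral is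
  -- bounded by the convolution of the majorants
  refine ⟨z, hz, (lintegral_mono_ae hzΩ).trans hΩ1, hlim, hmild, ?_,
    fun ξ => ‖z₀ ξ‖ₑ + K * (‖ξ‖ₑ * cv Ω Ω ξ), ?_, ?_, ?_⟩
  · filter_upwards [hmild, hfin2] with ξ h1 h2
    refine ContinuousOn.congr ?_ h1
    refine ContinuousOn.add (Continuous.continuousOn (by unfold heat; fun_prop)) ?_
    exact continuousOn_volterra hA (by positivity) (integrable_bconv hM hz hz hzΩ hzΩ h2).2
  · exact hz₀.enorm.add ((measurable_enorm.mul (measurable_cv hΩm hΩm)).const_mul _)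
  · filter_upwards [hmild] with ξ h1 t ht
    rw [h1 t ht]
    refine (enorm_add_le _ _).trans (add_le_add (enorm_heat_le hν.le (hA0 ht) ξ) ?_)
    rw [← mul_assoc]
    exact enorm_duh_le hM hν.le hA hz hz hzΩ hzΩ ht ξ
  · intro s hs h
    have hD := hΩD s hs h
    constructor
    · refine (bs_add_le hz₀.enorm ((measurable_enorm.mul (measurable_cv hΩm hΩm)).const_mul _)
        s).trans_lt (ENNReal.add_lt_top.2 ⟨h, ?_⟩)
      have h1 : bs s (fun ξ => K * (‖ξ‖ₑ * cv Ω Ω ξ)) ≤ K * bs s (fun ξ => ‖ξ‖ₑ * cv Ω Ω ξ) := by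
        simpa using bs_le_of_shell_ae (d := d) (F := fun ξ => K * (‖ξ‖ₑ * cv Ω Ω ξ))
          (G := fun ξ => ‖ξ‖ₑ * cv Ω Ω ξ) (c := K) (by finiteness) s 0
          fun j => Eventually.of_forall fun ξ _ => by simp
      refine h1.trans_lt (ENNReal.mul_lt_top (by finiteness) ?_)
      refine (bs_norm_mul_le s _).trans_lt (ENNReal.mul_lt_top (by norm_num) ?_)
      refine (bs_le_tailNorm _ _).trans_lt ((tailNorm_cv_self_le hΩm _).trans_lt ?_)
      exact ENNReal.mul_lt_top (ENNReal.mul_lt_top (by norm_num) (two_rpow_ne_top _).lt_top)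
        (ENNReal.mul_lt_top hΩt.lt_top hD)
    · exact lintegral_bs_mild_lt_top hM hν hAm hA hA0 hz₀ hz hmild s h
        ((lintegral_mono_ae hzΩ).trans_lt hΩt.lt_top) ((tailNorm_mono_ae hzΩ _).trans_lt hD)

end regularity

end

section

/-! ### Tempered distributions with locally integrable Fourier transform -/

section tame

variable {d : ℕ}

/-- Functions which are integrable in the unit ball and square integrable outside. -/
structure Tame (g : Space d → Vec d) : Prop where
  meas : AEStronglyMeasurable g
  low : Integrable ((Metric.closedBall (0 : Space d) 1).indicator g)
  high : MemLp ((Metric.closedBall (0 : Space d) 1)ᶜ.indicator g) 2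

variable {g g' : Space d → Vec d} {f f' : TField d} {φ : Space d → ℂ}

lemma Tame.mono (hg : Tame g) (h : AEStronglyMeasurable g') (c : ℝ)
    (hle : ∀ᵐ ξ, ‖g' ξ‖ ≤ c * ‖g ξ‖) : Tame g' := by
  refine ⟨h, ?_, ?_⟩
  · refine (hg.low.norm.const_mul c).mono' (h.indicator measurableSet_closedBall) ?_
    filter_upwards [hle] with ξ hξ
    by_cases hm : ξ ∈ Metric.closedBall (0 : Space d) 1
    · simpa [indicator_of_mem hm] using hξ
    · simp [indicator_of_notMem hm]
  · refine hg.high.of_le_mul (c := c) (h.indicator measurableSet_closedBall.compl) ?_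
    filter_upwards [hle] with ξ hξ
    by_cases hm : ξ ∈ (Metric.closedBall (0 : Space d) 1)ᶜ
    · simpa [indicator_of_mem hm] using hξ
    · simp [indicator_of_notMem hm]

lemma Tame.add (hg : Tame g) (hg' : Tame g') : Tame (g + g') := by
  refine ⟨hg.meas.add hg'.meas, ?_, ?_⟩
  · rw [indicator_add']; exact hg.low.add hg'.low
  · rw [indicator_add']; exact hg.high.add hg'.high

lemma Tame.neg (hg : Tame g) : Tame (-g) :=
  hg.mono hg.meas.neg 1 (Eventually.of_forall fun ξ => by simp)

lemma Tame.sub (hg : Tame g) (hg' : Tame g') : Tame (g - g') := by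
  rw [sub_eq_add_neg]; exact hg.add hg'.neg

lemma Tame.smul (hg : Tame g) {m : Space d → ℂ} (hm : AEStronglyMeasurable m) {c : ℝ}
    (hc : ∀ ξ, ‖m ξ‖ ≤ c) : Tame fun ξ => m ξ • g ξ :=
  hg.mono (hm.smul hg.meas) c (Eventually.of_forall fun ξ => by
    rw [norm_smul]; exact mul_le_mul_of_nonneg_right (hc ξ) (norm_nonneg _))

lemma Tame.congr (hg : Tame g) (h : g =ᵐ[volume] g') : Tame g' :=
  hg.mono (hg.meas.congr h) 1 (h.mono fun ξ h => by simp [h])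

/-- Integrability against a bounded and square integrable function. -/
lemma Tame.integrable_smul (hg : Tame g) {m : Space d → ℂ} (h1 : MemLp m ⊤) (h2 : MemLp m 2) :
    Integrable fun ξ => m ξ • g ξ := by
  have e : (fun ξ => m ξ • g ξ) = fun ξ => m ξ • (Metric.closedBall (0 : Space d) 1).indicator g ξ
      + m ξ • (Metric.closedBall (0 : Space d) 1)ᶜ.indicator g ξ := by
    ext1 ξ
    rw [← smul_add, ← Pi.add_apply, indicator_self_add_compl]
  rw [e]
  refine Integrable.add ?_ ?_
  · have := (memLp_one_iff_integrable.2 hg.low).smul (r := 1) h1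
    exact memLp_one_iff_integrable.1 this
  · have := hg.high.smul (r := 1) h2
    exact memLp_one_iff_integrable.1 this

lemma Tame.integrable (hg : Tame g) (ψ : 𝓢(Space d, ℂ)) : Integrable fun ξ => ψ ξ • g ξ :=
  hg.integrable_smul (ψ.memLp_top) (ψ.memLp 2)

lemma Tame.locallyIntegrable (hg : Tame g) : LocallyIntegrable g := by
  have := hg.low.locallyIntegrable.add (hg.high.locallyIntegrable (by norm_num))
  rwa [indicator_self_add_compl] at this

lemma memLp_two_iff (hg : AEStronglyMeasurable g) : MemLp g 2 ↔ n2 volume (fun ξ => ‖g ξ‖ₑ) < ⊤ :=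
    by
  rw [MemLp, and_iff_right hg, eLpNorm_eq_lintegral_rpow_enorm_toReal (by norm_num) (by norm_num)]
  simp [n2]

lemma eLpNorm_two_eq (g : Space d → Vec d) : eLpNorm g 2 volume = n2 volume (fun ξ => ‖g ξ‖ₑ) := by
  rw [eLpNorm_eq_lintegral_rpow_enorm_toReal (by norm_num) (by norm_num)]
  simp [n2]

lemma tame_of_memLp_two (hg : MemLp g 2) : Tame g := by
  refine ⟨hg.1, ?_, hg.indicator measurableSet_closedBall.compl⟩
  have : IsFiniteMeasure (volume.restrict (Metric.closedBall (0 : Space d) 1)) :=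
    ⟨by rw [Measure.restrict_apply_univ]; exact measure_closedBall_lt_top⟩
  rw [integrable_indicator_iff measurableSet_closedBall]
  exact (hg.mono_measure Measure.restrict_le_self).integrable (by norm_num)

/-- The function `g` is the Fourier transform of the distribution `f`. -/
structure IsFT (f : TField d) (g : Space d → Vec d) : Prop where
  tame : Tame g
  eq : ∀ ψ : 𝓢(Space d, ℂ), f (𝓕 ψ) = ∫ ξ, ψ ξ • g ξ

lemma IsFT.apply (h : IsFT f g) (θ : 𝓢(Space d, ℂ)) : f θ = ∫ ξ, (𝓕⁻ θ) ξ • g ξ := by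
  rw [← h.eq]; simp

lemma ae_eq_zero_of_forall_schwartz {F : Type*} [NormedAddCommGroup F] [NormedSpace ℂ F]
    [CompleteSpace F] {g : Space d → F} (hg : LocallyIntegrable g)
    (h : ∀ ψ : 𝓢(Space d, ℂ), (∀ ξ, (ψ ξ).im = 0) → ∫ ξ, ψ ξ • g ξ = 0) : ∀ᵐ ξ, g ξ = 0 := by
  refine ae_eq_zero_of_integral_contDiff_smul_eq_zero hg fun ψ hψ hc => ?_
  have h1 : HasCompactSupport (Complex.ofRealCLM ∘ ψ) := hc.comp_left rfl
  have h2 : ContDiff ℝ ∞ (Complex.ofRealCLM ∘ ψ) := by fun_prop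
  have := h (h1.toSchwartzMap h2) (fun ξ => by simp)
  simpa using this

lemma IsFT.unique (h : IsFT f g) (h' : IsFT f g') : g =ᵐ[volume] g' := by
  have := ae_eq_zero_of_forall_schwartz (h.tame.sub h'.tame).locallyIntegrable fun ψ _ => by
    simp only [Pi.sub_apply, smul_sub]
    rw [integral_sub (h.tame.integrable ψ) (h'.tame.integrable ψ), ← h.eq, ← h'.eq, sub_self]
  filter_upwards [this] with ξ hξ
  exact sub_eq_zero.1 hξ

lemma IsFT.congr (h : IsFT f g) (hg : g =ᵐ[volume] g') : IsFT f g' :=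
  ⟨h.tame.congr hg, fun ψ => by
    rw [h.eq]; exact integral_congr_ae (hg.mono fun ξ h => by simp [h])⟩

lemma IsFT.ext (h : IsFT f g) (h' : IsFT f' g') (hg : g =ᵐ[volume] g') : f = f' := by
  ext1 θ
  rw [h.apply, h'.apply]
  exact integral_congr_ae (hg.mono fun ξ h => by simp [h])

lemma IsFT.sub (h : IsFT f g) (h' : IsFT f' g') : IsFT (f - f') (g - g') :=
  ⟨h.tame.sub h'.tame, fun ψ => by
    simp only [Pi.sub_apply, smul_sub]
    rw [integral_sub (h.tame.integrable ψ) (h'.tame.integrable ψ), ← h.eq, ← h'.eq]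
    rfl⟩

lemma Tame.exists_isFT (hg : Tame g) : ∃ f, IsFT f g := by
  have h1 : MemLp ((Metric.closedBall (0 : Space d) 1).indicator g) 1 :=
    memLp_one_iff_integrable.2 hg.low
  refine ⟨𝓕⁻ ((h1.toLp _ : TField d) + (hg.high.toLp _ : TField d)), hg, fun ψ => ?_⟩
  have e : (𝓕⁻ ((h1.toLp _ : TField d) + (hg.high.toLp _ : TField d)) : TField d) (𝓕 ψ)
      = (h1.toLp _ : TField d) ψ + (hg.high.toLp _ : TField d) ψ := by
    rw [TemperedDistribution.fourierInv_apply, FourierTransform.fourierInv_fourier_eq]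
    rfl
  rw [e, Lp.toTemperedDistribution_apply, Lp.toTemperedDistribution_apply]
  have e1 : ∫ ξ, ψ ξ • (h1.toLp _ : Lp (Vec d) 1 (volume : Measure (Space d))) ξ
      = ∫ ξ, ψ ξ • (Metric.closedBall (0 : Space d) 1).indicator g ξ :=
    integral_congr_ae (h1.coeFn_toLp.mono fun ξ h => by simp [h])
  have e2 : ∫ ξ, ψ ξ • (hg.high.toLp _ : Lp (Vec d) 2 (volume : Measure (Space d))) ξ
      = ∫ ξ, ψ ξ • (Metric.closedBall (0 : Space d) 1)ᶜ.indicator g ξ :=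
    integral_congr_ae (hg.high.coeFn_toLp.mono fun ξ h => by simp [h])
  have i1 : Tame ((Metric.closedBall (0 : Space d) 1).indicator g) :=
    hg.mono (hg.meas.indicator measurableSet_closedBall) 1
      (Eventually.of_forall fun ξ => by rw [one_mul]; exact norm_indicator_le_norm_self _ _)
  have i2 : Tame ((Metric.closedBall (0 : Space d) 1)ᶜ.indicator g) :=
    hg.mono (hg.meas.indicator measurableSet_closedBall.compl) 1
      (Eventually.of_forall fun ξ => by rw [one_mul]; exact norm_indicator_le_norm_self _ _)
  rw [e1, e2, ← integral_add (i1.integrable ψ) (i2.integrable ψ)]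
  refine integral_congr_ae (Eventually.of_forall fun ξ => ?_)
  simp only
  rw [← smul_add, ← Pi.add_apply, indicator_self_add_compl]

lemma isFT_lp (h : Lp (Vec d) 2 (volume : Measure (Space d))) :
    IsFT (h : TField d) (𝓕 h : Lp (Vec d) 2 (volume : Measure (Space d))) := by
  refine ⟨tame_of_memLp_two (Lp.memLp _), fun ψ => ?_⟩
  rw [← TemperedDistribution.fourier_apply, Lp.fourier_toTemperedDistribution_eq,
    Lp.toTemperedDistribution_apply]

lemma enorm_lp_eq (h : Lp (Vec d) 2 (volume : Measure (Space d))) :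
    ‖h‖ₑ = n2 volume (fun ξ => ‖(𝓕 h : Lp (Vec d) 2 (volume : Measure (Space d))) ξ‖ₑ) := by
  rw [← eLpNorm_two_eq, ← Lp.enorm_def, enorm_eq_iff_norm_eq.2 (Lp.norm_fourier_eq h)]

/-- A distribution of finite `L²` norm has a square integrable Fourier transform. -/
lemma exists_isFT_of_l2Norm (h : l2Norm f < ⊤) : ∃ g, IsFT f g ∧ MemLp g 2 := by
  unfold l2Norm at h
  simp only [iInf_lt_iff] at h
  obtain ⟨h, hf, -⟩ := h
  exact ⟨_, hf ▸ isFT_lp h, Lp.memLp _⟩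

/-- Plancherel's identity. -/
lemma IsFT.l2Norm_eq (h : IsFT f g) : l2Norm f = n2 volume (fun ξ => ‖g ξ‖ₑ) := by
  refine le_antisymm ?_ ?_
  · rcases eq_or_ne (n2 volume (fun ξ => ‖g ξ‖ₑ)) ⊤ with ht | ht
    · rw [ht]; exact le_top
    have hg : MemLp g 2 := (memLp_two_iff h.tame.meas).2 ht.lt_top
    set G := hg.toLp g
    have e : ((𝓕⁻ G : Lp (Vec d) 2 (volume : Measure (Space d))) : TField d) = f := by
      refine (isFT_lp _).ext h ?_
      rw [FourierTransform.fourier_fourierInv_eq]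
      exact hg.coeFn_toLp
    refine (iInf₂_le (𝓕⁻ G) e).trans (le_of_eq ?_)
    rw [enorm_lp_eq, FourierTransform.fourier_fourierInv_eq]
    exact n2_congr_ae (hg.coeFn_toLp.mono fun ξ h => by rw [h])
  · refine le_iInf₂ fun G hG => ?_
    rw [enorm_lp_eq]
    refine le_of_eq (n2_congr_ae ?_)
    filter_upwards [h.unique (hG ▸ isFT_lp G)] with ξ hξ
    rw [hξ]

end tame

end

section

/-! ### Besov norms on the Fourier side -/

section besov

variable {d : ℕ} {g g' : Space d → Vec d} {f f' : TField d} {φ : Space d → ℂ}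

/-- The dilated function `φ(2^{-j} ξ)`. -/
def dil (φ : Space d → ℂ) (j : ℤ) (ξ : Space d) : ℂ := φ ((2 : ℝ) ^ (-j) • ξ)

lemma IsLittlewoodPaley.hasCompactSupport (hφ : IsLittlewoodPaley φ) : HasCompactSupport φ := by
  refine HasCompactSupport.of_support_subset_isCompact (isCompact_closedBall (0 : Space d) 2) ?_
  intro ξ hξ
  simpa using (hφ.support (subset_tsupport φ hξ)).2

lemma IsLittlewoodPaley.exists_bound (hφ : IsLittlewoodPaley φ) : ∃ B : ℝ≥0, ∀ ξ, ‖φ ξ‖ ≤ B := by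
  obtain ⟨C, hC⟩ := hφ.hasCompactSupport.exists_bound_of_continuous hφ.smooth.continuous
  exact ⟨C.toNNReal, fun ξ => (hC ξ).trans (Real.le_coe_toNNReal C)⟩

lemma IsLittlewoodPaley.contDiff_dil (hφ : IsLittlewoodPaley φ) (j : ℤ) : ContDiff ℝ ∞ (dil φ j) :=
  hφ.smooth.comp (contDiff_const_smul _)

lemma IsLittlewoodPaley.hasTemperateGrowth_dil (hφ : IsLittlewoodPaley φ) (j : ℤ) :
    (dil φ j).HasTemperateGrowth := by
  have h : HasCompactSupport (dil φ j) :=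
    hφ.hasCompactSupport.comp_homeomorph (Homeomorph.smulOfNeZero ((2 : ℝ) ^ (-j)) (by positivity))
  exact (h.toSchwartzMap (hφ.contDiff_dil j)).hasTemperateGrowth

lemma IsLittlewoodPaley.norm_of_ne_zero (hφ : IsLittlewoodPaley φ) {j : ℤ} {ξ : Space d}
    (h : dil φ j ξ ≠ 0) : (2 : ℝ) ^ (j - 1) ≤ ‖ξ‖ ∧ ‖ξ‖ ≤ 2 ^ (j + 1) := by
  have h1 := hφ.support (subset_tsupport φ h)
  have h2 : ‖(2 : ℝ) ^ (-j) • ξ‖ = ‖ξ‖ / 2 ^ j := by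
    rw [norm_smul, norm_zpow, Real.norm_eq_abs, abs_two, zpow_neg, div_eq_inv_mul]
  have hp : (0 : ℝ) < 2 ^ j := by positivity
  rw [mem_ofPred_eq, h2, le_div_iff₀ hp, div_le_iff₀ hp] at h1
  rw [zpow_sub_one₀ (by norm_num), zpow_add_one₀ (by norm_num)]
  constructor <;> linarith [h1.1, h1.2]

/-- Only the blocks `k-1`, `k`, `k+1` meet the shell of index `k`. -/
lemma IsLittlewoodPaley.index_of_mem_shell (hφ : IsLittlewoodPaley φ) {j k : ℤ} {ξ : Space d}
    (h : dil φ j ξ ≠ 0) (hk : ξ ∈ shell d k) : j = k - 1 ∨ j = k ∨ j = k + 1 := by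
  obtain ⟨h1, h2⟩ := hφ.norm_of_ne_zero h
  have h3 : j - 1 < k + 1 := (zpow_lt_zpow_iff_right₀ (by norm_num : (1 : ℝ) < 2)).1
    (h1.trans_lt hk.2)
  have h4 : k ≤ j + 1 := (zpow_le_zpow_iff_right₀ (by norm_num : (1 : ℝ) < 2)).1 (hk.1.trans h2)
  omega

lemma IsLittlewoodPaley.dil_zero (hφ : IsLittlewoodPaley φ) (j : ℤ) : dil φ j 0 = 0 := by
  by_contra h
  have := (hφ.norm_of_ne_zero h).1
  rw [norm_zero] at this
  exact absurd this (not_le.2 (by positivity))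

lemma smulLeftCLM_dil_apply (hφ : IsLittlewoodPaley φ) (j : ℤ) (ψ : 𝓢(Space d, ℂ)) (ξ : Space d) :
    SchwartzMap.smulLeftCLM ℂ (dil φ j) ψ ξ = dil φ j ξ * ψ ξ := by
  rw [SchwartzMap.smulLeftCLM_apply_apply (hφ.hasTemperateGrowth_dil j), smul_eq_mul]

lemma block_fourier (j : ℤ) (f : TField d) (ψ : 𝓢(Space d, ℂ)) :
    block φ j f (𝓕 ψ) = f (𝓕 (SchwartzMap.smulLeftCLM ℂ (dil φ j) ψ)) := by
  unfold block
  rw [TemperedDistribution.fourierMultiplierCLM_apply_apply, FourierTransform.fourierInv_fourier_eq]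
  rfl

lemma IsFT.block (hφ : IsLittlewoodPaley φ) (h : IsFT f g) (j : ℤ) :
    IsFT (block φ j f) fun ξ => dil φ j ξ • g ξ := by
  obtain ⟨B, hB⟩ := hφ.exists_bound
  refine ⟨h.tame.smul (hφ.contDiff_dil j).continuous.aestronglyMeasurable (c := B)
    fun ξ => hB _, fun ψ => ?_⟩
  rw [block_fourier, h.eq]
  refine integral_congr_ae (Eventually.of_forall fun ξ => ?_)
  simp only [smulLeftCLM_dil_apply hφ, smul_smul]
  rw [mul_comm]

lemma IsFT.besovNorm_eq (hφ : IsLittlewoodPaley φ) (h : IsFT f g) (s : ℝ) :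
    besovNorm φ s f = ∑' j : ℤ, (2 : ℝ≥0∞) ^ ((j : ℝ) * s) *
      n2 volume (fun ξ => ‖dil φ j ξ • g ξ‖ₑ) := by
  unfold besovNorm
  exact tsum_congr fun j => by rw [(h.block hφ j).l2Norm_eq]

/-- Summation of a sequence which is dominated by three neighbours in another one. -/
lemma tsum_le_of_three {a b : ℤ → ℝ≥0∞} (s : ℝ) (h : ∀ j, a j ≤ b (j - 1) + b j + b (j + 1)) :
    ∑' j : ℤ, (2 : ℝ≥0∞) ^ ((j : ℝ) * s) * a j
      ≤ (2 ^ s + 1 + 2 ^ (-s)) * ∑' j : ℤ, (2 : ℝ≥0∞) ^ ((j : ℝ) * s) * b j := by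
  have e1 : ∑' j : ℤ, (2 : ℝ≥0∞) ^ ((j : ℝ) * s) * b (j - 1)
      = 2 ^ s * ∑' j : ℤ, (2 : ℝ≥0∞) ^ ((j : ℝ) * s) * b j := by
    rw [← ENNReal.tsum_mul_left, ← (Equiv.subRight (1 : ℤ)).tsum_eq
      (fun j : ℤ => (2 : ℝ≥0∞) ^ s * (2 ^ ((j : ℝ) * s) * b j))]
    refine tsum_congr fun j => ?_
    rw [Equiv.subRight_apply, ← mul_assoc, ← two_rpow_add]
    congr 2
    push_cast; ring
  have e2 : ∑' j : ℤ, (2 : ℝ≥0∞) ^ ((j : ℝ) * s) * b (j + 1)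
      = 2 ^ (-s) * ∑' j : ℤ, (2 : ℝ≥0∞) ^ ((j : ℝ) * s) * b j := by
    rw [← ENNReal.tsum_mul_left, ← (Equiv.addRight (1 : ℤ)).tsum_eq
      (fun j : ℤ => (2 : ℝ≥0∞) ^ (-s) * (2 ^ ((j : ℝ) * s) * b j))]
    refine tsum_congr fun j => ?_
    rw [Equiv.coe_addRight, ← mul_assoc, ← two_rpow_add]
    congr 2
    push_cast; ring
  rw [add_mul, add_mul, ← e1, ← e2, one_mul, ← ENNReal.tsum_add, ← ENNReal.tsum_add]
  refine ENNReal.tsum_le_tsum fun j => ?_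
  rw [← mul_add, ← mul_add]
  gcongr
  exact h j

lemma one_le_two_rpow {x : ℝ} (hx : 0 ≤ x) : (1 : ℝ≥0∞) ≤ 2 ^ x := by
  rw [← ENNReal.rpow_zero (x := 2)]
  exact ENNReal.rpow_le_rpow_of_exponent_le (by norm_num) hx

lemma three_ne_top (s : ℝ) : (2 : ℝ≥0∞) ^ s + 1 + 2 ^ (-s) ≠ ⊤ := by
  have := two_rpow_ne_top s
  have := two_rpow_ne_top (-s)
  finiteness

lemma n2_three_le {F F₁ F₂ F₃ : Space d → ℝ≥0∞} (h1 : AEMeasurable F₁) (h2 : AEMeasurable F₂)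
    (h3 : AEMeasurable F₃) (h : ∀ᵐ ξ, F ξ ≤ F₁ ξ + F₂ ξ + F₃ ξ) :
    n2 volume F ≤ n2 volume F₁ + n2 volume F₂ + n2 volume F₃ :=
  (n2_mono_ae h).trans ((n2_add_le (h1.add h2) h3).trans (add_le_add_left (n2_add_le h1 h2) _))

lemma tsum_block_le_bs (hφ : IsLittlewoodPaley φ) (s : ℝ) : ∃ C : ℝ≥0∞, C ≠ ⊤ ∧
    ∀ g : Space d → Vec d, AEStronglyMeasurable g →
      ∑' j : ℤ, (2 : ℝ≥0∞) ^ ((j : ℝ) * s) * n2 volume (fun ξ => ‖dil φ j ξ • g ξ‖ₑ)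
        ≤ C * bs s (fun ξ => ‖g ξ‖ₑ) := by
  obtain ⟨B, hB⟩ := hφ.exists_bound
  have hm := two_rpow_ne_top
  refine ⟨(2 ^ s + 1 + 2 ^ (-s)) * B, ENNReal.mul_ne_top (three_ne_top s) (by finiteness),
    fun g hg => ?_⟩
  refine (tsum_le_of_three (b := fun k => B * n2 volume ((shell d k).indicator fun ξ => ‖g ξ‖ₑ)) s
    fun j => ?_).trans (le_of_eq ?_)
  · have hgi : ∀ k, AEMeasurable fun ξ => (B : ℝ≥0∞) * (shell d k).indicator (fun ξ => ‖g ξ‖ₑ) ξ :=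
      fun k => (hg.enorm.indicator (measurableSet_shell k)).const_mul _
    simp only [← n2_const_mul (B : ℝ≥0∞) (by finiteness)]
    refine n2_three_le (hgi _) (hgi _) (hgi _) (Eventually.of_forall fun ξ => ?_)
    by_cases h0 : dil φ j ξ = 0
    · simp [h0]
    have hξ : ξ ≠ 0 := by rintro rfl; exact h0 (hφ.dil_zero j)
    obtain ⟨k, hk⟩ := exists_mem_shell hξ
    have hle : ‖dil φ j ξ • g ξ‖ₑ ≤ B * ‖g ξ‖ₑ := by
      rw [enorm_smul]
      gcongr
      rw [← ofReal_norm]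
      exact (ENNReal.ofReal_le_ofReal (hB _)).trans (by simp)
    have e : (shell d k).indicator (fun ξ => ‖g ξ‖ₑ) ξ = ‖g ξ‖ₑ := indicator_of_mem hk _
    -- a dyadic block only meets three shells
    rcases hφ.index_of_mem_shell h0 hk with h | h | h
    · obtain rfl : k = j + 1 := by omega
      rw [e]; exact hle.trans le_add_self
    · obtain rfl : k = j := by omega
      rw [e]; exact hle.trans (le_add_self.trans le_self_add)
    · obtain rfl : k = j - 1 := by omega
      rw [e]; exact hle.trans (le_self_add.trans le_self_add)
  · unfold bs
    rw [mul_assoc]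
    congr 1
    rw [← ENNReal.tsum_mul_left]
    exact tsum_congr fun j => mul_left_comm _ _ _

/-- A sequence of functions which are localised like the dyadic blocks. -/
lemma bs_tsum_le {F : ℤ → Space d → ℝ≥0∞} (hF : ∀ j, AEMeasurable (F j))
    (hsupp : ∀ j k : ℤ, ∀ᵐ ξ, F j ξ ≠ 0 → ξ ∈ shell d k → j = k - 1 ∨ j = k ∨ j = k + 1) (s : ℝ) :
    bs s (fun ξ => ∑' j, F j ξ)
      ≤ (2 ^ s + 1 + 2 ^ (-s)) * ∑' j : ℤ, (2 : ℝ≥0∞) ^ ((j : ℝ) * s) * n2 volume (F j) := by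
  refine tsum_le_of_three s fun k => n2_three_le (hF _) (hF _) (hF _) ?_
  filter_upwards [ae_all_iff.2 fun j => hsupp j k] with ξ hξ
  by_cases hk : ξ ∈ shell d k
  · rw [indicator_of_mem hk, tsum_eq_sum (s := {k - 1, k, k + 1})]
    · rw [Finset.sum_insert (by simp; omega), Finset.sum_insert (by simp), Finset.sum_singleton,
        add_assoc]
    · intro j hj
      by_contra h0
      rcases hξ j h0 hk with h | h | h <;> simp [h] at hj
  · rw [indicator_of_notMem hk]; exact zero_le

lemma one_le_tsum_dil (hφ : IsLittlewoodPaley φ) {ξ : Space d} (hξ : ξ ≠ 0) :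
    1 ≤ ∑' j, ‖dil φ j ξ‖ₑ := by
  have h := hφ.partition ξ hξ
  calc (1 : ℝ≥0∞) = ‖(1 : ℂ)‖ₑ := by simp
    _ = ‖∑' j, dil φ j ξ‖ₑ := by rw [← h.tsum_eq]; rfl
    _ ≤ _ := enorm_tsum_le_tsum_enorm

lemma bs_le_tsum_block [NeZero d] (hφ : IsLittlewoodPaley φ) (hg : AEStronglyMeasurable g) (s : ℝ) :
    bs s (fun ξ => ‖g ξ‖ₑ) ≤ (2 ^ s + 1 + 2 ^ (-s)) *
      ∑' j : ℤ, (2 : ℝ≥0∞) ^ ((j : ℝ) * s) * n2 volume (fun ξ => ‖dil φ j ξ • g ξ‖ₑ) := by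
  refine (bs_mono_ae (G := fun ξ => ∑' j, ‖dil φ j ξ • g ξ‖ₑ) ?_ s).trans (bs_tsum_le ?_ ?_ s)
  · filter_upwards [compl_mem_ae_iff.2 (measure_singleton (0 : Space d))] with ξ hξ
    simp only [enorm_smul]
    rw [ENNReal.tsum_mul_right]
    exact le_mul_of_one_le_left' (one_le_tsum_dil hφ hξ)
  · exact fun j => ((hφ.contDiff_dil j).continuous.aestronglyMeasurable.smul hg).enorm
  · refine fun j k => Eventually.of_forall fun ξ h hk => hφ.index_of_mem_shell (fun h0 => h ?_) hk
    simp [h0]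

lemma n2_le_bs_zero [NeZero d] {F : Space d → ℝ≥0∞} (hF : Measurable F) :
    n2 volume F ≤ bs 0 F := by
  have h : n2 volume F ≤ n2 volume (fun ξ => ∑' j, (shell d j).indicator F ξ) := by
    refine n2_mono_ae ?_
    filter_upwards [compl_mem_ae_iff.2 (measure_singleton (0 : Space d))] with ξ hξ
    obtain ⟨k, hk⟩ := exists_mem_shell hξ
    exact (indicator_of_mem hk F).ge.trans (ENNReal.le_tsum k)
  refine h.trans ((n2_tsum_le fun j => hF.indicator (measurableSet_shell j)).trans (le_of_eq ?_))
  simp [bs]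

/-- Functions of finite Besov norm, with regularity at least `0` at high frequencies and at most
`d/2` at low frequencies, are tame. -/
lemma tame_of_bs [NeZero d] (hg : AEStronglyMeasurable g) {s : ℝ} (hs : 0 ≤ s)
    (hsd : s ≤ d / 2) (h : bs s (fun ξ => ‖g ξ‖ₑ) < ⊤) : Tame g := by
  wlog hgm : Measurable g generalizing g
  · have := this (g := hg.aemeasurable.mk g) hg.aemeasurable.measurable_mk.aestronglyMeasurable
      ((bs_mono_ae (hg.aemeasurable.ae_eq_mk.mono fun ξ h => by rw [h]) s).trans_lt h)
      hg.aemeasurable.measurable_mk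
    exact this.congr hg.aemeasurable.ae_eq_mk.symm
  set B := Metric.closedBall (0 : Space d) 1 with hB
  have hBm : MeasurableSet B := measurableSet_closedBall
  -- for `|ξ| ≤ 1` the weight `2 ^ (j s)` dominates `2 ^ (j d / 2)`, and for `|ξ| > 1` it dominates
  -- `1`
  refine ⟨hg, ⟨hg.indicator hBm, ?_⟩, (memLp_two_iff (hg.indicator hBm.compl)).2 ?_⟩
  · rw [hasFiniteIntegral_iff_enorm]
    obtain ⟨C, hC, h1⟩ := lintegral_le_bs d
    refine (h1 _ (hgm.indicator hBm).enorm).trans_lt (ENNReal.mul_lt_top hC.lt_top ?_)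
    refine lt_of_le_of_lt ?_ h
    have := bs_le_of_shell_ae (F := fun ξ => ‖B.indicator g ξ‖ₑ) (G := fun ξ => ‖g ξ‖ₑ) (c := 1)
      (by simp) (d / 2) (s - d / 2) fun j => Eventually.of_forall fun ξ hξ => ?_
    · simpa using this
    by_cases hm : ξ ∈ B
    · rw [indicator_of_mem hm, one_mul]
      refine le_mul_of_one_le_left' ?_
      have h3 : (2 : ℝ) ^ j ≤ 2 ^ (0 : ℤ) := hξ.1.trans (by simpa [hB] using hm)
      have h4 : j ≤ 0 := (zpow_le_zpow_iff_right₀ (by norm_num : (1 : ℝ) < 2)).1 h3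
      have h5 : (j : ℝ) ≤ 0 := by exact_mod_cast h4
      exact one_le_two_rpow
        (mul_nonneg_of_nonpos_of_nonpos h5 (by linarith))
    · simp [indicator_of_notMem hm]
  · refine (n2_le_bs_zero (hgm.indicator hBm.compl).enorm).trans_lt (lt_of_le_of_lt ?_ h)
    have := bs_le_of_shell_ae (F := fun ξ => ‖Bᶜ.indicator g ξ‖ₑ) (G := fun ξ => ‖g ξ‖ₑ) (c := 1)
      (by simp) 0 s fun j => Eventually.of_forall fun ξ hξ => ?_
    · simpa using this
    by_cases hm : ξ ∈ Bᶜ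
    · rw [indicator_of_mem hm, one_mul]
      refine le_mul_of_one_le_left' ?_
      have h3 : (2 : ℝ) ^ (0 : ℤ) < 2 ^ (j + 1) := by
        refine lt_trans ?_ hξ.2
        simpa [hB] using hm
      have h4 : 0 < j + 1 := (zpow_lt_zpow_iff_right₀ (by norm_num : (1 : ℝ) < 2)).1 h3
      have h5 : (0 : ℝ) ≤ j := by exact_mod_cast (by omega : 0 ≤ j)
      exact one_le_two_rpow (by positivity)
    · simp [indicator_of_notMem hm]

lemma isRealized_iff : IsRealized φ f ↔ ∀ θ : 𝓢(Space d, ℂ),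
    Tendsto (fun N : ℕ => ∑ j ∈ Finset.Icc (-(N : ℤ)) (N : ℤ), block φ j f θ) atTop (𝓝 (f θ)) := by
  unfold IsRealized
  rw [PointwiseConvergenceCLM.tendsto_iff_forall_tendsto]
  refine forall_congr' fun θ => ?_
  refine tendsto_congr fun N => ?_
  exact map_sum (PointwiseConvergenceCLM.evalCLM (RingHom.id ℂ) (Vec d) θ) _ _

lemma tendsto_Icc_int : Tendsto (fun N : ℕ => Finset.Icc (-(N : ℤ)) (N : ℤ)) atTop atTop := by
  refine tendsto_atTop_finset_of_monotone (fun a b h => ?_) fun x => ⟨x.natAbs, ?_⟩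
  · exact Finset.Icc_subset_Icc (by simpa using h) (by simpa using h)
  · simp only [Finset.mem_Icc]; omega

/-- Passage to the limit in a series of distributions, on the Fourier side. -/
lemma tendsto_sum_integral {G : ℤ → Space d → Vec d} {H : Space d → Vec d} (hH : Tame H)
    (hG : ∀ j, AEStronglyMeasurable (G j)) (hle : ∀ᵐ ξ, ∀ s : Finset ℤ, ‖∑ j ∈ s, G j ξ‖ ≤ ‖H ξ‖)
    (hlim : ∀ᵐ ξ, HasSum (fun j => G j ξ) (g ξ)) (θ : 𝓢(Space d, ℂ)) :
    Tendsto (fun N : ℕ => ∫ ξ, θ ξ • ∑ j ∈ Finset.Icc (-(N : ℤ)) (N : ℤ), G j ξ) atTop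
      (𝓝 (∫ ξ, θ ξ • g ξ)) := by
  refine tendsto_integral_of_dominated_convergence (fun ξ => ‖θ ξ • H ξ‖) ?_
    (hH.integrable θ).norm ?_ ?_
  · intro N
    exact θ.continuous.aestronglyMeasurable.smul
      (Finset.aestronglyMeasurable_fun_sum _ fun j _ => hG j)
  · intro N
    filter_upwards [hle] with ξ hξ
    rw [norm_smul, norm_smul]
    exact mul_le_mul_of_nonneg_left (hξ _) (norm_nonneg _)
  · filter_upwards [hlim] with ξ hξ
    exact (hξ.comp tendsto_Icc_int).const_smul _

/-- The low frequency cut-offs tend to zero, by dominated convergence, since the Fourier transform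
has no mass at the origin. -/
lemma IsFT.isRealized [NeZero d] (hφ : IsLittlewoodPaley φ) (h : IsFT f g) : IsRealized φ f := by
  obtain ⟨B, hB⟩ := hφ.exists_bound
  rw [isRealized_iff]
  intro θ
  have hH : Tame fun ξ => ((3 * B : ℝ) : ℂ) • g ξ :=
    h.tame.smul (m := fun _ => ((3 * B : ℝ) : ℂ)) aestronglyMeasurable_const
      (c := ‖((3 * B : ℝ) : ℂ)‖) fun _ => le_rfl
  have hne : ∀ᵐ ξ : Space d, ξ ≠ 0 := compl_mem_ae_iff.2 (measure_singleton (0 : Space d))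
  have := tendsto_sum_integral (G := fun j ξ => dil φ j ξ • g ξ) (g := g) hH
    (fun j => (hφ.contDiff_dil j).continuous.aestronglyMeasurable.smul h.tame.meas) ?_ ?_ (𝓕⁻ θ)
  · rw [← h.apply] at this
    refine this.congr fun N => ?_
    simp_rw [Finset.smul_sum]
    rw [integral_finsetSum _ fun j _ => (h.block hφ j).tame.integrable _]
    exact Finset.sum_congr rfl fun j _ => ((h.block hφ j).apply θ).symm
  · filter_upwards [hne] with ξ hξ s
    obtain ⟨k, hk⟩ := exists_mem_shell hξ
    rw [← Finset.sum_smul, norm_smul, norm_smul]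
    refine mul_le_mul_of_nonneg_right ?_ (norm_nonneg _)
    -- at most three blocks do not vanish at a given frequency
    have h1 : ∑ j ∈ s, ‖dil φ j ξ‖ ≤ ∑ j ∈ ({k - 1, k, k + 1} : Finset ℤ), ‖dil φ j ξ‖ := by
      classical
      rw [← Finset.sum_filter_ne_zero]
      refine Finset.sum_le_sum_of_subset_of_nonneg (fun j hj => ?_) fun _ _ _ => norm_nonneg _
      have := hφ.index_of_mem_shell (norm_ne_zero_iff.1 (Finset.mem_filter.1 hj).2) hk
      simpa using this
    refine (norm_sum_le _ _).trans (h1.trans ?_)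
    refine (Finset.sum_le_card_nsmul _ _ (B : ℝ) fun j _ => hB _).trans ?_
    rw [nsmul_eq_mul, Complex.norm_of_nonneg (by positivity)]
    gcongr
    exact_mod_cast Finset.card_le_three
  · filter_upwards [hne] with ξ hξ
    have := (hφ.partition ξ hξ).smul_const (g ξ)
    rwa [one_smul] at this

lemma memBesov_iff [NeZero d] (hφ : IsLittlewoodPaley φ) (h : IsFT f g) (s : ℝ) :
    MemBesov φ s f ↔ bs s (fun ξ => ‖g ξ‖ₑ) < ⊤ := by
  unfold MemBesov
  rw [and_iff_right (h.isRealized hφ), h.besovNorm_eq hφ]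
  constructor
  · intro h1
    exact (bs_le_tsum_block hφ h.tame.meas s).trans_lt
      (ENNReal.mul_lt_top (three_ne_top s).lt_top h1)
  · intro h1
    obtain ⟨C, hC, h2⟩ := tsum_block_le_bs (d := d) hφ s
    exact (h2 g h.tame.meas).trans_lt (ENNReal.mul_lt_top hC.lt_top h1)

/-- The elements of the Besov spaces under consideration have a Fourier transform which is a
function. -/
lemma exists_isFT_of_memBesov [NeZero d] (hφ : IsLittlewoodPaley φ) {s : ℝ} (hs : 0 ≤ s)
    (hsd : s ≤ d / 2) (h : MemBesov φ s f) : ∃ g, IsFT f g := by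
  have hfin : ∀ j, l2Norm (block φ j f) < ⊤ := by
    intro j
    have h1 := (ENNReal.le_tsum (f := fun j : ℤ => (2 : ℝ≥0∞) ^ ((j : ℝ) * s) *
      l2Norm (block φ j f)) j).trans_lt h.2
    by_contra h2
    rw [not_lt, top_le_iff] at h2
    simp only [h2] at h1
    rw [ENNReal.mul_top] at h1
    · exact lt_irrefl _ h1
    · exact (ENNReal.rpow_pos (by norm_num) (by norm_num)).ne'
  choose G hG hG2 using fun j => exists_isFT_of_l2Norm (hfin j)
  -- the Fourier transform of a dyadic block is supported in the corresponding annulus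
  have hsupp : ∀ j, ∀ᵐ ξ, G j ξ ≠ 0 → (2 : ℝ) ^ (j - 1) ≤ ‖ξ‖ ∧ ‖ξ‖ ≤ 2 ^ (j + 1) := by
    intro j
    have hU : IsOpen (tsupport (dil φ j))ᶜ := (isClosed_tsupport _).isOpen_compl
    have := hU.ae_eq_zero_of_integral_contDiff_smul_eq_zero (μ := volume) (f := G j)
      ((hG j).tame.locallyIntegrable.locallyIntegrableOn _) fun ψ hψ hc hs => ?_
    · filter_upwards [this] with ξ h1 h2
      have h3 : ξ ∈ tsupport (dil φ j) := by
        by_contra h4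
        exact h2 (h1 h4)
      have hcl : IsClosed {ξ : Space d | (2 : ℝ) ^ (j - 1) ≤ ‖ξ‖ ∧ ‖ξ‖ ≤ 2 ^ (j + 1)} :=
        (isClosed_le continuous_const continuous_norm).inter
          (isClosed_le continuous_norm continuous_const)
      exact closure_minimal (fun ξ hξ => hφ.norm_of_ne_zero hξ) hcl h3
    · have h1 : HasCompactSupport (Complex.ofRealCLM ∘ ψ) := hc.comp_left rfl
      have h2 : ContDiff ℝ ∞ (Complex.ofRealCLM ∘ ψ) := by fun_prop
      have h3 := (hG j).eq (h1.toSchwartzMap h2)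
      rw [block_fourier] at h3
      have h4 : SchwartzMap.smulLeftCLM ℂ (dil φ j) (h1.toSchwartzMap h2) = 0 := by
        ext ξ
        rw [smulLeftCLM_dil_apply hφ]
        by_cases h5 : dil φ j ξ = 0
        · simp [h5]
        · have : ξ ∉ tsupport ψ := fun h6 => hs h6 (subset_tsupport _ h5)
          simp [image_eq_zero_of_notMem_tsupport this]
      rw [h4] at h3
      simpa using h3.symm
  have hidx : ∀ j k : ℤ, ∀ᵐ ξ, ‖G j ξ‖ₑ ≠ 0 → ξ ∈ shell d k → j = k - 1 ∨ j = k ∨ j = k + 1 := by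
    intro j k
    filter_upwards [hsupp j] with ξ h1 h2 hk
    obtain ⟨h1, h2⟩ := h1 (by simpa using h2)
    have h3 : j - 1 < k + 1 := (zpow_lt_zpow_iff_right₀ (by norm_num : (1 : ℝ) < 2)).1
      (h1.trans_lt hk.2)
    have h4 : k ≤ j + 1 := (zpow_le_zpow_iff_right₀ (by norm_num : (1 : ℝ) < 2)).1 (hk.1.trans h2)
    omega
  have hGm : ∀ j, AEMeasurable (fun ξ => ‖G j ξ‖ₑ) := fun j => (hG j).tame.meas.enorm
  have hbs : bs s (fun ξ => ∑' j, ‖G j ξ‖ₑ) < ⊤ := by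
    refine (bs_tsum_le hGm hidx s).trans_lt (ENNReal.mul_lt_top (three_ne_top s).lt_top ?_)
    refine lt_of_eq_of_lt (tsum_congr fun j => ?_) h.2
    rw [(hG j).l2Norm_eq]
  have hne : ∀ᵐ ξ : Space d, ξ ≠ 0 := compl_mem_ae_iff.2 (measure_singleton (0 : Space d))
  have hfin2 : ∀ᵐ ξ, ∑' j, ‖G j ξ‖ₑ ≠ ⊤ := by
    filter_upwards [hne, ae_all_iff.2 fun j => ae_all_iff.2 fun k => hidx j k] with ξ hξ h1
    obtain ⟨k, hk⟩ := exists_mem_shell hξ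
    rw [tsum_eq_sum (s := {k - 1, k, k + 1})]
    · exact ENNReal.sum_ne_top.2 fun j _ => by finiteness
    · intro j hj
      by_contra h0
      rcases h1 j k h0 hk with h | h | h <;> simp [h] at hj
  have hsum : ∀ᵐ ξ, Summable fun j => ‖G j ξ‖ := by
    filter_upwards [hfin2] with ξ hξ
    have h1 : ∑' j, ((‖G j ξ‖₊ : ℝ≥0) : ℝ≥0∞) ≠ ⊤ := hξ
    have h2 := ENNReal.tsum_coe_ne_top_iff_summable.1 h1
    exact NNReal.summable_coe.2 h2
  set g : Space d → Vec d := fun ξ => ∑' j, G j ξ with hg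
  have hlim : ∀ᵐ ξ, HasSum (fun j => G j ξ) (g ξ) := by
    filter_upwards [hsum] with ξ hξ using hξ.of_norm.hasSum
  have hgm : AEStronglyMeasurable g := by
    refine aestronglyMeasurable_of_tendsto_ae atTop (f := fun N : ℕ => fun ξ =>
      ∑ j ∈ Finset.Icc (-(N : ℤ)) (N : ℤ), G j ξ)
      (fun N => Finset.aestronglyMeasurable_fun_sum _ fun j _ => (hG j).tame.meas) ?_
    filter_upwards [hlim] with ξ hξ using hξ.comp tendsto_Icc_int
  -- a tame function which dominates the partial sums
  set H : Space d → Vec d := fun ξ => EuclideanSpace.single 0 ((∑' j, ‖G j ξ‖ₑ).toReal : ℂ) with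
      hHdef
  have hHn : ∀ ξ, ‖H ξ‖ = (∑' j, ‖G j ξ‖ₑ).toReal := fun ξ => by
    rw [hHdef]; simp
  have hHm : AEStronglyMeasurable H := by
    have h1 : AEMeasurable fun ξ => ((∑' j, ‖G j ξ‖ₑ).toReal : ℂ) :=
      Complex.measurable_ofReal.comp_aemeasurable (AEMeasurable.tsum hGm).ennreal_toReal
    have h2 : Continuous fun c : ℂ => (EuclideanSpace.single (0 : Fin d) c : Vec d) := by
      have : (fun c : ℂ => (EuclideanSpace.single (0 : Fin d) c : Vec d))
          = fun c => c • EuclideanSpace.single (0 : Fin d) (1 : ℂ) := by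
        ext1 c; ext i; by_cases h : i = 0 <;> simp [h]
      rw [this]; fun_prop
    exact h2.comp_aestronglyMeasurable h1.aestronglyMeasurable
  have hH : Tame H := by
    refine tame_of_bs hHm hs hsd (lt_of_le_of_lt (bs_mono_ae ?_ s) hbs)
    refine Eventually.of_forall fun ξ => ?_
    rw [← ofReal_norm, hHn]
    exact ENNReal.ofReal_toReal_le
  have hle : ∀ᵐ ξ, ∀ s : Finset ℤ, ‖∑ j ∈ s, G j ξ‖ ≤ ‖H ξ‖ := by
    filter_upwards [hfin2] with ξ hξ s
    rw [hHn, ← toReal_enorm]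
    refine ENNReal.toReal_mono hξ ((enorm_sum_le _ _).trans (ENNReal.sum_le_tsum s))
  have hgt : Tame g := by
    refine hH.mono hgm 1 ?_
    filter_upwards [hle, hlim] with ξ h1 h2
    rw [one_mul]
    exact le_of_tendsto h2.norm (Eventually.of_forall h1)
  refine ⟨g, hgt, fun ψ => ?_⟩
  refine tendsto_nhds_unique ((isRealized_iff.1 h.1) (𝓕 ψ)) ?_
  refine (tendsto_sum_integral hH (fun j => (hG j).tame.meas) hle hlim ψ).congr fun N => ?_
  simp_rw [Finset.smul_sum]
  rw [integral_finsetSum _ fun j _ => (hG j).tame.integrable _]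
  exact Finset.sum_congr rfl fun j _ => ((hG j).eq ψ).symm

end besov

end

section

/-! ### Real and divergence-free fields on the Fourier side -/

section real

variable {d : ℕ} {g g' : Space d → Vec d} {f f' : TField d} {φ : Space d → ℂ}

lemma integral_apply {α : Type*} [MeasurableSpace α] {μ : Measure α} {h : α → Vec d}
    (hh : Integrable h μ) (i : Fin d) : (∫ x, h x ∂μ) i = ∫ x, h x i ∂μ :=
  ((EuclideanSpace.proj (𝕜 := ℂ) i).integral_comp_comm hh).symm

lemma integrable_coord {α : Type*} [MeasurableSpace α] {μ : Measure α} {h : α → Vec d}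
    (hh : Integrable h μ) (i : Fin d) : Integrable (fun x => h x i) μ :=
  (EuclideanSpace.proj (𝕜 := ℂ) i).integrable_comp hh

lemma locallyIntegrable_coord {h : Space d → Vec d}
    (hh : LocallyIntegrable h) (i : Fin d) : LocallyIntegrable (fun x => h x i) := by
  intro x
  obtain ⟨U, hU, h1⟩ := hh x
  exact ⟨U, hU, integrable_coord h1 i⟩

lemma IsFT.eq_coord (h : IsFT f g) (ψ : 𝓢(Space d, ℂ)) (i : Fin d) :
    f (𝓕 ψ) i = ∫ ξ, ψ ξ * g ξ i := by
  rw [h.eq, integral_apply (h.tame.integrable ψ)]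
  rfl

lemma Tame.integrable_coord (h : Tame g) (ψ : 𝓢(Space d, ℂ)) (i : Fin d) :
    Integrable fun ξ => ψ ξ * g ξ i := MHD.integrable_coord (h.integrable ψ) i

/-- The bilinear product `∑ ξ_i v_i`. -/
def dotc (ξ : Space d) (v : Vec d) : ℂ := ∑ i, (ξ i : ℂ) * v i

lemma lineDeriv_fourier_apply (f : TField d) (ψ : 𝓢(Space d, ℂ)) (i : Fin d) :
    (∂_{(e i : Space d)} f : TField d) (𝓕 ψ)
      = f (𝓕 ((2 * Real.pi * Complex.I) •
          SchwartzMap.smulLeftCLM ℂ (inner ℝ · (e i : Space d)) ψ)) := by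
  rw [TemperedDistribution.lineDerivOp_apply_apply, SchwartzMap.lineDerivOp_fourier_eq,
    ← FourierTransform.fourier_neg, neg_smul, neg_neg]

lemma inner_e (ξ : Space d) (i : Fin d) : inner ℝ ξ (e i : Space d) = ξ i := by
  simp [EuclideanSpace.inner_single_right]

lemma smulLeftCLM_inner_apply (ψ : 𝓢(Space d, ℂ)) (i : Fin d) (ξ : Space d) :
    SchwartzMap.smulLeftCLM ℂ (inner ℝ · (e i : Space d)) ψ ξ = (ξ i : ℂ) * ψ ξ := by
  have hi : (fun ξ : Space d => inner ℝ ξ (e i : Space d)).HasTemperateGrowth := by fun_prop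
  rw [SchwartzMap.smulLeftCLM_apply_apply hi, inner_e, Complex.real_smul]

lemma IsFT.isDivFree_iff (h : IsFT f g) : IsDivFree f ↔ ∀ᵐ ξ, dotc ξ (g ξ) = 0 := by
  -- up to a constant, the divergence acts as the multiplication of the Fourier transform by `ξ`
  have key : ∀ ψ : 𝓢(Space d, ℂ), ∑ i, ((∂_{(e i : Space d)} f : TField d) (𝓕 ψ)) i
      = (2 * Real.pi * Complex.I) * ∫ ξ, ψ ξ • dotc ξ (g ξ) := by
    intro ψ
    have e1 : ∀ i, ((∂_{(e i : Space d)} f : TField d) (𝓕 ψ)) i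
        = (2 * Real.pi * Complex.I) * ∫ ξ, (ξ i : ℂ) * (ψ ξ * g ξ i) := by
      intro i
      rw [lineDeriv_fourier_apply, h.eq_coord, ← integral_const_mul]
      refine integral_congr_ae (Eventually.of_forall fun ξ => ?_)
      simp only [_root_.smul_apply, smulLeftCLM_inner_apply, smul_eq_mul]
      ring
    simp only [e1]
    rw [← Finset.mul_sum, ← integral_finsetSum]
    · congr 1
      refine integral_congr_ae (Eventually.of_forall fun ξ => ?_)
      simp only [dotc, smul_eq_mul, Finset.mul_sum]
      exact Finset.sum_congr rfl fun i _ => by ring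
    · intro i _
      have := h.tame.integrable_coord (SchwartzMap.smulLeftCLM ℂ (inner ℝ · (e i : Space d)) ψ) i
      refine this.congr (Eventually.of_forall fun ξ => ?_)
      simp only [smulLeftCLM_inner_apply]
      ring
  constructor
  · intro hd
    refine ae_eq_zero_of_forall_schwartz ?_ fun ψ _ => ?_
    · have : (fun ξ => dotc ξ (g ξ)) = fun ξ => ∑ i, ((fun ξ : Space d => (ξ i : ℂ)) • fun ξ => g ξ
        i) ξ := by
        ext ξ; simp [dotc]
      rw [this]
      refine locallyIntegrable_finsetSum _ fun i _ => ?_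
      exact LocallyIntegrable.continuous_smul (g := fun ξ : Space d => (ξ i : ℂ)) (by fun_prop)
        (locallyIntegrable_coord h.tame.locallyIntegrable i)
    · have h1 := (key ψ).symm.trans (hd (𝓕 ψ))
      have h2 : (2 * Real.pi * Complex.I : ℂ) ≠ 0 := Complex.two_pi_I_ne_zero
      exact (mul_eq_zero.1 h1).resolve_left h2
  · intro h0 θ
    have : θ = 𝓕 (𝓕⁻ θ) := (FourierTransform.fourier_fourierInv_eq θ).symm
    rw [this, key]
    have h2 : ∫ ξ, (𝓕⁻ θ) ξ • dotc ξ (g ξ) = 0 := by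
      rw [← integral_zero (Space d) ℂ (μ := volume)]
      exact integral_congr_ae (h0.mono fun ξ h => by simp [h])
    rw [h2, mul_zero]

/-- The Fourier transforms of real fields. -/
def Herm (g : Space d → Vec d) : Prop := ∀ᵐ ξ, ∀ i, g (-ξ) i = conj (g ξ i)

/-- Complex conjugation of Schwartz functions. -/
def conjS (θ : 𝓢(Space d, ℂ)) : 𝓢(Space d, ℂ) :=
  SchwartzMap.postcompCLM (𝕜 := ℝ) (Complex.conjCLE : ℂ →L[ℝ] ℂ) θ

@[simp] lemma conjS_apply (θ : 𝓢(Space d, ℂ)) (x : Space d) : conjS θ x = conj (θ x) := rfl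

/-- Reflection of Schwartz functions. -/
def reflS (θ : 𝓢(Space d, ℂ)) : 𝓢(Space d, ℂ) :=
  SchwartzMap.compCLMOfContinuousLinearEquiv ℂ (LinearIsometryEquiv.neg ℝ (E := Space
      d)).toContinuousLinearEquiv θ

@[simp] lemma reflS_apply (θ : 𝓢(Space d, ℂ)) (x : Space d) : reflS θ x = θ (-x) := rfl

lemma fourier_conj {V : Type*} [NormedAddCommGroup V] [InnerProductSpace ℝ V]
    [FiniteDimensional ℝ V] [MeasurableSpace V] [BorelSpace V] (h : V → ℂ) (x : V) :
    𝓕 (fun ξ => conj (h ξ)) x = conj (𝓕⁻ h x) := by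
  rw [Real.fourier_eq', Real.fourierInv_eq', ← integral_conj]
  refine integral_congr_ae (Eventually.of_forall fun ξ => ?_)
  simp only [smul_eq_mul, map_mul, ← Complex.exp_conj, Complex.conj_ofReal, Complex.conj_I]
  congr 2
  push_cast
  ring

lemma fourier_conjS_reflS (ψ : 𝓢(Space d, ℂ)) : 𝓕 (conjS (reflS ψ)) = conjS (𝓕 ψ) := by
  ext x
  rw [conjS_apply, SchwartzMap.fourier_coe, SchwartzMap.fourier_coe]
  have : (conjS (reflS ψ) : Space d → ℂ) = fun ξ => conj ((fun ξ => ψ (-ξ)) ξ) := rfl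
  rw [this, fourier_conj]
  congr 1
  have := Real.fourierInv_comp_linearIsometry (LinearIsometryEquiv.neg ℝ (E := Space d)) ψ x
  rw [show (fun ξ => ψ (-ξ)) = ψ ∘ (LinearIsometryEquiv.neg ℝ (E := Space d)) from rfl, this,
    Real.fourierInv_eq_fourier_neg]
  simp

lemma isRealField_iff_conj :
    IsRealField f ↔ ∀ (θ : 𝓢(Space d, ℂ)) (i : Fin d), f (conjS θ) i = conj (f θ i) := by
  constructor
  · intro h θ i
    -- the real and imaginary parts of the test function
    set a : 𝓢(Space d, ℂ) := (2⁻¹ : ℂ) • (θ + conjS θ) with ha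
    set b : 𝓢(Space d, ℂ) := (-Complex.I * 2⁻¹) • (θ - conjS θ) with hb
    have e1 : θ = a + Complex.I • b := by
      ext x
      simp only [ha, hb, _root_.add_apply, _root_.smul_apply, _root_.sub_apply,
        smul_eq_mul]
      ring_nf
      simp only [Complex.I_sq]
      ring
    have e2 : conjS θ = a - Complex.I • b := by
      ext x
      simp only [ha, hb, _root_.add_apply, _root_.smul_apply, _root_.sub_apply,
        smul_eq_mul]
      ring_nf
      simp only [Complex.I_sq]
      ring
    have h1 := h a (fun x => by
      simp only [ha, _root_.add_apply, _root_.smul_apply, smul_eq_mul, conjS_apply,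
        Complex.add_conj]
      rw [← Complex.conj_eq_iff_im]; simp) i
    have h2 := h b (fun x => by
      simp only [hb, _root_.sub_apply, _root_.smul_apply, smul_eq_mul, conjS_apply,
        Complex.sub_conj]
      rw [← Complex.conj_eq_iff_im]; simp [map_ofNat]) i
    have h1' := Complex.conj_eq_iff_im.2 h1
    have h2' := Complex.conj_eq_iff_im.2 h2
    have hI : f (Complex.I • b) i = Complex.I * f b i := by rw [map_smul]; rfl
    have e3 : f (conjS θ) i = f a i - Complex.I * f b i := by
      rw [← hI, e2, map_sub]; rfl
    have e4 : f θ i = f a i + Complex.I * f b i := by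
      rw [← hI]
      conv_lhs => rw [e1, map_add]
      rfl
    rw [e3, e4, map_add, map_mul, h1', h2', Complex.conj_I]
    ring
  · intro h θ hθ i
    have e1 : conjS θ = θ := by
      ext x
      exact Complex.conj_eq_iff_im.2 (hθ x)
    have := h θ i
    rw [e1] at this
    exact Complex.conj_eq_iff_im.1 this.symm

lemma IsFT.isRealField_iff (h : IsFT f g) : IsRealField f ↔ Herm g := by
  -- a Schwartz function is conjugated by conjugation and reflection of its Fourier transform
  have key : ∀ (ψ : 𝓢(Space d, ℂ)) (i : Fin d),
      f (conjS (𝓕 ψ)) i = conj (∫ ξ, ψ ξ * conj (g (-ξ) i)) := by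
    intro ψ i
    rw [← fourier_conjS_reflS, h.eq_coord, ← integral_conj, ← integral_neg_eq_self]
    refine integral_congr_ae (Eventually.of_forall fun ξ => ?_)
    simp
  have hint : ∀ (ψ : 𝓢(Space d, ℂ)) (i : Fin d), Integrable fun ξ => ψ ξ * conj (g (-ξ) i) := by
    intro ψ i
    have h1 := ((h.tame.integrable_coord (conjS (reflS ψ)) i).comp_neg)
    have h2 := (Complex.conjCLE : ℂ →L[ℝ] ℂ).integrable_comp h1
    refine h2.congr (Eventually.of_forall fun ξ => ?_)
    simp
  rw [isRealField_iff_conj]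
  constructor
  · intro hr
    have h1 : ∀ i, ∀ᵐ ξ, conj (g (-ξ) i) - g ξ i = 0 := by
      intro i
      refine ae_eq_zero_of_forall_schwartz ?_ fun ψ _ => ?_
      · have hl := locallyIntegrable_coord h.tame.locallyIntegrable i
        refine LocallyIntegrable.sub (fun x => ?_) hl
        obtain ⟨U, hU, h2⟩ := hl (-x)
        refine ⟨-U, ?_, ?_⟩
        · have := (continuous_neg (G := Space d)).tendsto x hU
          exact this
        · have h3 : IntegrableOn (fun ξ => g (-ξ) i) (-U) := by
            have := (MeasurePreserving.integrableOn_comp_preimage (f := fun ξ => g ξ i)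
              (Measure.measurePreserving_neg (volume : Measure (Space d)))
              (Homeomorph.neg (Space d)).measurableEmbedding (s := U)).2 h2
            exact this
          exact (Complex.conjCLE : ℂ →L[ℝ] ℂ).integrable_comp h3
      · simp only [smul_eq_mul, mul_sub]
        rw [integral_sub (hint ψ i) (h.tame.integrable_coord ψ i), ← h.eq_coord, sub_eq_zero]
        have h2 := hr (𝓕 ψ) i
        rw [key] at h2
        exact (starRingEnd ℂ).injective h2
    filter_upwards [ae_all_iff.2 h1] with ξ hξ i
    have := sub_eq_zero.1 (hξ i)
    rw [← this, Complex.conj_conj]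
  · intro hh θ i
    have e1 : θ = 𝓕 (𝓕⁻ θ) := (FourierTransform.fourier_fourierInv_eq θ).symm
    rw [e1, key, h.eq_coord]
    congr 1
    refine integral_congr_ae (hh.mono fun ξ hξ => ?_)
    simp [hξ i]

/-! ### Real fields given by functions -/

/-- The Fourier transform is self-adjoint. -/
lemma integral_fourierInv_smul {F : Type*} [NormedAddCommGroup F] [NormedSpace ℂ F]
    [CompleteSpace F] {m : Space d → ℂ} {h : Space d → F} (hm : Integrable m) (hh : Integrable h) :
    ∫ ξ, 𝓕⁻ m ξ • h ξ = ∫ x, m x • 𝓕⁻ h x := by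
  have hL : Continuous fun p : Space d × Space d => (-innerₗ (Space d)) p.1 p.2 := by
    have : Continuous fun p : Space d × Space d => -inner ℝ p.1 p.2 := by fun_prop
    exact this
  have := VectorFourier.integral_fourierIntegral_smul_eq_flip (μ := (volume : Measure (Space d)))
    (ν := (volume : Measure (Space d))) (L := -innerₗ (Space d)) Real.continuous_fourierChar hL hm
        hh
  have e : (-innerₗ (Space d)).flip = -innerₗ (Space d) := by
    ext x y
    simp [real_inner_comm]
  rw [e] at this
  exact this

lemma continuous_fourierInv {F : Type*} [NormedAddCommGroup F] [NormedSpace ℂ F]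
    [CompleteSpace F] {h : Space d → F} (hh : Integrable h) : Continuous (𝓕⁻ h) := by
  have hL : Continuous fun p : Space d × Space d => (-innerₗ (Space d)) p.1 p.2 := by
    have : Continuous fun p : Space d × Space d => -inner ℝ p.1 p.2 := by fun_prop
    exact this
  exact VectorFourier.fourierIntegral_continuous Real.continuous_fourierChar hL hh

lemma norm_fourierInv_le {F : Type*} [NormedAddCommGroup F] [NormedSpace ℂ F]
    (h : Space d → F) (x : Space d) : ‖𝓕⁻ h x‖ ≤ ∫ ξ, ‖h ξ‖ :=
  VectorFourier.norm_fourierIntegral_le_integral_norm Real.fourierChar volume (-innerₗ (Space d)) h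
      x

/-- Distributions with tame Fourier transform are given by locally square integrable functions. -/
lemma IsFT.exists_function (h : IsFT f g) : ∃ W : Space d → Vec d, AEStronglyMeasurable W ∧
    LocallyIntegrable (fun x => ‖W x‖ ^ 2) ∧ (∀ θ : 𝓢(Space d, ℂ), Integrable fun x => θ x • W x) ∧
    ∀ θ : 𝓢(Space d, ℂ), f θ = ∫ x, θ x • W x := by
  set B := Metric.closedBall (0 : Space d) 1
  have hlow := h.tame.low
  have hhigh := h.tame.high
  set G := hhigh.toLp _ with hG
  -- the low frequencies give a bounded continuous function, the high frequencies one of `L²`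
  set w₁ : Space d → Vec d := 𝓕⁻ (B.indicator g) with hw₁
  set w₂ : Lp (Vec d) 2 (volume : Measure (Space d)) := 𝓕⁻ G with hw₂
  have hc : Continuous w₁ := continuous_fourierInv hlow
  have i1 : ∀ θ : 𝓢(Space d, ℂ), Integrable fun x => θ x • w₁ x := fun θ =>
    θ.integrable.smul_of_top_left (memLp_top_of_bound hc.aestronglyMeasurable _
      (Eventually.of_forall (norm_fourierInv_le _)))
  have i2 : ∀ θ : 𝓢(Space d, ℂ), Integrable fun x => θ x • w₂ x := fun θ =>
    (tame_of_memLp_two (Lp.memLp w₂)).integrable θ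
  refine ⟨fun x => w₁ x + w₂ x, hc.aestronglyMeasurable.add (Lp.aestronglyMeasurable w₂), ?_, ?_,
      ?_⟩
  · have l1 : LocallyIntegrable fun x => 2 * ‖w₁ x‖ ^ 2 :=
      Continuous.locallyIntegrable (by fun_prop)
    have l2 : LocallyIntegrable fun x => 2 * ‖w₂ x‖ ^ 2 :=
      (((memLp_two_iff_integrable_sq_norm (Lp.aestronglyMeasurable w₂)).1
        (Lp.memLp w₂)).const_mul 2).locallyIntegrable
    refine (l1.add l2).mono ((hc.aestronglyMeasurable.add (Lp.aestronglyMeasurable w₂)).norm.pow 2)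
        ?_
    refine Eventually.of_forall fun x => ?_
    rw [Real.norm_of_nonneg (by positivity), Pi.add_apply, Real.norm_of_nonneg (by positivity)]
    have h1 := norm_add_le (w₁ x) (w₂ x)
    have h2 := norm_nonneg (w₁ x + w₂ x)
    nlinarith [sq_nonneg (‖w₁ x‖ - ‖w₂ x‖)]
  · intro θ
    simp only [smul_add]
    exact (i1 θ).add (i2 θ)
  · intro θ
    simp only [smul_add]
    rw [integral_add (i1 θ) (i2 θ), h.apply]
    have e1 : ∫ x, θ x • w₁ x = ∫ ξ, (𝓕⁻ θ) ξ • B.indicator g ξ := by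
      rw [hw₁, ← integral_fourierInv_smul θ.integrable hlow, SchwartzMap.fourierInv_coe]
    have e2 : ∫ x, θ x • w₂ x = ∫ ξ, (𝓕⁻ θ) ξ • Bᶜ.indicator g ξ := by
      rw [← Lp.toTemperedDistribution_apply, hw₂, ← Lp.fourierInv_toTemperedDistribution_eq,
        TemperedDistribution.fourierInv_apply, Lp.toTemperedDistribution_apply]
      exact integral_congr_ae (hhigh.coeFn_toLp.mono fun ξ h => by simp only [hG, h, B])
    have j1 : Integrable fun ξ => (𝓕⁻ θ) ξ • B.indicator g ξ :=
      hlow.smul_of_top_right ((𝓕⁻ θ).memLp_top volume)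
    have j2 : Integrable fun ξ => (𝓕⁻ θ) ξ • Bᶜ.indicator g ξ :=
      (tame_of_memLp_two hhigh).integrable _
    rw [e1, e2, ← integral_add j1 j2]
    refine integral_congr_ae (Eventually.of_forall fun ξ => ?_)
    simp only
    rw [← smul_add, ← Pi.add_apply, indicator_self_add_compl]

lemma IsFT.exists_isGivenBy (h : IsFT f g) (hr : Herm g) : ∃ U, IsGivenBy f U := by
  obtain ⟨W, hWm, hW2, hWi, hW⟩ := h.exists_function
  have hreal := h.isRealField_iff.2 hr
  -- locally square integrable functions are locally integrable
  have hWl : LocallyIntegrable W := by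
    intro x
    obtain ⟨s, hs, h1⟩ := hW2 x
    obtain ⟨r, hr, hrs⟩ := Metric.mem_nhds_iff.1 hs
    refine ⟨Metric.ball x r, Metric.ball_mem_nhds x hr, ?_⟩
    have : IsFiniteMeasure (volume.restrict (Metric.ball x r)) :=
      ⟨by rw [Measure.restrict_apply_univ]; exact measure_ball_lt_top⟩
    have h2 : MemLp W 2 (volume.restrict (Metric.ball x r)) :=
      (memLp_two_iff_integrable_sq_norm hWm.restrict).2 (h1.mono_set hrs)
    exact h2.integrable (by norm_num)
  -- the imaginary part vanishes, since its integrals against real functions do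
  have him : ∀ i, ∀ᵐ x, ((W x i).im : ℂ) = 0 := by
    intro i
    have hl := locallyIntegrable_coord hWl i
    refine ae_eq_zero_of_forall_schwartz (fun x => ?_) fun ψ hψ => ?_
    · obtain ⟨s, hs, h1⟩ := hl x
      exact ⟨s, hs, (Complex.ofRealCLM.comp Complex.imCLM).integrable_comp h1⟩
    · have h1 := hreal ψ hψ i
      rw [hW, integral_apply (hWi ψ)] at h1
      have h2 : ∫ x, ((ψ x • W x) i).im = 0 := by
        have := Complex.imCLM.integral_comp_comm (integrable_coord (hWi ψ) i)
        exact this.trans h1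
      have h3 : ∫ x, ψ x • ((W x i).im : ℂ) = ((∫ x, ((ψ x • W x) i).im : ℝ) : ℂ) := by
        refine Eq.trans ?_ (integral_ofReal (𝕜 := ℂ))
        refine integral_congr_ae (Eventually.of_forall fun x => ?_)
        have h4 : ψ x = ((ψ x).re : ℂ) := by
          apply Complex.ext <;> simp [hψ x]
        have h5 : ((ψ x • W x) i).im = (ψ x).re * (W x i).im := by
          simp [Complex.mul_im, hψ x]
        simp only [smul_eq_mul, h5]
        rw [h4]
        push_cast
        simp
      rw [h3, h2, Complex.ofReal_zero]
  refine ⟨fun x => WithLp.toLp 2 fun i => (W x i).re, ?_, ?_, ?_, ?_⟩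
  · have : Continuous fun v : Vec d => (WithLp.toLp 2 fun i => (v i).re : Space d) := by fun_prop
    exact this.comp_aestronglyMeasurable hWm
  · have hcont : Continuous fun v : Vec d => (WithLp.toLp 2 fun i => (v i).re : Space d) := by
      fun_prop
    refine hW2.mono ((hcont.comp_aestronglyMeasurable hWm).norm.pow 2) ?_
    refine Eventually.of_forall fun x => ?_
    rw [Real.norm_of_nonneg (by positivity), Real.norm_of_nonneg (by positivity),
      EuclideanSpace.norm_sq_eq, EuclideanSpace.norm_sq_eq]
    refine Finset.sum_le_sum fun i _ => ?_
    have := Complex.abs_re_le_norm (W x i)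
    rw [Real.norm_eq_abs]
    gcongr
  all_goals
    intro θ i
    have e : ∀ᵐ x, (θ x • W x) i = θ x * (((W x i).re : ℝ) : ℂ) := by
      filter_upwards [him i] with x hx
      have hx' : (W x i).im = 0 := by exact_mod_cast hx
      have : W x i = (((W x i).re : ℝ) : ℂ) := by apply Complex.ext <;> simp [hx']
      rw [← this]
      rfl
  · exact (integrable_coord (hWi θ) i).congr e
  · rw [hW, integral_apply (hWi θ)]
    exact integral_congr_ae e

/-- If the Fourier transform is integrable, then the field is given by the inversion formula. -/
lemma IsGivenBy.ae_eq_fourierInv {U : Space d → Space d} (hU : IsGivenBy f U) (h : IsFT f g)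
    (hg : Integrable g) (i : Fin d) : ∀ᵐ x, (U x i : ℂ) = 𝓕⁻ (fun ξ => g ξ i) x := by
  have hgi := integrable_coord hg i
  have hc := continuous_fourierInv hgi
  have hUl : LocallyIntegrable fun x => (U x i : ℂ) := by
    intro x
    obtain ⟨s, hs, h1⟩ := hU.locallySqIntegrable x
    obtain ⟨r, hr, hrs⟩ := Metric.mem_nhds_iff.1 hs
    refine ⟨Metric.ball x r, Metric.ball_mem_nhds x hr, ?_⟩
    have : IsFiniteMeasure (volume.restrict (Metric.ball x r)) :=
      ⟨by rw [Measure.restrict_apply_univ]; exact measure_ball_lt_top⟩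
    have h2 : MemLp U 2 (volume.restrict (Metric.ball x r)) :=
      (memLp_two_iff_integrable_sq_norm hU.measurable.restrict).2 (h1.mono_set hrs)
    have h3 := h2.integrable (by norm_num)
    exact (Complex.ofRealCLM.comp (EuclideanSpace.proj (𝕜 := ℝ) i)).integrable_comp h3
  have h0 : ∀ᵐ x, (U x i : ℂ) - 𝓕⁻ (fun ξ => g ξ i) x = 0 := by
    refine ae_eq_zero_of_forall_schwartz (hUl.sub hc.locallyIntegrable) fun ψ _ => ?_
    have i1 : Integrable fun x => ψ x * 𝓕⁻ (fun ξ => g ξ i) x :=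
      ψ.integrable.smul_of_top_left (memLp_top_of_bound hc.aestronglyMeasurable _
        (Eventually.of_forall (norm_fourierInv_le _)))
    simp only [smul_eq_mul, mul_sub]
    rw [integral_sub (hU.integrable ψ i) i1, ← hU.eq_integral, sub_eq_zero, h.apply,
      integral_apply (h.tame.integrable _), SchwartzMap.fourierInv_coe]
    exact integral_fourierInv_smul ψ.integrable hgi
  filter_upwards [h0] with x hx using sub_eq_zero.1 hx

end real

end

section

variable {d : ℕ} {T : ℝ≥0∞}

/-! ### Time slices of test functions and their Fourier transforms -/

lemma exists_support (ψ : 𝓓(slab d T, ℝ)) : ∃ a b R : ℝ, 0 < a ∧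
    (∀ t ∈ Icc a b, ENNReal.ofReal t < T) ∧
    ∀ t x, (t ∉ Icc a b ∨ x ∉ Metric.closedBall (0 : Space d) R) → ψ (t, x) = 0 := by
  have hK : IsCompact (tsupport ψ) := ψ.hasCompactSupport
  rcases (tsupport ψ).eq_empty_or_nonempty with h0 | hne
  · refine ⟨1, 0, 0, one_pos, fun t ht => ?_, fun t x _ => ?_⟩
    · linarith [ht.1, ht.2]
    · exact image_eq_zero_of_notMem_tsupport (by rw [h0]; exact notMem_empty _)
  · obtain ⟨p, hp, hpm⟩ := hK.exists_isMinOn hne continuous_fst.continuousOn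
    obtain ⟨q, hq, hqm⟩ := hK.exists_isMaxOn hne continuous_fst.continuousOn
    obtain ⟨r, hr, hrm⟩ := hK.exists_isMaxOn hne
      (f := fun z : ℝ × Space d => ‖z.2‖) (by fun_prop)
    refine ⟨p.1, q.1, ‖r.2‖, (ψ.tsupport_subset hp).1, fun t ht => ?_, fun t x h => ?_⟩
    · exact (ENNReal.ofReal_le_ofReal ht.2).trans_lt (ψ.tsupport_subset hq).2
    · refine image_eq_zero_of_notMem_tsupport fun hm => ?_
      rcases h with h | h
      · exact h ⟨hpm hm, hqm hm⟩
      · exact h (by simpa using hrm hm)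

lemma exists_bound_test (ψ : 𝓓(slab d T, ℝ)) : ∃ C : ℝ, ∀ z, ‖ψ z‖ ≤ C := by
  obtain ⟨C, hC⟩ := ψ.hasCompactSupport.exists_bound_of_continuous ψ.continuous
  exact ⟨C, hC⟩

lemma differentiable_test (ψ : 𝓓(slab d T, ℝ)) : Differentiable ℝ ψ :=
  ψ.contDiff.differentiable (by simp)

lemma hasDerivAt_test (ψ : 𝓓(slab d T, ℝ)) (t : ℝ) (x : Space d) :
    HasDerivAt (fun t => ψ (t, x)) (dt ψ (t, x)) t := by
  have h1 : HasDerivAt (fun t : ℝ => (t, x)) ((1 : ℝ), (0 : Space d)) t :=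
    (hasDerivAt_id t).prodMk (hasDerivAt_const t x)
  have h2 := (differentiable_test ψ (t, x)).hasFDerivAt.comp_hasDerivAt t h1
  rw [dt, TestFunction.lineDerivOp_eq_lineDerivCLM (𝕜 := ℝ), TestFunction.lineDerivCLM_apply]
  simp only [le_refl, if_true, top_add]
  rw [(differentiable_test ψ (t, x)).lineDeriv_eq_fderiv]
  exact h2

/-- The slice `ψ(t, ·)` of a test function at a fixed time. -/
def slice (ψ : 𝓓(slab d T, ℝ)) (t : ℝ) : 𝓢(Space d, ℂ) :=
  HasCompactSupport.toSchwartzMap (f := fun x => (ψ (t, x) : ℂ))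
    (by
      obtain ⟨a, b, R, -, -, h⟩ := exists_support ψ
      refine HasCompactSupport.intro (isCompact_closedBall (0 : Space d) R) fun x hx => ?_
      rw [h t x (Or.inr hx), Complex.ofReal_zero])
    (by
      have := ψ.contDiff
      exact Complex.ofRealCLM.contDiff.comp (this.comp (by fun_prop)))

@[simp] lemma slice_apply (ψ : 𝓓(slab d T, ℝ)) (t : ℝ) (x : Space d) :
    slice ψ t x = (ψ (t, x) : ℂ) := rfl

lemma slice_dx (ψ : 𝓓(slab d T, ℝ)) (t : ℝ) (i : Fin d) :
    slice (dx i ψ) t = ∂_{(e i : Space d)} (slice ψ t) := by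
  ext x
  rw [SchwartzMap.lineDerivOp_apply, slice_apply, dx, TestFunction.lineDerivOp_eq_lineDerivCLM (𝕜 :=
      ℝ),
    TestFunction.lineDerivCLM_apply]
  simp only [le_refl, if_true, top_add]
  rw [(differentiable_test ψ (t, x)).lineDeriv_eq_fderiv]
  have h1 : HasFDerivAt (fun x : Space d => (t, x)) (ContinuousLinearMap.inr ℝ ℝ (Space d)) x :=
    hasFDerivAt_prodMk_right t x
  have h2 := (differentiable_test ψ (t, x)).hasFDerivAt.comp x h1
  have h3 : HasFDerivAt (fun x => (ψ (t, x) : ℂ)) _ x :=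
    Complex.ofRealCLM.hasFDerivAt.comp x h2
  have h4 := h3.hasLineDerivAt (e i)
  exact h4.lineDeriv.symm

/-- The inverse Fourier transform in space of a test function. -/
def tf (ψ : 𝓓(slab d T, ℝ)) (t : ℝ) (ξ : Space d) : ℂ := (𝓕⁻ (slice ψ t) : 𝓢(Space d, ℂ)) ξ

lemma tf_eq_integral (ψ : 𝓓(slab d T, ℝ)) (t : ℝ) (ξ : Space d) :
    tf ψ t ξ = ∫ x, Complex.exp (↑(2 * Real.pi * inner ℝ x ξ) * Complex.I) * (ψ (t, x) : ℂ) := by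
  rw [tf, SchwartzMap.fourierInv_coe, Real.fourierInv_eq']
  rfl

lemma tf_add (ψ ψ' : 𝓓(slab d T, ℝ)) (t : ℝ) (ξ : Space d) :
    tf (ψ + ψ') t ξ = tf ψ t ξ + tf ψ' t ξ := by
  have : slice (ψ + ψ') t = slice ψ t + slice ψ' t := by ext x; simp
  rw [tf, this, FourierTransform.fourierInv_add]
  rfl

lemma tf_sub (ψ ψ' : 𝓓(slab d T, ℝ)) (t : ℝ) (ξ : Space d) :
    tf (ψ - ψ') t ξ = tf ψ t ξ - tf ψ' t ξ := by
  have : slice (ψ - ψ') t = slice ψ t - slice ψ' t := by ext x; simp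
  rw [tf, this, sub_eq_add_neg, FourierTransform.fourierInv_add, FourierTransform.fourierInv_neg,
    ← sub_eq_add_neg]
  rfl

lemma tf_zero (t : ℝ) (ξ : Space d) : tf (0 : 𝓓(slab d T, ℝ)) t ξ = 0 := by
  have := tf_sub (0 : 𝓓(slab d T, ℝ)) 0 t ξ
  simpa using this

lemma tf_sum {ι : Type*} (s : Finset ι) (ψ : ι → 𝓓(slab d T, ℝ)) (t : ℝ) (ξ : Space d) :
    tf (∑ i ∈ s, ψ i) t ξ = ∑ i ∈ s, tf (ψ i) t ξ := by
  classical
  induction s using Finset.induction_on with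
  | empty => simp [tf_zero]
  | insert a s ha ih => rw [Finset.sum_insert ha, Finset.sum_insert ha, tf_add, ih]

lemma tf_dx (ψ : 𝓓(slab d T, ℝ)) (t : ℝ) (i : Fin d) (ξ : Space d) :
    tf (dx i ψ) t ξ = -(2 * Real.pi * Complex.I) * ξ i * tf ψ t ξ := by
  rw [tf, slice_dx, SchwartzMap.fourierInv_lineDerivOp_eq, _root_.smul_apply,
    smulLeftCLM_inner_apply, tf, smul_eq_mul, ← mul_assoc]

lemma sum_sq_eq_norm (ξ : Space d) : ∑ i, (ξ i : ℂ) * ξ i = ((‖ξ‖ ^ 2 : ℝ) : ℂ) := by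
  rw [EuclideanSpace.norm_sq_eq]
  push_cast
  refine Finset.sum_congr rfl fun i _ => ?_
  rw [← sq, Real.norm_eq_abs, ← Complex.ofReal_pow, ← Complex.ofReal_pow, sq_abs]

lemma tf_lap (ψ : 𝓓(slab d T, ℝ)) (t : ℝ) (ξ : Space d) :
    tf (lap ψ) t ξ = -(((4 * Real.pi ^ 2) * ‖ξ‖ ^ 2 : ℝ) : ℂ) * tf ψ t ξ := by
  rw [lap, tf_sum]
  simp only [tf_dx]
  have : ∀ i, -(2 * Real.pi * Complex.I) * (ξ i : ℂ) * (-(2 * Real.pi * Complex.I) * ξ i * tf ψ t ξ)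
      = (ξ i * ξ i : ℂ) * (-(4 * Real.pi ^ 2) * tf ψ t ξ) := fun i => by
    linear_combination (4 * (Real.pi : ℂ) ^ 2 * ξ i * ξ i * tf ψ t ξ) * Complex.I_sq
  simp only [this]
  rw [← Finset.sum_mul, sum_sq_eq_norm]
  push_cast
  ring

lemma exists_bound_tf (ψ : 𝓓(slab d T, ℝ)) : ∃ C : ℝ, ∀ t ξ, ‖tf ψ t ξ‖ ≤ C := by
  obtain ⟨a, b, R, -, -, h⟩ := exists_support ψ
  obtain ⟨C, hC⟩ := exists_bound_test ψ
  refine ⟨∫ x, (Metric.closedBall (0 : Space d) R).indicator (fun _ => C) x, fun t ξ => ?_⟩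
  rw [tf_eq_integral]
  refine norm_integral_le_of_norm_le ?_ (Eventually.of_forall fun x => ?_)
  · exact (integrable_indicator_iff measurableSet_closedBall).2
      (integrableOn_const measure_closedBall_lt_top.ne)
  · rw [norm_mul, Complex.norm_exp_ofReal_mul_I, one_mul, Complex.norm_real]
    by_cases hx : x ∈ Metric.closedBall (0 : Space d) R
    · rw [indicator_of_mem hx]; exact hC _
    · rw [indicator_of_notMem hx, h t x (Or.inr hx), norm_zero]

lemma tf_eq_zero {ψ : 𝓓(slab d T, ℝ)} {t : ℝ} (h : ∀ x, ψ (t, x) = 0) (ξ : Space d) :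
    tf ψ t ξ = 0 := by
  rw [tf_eq_integral]
  simp [h]

lemma continuous_tf (ψ : 𝓓(slab d T, ℝ)) : Continuous (Function.uncurry (tf ψ)) := by
  obtain ⟨a, b, R, -, -, h⟩ := exists_support ψ
  have e1 : Function.uncurry (tf ψ) = fun p : ℝ × Space d => ∫ x in Metric.closedBall (0 : Space d)
      R,
      Complex.exp (↑(2 * Real.pi * inner ℝ x p.2) * Complex.I) * (ψ (p.1, x) : ℂ) := by
    ext p
    rw [setIntegral_eq_integral_of_forall_compl_eq_zero]
    · exact tf_eq_integral ψ p.1 p.2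
    · intro x hx
      rw [h _ x (Or.inr hx)]
      simp
  rw [e1]
  refine continuous_parametric_integral_of_continuous ?_ (isCompact_closedBall _ _)
  have := ψ.continuous
  unfold Function.uncurry
  fun_prop

lemma hasDerivAt_tf (ψ : 𝓓(slab d T, ℝ)) (t : ℝ) (ξ : Space d) :
    HasDerivAt (fun t => tf ψ t ξ) (tf (dt ψ) t ξ) t := by
  obtain ⟨a, b, R, -, -, h⟩ := exists_support ψ
  obtain ⟨a', b', R', -, -, h'⟩ := exists_support (dt ψ)
  obtain ⟨C, hC⟩ := exists_bound_test (dt ψ)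
  simp only [tf_eq_integral]
  have hcont : ∀ (ψ : 𝓓(slab d T, ℝ)) (t : ℝ), Continuous fun x : Space d =>
      Complex.exp (↑(2 * Real.pi * inner ℝ x ξ) * Complex.I) * (ψ (t, x) : ℂ) := fun ψ t => by
    have := ψ.continuous
    fun_prop
  refine (hasDerivAt_integral_of_dominated_loc_of_deriv_le (s := univ)
    (F' := fun t x => Complex.exp (↑(2 * Real.pi * inner ℝ x ξ) * Complex.I) * (dt ψ (t, x) : ℂ))
    (bound := (Metric.closedBall (0 : Space d) R').indicator (fun _ => C)) univ_mem
    (Eventually.of_forall fun t => (hcont ψ t).aestronglyMeasurable) ?_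
    (hcont (dt ψ) t).aestronglyMeasurable ?_ ?_ ?_).2
  · refine (hcont ψ t).integrable_of_hasCompactSupport ?_
    refine HasCompactSupport.intro (isCompact_closedBall (0 : Space d) R) fun x hx => ?_
    rw [h t x (Or.inr hx), Complex.ofReal_zero, mul_zero]
  · refine Eventually.of_forall fun x t _ => ?_
    rw [norm_mul, Complex.norm_exp_ofReal_mul_I, one_mul, Complex.norm_real]
    by_cases hx : x ∈ Metric.closedBall (0 : Space d) R'
    · rw [indicator_of_mem hx]; exact hC _
    · rw [indicator_of_notMem hx, h' t x (Or.inr hx), norm_zero]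
  · exact (integrable_indicator_iff measurableSet_closedBall).2
      (integrableOn_const measure_closedBall_lt_top.ne)
  · exact Eventually.of_forall fun x t _ =>
      (hasDerivAt_test ψ t x).ofReal_comp.const_mul _

/-! ### Fourier representation of integrals against a slice -/

variable {f f' : TField d} {g g' : Space d → Vec d} {U U' : Space d → Space d}

/-- The convolution of two complex functions. -/
def conv (h k : Space d → ℂ) (ξ : Space d) : ℂ := ∫ η, h (ξ - η) * k η

lemma integral_slice_linear (hU : IsGivenBy f U) (h : IsFT f g) (ψ : 𝓓(slab d T, ℝ)) (t : ℝ)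
    (i : Fin d) : ((∫ x, U x i * ψ (t, x) : ℝ) : ℂ) = ∫ ξ, tf ψ t ξ * g ξ i := by
  have h1 := hU.eq_integral (slice ψ t) i
  rw [h.apply, integral_apply (h.tame.integrable _)] at h1
  refine Eq.trans ?_ h1.symm
  refine Eq.trans (integral_ofReal (𝕜 := ℂ)).symm ?_
  refine integral_congr_ae (Eventually.of_forall fun x => ?_)
  simp [mul_comm]

lemma integrable_slice_linear (hU : IsGivenBy f U) (ψ : 𝓓(slab d T, ℝ)) (t : ℝ)
    (i : Fin d) : Integrable fun x => U x i * ψ (t, x) := by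
  have h1 := (hU.integrable (slice ψ t) i).re
  refine h1.congr (Eventually.of_forall fun x => ?_)
  simp [mul_comm]

lemma integrable_conv {h k : Space d → ℂ} (hh : Integrable h) (hk : Integrable k) :
    Integrable (conv h k) := by
  have := Integrable.integrable_convolution (ContinuousLinearMap.mul ℝ ℂ) hk hh
  refine this.congr (Eventually.of_forall fun ξ => ?_)
  simp only [conv, convolution, ContinuousLinearMap.mul_apply']
  exact integral_congr_ae (Eventually.of_forall fun η => mul_comm _ _)

lemma fourierInv_conv {h k : Space d → ℂ} (hh : Integrable h) (hk : Integrable k) (x : Space d) :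
    𝓕⁻ (conv h k) x = 𝓕⁻ h x * 𝓕⁻ k x := by
  have := Real.fourier_mul_convolution_eq hk hh (-x)
  rw [Real.fourierInv_eq_fourier_neg, Real.fourierInv_eq_fourier_neg,
    Real.fourierInv_eq_fourier_neg, mul_comm, ← this]
  refine congrArg (fun h : Space d → ℂ => 𝓕 h (-x)) (funext fun ξ => ?_)
  simp only [conv, convolution, ContinuousLinearMap.mul_apply']
  exact integral_congr_ae (Eventually.of_forall fun η => mul_comm _ _)

/-- Products of fields against a test function are convolutions of their Fourier transforms. -/
lemma integral_slice_quadratic (hU : IsGivenBy f U) (h : IsFT f g) (hg : Integrable g)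
    (hU' : IsGivenBy f' U') (h' : IsFT f' g') (hg' : Integrable g') (ψ : 𝓓(slab d T, ℝ)) (t : ℝ)
    (i j : Fin d) : Integrable (fun x => U x i * U' x j * ψ (t, x)) ∧
    ((∫ x, U x i * U' x j * ψ (t, x) : ℝ) : ℂ)
      = ∫ ξ, tf ψ t ξ * conv (fun ξ => g ξ i) (fun ξ => g' ξ j) ξ := by
  have h1 := hU.ae_eq_fourierInv h hg i
  have h2 := hU'.ae_eq_fourierInv h' hg' j
  have i1 := integrable_coord hg i
  have i2 := integrable_coord hg' j
  have e1 : ∀ᵐ x, ((U x i * U' x j * ψ (t, x) : ℝ) : ℂ)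
      = slice ψ t x • 𝓕⁻ (conv (fun ξ => g ξ i) (fun ξ => g' ξ j)) x := by
    filter_upwards [h1, h2] with x hx hx'
    rw [fourierInv_conv i1 i2, ← hx, ← hx']
    simp
    ring
  have hc := continuous_fourierInv (integrable_conv i1 i2)
  have i3 : Integrable fun x => slice ψ t x • 𝓕⁻ (conv (fun ξ => g ξ i) (fun ξ => g' ξ j)) x :=
    (slice ψ t).integrable.smul_of_top_left (memLp_top_of_bound hc.aestronglyMeasurable _
      (Eventually.of_forall (norm_fourierInv_le _)))
  refine ⟨?_, ?_⟩
  · have := (i3.congr (e1.mono fun x hx => hx.symm)).re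
    exact this.congr (Eventually.of_forall fun x => by simp)
  · refine Eq.trans (integral_ofReal (𝕜 := ℂ)).symm ?_
    refine (integral_congr_ae e1).trans ?_
    rw [← integral_fourierInv_smul (slice ψ t).integrable (integrable_conv i1 i2)]
    simp only [tf, SchwartzMap.fourierInv_coe, smul_eq_mul]

end

section

variable {d : ℕ} {T : ℝ≥0∞}

/-! ### The bilinear symbol of the MHD system -/

/-- Pairs of complex vectors: the values of the Fourier transforms of `(u, b)`. -/
abbrev Pair (d : ℕ) := Vec d × Vec d

lemma dotc_add (ξ : Space d) (v w : Vec d) : dotc ξ (v + w) = dotc ξ v + dotc ξ w := by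
  simp [dotc, mul_add, Finset.sum_add_distrib]

lemma dotc_sub (ξ : Space d) (v w : Vec d) : dotc ξ (v - w) = dotc ξ v - dotc ξ w := by
  simp [dotc, mul_sub, Finset.sum_sub_distrib]

lemma dotc_smul (ξ : Space d) (c : ℂ) (v : Vec d) : dotc ξ (c • v) = c * dotc ξ v := by
  simp only [dotc, PiLp.smul_apply, smul_eq_mul, Finset.mul_sum]
  exact Finset.sum_congr rfl fun i _ => by ring

/-- A real vector seen as a complex one. -/
def cvec (ξ : Space d) : Vec d := WithLp.toLp 2 fun i => (ξ i : ℂ)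

@[simp] lemma cvec_apply (ξ : Space d) (i : Fin d) : cvec ξ i = (ξ i : ℂ) := rfl

lemma norm_cvec (ξ : Space d) : ‖cvec ξ‖ = ‖ξ‖ := by
  simp [EuclideanSpace.norm_eq]

lemma continuous_cvec : Continuous (cvec : Space d → Vec d) := by
  unfold cvec
  fun_prop

lemma dotc_eq_inner (ξ : Space d) (v : Vec d) : dotc ξ v = inner ℂ (cvec ξ) v := by
  simp [dotc, PiLp.inner_apply, mul_comm]

lemma norm_dotc_le (ξ : Space d) (v : Vec d) : ‖dotc ξ v‖ ≤ ‖ξ‖ * ‖v‖ := by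
  rw [dotc_eq_inner, ← norm_cvec]
  exact norm_inner_le_norm _ _

lemma dotc_cvec (ξ : Space d) : dotc ξ (cvec ξ) = ((‖ξ‖ ^ 2 : ℝ) : ℂ) := sum_sq_eq_norm ξ

lemma continuous_dotc : Continuous fun p : Space d × Vec d => dotc p.1 p.2 := by
  unfold dotc
  fun_prop

/-- The projection onto the vectors orthogonal to the frequency `ξ`. -/
def leray (ξ : Space d) (v : Vec d) : Vec d := v - (dotc ξ v / ((‖ξ‖ ^ 2 : ℝ) : ℂ)) • cvec ξ

lemma leray_sub (ξ : Space d) (v w : Vec d) : leray ξ (v - w) = leray ξ v - leray ξ w := by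
  rw [leray, leray, leray, dotc_sub, sub_div, sub_smul]
  abel

lemma dotc_leray {ξ : Space d} (hξ : ξ ≠ 0) (v : Vec d) : dotc ξ (leray ξ v) = 0 := by
  have : ((‖ξ‖ ^ 2 : ℝ) : ℂ) ≠ 0 := by
    exact_mod_cast pow_ne_zero 2 (norm_ne_zero_iff.2 hξ)
  rw [leray, dotc_sub, dotc_smul, dotc_cvec, div_mul_cancel₀ _ this, sub_self]

lemma norm_leray_le (ξ : Space d) (v : Vec d) : ‖leray ξ v‖ ≤ 2 * ‖v‖ := by
  rcases eq_or_ne ξ 0 with rfl | hξ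
  · simp only [leray, norm_zero, ne_eq, OfNat.ofNat_ne_zero, not_false_eq_true, zero_pow,
      Complex.ofReal_zero, div_zero, zero_smul, sub_zero]
    linarith [norm_nonneg v]
  have h0 : 0 < ‖ξ‖ := norm_pos_iff.2 hξ
  calc ‖leray ξ v‖ ≤ ‖v‖ + ‖(dotc ξ v / ((‖ξ‖ ^ 2 : ℝ) : ℂ)) • cvec ξ‖ := norm_sub_le _ _
    _ ≤ ‖v‖ + ‖v‖ := by
        gcongr
        rw [norm_smul, norm_div, Complex.norm_real, norm_cvec, Real.norm_of_nonneg (by positivity),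
          div_mul_eq_mul_div, div_le_iff₀ (by positivity)]
        nlinarith [norm_dotc_le ξ v]
    _ = _ := by ring

lemma measurable_leray : Measurable fun p : Space d × Vec d => leray p.1 p.2 := by
  unfold leray
  have h1 : Measurable fun p : Space d × Vec d => dotc p.1 p.2 := continuous_dotc.measurable
  have h2 : Measurable fun p : Space d × Vec d => cvec p.1 :=
    (continuous_cvec.comp continuous_fst).measurable
  have h3 : Measurable fun p : Space d × Vec d => ((‖p.1‖ ^ 2 : ℝ) : ℂ) :=
    Continuous.measurable (by fun_prop)
  exact measurable_snd.sub ((h1.div h3).smul h2)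

/-- The projection onto the vectors orthogonal to `ξ`, as a continuous linear map. -/
def lerayL (ξ : Space d) : Vec d →L[ℂ] Vec d :=
  ContinuousLinearMap.id ℂ _ - (((‖ξ‖ ^ 2 : ℝ) : ℂ)⁻¹ • innerSL ℂ (cvec ξ)).smulRight (cvec ξ)

lemma lerayL_apply (ξ : Space d) (v : Vec d) : lerayL ξ v = leray ξ v := by
  simp [lerayL, leray, dotc_eq_inner, div_eq_inv_mul]

/-- The divergence form nonlinearity of the MHD system on the Fourier side, without pressure. The
second component is arranged so as to be orthogonal to `ξ`. -/
def nl (ξ : Space d) (z z' : Pair d) : Pair d :=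
  (dotc ξ z.1 • z'.1 - dotc ξ z.2 • z'.2, dotc ξ z.1 • z'.2 - dotc ξ z'.2 • z.1)

/-- The bilinear symbol of the MHD system on the Fourier side, after elimination of the pressure. -/
def mhdSym (ξ : Space d) (z z' : Pair d) : Pair d :=
  (-(2 * Real.pi * Complex.I)) • (leray ξ (nl ξ z z').1, (nl ξ z z').2)

lemma dotc_nl_snd (ξ : Space d) (z z' : Pair d) : dotc ξ (nl ξ z z').2 = 0 := by
  simp only [nl, dotc_sub, dotc_smul]
  ring

lemma norm_dotc_smul_le (ξ : Space d) (v w : Vec d) : ‖dotc ξ v • w‖ ≤ ‖ξ‖ * ‖v‖ * ‖w‖ := by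
  rw [norm_smul]
  exact mul_le_mul_of_nonneg_right (norm_dotc_le ξ v) (norm_nonneg _)

lemma norm_nl_le (ξ : Space d) (z z' : Pair d) : ‖nl ξ z z'‖ ≤ 2 * ‖ξ‖ * ‖z‖ * ‖z'‖ := by
  have key : ∀ v w : Vec d, ‖v‖ * ‖w‖ ≤ ‖z‖ * ‖z'‖ → ‖ξ‖ * ‖v‖ * ‖w‖ ≤ ‖ξ‖ * ‖z‖ * ‖z'‖ :=
    fun v w h => by
      rw [mul_assoc, mul_assoc]; exact mul_le_mul_of_nonneg_left h (norm_nonneg _)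
  have m : ∀ a b : ℝ, 0 ≤ b → a ≤ ‖z‖ → b ≤ ‖z'‖ → a * b ≤ ‖z‖ * ‖z'‖ := fun a b hb h1 h2 =>
    mul_le_mul h1 h2 hb (norm_nonneg _)
  have h1 := norm_fst_le z
  have h2 := norm_snd_le z
  have h1' := norm_fst_le z'
  have h2' := norm_snd_le z'
  refine max_le ?_ ?_
  · refine (norm_sub_le _ _).trans ?_
    have a1 := (norm_dotc_smul_le ξ z.1 z'.1).trans (key _ _ (m _ _ (norm_nonneg _) h1 h1'))
    have a2 := (norm_dotc_smul_le ξ z.2 z'.2).trans (key _ _ (m _ _ (norm_nonneg _) h2 h2'))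
    linarith
  · refine (norm_sub_le _ _).trans ?_
    have a1 := (norm_dotc_smul_le ξ z.1 z'.2).trans (key _ _ (m _ _ (norm_nonneg _) h1 h2'))
    have a2 := (norm_dotc_smul_le ξ z'.2 z.1).trans (key _ _ (by
      rw [mul_comm]; exact m _ _ (norm_nonneg _) h1 h2'))
    linarith

lemma measurable_nl : Measurable fun p : Space d × Pair d × Pair d => nl p.1 p.2.1 p.2.2 := by
  have hc : ∀ f : Space d × Pair d × Pair d → Vec d, Continuous f →
      Continuous fun p : Space d × Pair d × Pair d => dotc p.1 (f p) := fun f hf =>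
    continuous_dotc.comp (continuous_fst.prodMk hf)
  have h1 := hc (fun p => p.2.1.1) (by fun_prop)
  have h2 := hc (fun p => p.2.1.2) (by fun_prop)
  have h3 := hc (fun p => p.2.2.2) (by fun_prop)
  refine Continuous.measurable ?_
  unfold nl
  fun_prop

lemma enorm_le_of_norm_le {E F G : Type*} [NormedAddCommGroup E] [NormedAddCommGroup F]
    [NormedAddCommGroup G] {a : E} {K : ℝ≥0} {ξ : Space d} {b : F} {c : G}
    (h : ‖a‖ ≤ K * ‖ξ‖ * ‖b‖ * ‖c‖) : ‖a‖ₑ ≤ K * ‖ξ‖ₑ * ‖b‖ₑ * ‖c‖ₑ := by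
  have h' : ‖a‖₊ ≤ K * ‖ξ‖₊ * ‖b‖₊ * ‖c‖₊ := by exact_mod_cast h
  simp only [enorm_eq_nnnorm]
  exact_mod_cast h'

lemma isSymbol_nl : IsSymbol (nl (d := d)) 2 where
  meas := measurable_nl
  sub_left ξ a a' b := by
    ext1 <;> simp only [nl, Prod.fst_sub, Prod.snd_sub, dotc_sub, sub_smul, smul_sub] <;> abel
  sub_right ξ a a' b := by
    ext1 <;> simp only [nl, Prod.fst_sub, Prod.snd_sub, dotc_sub, sub_smul, smul_sub] <;> abel
  bound ξ a b := enorm_le_of_norm_le (norm_nl_le ξ a b)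

/-- The size `8π` of the symbol of the MHD system. -/
def symK : ℝ≥0 := 8 * NNReal.pi

lemma isSymbol_mhdSym : IsSymbol (mhdSym (d := d)) symK where
  meas := by
    have h := measurable_nl (d := d)
    unfold mhdSym
    exact (((measurable_leray.comp (measurable_fst.prodMk h.fst)).prodMk h.snd).const_smul
      (-(2 * Real.pi * Complex.I)))
  sub_left ξ a a' b := by
    have := isSymbol_nl.sub_left ξ a a' b
    rw [mhdSym, this, Prod.fst_sub, Prod.snd_sub, leray_sub, ← Prod.mk_sub_mk, smul_sub]
    rfl
  sub_right ξ a b b' := by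
    have := isSymbol_nl.sub_right ξ a b b'
    rw [mhdSym, this, Prod.fst_sub, Prod.snd_sub, leray_sub, ← Prod.mk_sub_mk, smul_sub]
    rfl
  bound ξ a b := by
    refine enorm_le_of_norm_le ?_
    have h1 := norm_nl_le ξ a b
    have h2 : ‖(leray ξ (nl ξ a b).1, (nl ξ a b).2)‖ ≤ 2 * ‖nl ξ a b‖ := by
      refine max_le ((norm_leray_le _ _).trans ?_) ?_
      · linarith [norm_fst_le (nl ξ a b)]
      · linarith [norm_snd_le (nl ξ a b), norm_nonneg (nl ξ a b)]
    have h3 : ‖-(2 * Real.pi * Complex.I : ℂ)‖ = 2 * Real.pi := by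
      simp [abs_of_pos Real.pi_pos]
    have h4 : ((symK : ℝ≥0) : ℝ) = 8 * Real.pi := by simp [symK]
    rw [mhdSym, norm_smul, h3, h4]
    calc 2 * Real.pi * ‖(leray ξ (nl ξ a b).1, (nl ξ a b).2)‖
        ≤ 2 * Real.pi * (2 * (2 * ‖ξ‖ * ‖a‖ * ‖b‖)) :=
          mul_le_mul_of_nonneg_left (h2.trans (by linarith)) (by positivity)
      _ = _ := by ring

lemma dotc_mhdSym {ξ : Space d} (hξ : ξ ≠ 0) (z z' : Pair d) :
    dotc ξ (mhdSym ξ z z').1 = 0 ∧ dotc ξ (mhdSym ξ z z').2 = 0 := by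
  simp only [mhdSym, Prod.smul_fst, Prod.smul_snd, dotc_smul, dotc_leray hξ, dotc_nl_snd, mul_zero,
    and_self]

/-! ### The convolution form of the nonlinearity -/

lemma conv_comm (h k : Space d → ℂ) (ξ : Space d) : conv h k ξ = conv k h ξ := by
  have := integral_sub_left_eq_self (fun η => h (ξ - η) * k η) volume ξ
  rw [conv, conv, ← this]
  simp only [sub_sub_cancel]
  exact integral_congr_ae (Eventually.of_forall fun η => mul_comm _ _)

lemma ae_integrable_conv {h k : Space d → ℂ} (hh : Integrable h) (hk : Integrable k) :
    ∀ᵐ ξ, Integrable fun η => h (ξ - η) * k η := by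
  have := Integrable.ae_convolution_exists (ContinuousLinearMap.mul ℝ ℂ) hk hh
  filter_upwards [this] with ξ hξ
  refine hξ.congr (Eventually.of_forall fun η => ?_)
  simp [mul_comm]

lemma ae_integrable_bconv {E : Type*} [NormedAddCommGroup E] [NormedSpace ℝ E] [CompleteSpace E]
    [MeasurableSpace E] [BorelSpace E] [SecondCountableTopology E]
    {M : Space d → E → E → E} {K : ℝ≥0} (hM : IsSymbol M K) {f g : Space d → E}
    (hfm : Measurable f) (hgm : Measurable g) (hf : Integrable f) (hg : Integrable g) :
    ∀ᵐ ξ, Integrable fun η => M ξ (f (ξ - η)) (g η) := by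
  have h1 : ∫⁻ ξ, cv (fun ξ => ‖f ξ‖ₑ) (fun ξ => ‖g ξ‖ₑ) ξ < ⊤ := by
    rw [lintegral_cv hfm.enorm hgm.enorm]
    exact ENNReal.mul_lt_top hf.2 hg.2
  filter_upwards [ae_lt_top' (measurable_cv hfm.enorm hgm.enorm).aemeasurable h1.ne] with ξ hξ
  refine ⟨?_, ?_⟩
  · exact (hM.meas.comp (measurable_const.prodMk
      ((hfm.comp (measurable_const.sub measurable_id)).prodMk hgm))).aestronglyMeasurable
  · refine lt_of_le_of_lt (lintegral_mono fun η => hM.bound _ _ _) ?_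
    simp_rw [mul_assoc]
    rw [lintegral_const_mul' _ _ (by finiteness), lintegral_const_mul' _ _ (by finiteness)]
    exact ENNReal.mul_lt_top (by finiteness) (ENNReal.mul_lt_top (by finiteness) hξ)

variable {z z' : Space d → Pair d}

lemma Pair.integrable_coord {α : Type*} [MeasurableSpace α] {μ : Measure α} {h : α → Pair d}
    (hh : Integrable h μ) (i : Fin d) :
    Integrable (fun x => (h x).1 i) μ ∧ Integrable (fun x => (h x).2 i) μ :=
  ⟨MHD.integrable_coord hh.fst i, MHD.integrable_coord hh.snd i⟩

lemma bconv_nl_fst (hm : Measurable z) (hz : Integrable z) : ∀ᵐ ξ, ∀ i,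
    (bconv nl z z ξ).1 i = ∑ j, (ξ j : ℂ) * (conv (fun ξ => (z ξ).1 j) (fun ξ => (z ξ).1 i) ξ
      - conv (fun ξ => (z ξ).2 j) (fun ξ => (z ξ).2 i) ξ) := by
  have h1 : ∀ᵐ ξ, ∀ i j, Integrable fun η => (z (ξ - η)).1 j * (z η).1 i :=
    ae_all_iff.2 fun i => ae_all_iff.2 fun j => ae_integrable_conv
      (h := fun η => (z η).1 j) (k := fun η => (z η).1 i)
      (Pair.integrable_coord hz j).1 (Pair.integrable_coord hz i).1
  have h2 : ∀ᵐ ξ, ∀ i j, Integrable fun η => (z (ξ - η)).2 j * (z η).2 i :=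
    ae_all_iff.2 fun i => ae_all_iff.2 fun j => ae_integrable_conv
      (h := fun η => (z η).2 j) (k := fun η => (z η).2 i)
      (Pair.integrable_coord hz j).2 (Pair.integrable_coord hz i).2
  filter_upwards [h1, h2, ae_integrable_bconv isSymbol_nl hm hm hz hz] with ξ h1 h2 h3 i
  rw [bconv, fst_integral h3, integral_apply h3.fst]
  have : ∀ η, (nl ξ (z (ξ - η)) (z η)).1 i = ∑ j, (ξ j : ℂ) * ((z (ξ - η)).1 j * (z η).1 i
      - (z (ξ - η)).2 j * (z η).2 i) := fun η => by
    simp only [nl, dotc, PiLp.sub_apply, PiLp.smul_apply, smul_eq_mul, Finset.sum_mul]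
    rw [← Finset.sum_sub_distrib]
    exact Finset.sum_congr rfl fun j _ => by ring
  simp only [this]
  have hi : ∀ j ∈ Finset.univ, Integrable fun η => (ξ j : ℂ) * ((z (ξ - η)).1 j * (z η).1 i
      - (z (ξ - η)).2 j * (z η).2 i) := fun j _ =>
    Integrable.const_mul (f := fun η => (z (ξ - η)).1 j * (z η).1 i
      - (z (ξ - η)).2 j * (z η).2 i) ((h1 i j).sub (h2 i j)) _
  rw [integral_finsetSum _ hi]
  refine Finset.sum_congr rfl fun j _ => ?_
  rw [integral_const_mul, integral_sub (h1 i j) (h2 i j)]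
  rfl

lemma bconv_nl_snd (hm : Measurable z) (hz : Integrable z) : ∀ᵐ ξ, ∀ i,
    (bconv nl z z ξ).2 i = ∑ j, (ξ j : ℂ) * (conv (fun ξ => (z ξ).1 j) (fun ξ => (z ξ).2 i) ξ
      - conv (fun ξ => (z ξ).2 j) (fun ξ => (z ξ).1 i) ξ) := by
  have h1 : ∀ᵐ ξ, ∀ i j, Integrable fun η => (z (ξ - η)).1 j * (z η).2 i :=
    ae_all_iff.2 fun i => ae_all_iff.2 fun j => ae_integrable_conv
      (h := fun η => (z η).1 j) (k := fun η => (z η).2 i)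
      (Pair.integrable_coord hz j).1 (Pair.integrable_coord hz i).2
  filter_upwards [h1, ae_integrable_bconv isSymbol_nl hm hm hz hz] with ξ h1 h3 i
  rw [bconv, snd_integral h3, integral_apply h3.snd]
  have : ∀ η, (nl ξ (z (ξ - η)) (z η)).2 i = ∑ j, (ξ j : ℂ) * ((z (ξ - η)).1 j * (z η).2 i
      - (z (ξ - η)).1 i * (z η).2 j) := fun η => by
    simp only [nl, dotc, PiLp.sub_apply, PiLp.smul_apply, smul_eq_mul, Finset.sum_mul]
    rw [← Finset.sum_sub_distrib]
    exact Finset.sum_congr rfl fun j _ => by ring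
  simp only [this]
  have hi : ∀ j ∈ Finset.univ, Integrable fun η => (ξ j : ℂ) * ((z (ξ - η)).1 j * (z η).2 i
      - (z (ξ - η)).1 i * (z η).2 j) := fun j _ =>
    Integrable.const_mul (f := fun η => (z (ξ - η)).1 j * (z η).2 i
      - (z (ξ - η)).1 i * (z η).2 j) ((h1 i j).sub (h1 j i)) _
  rw [integral_finsetSum _ hi]
  refine Finset.sum_congr rfl fun j _ => ?_
  rw [integral_const_mul, integral_sub (h1 i j) (h1 j i), conv_comm (fun ξ => (z ξ).2 j)]
  rfl

lemma bconv_mhdSym (hm : Measurable z) (hz : Integrable z) : ∀ᵐ ξ,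
    bconv mhdSym z z ξ = (-(2 * Real.pi * Complex.I)) •
      (leray ξ (bconv nl z z ξ).1, (bconv nl z z ξ).2) := by
  filter_upwards [ae_integrable_bconv isSymbol_nl hm hm hz hz] with ξ h3
  simp only [bconv, mhdSym]
  rw [integral_smul, fst_integral h3, snd_integral h3]
  congr 1
  simp only [← lerayL_apply]
  rw [integral_pair, (lerayL ξ).integral_comp_comm h3.fst]
  · exact (lerayL ξ).integrable_comp h3.fst
  · exact h3.snd

end

section

variable {d : ℕ} {T : ℝ≥0∞}

/-! ### The weak formulation on the Fourier side -/

/-- The viscosity `4π²` of the heat semigroup `e^{-4π²|ξ|²t}` of `Δ` on the Fourier side. -/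
def nu : ℝ := 4 * Real.pi ^ 2

lemma nu_pos : 0 < nu := by unfold nu; positivity

section slice

variable {fw fv fa fc : TField d} {gw gv ga gc : Space d → Vec d} {w v a c : Space d → Space d}

lemma integrable_tf_mul {h : Space d → ℂ} (hh : Integrable h) (ψ : 𝓓(slab d T, ℝ)) (t : ℝ) :
    Integrable fun ξ => tf ψ t ξ * h ξ := by
  obtain ⟨C, hC⟩ := exists_bound_tf ψ
  refine hh.smul_of_top_right (φ := tf ψ t) (memLp_top_of_bound ?_ C (Eventually.of_forall (hC t)))
  exact ((continuous_tf ψ).comp (Continuous.prodMk_right t)).aestronglyMeasurable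

/-- The weak form of the equations at a fixed time, on the Fourier side. -/
lemma integral_slice_weakForm (hw : IsGivenBy fw w) (hv : IsGivenBy fv v) (ha : IsGivenBy fa a)
    (hc : IsGivenBy fc c) (kw : IsFT fw gw) (kv : IsFT fv gv) (ka : IsFT fa ga) (kc : IsFT fc gc)
    (iw : Integrable gw) (iv : Integrable gv) (ia : Integrable ga) (ic : Integrable gc) (i : Fin d)
    (ψ : 𝓓(slab d T, ℝ)) (t : ℝ) :
    ((∫ x, (- (w x i * (dt ψ (t, x) + lap ψ (t, x)))
      - ∑ j, (v x j * w x i - a x j * c x i) * dx j ψ (t, x)) : ℝ) : ℂ)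
    = -(∫ ξ, (tf (dt ψ) t ξ - (nu * ‖ξ‖ ^ 2 : ℝ) * tf ψ t ξ) * gw ξ i)
      + 2 * Real.pi * Complex.I * ∫ ξ, tf ψ t ξ * ∑ j, (ξ j : ℂ) *
        (conv (fun ξ => gv ξ j) (fun ξ => gw ξ i) ξ - conv (fun ξ => ga ξ j) (fun ξ => gc ξ i) ξ)
      := by
  have l1 := integral_slice_linear hw kw (dt ψ + lap ψ) t i
  have l2 := integrable_slice_linear hw (dt ψ + lap ψ) t i
  have q1 := fun j => integral_slice_quadratic hv kv iv hw kw iw (dx j ψ) t j i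
  have q2 := fun j => integral_slice_quadratic ha ka ia hc kc ic (dx j ψ) t j i
  have hvw : ∀ j, Integrable (conv (fun ξ => gv ξ j) (fun ξ => gw ξ i)) := fun j =>
    integrable_conv (integrable_coord iv j) (integrable_coord iw i)
  have hac : ∀ j, Integrable (conv (fun ξ => ga ξ j) (fun ξ => gc ξ i)) := fun j =>
    integrable_conv (integrable_coord ia j) (integrable_coord ic i)
  have hj : ∀ j ∈ Finset.univ, Integrable fun x =>
      (v x j * w x i - a x j * c x i) * dx j ψ (t, x) := fun j _ => by
    refine ((q1 j).1.sub (q2 j).1).congr (Eventually.of_forall fun x => ?_)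
    simp only [Pi.sub_apply]
    ring
  have e1 : ∀ j, ((∫ x, (v x j * w x i - a x j * c x i) * dx j ψ (t, x) : ℝ) : ℂ)
      = -(2 * Real.pi * Complex.I) * ∫ ξ, tf ψ t ξ * ((ξ j : ℂ) *
        (conv (fun ξ => gv ξ j) (fun ξ => gw ξ i) ξ
          - conv (fun ξ => ga ξ j) (fun ξ => gc ξ i) ξ)) := fun j => by
    have : ∀ x, (v x j * w x i - a x j * c x i) * dx j ψ (t, x)
        = v x j * w x i * dx j ψ (t, x) - a x j * c x i * dx j ψ (t, x) := fun x => by ring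
    simp only [this]
    rw [integral_sub (q1 j).1 (q2 j).1, Complex.ofReal_sub, (q1 j).2, (q2 j).2,
      ← integral_sub (integrable_tf_mul (hvw j) _ t) (integrable_tf_mul (hac j) _ t),
      ← integral_const_mul]
    refine integral_congr_ae (Eventually.of_forall fun ξ => ?_)
    simp only [tf_dx]
    ring
  have i2 : ∀ j ∈ Finset.univ, Integrable fun ξ => tf ψ t ξ * ((ξ j : ℂ) *
        (conv (fun ξ => gv ξ j) (fun ξ => gw ξ i) ξ
          - conv (fun ξ => ga ξ j) (fun ξ => gc ξ i) ξ)) := fun j _ => by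
    have h0 := (integrable_tf_mul ((hvw j).sub (hac j)) (dx j ψ) t).const_mul
      (-(2 * Real.pi * Complex.I))⁻¹
    refine h0.congr (Eventually.of_forall fun ξ => ?_)
    have hne : (-(2 * Real.pi * Complex.I)) ≠ 0 := by simp [Real.pi_ne_zero]
    simp only [tf_dx, Pi.sub_apply]
    field_simp
  rw [integral_sub, integral_neg, integral_finsetSum _ hj]
  · rw [Complex.ofReal_sub, Complex.ofReal_neg, Complex.ofReal_sum]
    simp only [e1]
    rw [← Finset.mul_sum, ← integral_finsetSum _ i2]
    have l3 : ((∫ x, w x i * (dt ψ (t, x) + lap ψ (t, x)) : ℝ) : ℂ)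
        = ∫ ξ, (tf (dt ψ) t ξ - (nu * ‖ξ‖ ^ 2 : ℝ) * tf ψ t ξ) * gw ξ i := by
      refine l1.trans (integral_congr_ae (Eventually.of_forall fun ξ => ?_))
      simp only [tf_add, tf_lap, nu]
      ring
    rw [l3]
    simp only [Finset.mul_sum]
    ring
  · exact l2.neg
  · exact integrable_finsetSum _ hj

end slice

/-- The Fourier transforms at each time of a solution, with enough integrability to express the
nonlinear terms as convolutions at almost every time. -/
structure IsRep (T : ℝ≥0∞) (u b : ℝ → TField d) (z : ℝ → Space d → Pair d) : Prop where
  meas : Measurable (Function.uncurry z)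
  ft_fst : ∀ t ∈ timeInterval T, IsFT (u t) fun ξ => (z t ξ).1
  ft_snd : ∀ t ∈ timeInterval T, IsFT (b t) fun ξ => (z t ξ).2
  sq : ∫⁻ t in timeInterval T, (∫⁻ ξ, ‖z t ξ‖ₑ) ^ 2 < ⊤

lemma measurableSet_timeInterval (T : ℝ≥0∞) : MeasurableSet (timeInterval T) :=
  (measurableSet_le measurable_const measurable_id).inter
    (measurableSet_le ENNReal.measurable_ofReal measurable_const)

variable {u b : ℝ → TField d} {z : ℝ → Space d → Pair d} {U B : ℝ → Space d → Space d}

lemma measurable_lintegral_enorm (hz : Measurable (Function.uncurry z)) :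
    Measurable fun t => ∫⁻ ξ, ‖z t ξ‖ₑ := hz.enorm.lintegral_prod_right'

lemma IsRep.ae_integrable (hz : IsRep T u b z) :
    ∀ᵐ t ∂(volume.restrict (timeInterval T)), Measurable (z t) ∧ Integrable (z t) := by
  filter_upwards [ae_lt_top ((measurable_lintegral_enorm hz.meas).pow_const 2) hz.sq.ne] with t ht
  have hm : Measurable (z t) := hz.meas.comp measurable_prodMk_left
  refine ⟨hm, hm.aestronglyMeasurable, ?_⟩
  by_contra h
  simp only [HasFiniteIntegral, not_lt, top_le_iff] at h
  rw [h] at ht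
  simp at ht

lemma test_eq_zero {ψ : 𝓓(slab d T, ℝ)} {t : ℝ} (ht : t ∉ timeInterval T) (x : Space d) :
    ψ (t, x) = 0 := by
  obtain ⟨a, b, R, ha, h1, h2⟩ := exists_support ψ
  refine h2 t x (Or.inl fun h => ht ⟨ha.le.trans h.1, (h1 t h).le⟩)

lemma IsRep.weakForm_fst (hz : IsRep T u b z)
    (hU : ∀ t ∈ timeInterval T, IsGivenBy (u t) (U t) ∧ IsGivenBy (b t) (B t)) (i : Fin d)
    (ψ : 𝓓(slab d T, ℝ)) :
    ((weakForm U U B B i ψ : ℝ) : ℂ) = ∫ t in timeInterval T,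
      (-(∫ ξ, (tf (dt ψ) t ξ - (nu * ‖ξ‖ ^ 2 : ℝ) * tf ψ t ξ) * (z t ξ).1 i)
      + 2 * Real.pi * Complex.I * ∫ ξ, tf ψ t ξ * (bconv nl (z t) (z t) ξ).1 i) := by
  rw [weakForm, ← setIntegral_eq_integral_of_forall_compl_eq_zero (s := timeInterval T)]
  · refine Eq.trans (integral_ofReal (𝕜 := ℂ)).symm (integral_congr_ae ?_)
    filter_upwards [hz.ae_integrable, ae_restrict_mem (measurableSet_timeInterval T)]
      with t ⟨hm, hi⟩ ht
    refine (integral_slice_weakForm (hU t ht).1 (hU t ht).1 (hU t ht).2 (hU t ht).2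
      (hz.ft_fst t ht) (hz.ft_fst t ht) (hz.ft_snd t ht) (hz.ft_snd t ht)
      hi.fst hi.fst hi.snd hi.snd i ψ t).trans ?_
    congr 2
    refine integral_congr_ae ?_
    filter_upwards [bconv_nl_fst hm hi] with ξ hξ
    rw [hξ]
  · intro t ht
    simp [test_eq_zero ht]

lemma IsRep.weakForm_snd (hz : IsRep T u b z)
    (hU : ∀ t ∈ timeInterval T, IsGivenBy (u t) (U t) ∧ IsGivenBy (b t) (B t)) (i : Fin d)
    (ψ : 𝓓(slab d T, ℝ)) :
    ((weakForm B U B U i ψ : ℝ) : ℂ) = ∫ t in timeInterval T,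
      (-(∫ ξ, (tf (dt ψ) t ξ - (nu * ‖ξ‖ ^ 2 : ℝ) * tf ψ t ξ) * (z t ξ).2 i)
      + 2 * Real.pi * Complex.I * ∫ ξ, tf ψ t ξ * (bconv nl (z t) (z t) ξ).2 i) := by
  rw [weakForm, ← setIntegral_eq_integral_of_forall_compl_eq_zero (s := timeInterval T)]
  · refine Eq.trans (integral_ofReal (𝕜 := ℂ)).symm (integral_congr_ae ?_)
    filter_upwards [hz.ae_integrable, ae_restrict_mem (measurableSet_timeInterval T)]
      with t ⟨hm, hi⟩ ht
    refine (integral_slice_weakForm (hU t ht).2 (hU t ht).1 (hU t ht).2 (hU t ht).1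
      (hz.ft_snd t ht) (hz.ft_fst t ht) (hz.ft_snd t ht) (hz.ft_fst t ht)
      hi.snd hi.fst hi.snd hi.fst i ψ t).trans ?_
    congr 2
    refine integral_congr_ae ?_
    filter_upwards [bconv_nl_snd hm hi] with ξ hξ
    rw [hξ]
  · intro t ht
    simp [test_eq_zero ht]

/-! ### Space-time integrability -/

lemma IsRep.lintegral_cv (hz : IsRep T u b z) :
    ∫⁻ t in timeInterval T, ∫⁻ ξ, cv (fun ξ => ‖z t ξ‖ₑ) (fun ξ => ‖z t ξ‖ₑ) ξ < ⊤ := by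
  refine lt_of_le_of_lt (lintegral_mono fun t => ?_) hz.sq
  have hm : Measurable fun ξ => ‖z t ξ‖ₑ := (hz.meas.comp measurable_prodMk_left).enorm
  rw [MHD.lintegral_cv hm hm, pow_two]

/-- Bounded time intervals carry finite mass, so that square integrability in time gives
integrability. -/
lemma IsRep.lintegral_lt_top (hz : IsRep T u b z) {s : Set ℝ} (hs : s ⊆ timeInterval T)
    (hv : volume s ≠ ⊤) : ∫⁻ t in s, ∫⁻ ξ, ‖z t ξ‖ₑ < ⊤ := by
  have h1 : ∀ t, ∫⁻ ξ, ‖z t ξ‖ₑ ≤ 1 + (∫⁻ ξ, ‖z t ξ‖ₑ) ^ 2 := fun t => by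
    rcases le_total (∫⁻ ξ, ‖z t ξ‖ₑ) 1 with h | h
    · exact h.trans le_self_add
    · refine le_trans ?_ le_add_self
      rw [pow_two]
      exact le_mul_of_one_le_left' h
  refine lt_of_le_of_lt (lintegral_mono h1) ?_
  rw [lintegral_add_left measurable_const, lintegral_const, one_mul, Measure.restrict_apply_univ]
  exact ENNReal.add_lt_top.2 ⟨hv.lt_top, (lintegral_mono_set hs).trans_lt hz.sq⟩

lemma norm_le_sum_abs (ξ : Space d) : ‖ξ‖ ≤ ∑ i, |ξ i| := by
  have h : ξ = ∑ i, ξ i • (e i : Space d) := by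
    ext j
    simp [Finset.sum_apply, Pi.single_apply]
  calc ‖ξ‖ = ‖∑ i, ξ i • (e i : Space d)‖ := by rw [← h]
    _ ≤ ∑ i, ‖ξ i • (e i : Space d)‖ := norm_sum_le _ _
    _ = _ := by simp [norm_smul]

lemma exists_bound_norm_mul_tf (ψ : 𝓓(slab d T, ℝ)) : ∃ C : ℝ, 0 ≤ C ∧
    ∀ t ξ, ‖ξ‖ * ‖tf ψ t ξ‖ ≤ C := by
  choose C hC using fun i => exists_bound_tf (dx i ψ)
  have hC0 : ∀ i, 0 ≤ C i := fun i => (norm_nonneg _).trans (hC i 0 0)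
  refine ⟨∑ i, C i, Finset.sum_nonneg fun i _ => hC0 i, fun t ξ => ?_⟩
  refine (mul_le_mul_of_nonneg_right (norm_le_sum_abs ξ) (norm_nonneg _)).trans ?_
  rw [Finset.sum_mul]
  refine Finset.sum_le_sum fun i _ => le_trans ?_ (hC i t ξ)
  rw [tf_dx, norm_mul, norm_mul, norm_neg, Complex.norm_real, Real.norm_eq_abs]
  have : (1 : ℝ) ≤ ‖(2 * Real.pi * Complex.I : ℂ)‖ := by
    simp [abs_of_pos Real.pi_pos]
    linarith [Real.pi_gt_three]
  have h0 : 0 ≤ |ξ i| * ‖tf ψ t ξ‖ := by positivity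
  nlinarith

end

section

variable {d : ℕ} {T : ℝ≥0∞}

/-! ### Linear ordinary differential equations in integral form -/

lemma integrable_prod_of_lintegral {α β E : Type*} [MeasurableSpace α] [MeasurableSpace β]
    [NormedAddCommGroup E] {μ : Measure α} {ν : Measure β} [SFinite μ] [SFinite ν]
    {F : α → β → E} (hF : AEStronglyMeasurable (Function.uncurry F) (μ.prod ν))
    (h : ∫⁻ x, ∫⁻ y, ‖F x y‖ₑ ∂ν ∂μ < ⊤) : Integrable (Function.uncurry F) (μ.prod ν) := by
  refine ⟨hF, ?_⟩
  rw [HasFiniteIntegral, lintegral_prod _ hF.enorm]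
  exact h

/-- Exchange of the order of integration on the triangle `0 < s ≤ t ≤ b`. -/
lemma integral_deriv_mul_primitive {b : ℝ} {g g' k : ℝ → ℂ} (hg : ∀ t, HasDerivAt g (g' t) t)
    (hg' : Continuous g') (hk : IntegrableOn k (Ioc 0 b)) :
    ∫ t in Ioc 0 b, g' t * ∫ s in Ioc 0 t, k s = ∫ s in Ioc 0 b, (g b - g s) * k s := by
  have e1 : ∀ t ∈ Ioc 0 b, g' t * ∫ s in Ioc 0 t, k s
      = ∫ s in Ioc 0 b, (Iic t).indicator (fun s => g' t * k s) s := fun t ht => by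
    rw [setIntegral_indicator measurableSet_Iic, ← integral_const_mul,
      show Ioc 0 b ∩ Iic t = Ioc 0 t by rw [Ioc_inter_Iic, min_eq_right ht.2]]
  -- exchange the order of integration over `0 < s ≤ t ≤ b`
  have hint : Integrable (Function.uncurry fun t s => (Iic t).indicator (fun s => g' t * k s) s)
      ((volume.restrict (Ioc 0 b)).prod (volume.restrict (Ioc 0 b))) := by
    have h1 : Integrable (fun p : ℝ × ℝ => g' p.1 * k p.2)
        ((volume.restrict (Ioc 0 b)).prod (volume.restrict (Ioc 0 b))) :=
      (hg'.integrableOn_Ioc).mul_prod hk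
    have h2 : MeasurableSet {p : ℝ × ℝ | p.2 ≤ p.1} :=
      measurableSet_le measurable_snd measurable_fst
    refine (h1.indicator h2).congr (Eventually.of_forall fun p => ?_)
    simp only [Function.uncurry, indicator, mem_ofPred_eq, mem_Iic]
  rw [setIntegral_congr_fun measurableSet_Ioc e1, integral_integral_swap hint]
  refine setIntegral_congr_fun measurableSet_Ioc fun s hs => ?_
  have e2 : ∀ t, (Iic t).indicator (fun s => g' t * k s) s
      = (Ici s).indicator (fun t => g' t * k s) t := fun t => by
    simp only [indicator, mem_Iic, mem_Ici]
  simp only [e2]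
  rw [setIntegral_indicator measurableSet_Ici, integral_mul_const]
  congr 1
  have e3 : Ioc 0 b ∩ Ici s = Icc s b := by
    ext t
    simp only [mem_inter_iff, mem_Ioc, mem_Ici, mem_Icc]
    exact ⟨fun h => ⟨h.2, h.1.2⟩, fun h => ⟨⟨hs.1.trans_le h.1, h.2⟩, h.1⟩⟩
  rw [e3, integral_Icc_eq_integral_Ioc, ← intervalIntegral.integral_of_le hs.2]
  exact intervalIntegral.integral_eq_sub_of_hasDerivAt (fun t _ => hg t)
    (hg'.intervalIntegrable _ _)

/-- A solution in the mild sense is a solution in the weak sense. -/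
lemma integral_test_of_mild {a b : ℝ} {p p' y D : ℝ → ℂ} {y₀ : ℂ} (hD : IntegrableOn D (Ioc 0 b))
    (hy : ∀ t ∈ Ioc 0 b, y t = Real.exp (-(a * t)) * y₀
      + ∫ s in Ioc 0 t, Real.exp (-(a * (t - s))) * D s)
    (hp : ∀ t, HasDerivAt p (p' t) t) (hp' : Continuous p') (h0 : p 0 = 0) (hb : p b = 0) :
    ∫ t in Ioc 0 b, (p' t - a * p t) * y t = -∫ s in Ioc 0 b, p s * D s := by
  rcases le_or_gt b 0 with hb0 | hb0
  · simp [Ioc_eq_empty_of_le hb0]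
  -- the integrating factor, transferred to the test function
  set g : ℝ → ℂ := fun t => Real.exp (-(a * t)) * p t
  set g' : ℝ → ℂ := fun t => Real.exp (-(a * t)) * (p' t - a * p t)
  have hpc : Continuous p := continuous_iff_continuousAt.2 fun t => (hp t).continuousAt
  have hg' : Continuous g' := by fun_prop
  have hg : ∀ t, HasDerivAt g (g' t) t := fun t => by
    have h1 : HasDerivAt (fun t : ℝ => Real.exp (-(a * t))) (Real.exp (-(a * t)) * (-(a * 1))) t :=
      ((hasDerivAt_id t).const_mul a).neg.exp
    refine (h1.ofReal_comp.mul (hp t)).congr_deriv ?_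
    simp only [g']
    push_cast
    ring
  set k : ℝ → ℂ := fun s => Real.exp (a * s) * D s
  have hk : IntegrableOn k (Ioc 0 b) := by
    refine Integrable.bdd_mul (c := Real.exp (|a| * b)) hD
      (Continuous.aestronglyMeasurable (by fun_prop)) ?_
    filter_upwards [ae_restrict_mem measurableSet_Ioc] with s hs
    rw [Complex.norm_real, Real.norm_of_nonneg (Real.exp_pos _).le]
    refine Real.exp_le_exp.2 ((mul_le_mul_of_nonneg_right (le_abs_self a) hs.1.le).trans ?_)
    exact mul_le_mul_of_nonneg_left hs.2 (abs_nonneg a)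
  have e1 : ∀ t ∈ Ioc 0 b, (p' t - a * p t) * y t
      = g' t * y₀ + g' t * ∫ s in Ioc 0 t, k s := fun t ht => by
    have : ∫ s in Ioc 0 t, (Real.exp (-(a * (t - s))) : ℂ) * D s
        = Real.exp (-(a * t)) * ∫ s in Ioc 0 t, k s := by
      rw [← integral_const_mul]
      refine integral_congr_ae (Eventually.of_forall fun s => ?_)
      simp only [k]
      rw [← mul_assoc, ← Complex.ofReal_mul, ← Real.exp_add]
      ring_nf
    rw [hy t ht, this]
    simp only [g']
    ring
  have i1 : IntegrableOn (fun t => g' t * y₀) (Ioc 0 b) :=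
    Continuous.integrableOn_Ioc (by fun_prop)
  have i2 : IntegrableOn (fun t => g' t * ∫ s in Ioc 0 t, k s) (Ioc 0 b) := by
    have hc : ContinuousOn (fun t => ∫ s in Ioc 0 t, k s) (Icc 0 b) :=
      intervalIntegral.continuousOn_primitive ((integrableOn_Icc_iff_integrableOn_Ioc (by simp)).2
          hk)
    exact ((hg'.continuousOn.mul hc).integrableOn_Icc).mono_set Ioc_subset_Icc_self
  rw [setIntegral_congr_fun measurableSet_Ioc e1, integral_add i1 i2,
    integral_deriv_mul_primitive hg hg' hk, integral_mul_const,
    ← intervalIntegral.integral_of_le hb0.le,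
    intervalIntegral.integral_eq_sub_of_hasDerivAt (fun t _ => hg t) (hg'.intervalIntegrable _ _)]
  have hgb : g b = 0 := by simp [g, hb]
  have hg0 : g 0 = 0 := by simp [g, h0]
  rw [hgb, hg0, sub_self, zero_mul, zero_add, ← integral_neg]
  refine integral_congr_ae (Eventually.of_forall fun s => ?_)
  simp only [g, k]
  have : (Real.exp (-(a * s)) : ℂ) * Real.exp (a * s) = 1 := by
    rw [← Complex.ofReal_mul, ← Real.exp_add]; simp
  linear_combination (-(p s * D s)) * this

/-- An integrable solution of the integrated equation `y' = -a y + D` is given by Duhamel's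
formula. -/
lemma duhamel_of_integral {a b : ℝ} {y D : ℝ → ℂ} {y₀ : ℂ} (hD : IntegrableOn D (Ioc 0 b))
    (hyi : IntegrableOn y (Ioc 0 b)) (hb0 : 0 ≤ b)
    (hyae : ∀ᵐ t ∂(volume.restrict (Ioc 0 b)), y t = y₀ + ∫ s in Ioc 0 t, (-a * y s + D s))
    (hyb : y b = y₀ + ∫ s in Ioc 0 b, (-a * y s + D s)) :
    y b = Real.exp (-(a * b)) * y₀ + ∫ s in Ioc 0 b, Real.exp (-(a * (b - s))) * D s := by
  -- the integrating factor
  set g : ℝ → ℂ := fun t => Real.exp (a * t)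
  set g' : ℝ → ℂ := fun t => a * Real.exp (a * t)
  have hg' : Continuous g' := by fun_prop
  have hgc : Continuous g := by fun_prop
  have hg : ∀ t, HasDerivAt g (g' t) t := fun t => by
    have h1 : HasDerivAt (fun t : ℝ => Real.exp (a * t)) (Real.exp (a * t) * (a * 1)) t :=
      ((hasDerivAt_id t).const_mul a).exp
    refine h1.ofReal_comp.congr_deriv ?_
    simp only [g']
    push_cast
    ring
  have hk : IntegrableOn (fun s => -a * y s + D s) (Ioc 0 b) := (hyi.const_mul _).add hD
  have hbd : ∀ h : ℝ → ℂ, IntegrableOn h (Ioc 0 b) → IntegrableOn (fun s => g s * h s) (Ioc 0 b) :=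
      by
    intro h hh
    refine Integrable.bdd_mul (c := Real.exp (|a| * b)) hh hgc.aestronglyMeasurable ?_
    filter_upwards [ae_restrict_mem measurableSet_Ioc] with s hs
    rw [Complex.norm_real, Real.norm_of_nonneg (Real.exp_pos _).le]
    refine Real.exp_le_exp.2 ((mul_le_mul_of_nonneg_right (le_abs_self a) hs.1.le).trans ?_)
    exact mul_le_mul_of_nonneg_left hs.2 (abs_nonneg a)
  have h1 := integral_deriv_mul_primitive hg hg' hk
  have hgi : ∫ t in Ioc 0 b, g' t = g b - g 0 := by
    rw [← intervalIntegral.integral_of_le hb0]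
    exact intervalIntegral.integral_eq_sub_of_hasDerivAt (fun t _ => hg t)
      (hg'.intervalIntegrable _ _)
  -- both sides of the integration by parts `h1`, computed with the equation
  have h2 : ∫ t in Ioc 0 b, g' t * ∫ s in Ioc 0 t, (-a * y s + D s)
      = a * (∫ t in Ioc 0 b, g t * y t) - (g b - g 0) * y₀ := by
    rw [← integral_const_mul, ← hgi, ← integral_mul_const, ← integral_sub]
    · refine integral_congr_ae ?_
      filter_upwards [hyae] with t ht
      have h0 : ∫ s in Ioc 0 t, (-a * y s + D s) = y t - y₀ := by rw [ht]; ring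
      rw [h0]
      simp only [g', g]
      ring
    · exact (hbd y hyi).const_mul _
    · exact Continuous.integrableOn_Ioc (by fun_prop)
  have h3 : ∫ s in Ioc 0 b, (g b - g s) * (-a * y s + D s)
      = g b * (y b - y₀) + a * (∫ t in Ioc 0 b, g t * y t) - ∫ t in Ioc 0 b, g t * D t := by
    have : ∀ s, (g b - g s) * (-a * y s + D s)
        = g b * (-a * y s + D s) + (a * (g s * y s) - g s * D s) := fun s => by ring
    simp only [this]
    have i1 : IntegrableOn (fun s => a * (g s * y s)) (Ioc 0 b) := (hbd y hyi).const_mul _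
    have i2 : IntegrableOn (fun s => a * (g s * y s) - g s * D s) (Ioc 0 b) := i1.sub (hbd D hD)
    rw [integral_add (hk.const_mul _) i2,
      integral_sub ((hbd y hyi).const_mul _) (hbd D hD), integral_const_mul, integral_const_mul,
      hyb]
    ring
  rw [h2, h3] at h1
  have hg0 : g 0 = 1 := by simp [g]
  have h4 : g b * y b = y₀ + ∫ t in Ioc 0 b, g t * D t := by
    rw [hg0] at h1
    linear_combination -h1
  have h5 : (Real.exp (-(a * b)) : ℂ) * g b = 1 := by
    simp only [g]
    rw [← Complex.ofReal_mul, ← Real.exp_add]; simp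
  calc y b = Real.exp (-(a * b)) * (g b * y b) := by rw [← mul_assoc, h5, one_mul]
    _ = _ := by
      rw [h4, mul_add, ← integral_const_mul]
      congr 1
      refine integral_congr_ae (Eventually.of_forall fun s => ?_)
      simp only [g]
      rw [← mul_assoc, ← Complex.ofReal_mul, ← Real.exp_add]
      ring_nf

/-! ### Mild solutions are weak solutions -/

/-- The Duhamel formulation of the MHD system on the Fourier side. -/
structure IsMild (A : Set ℝ) (z₀ : Space d → Pair d) (z : ℝ → Space d → Pair d) : Prop where
  meas : Measurable (Function.uncurry z)
  finite : ∫⁻ ξ, timeNorm A z ξ < ⊤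
  eq : ∀ᵐ ξ, ∀ t ∈ A, z t ξ = heat nu z₀ t ξ + duh nu mhdSym z z t ξ

variable {z : ℝ → Space d → Pair d} {z₀ : Space d → Pair d}

/-- By Minkowski's inequality, `L¹_ξ L²_t` is contained in `L²_t L¹_ξ`. -/
lemma lintegral_sq_le_of_timeNorm {A : Set ℝ} (hz : Measurable (Function.uncurry z)) :
    ∫⁻ t in A, (∫⁻ ξ, ‖z t ξ‖ₑ) ^ 2 ≤ (∫⁻ ξ, timeNorm A z ξ) ^ 2 := by
  rw [← n2_sq (μ := volume.restrict A) (fun t => ∫⁻ ξ, ‖z t ξ‖ₑ)]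
  exact pow_le_pow_left₀ zero_le (n2_lintegral_le (f := fun t ξ => ‖z t ξ‖ₑ) hz.enorm) 2

lemma IsMild.ae_integrableOn {A : Set ℝ} (hz : IsMild A z₀ z) :
    ∀ᵐ ξ, IntegrableOn (fun s => bconv mhdSym (z s) (z s) ξ) A := by
  have hm := measurable_timeNorm A hz.meas
  have h1 : ∫⁻ ξ, cv (timeNorm A z) (timeNorm A z) ξ ≠ ⊤ := by
    rw [lintegral_cv hm hm]; exact ENNReal.mul_ne_top hz.finite.ne hz.finite.ne
  filter_upwards [ae_lt_top (measurable_cv hm hm) h1] with ξ hξ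
  exact (integrable_bconv isSymbol_mhdSym hz.meas hz.meas (Eventually.of_forall fun _ => le_rfl)
    (Eventually.of_forall fun _ => le_rfl) hξ.ne).2

lemma continuous_tf_left (ψ : 𝓓(slab d T, ℝ)) (ξ : Space d) : Continuous fun t => tf ψ t ξ :=
  continuous_iff_continuousAt.2 fun t => (hasDerivAt_tf ψ t ξ).continuousAt

/-- Test functions vanish near the ends of the time interval. -/
lemma exists_time_support (ψ : 𝓓(slab d T, ℝ)) : ∃ b : ℝ, Ioc 0 b ⊆ timeInterval T ∧
    (∀ t, t ∉ Ioc 0 b → ∀ x, ψ (t, x) = 0) ∧ ∀ x, ψ (0, x) = 0 ∧ ψ (b, x) = 0 := by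
  obtain ⟨a, b, R, ha, h1, h2⟩ := exists_support ψ
  rcases le_or_gt a b with hab | hab
  · have h3 : ∀ t, t ∉ Icc a b → ∀ x, ψ (t, x) = 0 := fun t ht x => h2 t x (Or.inl ht)
    refine ⟨b, fun t ht => ⟨ht.1.le, ?_⟩, fun t ht => h3 t fun h => ht ⟨ha.trans_le h.1, h.2⟩,
      fun x => ⟨h3 0 (fun h => by linarith [h.1]) x, ?_⟩⟩
    · exact (ENNReal.ofReal_le_ofReal ht.2).trans (h1 b ⟨hab, le_rfl⟩).le
    · -- by continuity, the function also vanishes at the right end of its support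
      have hc : Continuous fun t => ψ (t, x) := ψ.continuous.comp (by fun_prop)
      have h4 : Tendsto (fun t => ψ (t, x)) (𝓝[>] b) (𝓝 (ψ (b, x))) :=
        hc.continuousAt.tendsto.mono_left nhdsWithin_le_nhds
      refine tendsto_nhds_unique h4 (tendsto_const_nhds.congr' ?_)
      filter_upwards [self_mem_nhdsWithin] with t ht
      exact (h3 t (fun h => (not_lt.2 h.2) ht) x).symm
  · have h3 : ∀ t x, ψ (t, x) = 0 := fun t x => h2 t x (Or.inl fun h => by linarith [h.1, h.2])
    exact ⟨0, by simp, fun t _ => h3 t, fun x => ⟨h3 _ _, h3 _ _⟩⟩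

/-- The weak form of the equation in time, at almost every frequency. -/
lemma IsMild.integral_test (hz : IsMild (timeInterval T) z₀ z) (c : Pair d →L[ℂ] ℂ)
    (ψ : 𝓓(slab d T, ℝ)) : ∀ᵐ ξ,
    ∫ t in timeInterval T, (tf (dt ψ) t ξ - (nu * ‖ξ‖ ^ 2 : ℝ) * tf ψ t ξ) * c (z t ξ)
      = -∫ t in timeInterval T, tf ψ t ξ * c (bconv mhdSym (z t) (z t) ξ) := by
  obtain ⟨b₁, hb₁, s₁, z₁⟩ := exists_time_support ψ
  obtain ⟨b₂, hb₂, s₂, z₂⟩ := exists_time_support (dt ψ)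
  -- an interval which contains the support in time of the test function
  set b := max b₁ b₂ with hb
  have hbA : Ioc 0 b ⊆ timeInterval T := by
    rcases max_choice b₁ b₂ with h | h <;> rw [hb, h] <;> assumption
  have hs₁ : ∀ t, t ∉ Ioc 0 b → ∀ ξ, tf ψ t ξ = 0 := fun t ht ξ =>
    tf_eq_zero (s₁ t fun h => ht ⟨h.1, h.2.trans (le_max_left _ _)⟩) ξ
  have hs₂ : ∀ t, t ∉ Ioc 0 b → ∀ ξ, tf (dt ψ) t ξ = 0 := fun t ht ξ =>
    tf_eq_zero (s₂ t fun h => ht ⟨h.1, h.2.trans (le_max_right _ _)⟩) ξ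
  have hψb : ∀ x, ψ (b, x) = 0 := fun x => by
    rcases le_total b₂ b₁ with h | h
    · rw [hb, max_eq_left h]; exact (z₁ x).2
    · rcases h.eq_or_lt with h | h
      · rw [hb, h, max_self, ← h]; exact (z₁ x).2
      · exact s₁ b (fun h' => by rw [hb, max_eq_right h.le] at h'; linarith [h'.2]) x
  filter_upwards [hz.ae_integrableOn, hz.eq] with ξ h1 h2
  have hD : IntegrableOn (fun s => c (bconv mhdSym (z s) (z s) ξ)) (Ioc 0 b) :=
    c.integrable_comp (h1.mono_set hbA)
  have key := integral_test_of_mild (a := nu * ‖ξ‖ ^ 2) (b := b) (p := fun t => tf ψ t ξ)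
    (p' := fun t => tf (dt ψ) t ξ) (y := fun t => c (z t ξ))
    (D := fun s => c (bconv mhdSym (z s) (z s) ξ)) (y₀ := c (z₀ ξ)) hD ?_
    (fun t => hasDerivAt_tf ψ t ξ) (continuous_tf_left (dt ψ) ξ)
    (tf_eq_zero (fun x => (z₁ x).1) ξ) (tf_eq_zero hψb ξ)
  · have e1 : ∀ F : ℝ → ℂ, (∀ t, t ∉ Ioc 0 b → F t = 0) →
        ∫ t in timeInterval T, F t = ∫ t in Ioc 0 b, F t := fun F hF => by
      rw [setIntegral_eq_integral_of_forall_compl_eq_zero hF,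
        setIntegral_eq_integral_of_forall_compl_eq_zero fun t ht => hF t fun h => ht (hbA h)]
    rw [e1, e1]
    · exact key
    · intro t ht
      rw [hs₁ t ht, zero_mul]
    · intro t ht
      rw [hs₁ t ht, hs₂ t ht]
      ring
  · intro t ht
    have h3 : IntegrableOn (fun s => Real.exp (-(nu * ‖ξ‖ ^ 2 * (t - s))) •
        bconv mhdSym (z s) (z s) ξ) (Ioc 0 t) :=
      integrableOn_duh nu_pos.le (fun t ht => (Ioc_subset_Ioc_right ht.2).trans
        (subset_refl (Ioc 0 b))) (h1.mono_set hbA) ht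
    rw [h2 t (hbA ht), map_add, heat, duh, ← c.integral_comp_comm h3]
    simp only [ContinuousLinearMap.map_smul_of_tower, Complex.real_smul]

end

section

variable {d : ℕ} {T : ℝ≥0∞} {u b : ℝ → TField d} {z : ℝ → Space d → Pair d}
  {U B : ℝ → Space d → Space d} {z₀ : Space d → Pair d}

/-- The `i`-th coordinate of the first vector of a pair. -/
def coFst (i : Fin d) : Pair d →L[ℂ] ℂ :=
  (EuclideanSpace.proj (𝕜 := ℂ) i).comp (ContinuousLinearMap.fst ℂ (Vec d) (Vec d))

/-- The `i`-th coordinate of the second vector of a pair. -/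
def coSnd (i : Fin d) : Pair d →L[ℂ] ℂ :=
  (EuclideanSpace.proj (𝕜 := ℂ) i).comp (ContinuousLinearMap.snd ℂ (Vec d) (Vec d))

@[simp] lemma coFst_apply (i : Fin d) (v : Pair d) : coFst i v = v.1 i := rfl

@[simp] lemma coSnd_apply (i : Fin d) (v : Pair d) : coSnd i v = v.2 i := rfl

lemma measurable_uncurry_tf (ψ : 𝓓(slab d T, ℝ)) : Measurable (Function.uncurry (tf ψ)) :=
  (continuous_tf ψ).measurable

lemma IsRep.integrable_tf_mul (hz : IsRep T u b z) (c : Pair d →L[ℂ] ℂ) (χ : 𝓓(slab d T, ℝ)) :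
    Integrable (Function.uncurry fun t ξ => tf χ t ξ * c (z t ξ))
      ((volume.restrict (timeInterval T)).prod volume) := by
  obtain ⟨b, hb, s, -⟩ := exists_time_support χ
  obtain ⟨C, hC⟩ := exists_bound_tf χ
  have hbd : ∀ t ξ, ‖tf χ t ξ * c (z t ξ)‖ₑ
      ≤ (Ioc 0 b).indicator (fun t => ENNReal.ofReal C * ‖c‖ₑ * ‖z t ξ‖ₑ) t := fun t ξ => by
    by_cases ht : t ∈ Ioc 0 b
    · rw [indicator_of_mem ht, enorm_mul, mul_assoc]
      refine mul_le_mul' ?_ (c.le_opENorm _)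
      rw [← ofReal_norm]
      exact ENNReal.ofReal_le_ofReal (hC t ξ)
    · rw [tf_eq_zero (s t ht)]; simp
  refine integrable_prod_of_lintegral (Measurable.aestronglyMeasurable ?_) ?_
  · exact (measurable_uncurry_tf χ).mul (c.continuous.measurable.comp hz.meas)
  · refine lt_of_le_of_lt (lintegral_mono fun t => lintegral_mono fun ξ => hbd t ξ) ?_
    have e1 : ∀ t, ∫⁻ ξ, (Ioc 0 b).indicator (fun t => ENNReal.ofReal C * ‖c‖ₑ * ‖z t ξ‖ₑ) t
        = (Ioc 0 b).indicator (fun t => ENNReal.ofReal C * ‖c‖ₑ * ∫⁻ ξ, ‖z t ξ‖ₑ) t := fun t => by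
      by_cases ht : t ∈ Ioc 0 b
      · simp only [indicator_of_mem ht]
        rw [lintegral_const_mul' _ _ (by finiteness)]
      · simp [indicator_of_notMem ht]
    simp only [e1]
    rw [setLIntegral_indicator measurableSet_Ioc, lintegral_const_mul' _ _ (by finiteness),
      inter_eq_left.2 hb]
    exact ENNReal.mul_lt_top (by finiteness) (hz.lintegral_lt_top hb (by simp))

lemma IsRep.integrable_tf_mul_of_le (hz : IsRep T u b z) {F : ℝ → Space d → ℂ}
    (hF : Measurable (Function.uncurry F)) {K : ℝ≥0}
    (hle : ∀ t ξ, ‖F t ξ‖ₑ ≤ K * cv (fun ξ => ‖z t ξ‖ₑ) (fun ξ => ‖z t ξ‖ₑ) ξ) :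
    Integrable (Function.uncurry F) ((volume.restrict (timeInterval T)).prod volume) := by
  refine integrable_prod_of_lintegral hF.aestronglyMeasurable ?_
  refine lt_of_le_of_lt (lintegral_mono fun t => lintegral_mono fun ξ => hle t ξ) ?_
  simp_rw [lintegral_const_mul' _ _ (show (K : ℝ≥0∞) ≠ ⊤ by simp)]
  exact ENNReal.mul_lt_top (by simp) hz.lintegral_cv

lemma IsRep.integrable_tf_mul_bconv (hz : IsRep T u b z) (c : Pair d →L[ℂ] ℂ) {K : ℝ≥0}
    {M : Space d → Pair d → Pair d → Pair d} (hM : IsSymbol M K) (ψ : 𝓓(slab d T, ℝ)) :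
    Integrable (Function.uncurry fun t ξ => tf ψ t ξ * c (bconv M (z t) (z t) ξ))
      ((volume.restrict (timeInterval T)).prod volume) := by
  obtain ⟨C, hC0, hC⟩ := exists_bound_norm_mul_tf ψ
  refine hz.integrable_tf_mul_of_le (K := C.toNNReal * ‖c‖₊ * K)
    ((measurable_uncurry_tf ψ).mul
      (c.continuous.measurable.comp (measurable_bconv hM hz.meas hz.meas))) fun t ξ => ?_
  have h1 : ‖ξ‖ₑ * ‖tf ψ t ξ‖ₑ ≤ C.toNNReal := by
    rw [← ofReal_norm, ← ofReal_norm, ← ENNReal.ofReal_mul (norm_nonneg _)]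
    exact ENNReal.ofReal_le_ofReal (hC t ξ)
  rw [enorm_mul]
  calc ‖tf ψ t ξ‖ₑ * ‖c (bconv M (z t) (z t) ξ)‖ₑ
      ≤ ‖tf ψ t ξ‖ₑ * (‖c‖ₑ * (K * ‖ξ‖ₑ * cv (fun ξ => ‖z t ξ‖ₑ) (fun ξ => ‖z t ξ‖ₑ) ξ)) := by
        refine mul_le_mul_right ((c.le_opENorm _).trans ?_) _
        exact mul_le_mul_right (enorm_bconv_le hM _ _ _) _
    _ = (‖ξ‖ₑ * ‖tf ψ t ξ‖ₑ) * ‖c‖ₑ * K * cv (fun ξ => ‖z t ξ‖ₑ) (fun ξ => ‖z t ξ‖ₑ) ξ := by ring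
    _ ≤ C.toNNReal * ‖c‖ₑ * K * cv (fun ξ => ‖z t ξ‖ₑ) (fun ξ => ‖z t ξ‖ₑ) ξ := by
        gcongr
    _ = _ := by push_cast; rfl

lemma tf_dt_add_lap (ψ : 𝓓(slab d T, ℝ)) (t : ℝ) (ξ : Space d) :
    tf (dt ψ + lap ψ) t ξ = tf (dt ψ) t ξ - (nu * ‖ξ‖ ^ 2 : ℝ) * tf ψ t ξ := by
  rw [tf_add, tf_lap, nu]
  ring

lemma IsMild.integral_test_swap (hm : IsMild (timeInterval T) z₀ z) (hz : IsRep T u b z)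
    (c : Pair d →L[ℂ] ℂ) (ψ : 𝓓(slab d T, ℝ)) :
    ∫ t in timeInterval T, ∫ ξ, (tf (dt ψ) t ξ - (nu * ‖ξ‖ ^ 2 : ℝ) * tf ψ t ξ) * c (z t ξ)
      = -∫ t in timeInterval T, ∫ ξ, tf ψ t ξ * c (bconv mhdSym (z t) (z t) ξ) := by
  have i1 := hz.integrable_tf_mul c (dt ψ + lap ψ)
  have i2 := hz.integrable_tf_mul_bconv c isSymbol_mhdSym ψ
  simp only [tf_dt_add_lap] at i1
  rw [integral_integral_swap i1, integral_integral_swap i2, ← integral_neg]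
  exact integral_congr_ae (hm.integral_test c ψ)

lemma IsRep.ae_bconv (hz : IsRep T u b z) : ∀ᵐ t ∂(volume.restrict (timeInterval T)), ∀ᵐ ξ,
    bconv mhdSym (z t) (z t) ξ = (-(2 * Real.pi * Complex.I)) •
      (leray ξ (bconv nl (z t) (z t) ξ).1, (bconv nl (z t) (z t) ξ).2) := by
  filter_upwards [hz.ae_integrable] with t ⟨hm, hi⟩
  exact bconv_mhdSym hm hi

/-- The second equation has no pressure. -/
lemma IsMild.weakForm_snd (hm : IsMild (timeInterval T) z₀ z) (hz : IsRep T u b z)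
    (hU : ∀ t ∈ timeInterval T, IsGivenBy (u t) (U t) ∧ IsGivenBy (b t) (B t)) (i : Fin d)
    (ψ : 𝓓(slab d T, ℝ)) : weakForm B U B U i ψ = 0 := by
  have i1 := hz.integrable_tf_mul (coSnd i) (dt ψ + lap ψ)
  have i2 := hz.integrable_tf_mul_bconv (coSnd i) isSymbol_nl ψ
  have h1 := hm.integral_test_swap hz (coSnd i) ψ
  simp only [tf_dt_add_lap] at i1
  have h2 := hz.weakForm_snd hU i ψ
  simp only [← coSnd_apply] at h2
  rw [integral_add, integral_neg, integral_const_mul, h1] at h2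
  · have h3 : ∫ t in timeInterval T, ∫ ξ, tf ψ t ξ * coSnd i (bconv mhdSym (z t) (z t) ξ)
        = -(2 * Real.pi * Complex.I) *
          ∫ t in timeInterval T, ∫ ξ, tf ψ t ξ * coSnd i (bconv nl (z t) (z t) ξ) := by
      rw [← integral_const_mul]
      refine integral_congr_ae ?_
      filter_upwards [hz.ae_bconv] with t ht
      rw [← integral_const_mul]
      refine integral_congr_ae ?_
      filter_upwards [ht] with ξ hξ
      simp only [hξ, coSnd_apply, Prod.smul_snd, PiLp.smul_apply, smul_eq_mul]
      ring
    rw [h3] at h2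
    have : ((weakForm B U B U i ψ : ℝ) : ℂ) = 0 := by rw [h2]; ring
    exact_mod_cast this
  · exact i1.integral_prod_left.neg
  · exact i2.integral_prod_left.const_mul _

/-- The Fourier transform of the pressure, up to the sign. -/
def pressureFT (z : ℝ → Space d → Pair d) (t : ℝ) (ξ : Space d) : ℂ :=
  dotc ξ (bconv nl (z t) (z t) ξ).1 / ((‖ξ‖ ^ 2 : ℝ) : ℂ)

lemma measurable_pressureFT (hz : Measurable (Function.uncurry z)) :
    Measurable (Function.uncurry (pressureFT z)) := by
  have h1 := measurable_bconv (isSymbol_nl (d := d)) hz hz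
  have h2 : Measurable fun p : ℝ × Space d => dotc p.2 (bconv nl (z p.1) (z p.1) p.2).1 :=
    continuous_dotc.measurable.comp (measurable_snd.prodMk h1.fst)
  have h3 : Measurable fun p : ℝ × Space d => ((‖p.2‖ ^ 2 : ℝ) : ℂ) :=
    Continuous.measurable (by fun_prop)
  exact h2.div h3

lemma enorm_pressureFT_le (t : ℝ) (ξ : Space d) :
    ‖pressureFT z t ξ‖ₑ ≤ 2 * cv (fun ξ => ‖z t ξ‖ₑ) (fun ξ => ‖z t ξ‖ₑ) ξ := by
  rcases eq_or_ne ξ 0 with rfl | hξ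
  · simp [pressureFT]
  have h0 : 0 < ‖ξ‖ := norm_pos_iff.2 hξ
  set N := bconv nl (z t) (z t) ξ
  have h1 : ‖pressureFT z t ξ‖ ≤ ‖N‖ * ‖ξ‖⁻¹ := by
    rw [pressureFT, norm_div, Complex.norm_real, Real.norm_of_nonneg (by positivity),
      div_le_iff₀ (by positivity)]
    calc _ ≤ ‖ξ‖ * ‖N.1‖ := norm_dotc_le _ _
      _ ≤ ‖ξ‖ * ‖N‖ := mul_le_mul_of_nonneg_left (norm_fst_le N) h0.le
      _ = _ := by field_simp
  calc ‖pressureFT z t ξ‖ₑ ≤ ‖N‖ₑ * ‖ξ‖ₑ⁻¹ := by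
        rw [← ofReal_norm, ← ofReal_norm, ← ofReal_norm, ← ENNReal.ofReal_inv_of_pos h0,
          ← ENNReal.ofReal_mul (norm_nonneg _)]
        exact ENNReal.ofReal_le_ofReal h1
    _ ≤ ((2 : ℝ≥0) * ‖ξ‖ₑ * cv (fun ξ => ‖z t ξ‖ₑ) (fun ξ => ‖z t ξ‖ₑ) ξ) * ‖ξ‖ₑ⁻¹ :=
        mul_le_mul_left (enorm_bconv_le isSymbol_nl _ _ _) _
    _ = 2 * cv (fun ξ => ‖z t ξ‖ₑ) (fun ξ => ‖z t ξ‖ₑ) ξ * (‖ξ‖ₑ * ‖ξ‖ₑ⁻¹) := by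
        push_cast; ring
    _ = _ := by rw [ENNReal.mul_inv_cancel (by simpa using hξ) (by simp), mul_one]

lemma IsRep.integrable_pressureFT (hz : IsRep T u b z) :
    Integrable (Function.uncurry (pressureFT z))
      ((volume.restrict (timeInterval T)).prod volume) :=
  hz.integrable_tf_mul_of_le (K := 2) (measurable_pressureFT hz.meas) enorm_pressureFT_le

/-- The pressure, up to the sign, as a function of time and space. -/
def pressure (T : ℝ≥0∞) (z : ℝ → Space d → Pair d) (p : ℝ × Space d) : ℝ :=
  (timeInterval T).indicator (fun t => (𝓕⁻ (pressureFT z t) p.2).re) p.1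

lemma measurable_fourierInv_right {F : ℝ → Space d → ℂ} (hF : Measurable (Function.uncurry F)) :
    Measurable fun p : ℝ × Space d => 𝓕⁻ (F p.1) p.2 := by
  have hc : Continuous fun q : (ℝ × Space d) × Space d =>
      Complex.exp (↑(2 * Real.pi * inner ℝ q.2 q.1.2) * Complex.I) := by fun_prop
  have hg : Measurable fun q : (ℝ × Space d) × Space d => (q.1.1, q.2) :=
    measurable_fst.fst.prodMk measurable_snd
  have h3 := ((hc.measurable.smul (hF.comp hg)).stronglyMeasurable.integral_prod_right'
    (ν := volume)).measurable
  simp only [Real.fourierInv_eq']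
  exact h3

lemma measurable_pressure (hz : Measurable (Function.uncurry z)) : Measurable (pressure T z) := by
  have h1 := measurable_fourierInv_right (measurable_pressureFT hz)
  have h4 : pressure T z = (Prod.fst ⁻¹' (timeInterval T)).indicator
      fun p => (𝓕⁻ (pressureFT z p.1) p.2).re := by
    ext p
    by_cases h : p.1 ∈ timeInterval T <;> simp [pressure, h]
  rw [h4]
  exact (Complex.measurable_re.comp h1).indicator (measurable_fst (measurableSet_timeInterval T))

lemma IsRep.locallyIntegrable_pressure (hz : IsRep T u b z) :
    LocallyIntegrable (pressure T z) := by
  intro p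
  refine ⟨univ ×ˢ Metric.ball p.2 1, prod_mem_nhds univ_mem (Metric.ball_mem_nhds _ one_pos), ?_⟩
  rw [IntegrableOn, Measure.volume_eq_prod, ← Measure.prod_restrict, Measure.restrict_univ]
  refine integrable_prod_of_lintegral (F := fun t x => pressure T z (t, x))
    (measurable_pressure hz.meas).aestronglyMeasurable ?_
  have h1 : ∀ t x, ‖pressure T z (t, x)‖ₑ
      ≤ (timeInterval T).indicator (fun t => ∫⁻ ξ, ‖pressureFT z t ξ‖ₑ) t := fun t x => by
    by_cases ht : t ∈ timeInterval T
    · simp only [pressure, indicator_of_mem ht]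
      refine le_trans ?_ (enorm_integral_le_lintegral_enorm _ |>.trans (le_of_eq
        (b := ∫⁻ ξ, ‖pressureFT z t ξ‖ₑ) (a := ∫⁻ ξ, ‖Complex.exp
          (↑(2 * Real.pi * inner ℝ ξ x) * Complex.I) • pressureFT z t ξ‖ₑ) ?_))
      · rw [← Real.fourierInv_eq', ← ofReal_norm, ← ofReal_norm]
        exact ENNReal.ofReal_le_ofReal (Complex.abs_re_le_norm _)
      · refine lintegral_congr fun ξ => ?_
        rw [enorm_smul, ← ofReal_norm (Complex.exp _), Complex.norm_exp_ofReal_mul_I]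
        simp
    · simp [pressure, indicator_of_notMem ht]
  refine lt_of_le_of_lt (lintegral_mono fun t => lintegral_mono fun x => h1 t x) ?_
  simp only [lintegral_const, Measure.restrict_apply_univ]
  rw [lintegral_mul_const' _ _ measure_ball_lt_top.ne, lintegral_indicator
    (measurableSet_timeInterval T)]
  refine ENNReal.mul_lt_top ?_ measure_ball_lt_top
  have := hz.integrable_pressureFT.2
  rwa [HasFiniteIntegral, lintegral_prod _ hz.integrable_pressureFT.1.enorm] at this

/-- The distribution given by the pressure. -/
def pressureDist (T : ℝ≥0∞) (z : ℝ → Space d → Pair d) : 𝓓'(slab d T, ℝ) where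
  toFun := TestFunction.integralAgainstBilinCLM (ContinuousLinearMap.mul ℝ ℝ) volume (pressure T z)
  map_add' := map_add _
  map_smul' := map_smul _
  cont := (TestFunction.integralAgainstBilinCLM (ContinuousLinearMap.mul ℝ ℝ) volume
    (pressure T z)).cont

/-- Parseval's formula for the pressure. -/
lemma IsRep.pressureDist_apply (hz : IsRep T u b z) (χ : 𝓓(slab d T, ℝ)) :
    pressureDist T z χ = (∫ t in timeInterval T, ∫ ξ, tf χ t ξ * pressureFT z t ξ).re := by
  have hl : LocallyIntegrableOn (pressure T z) (slab d T) volume :=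
    hz.locallyIntegrable_pressure.locallyIntegrableOn _
  have h1 : pressureDist T z χ = ∫ p, χ p * pressure T z p :=
    TestFunction.integralAgainstBilinCLM_eq_integral hl
  have h2 : Integrable (fun p => χ p * pressure T z p) (volume : Measure (ℝ × Space d)) :=
    χ.integrable_bilin (ContinuousLinearMap.mul ℝ ℝ) hl
  obtain ⟨C, hC⟩ := exists_bound_tf χ
  have h3 : Integrable (Function.uncurry fun t ξ => tf χ t ξ * pressureFT z t ξ)
      ((volume.restrict (timeInterval T)).prod volume) :=
    hz.integrable_pressureFT.bdd_mul (c := C) (continuous_tf χ).aestronglyMeasurable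
      (Eventually.of_forall fun p => hC p.1 p.2)
  rw [h1, Measure.volume_eq_prod, integral_prod _ (by rwa [Measure.volume_eq_prod] at h2)]
  have h4 := Complex.reCLM.integral_comp_comm h3.integral_prod_left
  refine Eq.trans ?_ h4
  rw [← setIntegral_eq_integral_of_forall_compl_eq_zero (s := timeInterval T)]
  · refine integral_congr_ae ?_
    filter_upwards [hz.integrable_pressureFT.prod_right_ae,
      ae_restrict_mem (measurableSet_timeInterval T)] with t ht htm
    have ht' : Integrable (pressureFT z t) := ht
    -- at almost every time the Fourier transform of the pressure is integrable
    have h5 := integral_fourierInv_smul (slice χ t).integrable ht'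
    have h6 : Integrable fun x => slice χ t x • 𝓕⁻ (pressureFT z t) x :=
      (slice χ t).integrable.smul_of_top_left (memLp_top_of_bound
        (continuous_fourierInv ht').aestronglyMeasurable _
        (Eventually.of_forall (norm_fourierInv_le _)))
    have h7 : ∫ ξ, tf χ t ξ * pressureFT z t ξ = ∫ x, slice χ t x • 𝓕⁻ (pressureFT z t) x := by
      rw [← h5]
      simp only [tf, SchwartzMap.fourierInv_coe, smul_eq_mul]
    simp only [Function.uncurry]
    rw [h7]
    refine Eq.trans ?_ (Complex.reCLM.integral_comp_comm h6)
    refine integral_congr_ae (Eventually.of_forall fun x => ?_)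
    simp [pressure, indicator_of_mem htm]
  · intro t ht
    simp [pressure, indicator_of_notMem ht]

/-- The part of the nonlinearity which is removed by the projection is the gradient of the pressure.
-/
lemma IsMild.weakForm_fst (hm : IsMild (timeInterval T) z₀ z) (hz : IsRep T u b z)
    (hU : ∀ t ∈ timeInterval T, IsGivenBy (u t) (U t) ∧ IsGivenBy (b t) (B t)) (i : Fin d)
    (ψ : 𝓓(slab d T, ℝ)) : weakForm U U B B i ψ
      - (∂_{((0, e i) : ℝ × Space d)} (pressureDist T z) : 𝓓'(slab d T, ℝ)) ψ = 0 := by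
  have i1 := hz.integrable_tf_mul (coFst i) (dt ψ + lap ψ)
  have i2 := hz.integrable_tf_mul_bconv (coFst i) isSymbol_nl ψ
  have i3 := hz.integrable_tf_mul_bconv (coFst i) isSymbol_mhdSym ψ
  have h1 := hm.integral_test_swap hz (coFst i) ψ
  simp only [tf_dt_add_lap] at i1
  have h2 := hz.weakForm_fst hU i ψ
  simp only [← coFst_apply] at h2
  rw [integral_add, integral_neg, integral_const_mul, h1, neg_neg, ← integral_const_mul,
    ← integral_add] at h2
  -- projected minus full nonlinearity: a multiple of `ξ`, hence a gradient
  · have h3 : ∫ t in timeInterval T,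
          ((∫ ξ, tf ψ t ξ * coFst i (bconv mhdSym (z t) (z t) ξ))
            + 2 * Real.pi * Complex.I * ∫ ξ, tf ψ t ξ * coFst i (bconv nl (z t) (z t) ξ))
        = -∫ t in timeInterval T, ∫ ξ, tf (dx i ψ) t ξ * pressureFT z t ξ := by
      rw [← integral_neg]
      refine integral_congr_ae ?_
      filter_upwards [hz.ae_bconv, i2.prod_right_ae, i3.prod_right_ae] with t ht j2 j3
      simp only [Function.uncurry] at j2 j3
      rw [← integral_const_mul, ← integral_neg, ← integral_add j3 (j2.const_mul _)]
      refine integral_congr_ae ?_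
      filter_upwards [ht] with ξ hξ
      simp only [hξ, coFst_apply, Prod.smul_fst, PiLp.smul_apply, smul_eq_mul,
        leray, PiLp.sub_apply, cvec_apply, tf_dx, pressureFT]
      ring
    rw [h3] at h2
    have h4 : (∂_{((0, e i) : ℝ × Space d)} (pressureDist T z) : 𝓓'(slab d T, ℝ)) ψ
        = -pressureDist T z (dx i ψ) := by
      rw [Distribution.lineDerivOp_apply_apply, map_neg]
      rfl
    have h5 := congrArg Complex.re h2
    rw [Complex.ofReal_re, Complex.neg_re, ← hz.pressureDist_apply] at h5
    rw [h4, h5]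
    ring
  · exact i3.integral_prod_left
  · exact i2.integral_prod_left.const_mul _
  · exact i1.integral_prod_left.neg
  · exact i2.integral_prod_left.const_mul _

end

section

variable {d : ℕ} {T : ℝ≥0∞} {φ : Space d → ℂ}

/-! ### Regularity in time of fields with a given Fourier transform -/

section regularity

variable {w : ℝ → TField d} {h : ℝ → Space d → Vec d} {G : Space d → ℝ≥0∞} {s : ℝ}

/-- Dominated convergence in Besov norms on the Fourier side. -/
lemma tendsto_bs_zero {ι : Type*} {l : Filter ι} [l.IsCountablyGenerated]
    {F : ι → Space d → ℝ≥0∞} {H : Space d → ℝ≥0∞} (hF : ∀ i, Measurable (F i))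
    (hle : ∀ᶠ i in l, ∀ᵐ ξ, F i ξ ≤ H ξ) (hfin : bs s H ≠ ⊤)
    (hlim : ∀ᵐ ξ, Tendsto (fun i => F i ξ) l (𝓝 0)) : Tendsto (fun i => bs s (F i)) l (𝓝 0) := by
  have hne : ∀ j : ℤ, (2 : ℝ≥0∞) ^ ((j : ℝ) * s) ≠ ⊤ := fun j => two_rpow_ne_top _
  have hpos : ∀ j : ℤ, (2 : ℝ≥0∞) ^ ((j : ℝ) * s) ≠ 0 := fun j => by
    simp [ENNReal.rpow_eq_zero_iff]
  have hle' : ∀ᶠ i in l, ∀ j, n2 volume ((shell d j).indicator (F i))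
      ≤ n2 volume ((shell d j).indicator H) := by
    filter_upwards [hle] with i hi j
    refine n2_mono_ae (hi.mono fun ξ hξ => ?_)
    exact indicator_le_indicator hξ
  have hj : ∀ j, n2 volume ((shell d j).indicator H) ≠ ⊤ := fun j h0 => by
    refine hfin (top_le_iff.1 (le_trans (le_of_eq ?_) (ENNReal.le_tsum j)))
    rw [h0, ENNReal.mul_top (hpos j)]
  -- dominated convergence in each shell, and then in the sum over the shells
  have hlj : ∀ j, Tendsto (fun i => n2 volume ((shell d j).indicator (F i))) l (𝓝 0) := fun j => by
    have h1 : Tendsto (fun i => ∫⁻ ξ, (shell d j).indicator (F i) ξ ^ 2) l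
        (𝓝 (∫⁻ _ : Space d, 0)) := by
      refine tendsto_lintegral_filter_of_dominated_convergence
        (fun ξ => (shell d j).indicator H ξ ^ 2) ?_ ?_ ?_ ?_
      · exact Eventually.of_forall fun i =>
          ((hF i).indicator (measurableSet_shell j)).pow_const 2
      · filter_upwards [hle] with i hi
        filter_upwards [hi] with ξ hξ
        exact pow_le_pow_left₀ zero_le (indicator_le_indicator hξ) 2
      · rw [← n2_sq]
        exact ENNReal.pow_ne_top (hj j)
      · filter_upwards [hlim] with ξ hξ
        by_cases hm : ξ ∈ shell d j
        · simp only [indicator_of_mem hm]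
          have := ((ENNReal.continuous_pow 2).tendsto 0).comp hξ
          simpa [Function.comp_def] using this
        · simpa [indicator_of_notMem hm] using tendsto_const_nhds
    have h2 := h1.ennrpow_const (1 / 2 : ℝ)
    simpa [n2] using h2
  have e1 : ∀ F : Space d → ℝ≥0∞, bs s F = ∫⁻ j : ℤ, (2 : ℝ≥0∞) ^ ((j : ℝ) * s) *
      n2 volume ((shell d j).indicator F) ∂Measure.count := fun F => by
    rw [lintegral_count]; rfl
  simp only [e1] at hfin ⊢
  rw [show (0 : ℝ≥0∞) = ∫⁻ _ : ℤ, 0 ∂Measure.count by simp]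
  refine tendsto_lintegral_filter_of_dominated_convergence _
    (Eventually.of_forall fun i => Measurable.of_discrete) ?_ hfin ?_
  · filter_upwards [hle'] with i hi
    exact Eventually.of_forall fun j => mul_le_mul_right (hi j) _
  · refine Eventually.of_forall fun j => ?_
    have := ENNReal.Tendsto.const_mul (hlj j) (Or.inr (hne j))
    simpa using this

/-- Pointwise continuity in time of the Fourier transform and a bound which is uniform in time imply
continuity with values in the Besov space. -/
lemma memCb_of_isFT [NeZero d] (hφ : IsLittlewoodPaley φ) (hm : Measurable (Function.uncurry h))
    (hw : ∀ t ∈ timeInterval T, IsFT (w t) (h t))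
    (hc : ∀ᵐ ξ, ContinuousOn (fun t => h t ξ) (timeInterval T)) (hGm : Measurable G)
    (hG : ∀ᵐ ξ, ∀ t ∈ timeInterval T, ‖h t ξ‖ₑ ≤ G ξ) (hGs : bs s G < ⊤) : MemCb φ T s w := by
  obtain ⟨C, hC, hle⟩ := tsum_block_le_bs hφ s
  have hm' : ∀ t, Measurable (h t) := fun t => hm.comp measurable_prodMk_left
  have hG' : ∀ t ∈ timeInterval T, bs s (fun ξ => ‖h t ξ‖ₑ) ≤ bs s G := fun t ht =>
    bs_mono_ae (hG.mono fun ξ hξ => hξ t ht) s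
  refine ⟨fun t ht => (memBesov_iff hφ (hw t ht) s).2 ((hG' t ht).trans_lt hGs), ?_, ?_⟩
  · have hne : C * bs s G ≠ ⊤ := ENNReal.mul_ne_top hC hGs.ne
    refine ⟨(C * bs s G).toNNReal, fun t ht => ?_⟩
    rw [ENNReal.coe_toNNReal hne, (hw t ht).besovNorm_eq hφ]
    exact (hle _ (hm' t).aestronglyMeasurable).trans (mul_le_mul_right (hG' t ht) _)
  · intro t₀ ht₀
    have h1 : Tendsto (fun t => bs s (fun ξ => ‖h t ξ - h t₀ ξ‖ₑ)) (𝓝[timeInterval T] t₀) (𝓝 0) :=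
        by
      refine tendsto_bs_zero (H := fun ξ => G ξ + G ξ) (fun t => ((hm' t).sub (hm' t₀)).enorm)
        ?_ ?_ ?_
      · filter_upwards [self_mem_nhdsWithin] with t ht
        filter_upwards [hG] with ξ hξ
        exact (enorm_sub_le).trans (add_le_add (hξ t ht) (hξ t₀ ht₀))
      · exact ((bs_add_le hGm hGm s).trans_lt (ENNReal.add_lt_top.2 ⟨hGs, hGs⟩)).ne
      · filter_upwards [hc] with ξ hξ
        have h3 : Tendsto (fun t => h t ξ) (𝓝[timeInterval T] t₀) (𝓝 (h t₀ ξ)) := hξ t₀ ht₀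
        have h2 := (h3.sub_const (h t₀ ξ)).enorm
        simpa using h2
    have h2 := ENNReal.Tendsto.const_mul h1 (Or.inr hC)
    rw [mul_zero] at h2
    refine tendsto_of_tendsto_of_tendsto_of_le_of_le' tendsto_const_nhds h2
      (Eventually.of_forall fun _ => zero_le) ?_
    filter_upwards [self_mem_nhdsWithin] with t ht
    rw [((hw t ht).sub (hw t₀ ht₀)).besovNorm_eq hφ]
    exact hle _ ((hm' t).sub (hm' t₀)).aestronglyMeasurable

lemma block_sub (f f' : TField d) (j : ℤ) : block φ j (f - f') = block φ j f - block φ j f' :=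
  map_sub _ _ _

/-- Integrability in time with values in a Besov space, read on the Fourier side. -/
lemma memL1_of_isFT [NeZero d] (hφ : IsLittlewoodPaley φ) (hm : Measurable (Function.uncurry h))
    (hw : ∀ t ∈ timeInterval T, IsFT (w t) (h t))
    (hfin : ∫⁻ t in timeInterval T, bs s (fun ξ => ‖h t ξ‖ₑ) < ⊤) : MemL1 φ T s w := by
  obtain ⟨C, hC, hle⟩ := tsum_block_le_bs hφ s
  have hm' : ∀ t, Measurable (h t) := fun t => hm.comp measurable_prodMk_left
  refine ⟨?_, fun v hv => ?_, ?_⟩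
  · filter_upwards [ae_lt_top (measurable_bs_time hm s) hfin.ne,
      ae_restrict_mem (measurableSet_timeInterval T)] with t ht htm
    exact (memBesov_iff hφ (hw t htm) s).2 ht
  · -- the fixed field need not have a Fourier transform which is a function, but its blocks do
    have hv' : ∀ j, ∃ g, IsFT (block φ j v) g ∧ Measurable g := fun j => by
      have h1 : l2Norm (block φ j v) < ⊤ := by
        by_contra h0
        rw [not_lt, top_le_iff] at h0
        refine hv.2.ne (top_le_iff.1 (le_trans (le_of_eq ?_) (ENNReal.le_tsum j)))
        rw [h0, ENNReal.mul_top (by simp [ENNReal.rpow_eq_zero_iff])]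
      obtain ⟨g, hg, -⟩ := exists_isFT_of_l2Norm h1
      refine ⟨hg.tame.meas.mk g, hg.congr hg.tame.meas.ae_eq_mk, ?_⟩
      exact hg.tame.meas.stronglyMeasurable_mk.measurable
    choose g hg hgm using hv'
    have hmeas : Measurable fun t => ∑' j : ℤ, (2 : ℝ≥0∞) ^ ((j : ℝ) * s) *
        n2 volume (fun ξ => ‖dil φ j ξ • h t ξ - g j ξ‖ₑ) := by
      refine Measurable.tsum fun j => (measurable_n2_right
        (f := fun t ξ => ‖dil φ j ξ • h t ξ - g j ξ‖ₑ) ?_).const_mul _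
      have h1 : Measurable (dil φ j) := (hφ.contDiff_dil j).continuous.measurable
      exact (((h1.comp measurable_snd).smul hm).sub ((hgm j).comp measurable_snd)).enorm
    refine ⟨_, hmeas, ?_⟩
    filter_upwards [ae_restrict_mem (measurableSet_timeInterval T)] with t ht
    refine tsum_congr fun j => ?_
    rw [block_sub, (((hw t ht).block hφ j).sub (hg j)).l2Norm_eq]
    rfl
  · refine lt_of_le_of_lt ?_ (ENNReal.mul_lt_top hC.lt_top hfin)
    rw [← lintegral_const_mul' _ _ hC]
    refine lintegral_mono_ae ?_
    filter_upwards [ae_restrict_mem (measurableSet_timeInterval T)] with t ht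
    rw [(hw t ht).besovNorm_eq hφ]
    exact hle _ (hm' t).aestronglyMeasurable

end regularity

/-! ### Symmetries of mild solutions -/

variable {z : ℝ → Space d → Pair d} {z₀ : Space d → Pair d}

lemma clm_integral_eq_zero {α E F : Type*} [MeasurableSpace α] {μ : Measure α}
    [NormedAddCommGroup E] [NormedSpace ℝ E] [CompleteSpace E] [NormedAddCommGroup F]
    [NormedSpace ℝ F] [CompleteSpace F] (c : E →L[ℝ] F) {f : α → E} (h : ∀ᵐ x ∂μ, c (f x) = 0) :
    c (∫ x, f x ∂μ) = 0 := by
  by_cases hi : Integrable f μ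
  · rw [← c.integral_comp_comm hi, integral_congr_ae h, integral_zero]
  · rw [integral_undef hi, map_zero]

/-- The product with a frequency, as a continuous linear form on the second factor. -/
def dotcL (ξ : Space d) : Vec d →L[ℂ] ℂ := innerSL ℂ (cvec ξ)

lemma dotcL_apply (ξ : Space d) (v : Vec d) : dotcL ξ v = dotc ξ v := by
  simp [dotcL, dotc_eq_inner]

lemma dotc_bconv {ξ : Space d} (hξ : ξ ≠ 0) (f g : Space d → Pair d) :
    dotc ξ (bconv mhdSym f g ξ).1 = 0 ∧ dotc ξ (bconv mhdSym f g ξ).2 = 0 := by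
  constructor
  · have := clm_integral_eq_zero (μ := volume) (f := fun η => mhdSym ξ (f (ξ - η)) (g η))
      (((dotcL ξ).comp (ContinuousLinearMap.fst ℂ (Vec d) (Vec d))).restrictScalars ℝ)
      (Eventually.of_forall fun η => (dotcL_apply _ _).trans (dotc_mhdSym hξ _ _).1)
    exact (dotcL_apply _ _).symm.trans this
  · have := clm_integral_eq_zero (μ := volume) (f := fun η => mhdSym ξ (f (ξ - η)) (g η))
      (((dotcL ξ).comp (ContinuousLinearMap.snd ℂ (Vec d) (Vec d))).restrictScalars ℝ)
      (Eventually.of_forall fun η => (dotcL_apply _ _).trans (dotc_mhdSym hξ _ _).2)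
    exact (dotcL_apply _ _).symm.trans this

/-- A pair of vectors orthogonal to the frequency. -/
def Transversal (ξ : Space d) (v : Pair d) : Prop := dotc ξ v.1 = 0 ∧ dotc ξ v.2 = 0

lemma Transversal.add {ξ : Space d} {v w : Pair d} (hv : Transversal ξ v) (hw : Transversal ξ w) :
    Transversal ξ (v + w) := by
  simp only [Transversal, Prod.fst_add, Prod.snd_add, dotc_add, hv.1, hv.2, hw.1, hw.2, add_zero,
    and_self]

lemma Transversal.smul {ξ : Space d} {v : Pair d} (hv : Transversal ξ v) (c : ℝ) :
    Transversal ξ (c • v) := by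
  constructor
  · rw [Prod.smul_fst, ← Complex.coe_smul, dotc_smul, hv.1, mul_zero]
  · rw [Prod.smul_snd, ← Complex.coe_smul, dotc_smul, hv.2, mul_zero]

lemma transversal_integral {α : Type*} [MeasurableSpace α] {μ : Measure α} {ξ : Space d}
    {f : α → Pair d} (h : ∀ᵐ x ∂μ, Transversal ξ (f x)) : Transversal ξ (∫ x, f x ∂μ) := by
  constructor
  · have := clm_integral_eq_zero (((dotcL ξ).comp (ContinuousLinearMap.fst ℂ (Vec d)
      (Vec d))).restrictScalars ℝ) (h.mono fun x hx => (dotcL_apply _ _).trans hx.1)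
    exact (dotcL_apply _ _).symm.trans this
  · have := clm_integral_eq_zero (((dotcL ξ).comp (ContinuousLinearMap.snd ℂ (Vec d)
      (Vec d))).restrictScalars ℝ) (h.mono fun x hx => (dotcL_apply _ _).trans hx.2)
    exact (dotcL_apply _ _).symm.trans this

lemma IsMild.transversal [NeZero d] {A : Set ℝ} (hz : IsMild A z₀ z)
    (h₀ : ∀ᵐ ξ, Transversal ξ (z₀ ξ)) : ∀ᵐ ξ, ∀ t ∈ A, Transversal ξ (z t ξ) := by
  have hne : ∀ᵐ ξ : Space d, ξ ≠ 0 := by simp [ae_iff, measure_singleton]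
  filter_upwards [hz.eq, h₀, hne] with ξ h1 h2 h3 t ht
  rw [h1 t ht]
  refine (h2.smul _).add (transversal_integral (Eventually.of_forall fun s => ?_))
  exact Transversal.smul (dotc_bconv h3 _ _) _

/-- Complex conjugation of the components. -/
def conjV : Vec d ≃L[ℝ] Vec d :=
  (PiLp.continuousLinearEquiv 2 ℝ fun _ : Fin d => ℂ).trans
    ((ContinuousLinearEquiv.piCongrRight fun _ => Complex.conjCLE).trans
      (PiLp.continuousLinearEquiv 2 ℝ fun _ : Fin d => ℂ).symm)

@[simp] lemma conjV_apply (v : Vec d) (i : Fin d) : conjV v i = conj (v i) := rfl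

/-- Complex conjugation of pairs. -/
def conjP : Pair d ≃L[ℝ] Pair d := conjV.prodCongr conjV

@[simp] lemma conjP_fst (v : Pair d) : (conjP v).1 = conjV v.1 := rfl

@[simp] lemma conjP_snd (v : Pair d) : (conjP v).2 = conjV v.2 := rfl

lemma dotc_conjV (ξ : Space d) (v : Vec d) : dotc (-ξ) (conjV v) = -conj (dotc ξ v) := by
  simp [dotc]

lemma conjV_smul (c : ℂ) (v : Vec d) : conjV (c • v) = conj c • conjV v := by
  ext i; simp

lemma conjV_cvec (ξ : Space d) : conjV (cvec ξ) = cvec ξ := by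
  ext i; simp

lemma cvec_neg (ξ : Space d) : cvec (-ξ) = -cvec ξ := by
  ext i; simp

lemma leray_conjV (ξ : Space d) (v : Vec d) : leray (-ξ) (conjV v) = conjV (leray ξ v) := by
  simp only [leray, map_sub, conjV_smul, conjV_cvec, cvec_neg, dotc_conjV, norm_neg, map_div₀,
    Complex.conj_ofReal, neg_div, neg_smul, smul_neg, neg_neg]

lemma nl_conjP (ξ : Space d) (v w : Pair d) : nl (-ξ) (conjP v) (conjP w) = -conjP (nl ξ v w) := by
  ext1 <;>
  simp only [nl, conjP_fst, conjP_snd, dotc_conjV, neg_smul, map_sub, conjV_smul, Prod.fst_neg,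
    Prod.snd_neg] <;> abel

lemma leray_neg (ξ : Space d) (v : Vec d) : leray ξ (-v) = -leray ξ v := by
  have h0 : leray ξ 0 = 0 := by simp [leray, dotc]
  have := leray_sub ξ 0 v
  rwa [zero_sub, h0, zero_sub] at this

lemma mhdSym_conjP (ξ : Space d) (v w : Pair d) :
    mhdSym (-ξ) (conjP v) (conjP w) = conjP (mhdSym ξ v w) := by
  have hc : conj (-(2 * Real.pi * Complex.I)) = -(-(2 * Real.pi * Complex.I)) := by
    have h2 : conj (2 : ℂ) = 2 := Complex.conj_ofReal 2
    simp [h2]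
  rw [mhdSym, nl_conjP, Prod.fst_neg, Prod.snd_neg, conjP_fst, conjP_snd, leray_neg, leray_conjV,
    mhdSym]
  generalize -(2 * Real.pi * Complex.I) = c at hc
  refine Prod.ext ?_ ?_
  · change c • (-conjV _) = conjV (c • _)
    rw [conjV_smul, hc, smul_neg, neg_smul]
  · change c • (-conjV _) = conjV (c • _)
    rw [conjV_smul, hc, smul_neg, neg_smul]

/-- Hermitian symmetry: the Fourier transform of a pair of real fields. -/
def HermP (g : Space d → Pair d) : Prop := ∀ᵐ ξ, g (-ξ) = conjP (g ξ)

lemma bconv_conjP {f : Space d → Pair d} (hf : HermP f) (ξ : Space d) :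
    bconv mhdSym f f (-ξ) = conjP (bconv mhdSym f f ξ) := by
  rw [bconv, bconv, ← ContinuousLinearEquiv.integral_comp_comm, ← integral_neg_eq_self]
  refine integral_congr_ae ?_
  have h1 : ∀ᵐ η, f (-(ξ - η)) = conjP (f (ξ - η)) :=
    (quasiMeasurePreserving_sub_left volume ξ).ae hf
  filter_upwards [hf, h1] with η h2 h3
  rw [h2, ← mhdSym_conjP, ← h3]
  congr 2
  abel

lemma hermP_picard (h₀ : HermP z₀) (n : ℕ) :
    ∀ᵐ ξ, ∀ t, picard nu mhdSym z₀ n t (-ξ) = conjP (picard nu mhdSym z₀ n t ξ) := by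
  have hheat : ∀ᵐ ξ, ∀ t, heat nu z₀ t (-ξ) = conjP (heat nu z₀ t ξ) := by
    filter_upwards [h₀] with ξ hξ t
    rw [heat, heat, norm_neg, hξ, map_smul]
  induction n with
  | zero => exact hheat
  | succ n ih =>
    have h1 : ∀ t, HermP (picard nu mhdSym z₀ n t) := fun t => ih.mono fun ξ hξ => hξ t
    filter_upwards [hheat] with ξ hξ t
    simp only [picard, map_add, hξ t, duh, norm_neg]
    rw [← ContinuousLinearEquiv.integral_comp_comm]
    simp only [bconv_conjP (h1 _), map_smul]

lemma ae_neg {p : Space d → Prop} (h : ∀ᵐ ξ, p ξ) : ∀ᵐ ξ, p (-ξ) :=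
  (Measure.measurePreserving_neg volume).quasiMeasurePreserving.ae h

end

section

variable {d : ℕ} {T : ℝ≥0∞} {φ : Space d → ℂ}

/-! ### Existence -/

lemma Ioc_subset_timeInterval {t : ℝ} (ht : t ∈ timeInterval T) : Ioc 0 t ⊆ timeInterval T :=
  fun _ hs => ⟨hs.1.le, (ENNReal.ofReal_le_ofReal hs.2).trans ht.2⟩

lemma zero_mem_timeInterval (T : ℝ≥0∞) : (0 : ℝ) ∈ timeInterval T := ⟨le_rfl, by simp⟩

lemma enorm_fst_le {v : Pair d} : ‖v.1‖ₑ ≤ ‖v‖ₑ := by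
  rw [← ofReal_norm, ← ofReal_norm]; exact ENNReal.ofReal_le_ofReal (norm_fst_le v)

lemma enorm_snd_le {v : Pair d} : ‖v.2‖ₑ ≤ ‖v‖ₑ := by
  rw [← ofReal_norm, ← ofReal_norm]; exact ENNReal.ofReal_le_ofReal (norm_snd_le v)

lemma exists_field {A : Set ℝ} {h : ℝ → Space d → Vec d} (hT : ∀ t ∈ A, Tame (h t)) :
    ∃ w : ℝ → TField d, ∀ t ∈ A, IsFT (w t) (h t) := by
  have : ∀ t, ∃ f, t ∈ A → IsFT f (h t) := fun t => by
    by_cases ht : t ∈ A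
    · obtain ⟨f, hf⟩ := (hT t ht).exists_isFT
      exact ⟨f, fun _ => hf⟩
    · exact ⟨0, fun h => absurd h ht⟩
  choose w hw using this
  exact ⟨w, hw⟩

/-- Small data on the Fourier side give a solution of the system, which has all the regularity of
the data. It is the inverse Fourier transform of the mild solution. -/
theorem exists_solution [NeZero d] (hφ : IsLittlewoodPaley φ) (hd : 0 ≤ (d : ℝ) / 2 - 1)
    {z₀ : Space d → Pair d} {u₀ b₀ : TField d} (hz₀ : Measurable z₀)
    (hu₀ : IsFT u₀ fun ξ => (z₀ ξ).1) (hb₀ : IsFT b₀ fun ξ => (z₀ ξ).2)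
    (hherm : HermP z₀) (htr : ∀ᵐ ξ, Transversal ξ (z₀ ξ))
    (hcrit : bs ((d : ℝ) / 2 - 1) (fun ξ => ‖z₀ ξ‖ₑ) < ⊤)
    (hfin : ∫⁻ ξ, timeNorm (timeInterval T) (heat nu z₀) ξ ≠ ⊤)
    (hsmall : 4 * kap nu symK * ∫⁻ ξ, timeNorm (timeInterval T) (heat nu z₀) ξ ≤ 2⁻¹) :
    ∃ (u b : ℝ → TField d) (z : ℝ → Space d → Pair d), IsSolution T u₀ b₀ u b ∧ IsRep T u b z ∧
      IsMild (timeInterval T) z₀ z ∧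
      4 * kap nu symK * ∫⁻ ξ, timeNorm (timeInterval T) z ξ ≤ 1 ∧
      ∀ s, 0 ≤ s → bs s (fun ξ => ‖z₀ ξ‖ₑ) < ⊤ →
        (MemCb φ T s u ∧ MemL1 φ T (s + 2) u) ∧ (MemCb φ T s b ∧ MemL1 φ T (s + 2) b) := by
  obtain ⟨z, hzm, hz2, hlim, hmild, hcont, G, hGm, hG, hreg⟩ :=
    exists_regular_mild (A := timeInterval T) isSymbol_mhdSym nu_pos (measurableSet_timeInterval T)
      (fun t ht => Ioc_subset_timeInterval ht) (fun t ht => ht.1) hz₀ hfin hsmall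
  have hzfin : ∫⁻ ξ, timeNorm (timeInterval T) z ξ < ⊤ := hz2.trans_lt (by finiteness)
  have hM : IsMild (timeInterval T) z₀ z := ⟨hzm, hzfin, hmild⟩
  have hzt : ∀ t, Measurable (z t) := fun t => hzm.comp measurable_prodMk_left
  have hG1 : ∀ᵐ ξ, ∀ t ∈ timeInterval T, ‖(z t ξ).1‖ₑ ≤ G ξ :=
    hG.mono fun ξ h t ht => enorm_fst_le.trans (h t ht)
  have hG2 : ∀ᵐ ξ, ∀ t ∈ timeInterval T, ‖(z t ξ).2‖ₑ ≤ G ξ :=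
    hG.mono fun ξ h t ht => enorm_snd_le.trans (h t ht)
  have hGc := (hreg _ hd hcrit).1
  have hd2 : (d : ℝ) / 2 - 1 ≤ (d : ℝ) / 2 := by linarith
  obtain ⟨u, hu⟩ := exists_field (A := timeInterval T) (h := fun t ξ => (z t ξ).1) fun t ht =>
    tame_of_bs (hzt t).fst.aestronglyMeasurable hd hd2
      ((bs_mono_ae (hG1.mono fun ξ h => h t ht) _).trans_lt hGc)
  obtain ⟨b, hb⟩ := exists_field (A := timeInterval T) (h := fun t ξ => (z t ξ).2) fun t ht =>
    tame_of_bs (hzt t).snd.aestronglyMeasurable hd hd2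
      ((bs_mono_ae (hG2.mono fun ξ h => h t ht) _).trans_lt hGc)
  have hR : IsRep T u b z := ⟨hzm, hu, hb,
    (lintegral_sq_le_of_timeNorm hzm).trans_lt (ENNReal.pow_lt_top hzfin)⟩
  have h0 : ∀ᵐ ξ, z 0 ξ = z₀ ξ := by
    filter_upwards [hmild] with ξ h
    rw [h 0 (zero_mem_timeInterval T)]
    simp [heat, duh]
  have htrz := hM.transversal htr
  -- the iterates are Hermitian, hence so is their limit
  have hherm' : ∀ᵐ ξ, ∀ t ∈ timeInterval T, z t (-ξ) = conjP (z t ξ) := by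
    filter_upwards [hlim, ae_neg hlim, ae_all_iff.2 (hermP_picard hherm)] with ξ h1 h2 h3 t ht
    have h4 := (conjP.continuous.tendsto _).comp (h1 t ht)
    refine tendsto_nhds_unique (h2 t ht) (h4.congr fun n => (h3 n t).symm)
  have hU : ∀ t, ∃ U : Space d → Space d, t ∈ timeInterval T → IsGivenBy (u t) U := fun t => by
    by_cases ht : t ∈ timeInterval T
    · obtain ⟨U, h⟩ := (hu t ht).exists_isGivenBy (by
        filter_upwards [hherm'] with ξ h i
        rw [h t ht]
        rfl)
      exact ⟨U, fun _ => h⟩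
    · exact ⟨0, fun h => absurd h ht⟩
  have hB : ∀ t, ∃ U : Space d → Space d, t ∈ timeInterval T → IsGivenBy (b t) U := fun t => by
    by_cases ht : t ∈ timeInterval T
    · obtain ⟨U, h⟩ := (hb t ht).exists_isGivenBy (by
        filter_upwards [hherm'] with ξ h i
        rw [h t ht]
        rfl)
      exact ⟨U, fun _ => h⟩
    · exact ⟨0, fun h => absurd h ht⟩
  choose U hU using hU
  choose B hB using hB
  have hUB : ∀ t ∈ timeInterval T, IsGivenBy (u t) (U t) ∧ IsGivenBy (b t) (B t) := fun t ht =>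
    ⟨hU t ht, hB t ht⟩
  refine ⟨u, b, z, ⟨?_, ?_, ?_, ?_, U, B, hUB, ⟨pressureDist T z, fun i ψ => ?_⟩,
    fun i ψ => hM.weakForm_snd hR hUB i ψ⟩, hR, hM, ?_, fun s hs hsz => ⟨⟨?_, ?_⟩, ⟨?_, ?_⟩⟩⟩
  · exact (hu 0 (zero_mem_timeInterval T)).ext hu₀ (h0.mono fun ξ h => by simp only [h])
  · exact (hb 0 (zero_mem_timeInterval T)).ext hb₀ (h0.mono fun ξ h => by simp only [h])
  · exact fun t ht => (hu t ht).isDivFree_iff.2 (htrz.mono fun ξ h => (h t ht).1)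
  · exact fun t ht => (hb t ht).isDivFree_iff.2 (htrz.mono fun ξ h => (h t ht).2)
  · exact hM.weakForm_fst hR hUB i ψ
  · calc 4 * kap nu symK * ∫⁻ ξ, timeNorm (timeInterval T) z ξ
        ≤ 4 * kap nu symK * (2 * ∫⁻ ξ, timeNorm (timeInterval T) (heat nu z₀) ξ) :=
          mul_le_mul_right hz2 _
      _ = 2 * (4 * kap nu symK * ∫⁻ ξ, timeNorm (timeInterval T) (heat nu z₀) ξ) := by ring
      _ ≤ 2 * 2⁻¹ := mul_le_mul_right hsmall _
      _ = 1 := ENNReal.mul_inv_cancel (by simp) (by simp)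
  · exact memCb_of_isFT (h := fun t ξ => (z t ξ).1) hφ hzm.fst hu (hcont.mono fun ξ h => h.fst) hGm
      hG1 (hreg s hs hsz).1
  · refine memL1_of_isFT (h := fun t ξ => (z t ξ).1) hφ hzm.fst hu (lt_of_le_of_lt ?_ (hreg s hs
      hsz).2)
    exact lintegral_mono fun t => bs_mono_ae (Eventually.of_forall fun ξ => enorm_fst_le) _
  · exact memCb_of_isFT (h := fun t ξ => (z t ξ).2) hφ hzm.snd hb (hcont.mono fun ξ h => h.snd) hGm
      hG2 (hreg s hs hsz).1
  · refine memL1_of_isFT (h := fun t ξ => (z t ξ).2) hφ hzm.snd hb (lt_of_le_of_lt ?_ (hreg s hs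
      hsz).2)
    exact lintegral_mono fun t => bs_mono_ae (Eventually.of_forall fun ξ => enorm_snd_le) _

end

section

variable {d : ℕ} {T : ℝ≥0∞}

/-! ### Uniqueness of mild solutions -/

section mildUnique

variable {z Z : ℝ → Space d → Pair d} {z₀ : Space d → Pair d} {A : Set ℝ}

lemma timeNorm_mono {A' : Set ℝ} (h : A' ⊆ A) (f : ℝ → Space d → Pair d) (ξ : Space d) :
    timeNorm A' f ξ ≤ timeNorm A f ξ :=
  ENNReal.rpow_le_rpow (lintegral_mono_set h) (by norm_num)

/-- Norms over `(0, τ]` depend continuously on `τ`, by dominated convergence. -/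
lemma continuousOn_lintegral_timeNorm {b : ℝ} (hz : Measurable (Function.uncurry z))
    (hfin : ∫⁻ ξ, timeNorm (Ioc 0 b) z ξ ≠ ⊤) :
    ContinuousOn (fun τ => ∫⁻ ξ, timeNorm (Ioc 0 τ) z ξ) (Icc 0 b) := by
  have hfin' : ∀ᵐ ξ, timeNorm (Ioc 0 b) z ξ ≠ ⊤ :=
    (ae_lt_top (measurable_timeNorm _ hz) hfin).mono fun _ h => h.ne
  intro τ₀ hτ₀
  refine tendsto_lintegral_filter_of_dominated_convergence (timeNorm (Ioc 0 b) z)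
    (Eventually.of_forall fun τ => measurable_timeNorm _ hz) ?_ hfin ?_
  · filter_upwards [self_mem_nhdsWithin] with τ hτ
    exact Eventually.of_forall fun ξ => timeNorm_mono (Ioc_subset_Ioc_right hτ.2) z ξ
  · filter_upwards [hfin'] with ξ hξ
    have hm : Measurable fun t => ‖z t ξ‖ₑ ^ 2 :=
      (hz.comp measurable_prodMk_right).enorm.pow_const 2
    have h1 : ∫⁻ t in Ioc 0 b, ‖z t ξ‖ₑ ^ 2 ≠ ⊤ := by
      rw [← n2_sq]
      exact ENNReal.pow_ne_top hξ
    have e1 : ∀ τ, ∫⁻ t in Ioc 0 τ, ‖z t ξ‖ₑ ^ 2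
        = ∫⁻ t, (Ioc 0 τ).indicator (fun t => ‖z t ξ‖ₑ ^ 2) t := fun τ =>
      (lintegral_indicator measurableSet_Ioc _).symm
    have h2 : Tendsto (fun τ => ∫⁻ t in Ioc 0 τ, ‖z t ξ‖ₑ ^ 2) (𝓝[Icc 0 b] τ₀)
        (𝓝 (∫⁻ t in Ioc 0 τ₀, ‖z t ξ‖ₑ ^ 2)) := by
      simp only [e1]
      refine tendsto_lintegral_filter_of_dominated_convergence
        ((Ioc 0 b).indicator fun t => ‖z t ξ‖ₑ ^ 2)
        (Eventually.of_forall fun τ => hm.indicator measurableSet_Ioc) ?_ (by rwa [← e1]) ?_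
      · filter_upwards [self_mem_nhdsWithin] with τ hτ
        exact Eventually.of_forall fun t =>
          indicator_le_indicator_of_subset (Ioc_subset_Ioc_right hτ.2) (fun _ => zero_le) t
      · have hne : ∀ᵐ t : ℝ, t ≠ τ₀ := by simp [ae_iff, measure_singleton]
        filter_upwards [hne] with t ht
        refine Tendsto.mono_left (tendsto_const_nhds.congr' ?_) nhdsWithin_le_nhds
        rcases ht.lt_or_gt with h | h
        · filter_upwards [lt_mem_nhds h] with τ hτ
          by_cases h0 : 0 < t
          · rw [indicator_of_mem (show t ∈ Ioc 0 τ₀ from ⟨h0, h.le⟩),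
              indicator_of_mem (show t ∈ Ioc 0 τ from ⟨h0, le_of_lt hτ⟩)]
          · rw [indicator_of_notMem fun h' => h0 h'.1, indicator_of_notMem fun h' => h0 h'.1]
        · filter_upwards [gt_mem_nhds h] with τ hτ
          rw [indicator_of_notMem fun h' => not_lt.2 h'.2 h,
            indicator_of_notMem fun h' => not_lt.2 h'.2 hτ]
    exact h2.ennrpow_const (1 / 2 : ℝ)

lemma eq_zero_or_of_le_sq {κ y N : ℝ≥0∞} (hy : y ≠ ⊤) (hN : 4 * κ * N ≤ 1)
    (h : y ≤ κ * (y * (y + N) + N * y)) : y = 0 ∨ 2⁻¹ ≤ κ * y := by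
  rcases eq_or_ne y 0 with h0 | h0
  · exact Or.inl h0
  right
  have h2 : y * 1 ≤ y * (κ * y + 2⁻¹) := by
    calc y * 1 = y := mul_one y
      _ ≤ κ * (y * (y + N) + N * y) := h
      _ = y * (κ * y + 2 * κ * N) := by ring
      _ ≤ y * (κ * y + 2⁻¹) := by
        gcongr
        rw [ENNReal.le_inv_iff_mul_le]
        refine le_trans (le_of_eq ?_) hN
        ring
  have h3 : (1 : ℝ≥0∞) ≤ κ * y + 2⁻¹ := (ENNReal.mul_le_mul_iff_right h0 hy).1 h2
  rw [← ENNReal.inv_two_add_inv_two] at h3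
  exact (ENNReal.add_le_add_iff_right (by simp)).1 h3

/-- A mild solution coincides with a small one: the norm of the difference over `(0, τ]` is
continuous in `τ`, vanishes at `0`, and cannot take small nonzero values. -/
theorem mild_unique (hA : A = timeInterval T) (hz : Measurable (Function.uncurry z))
    (hZ : Measurable (Function.uncurry Z))
    (hzf : ∫⁻ ξ, timeNorm A z ξ ≠ ⊤) (hZf : ∫⁻ ξ, timeNorm A Z ξ ≠ ⊤)
    (hsmall : 4 * kap nu symK * ∫⁻ ξ, timeNorm A Z ξ ≤ 1)
    (ez : ∀ t ∈ A, ∀ᵐ ξ, z t ξ = heat nu z₀ t ξ + duh nu mhdSym z z t ξ)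
    (eZ : ∀ t ∈ A, ∀ᵐ ξ, Z t ξ = heat nu z₀ t ξ + duh nu mhdSym Z Z t ξ) :
    ∀ t ∈ A, ∀ᵐ ξ, z t ξ = Z t ξ := by
  set v : ℝ → Space d → Pair d := fun t ξ => z t ξ - Z t ξ with hv
  have hvm : Measurable (Function.uncurry v) := hz.sub hZ
  have hM := isSymbol_mhdSym (d := d)
  -- a common bound of both solutions
  set F : Space d → ℝ≥0∞ := fun ξ => timeNorm A z ξ + timeNorm A Z ξ with hF
  have hFm : Measurable F := (measurable_timeNorm A hz).add (measurable_timeNorm A hZ)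
  have hFi : ∫⁻ ξ, F ξ ≠ ⊤ := by
    rw [hF, lintegral_add_left (measurable_timeNorm A hz)]
    exact ENNReal.add_ne_top.2 ⟨hzf, hZf⟩
  have hcvF : ∀ᵐ ξ, cv F F ξ ≠ ⊤ := by
    have : ∫⁻ ξ, cv F F ξ ≠ ⊤ := by
      rw [lintegral_cv hFm hFm]; exact ENNReal.mul_ne_top hFi hFi
    exact (ae_lt_top (measurable_cv hFm hFm) this).mono fun _ h => h.ne
  have hsub : ∀ t ∈ A, Ioc 0 t ⊆ A := fun t ht => by
    subst hA; exact Ioc_subset_timeInterval ht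
  have hIoc : ∀ b : ℝ, ∀ t ∈ Ioc 0 b, Ioc 0 t ⊆ Ioc 0 b := fun b t ht =>
    Ioc_subset_Ioc_right ht.2
  have hAm : MeasurableSet A := by subst hA; exact measurableSet_timeInterval T
  -- the equation of the difference
  have ev : ∀ t ∈ A, ∀ᵐ ξ, v t ξ = duh nu mhdSym v z t ξ + duh nu mhdSym Z v t ξ := by
    intro t ht
    filter_upwards [ez t ht, eZ t ht, hcvF] with ξ h1 h2 h3
    rw [← duh_self_sub hM nu_pos.le hsub hz hZ (F := F) (Eventually.of_forall fun _ => le_self_add)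
      (Eventually.of_forall fun _ => le_add_self) h3 ht, hv]
    simp only
    rw [h1, h2]
    abel
  have hvle : ∀ (A' : Set ℝ) (ξ : Space d), timeNorm A' z ξ ≤ timeNorm A' v ξ + timeNorm A' Z ξ :=
    fun A' ξ => by
      have := timeNorm_add_le A' hvm hZ ξ
      simpa only [hv, sub_add_cancel] using this
  have hvF : ∀ (A' : Set ℝ), A' ⊆ A → ∀ ξ, timeNorm A' v ξ ≤ F ξ := fun A' h ξ => by
    have hZn : Measurable (Function.uncurry fun t ξ => -Z t ξ) := hZ.neg
    have h1 := timeNorm_add_le A' hz hZn ξ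
    have h2 : timeNorm A' (fun t ξ => -Z t ξ) ξ = timeNorm A' Z ξ := by
      simp only [timeNorm, enorm_neg]
    have h3 : timeNorm A' v ξ ≤ timeNorm A' z ξ + timeNorm A' (fun t ξ => -Z t ξ) ξ := by
      simpa only [hv, sub_eq_add_neg] using h1
    rw [h2] at h3
    exact h3.trans (add_le_add (timeNorm_mono h z ξ) (timeNorm_mono h Z ξ))
  set y : ℝ → ℝ≥0∞ := fun τ => ∫⁻ ξ, timeNorm (Ioc 0 τ) v ξ with hy
  have hyt : ∀ b ∈ A, y b ≠ ⊤ := fun b hb =>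
    ne_top_of_le_ne_top hFi (lintegral_mono fun ξ => hvF _ (hsub b hb) ξ)
  -- the norm `y` satisfies `y ≤ κ (y (y + N) + N y)`, where `N` is the norm of the small solution
  have hquad : ∀ b ∈ A, y b = 0 ∨ 2⁻¹ ≤ kap nu symK * y b := by
    intro b hb
    set N := ∫⁻ ξ, timeNorm (Ioc 0 b) Z ξ with hN
    have hNle : 4 * kap nu symK * N ≤ 1 :=
      (mul_le_mul_right (lintegral_mono fun ξ => timeNorm_mono (hsub b hb) Z ξ) _).trans hsmall
    refine eq_zero_or_of_le_sq (hyt b hb) hNle ?_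
    have hms : MeasurableSet {p : ℝ × Space d | v p.1 p.2
        = duh nu mhdSym v z p.1 p.2 + duh nu mhdSym Z v p.1 p.2} :=
      measurableSet_eq_fun hvm ((measurable_duh nu hM hvm hz).add (measurable_duh nu hM hZ hvm))
    have h1 : ∀ᵐ t ∂(volume.restrict (Ioc 0 b)), ∀ᵐ ξ,
        v t ξ = duh nu mhdSym v z t ξ + duh nu mhdSym Z v t ξ := by
      filter_upwards [ae_restrict_mem measurableSet_Ioc] with t ht
      exact ev t (hsub b hb ht)
    have h2 := (Measure.ae_ae_comm hms).1 h1
    have h3 : ∀ᵐ ξ, timeNorm (Ioc 0 b) v ξ ≤ kap nu symK *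
        (cv (timeNorm (Ioc 0 b) v) (fun ξ => timeNorm (Ioc 0 b) v ξ + timeNorm (Ioc 0 b) Z ξ) ξ
          + cv (timeNorm (Ioc 0 b) Z) (timeNorm (Ioc 0 b) v) ξ) := by
      filter_upwards [h2] with ξ hξ
      calc timeNorm (Ioc 0 b) v ξ
          = timeNorm (Ioc 0 b)
            (fun t ξ => duh nu mhdSym v z t ξ + duh nu mhdSym Z v t ξ) ξ :=
            n2_congr_ae (hξ.mono fun t ht => by rw [ht])
        _ ≤ _ := timeNorm_add_le _ (measurable_duh nu hM hvm hz) (measurable_duh nu hM hZ hvm) ξ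
        _ ≤ _ := by
          rw [mul_add]
          refine add_le_add ?_ ?_
          · exact timeNorm_duh_le hM nu_pos measurableSet_Ioc (hIoc b) hvm hz
              (Eventually.of_forall fun _ => le_rfl) (Eventually.of_forall fun ξ => hvle _ ξ) ξ
          · exact timeNorm_duh_le hM nu_pos measurableSet_Ioc (hIoc b) hZ hvm
              (Eventually.of_forall fun _ => le_rfl) (Eventually.of_forall fun ξ => le_rfl) ξ
    have m1 := measurable_timeNorm (Ioc 0 b) hvm
    have m2 := measurable_timeNorm (Ioc 0 b) hZ
    have m12 : Measurable fun ξ => timeNorm (Ioc 0 b) v ξ + timeNorm (Ioc 0 b) Z ξ := m1.add m2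
    refine (lintegral_mono_ae h3).trans (le_of_eq ?_)
    rw [lintegral_const_mul' _ _ kap_ne_top, lintegral_add_left (measurable_cv m1 m12),
      lintegral_cv m1 m12, lintegral_cv m2 m1, lintegral_add_left m1]
  have hy0 : ∀ b ∈ A, y b = 0 := by
    intro b hb
    rcases hquad b hb with h | h
    · exact h
    exfalso
    have hb0 : 0 ≤ b := by subst hA; exact hb.1
    have hc : ContinuousOn (fun τ => kap nu symK * y τ) (Icc 0 b) := fun τ hτ =>
      ENNReal.Tendsto.const_mul (continuousOn_lintegral_timeNorm hvm (hyt b hb) τ hτ)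
        (Or.inr kap_ne_top)
    have h0 : kap nu symK * y 0 = 0 := by simp [hy, timeNorm, n2]
    -- by continuity the norm would take a forbidden intermediate value
    have h4 : (4⁻¹ : ℝ≥0∞) ∈ Icc (kap nu symK * y 0) (kap nu symK * y b) := by
      rw [h0]
      exact ⟨zero_le, le_trans (ENNReal.inv_le_inv.2 (by norm_num)) h⟩
    obtain ⟨τ, hτ, hτ4⟩ := intermediate_value_Icc hb0 hc h4
    have hτA : τ ∈ A := by
      subst hA; exact ⟨hτ.1, (ENNReal.ofReal_le_ofReal hτ.2).trans hb.2⟩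
    replace hτ4 : kap nu symK * y τ = 4⁻¹ := hτ4
    rcases hquad τ hτA with h5 | h5
    · rw [h5, mul_zero] at hτ4
      exact ENNReal.inv_ne_zero.2 (by finiteness) hτ4.symm
    · rw [hτ4, ENNReal.inv_le_inv] at h5
      norm_num at h5
  intro t ht
  have ht0 : 0 ≤ t := by subst hA; exact ht.1
  rcases ht0.eq_or_lt with h0 | h0
  -- at the initial time both solutions equal `z₀`
  · filter_upwards [ez t ht, eZ t ht] with ξ h1 h2
    rw [h1, h2, ← h0]
    simp [duh]
  · have h1 : ∀ᵐ ξ, timeNorm (Ioc 0 t) v ξ ≤ (fun _ => 0 : Space d → ℝ≥0∞) ξ := by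
      have := (lintegral_eq_zero_iff (measurable_timeNorm _ hvm)).1 (hy0 t ht)
      exact this.mono fun ξ h => h.le
    have htm : t ∈ Ioc 0 t := ⟨h0, le_rfl⟩
    filter_upwards [ev t ht] with ξ hξ
    have h2 := enorm_duh_le hM nu_pos.le (hIoc t) hvm hz h1
      (Eventually.of_forall fun _ => le_rfl) htm ξ
    have h3 := enorm_duh_le hM nu_pos.le (hIoc t) hZ hvm (Eventually.of_forall fun _ => le_rfl)
      h1 htm ξ
    simp only [cv, zero_mul, mul_zero, lintegral_zero, nonpos_iff_eq_zero, enorm_eq_zero] at h2 h3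
    rw [h2, h3, add_zero] at hξ
    exact sub_eq_zero.1 hξ

lemma lintegral_timeNorm_duh_lt_top (hAm : MeasurableSet A) (hA : ∀ t ∈ A, Ioc 0 t ⊆ A)
    (hz : Measurable (Function.uncurry z)) (hsq : ∫⁻ t in A, (∫⁻ ξ, ‖z t ξ‖ₑ) ^ 2 < ⊤) :
    ∫⁻ ξ, timeNorm A (duh nu mhdSym z z) ξ < ⊤ := by
  refine lt_of_le_of_lt (lintegral_mono fun ξ =>
    timeNorm_duh_le_lintegral isSymbol_mhdSym nu_pos hAm hA hz hz ξ) ?_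
  rw [lintegral_const_mul' _ _ kap_ne_top]
  refine ENNReal.mul_lt_top kap_ne_top.lt_top ?_
  rw [lintegral_lintegral_swap]
  · refine lt_of_le_of_lt (lintegral_mono fun t => ?_) hsq
    have hm : Measurable fun ξ => ‖z t ξ‖ₑ := (hz.comp measurable_prodMk_left).enorm
    rw [lintegral_cv hm hm, sq]
  · exact ((measurable_cv_enorm hz hz).comp measurable_swap).aemeasurable

end mildUnique

end

section

variable {d : ℕ} {T : ℝ≥0∞} {φ : Space d → ℂ}

/-! ### Jointly measurable representatives -/

section joint

variable {E : Type*} [NormedAddCommGroup E] [NormedSpace ℝ E]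
  [MeasurableSpace E] [BorelSpace E] [SecondCountableTopology E]

lemma measurable_setAverage_closedBall {g : Space d → E} (hg : Measurable g) (r : ℝ) :
    Measurable fun ξ => ⨍ η in Metric.closedBall ξ r, g η := by
  have h1 : (fun ξ => ⨍ η in Metric.closedBall ξ r, g η) = fun ξ =>
      (volume.real (Metric.closedBall (0 : Space d) r))⁻¹ •
        ∫ η, {p : Space d × Space d | dist p.2 p.1 ≤ r}.indicator (fun p => g p.2) (ξ, η) := by
    funext ξ
    rw [setAverage_eq, Measure.real, Measure.real, Measure.addHaar_closedBall_center,
      ← integral_indicator measurableSet_closedBall]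
    rfl
  rw [h1]
  refine Measurable.const_smul ?_ _
  refine StronglyMeasurable.measurable (StronglyMeasurable.integral_prod_right ?_)
  refine ((hg.comp measurable_snd).indicator ?_).stronglyMeasurable
  exact measurableSet_le (measurable_snd.dist measurable_fst) measurable_const

/-- A family of functions which is continuous in time with values in `L¹_loc` has a jointly
measurable version: the limit of the averages over small balls. -/
lemma exists_measurable_uncurry [CompleteSpace E] {A : Set ℝ} (hA : MeasurableSet A) {g : ℝ → Space
    d → E}
    (hg : ∀ t ∈ A, Measurable (g t)) (hloc : ∀ t ∈ A, LocallyIntegrable (g t))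
    (hc : ∀ t₀ ∈ A, ∀ R : ℝ, Tendsto (fun t => ∫⁻ ξ in Metric.closedBall 0 R, ‖g t ξ - g t₀ ξ‖ₑ)
      (𝓝[A] t₀) (𝓝 0)) :
    ∃ z : ℝ → Space d → E, Measurable (Function.uncurry z) ∧ ∀ t ∈ A, z t =ᵐ[volume] g t := by
  set δ : ℕ → ℝ := fun n => 1 / ((n : ℝ) + 1) with hδ
  have hδ0 : ∀ n, 0 < δ n := fun n => by positivity
  -- averages over small balls are continuous in time and measurable in space, hence jointly
  -- measurable; they converge almost everywhere, by Lebesgue's differentiation theorem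
  set a : ℕ → A → Space d → E := fun n t ξ => ⨍ η in Metric.closedBall ξ (δ n), g t η with ha
  have hint : ∀ t ∈ A, ∀ (ξ : Space d) (r : ℝ), IntegrableOn (g t) (Metric.closedBall ξ r) :=
    fun t ht ξ r => (hloc t ht).integrableOn_isCompact (isCompact_closedBall ξ r)
  have hcont : ∀ n ξ, Continuous fun t => a n t ξ := by
    intro n ξ
    rw [continuous_iff_continuousAt]
    intro t₀
    simp only [ha, setAverage_eq]
    refine Tendsto.const_smul ?_ _
    refine tendsto_integral_of_L1 (fun η => g t₀ η) (hint t₀ t₀.2 ξ (δ n)).1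
      (Eventually.of_forall fun t => hint t t.2 ξ (δ n)) ?_
    have h1 : Tendsto (fun t : A => ∫⁻ η in Metric.closedBall 0 (‖ξ‖ + δ n),
        ‖g t η - g t₀ η‖ₑ) (𝓝 t₀) (𝓝 0) := by
      have := (hc t₀ t₀.2 (‖ξ‖ + δ n)).comp (tendsto_nhdsWithin_iff.2
        ⟨continuous_subtype_val.tendsto t₀, Eventually.of_forall fun t : A => t.2⟩)
      exact this
    refine tendsto_of_tendsto_of_tendsto_of_le_of_le tendsto_const_nhds h1 (fun _ => zero_le)
      fun t => ?_
    refine lintegral_mono_set (Metric.closedBall_subset_closedBall' ?_)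
    rw [dist_zero_right, add_comm]
  have hmeas : ∀ n, Measurable (Function.uncurry (a n)) := fun n =>
    measurable_uncurry_of_continuous_of_measurable (hcont n)
      fun t => measurable_setAverage_closedBall (hg t t.2) (δ n)
  set S : Set (A × Space d) := {p | ∃ l, Tendsto (fun n => Function.uncurry (a n) p) atTop (𝓝 l)}
  have hS : MeasurableSet S := measurableSet_exists_tendsto hmeas
  have hlim : ∀ p, ∃ l, Tendsto (fun n => S.indicator (Function.uncurry (a n)) p) atTop (𝓝 l) := by
    intro p
    by_cases hp : p ∈ S
    · obtain ⟨l, hl⟩ := id hp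
      exact ⟨l, by simpa only [indicator_of_mem hp] using hl⟩
    · exact ⟨0, by simpa only [indicator_of_notMem hp] using tendsto_const_nhds⟩
  choose z' hz' using hlim
  have hz'm : Measurable z' := measurable_of_tendsto_metrizable
    (fun n => (hmeas n).indicator hS) (tendsto_pi_nhds.2 hz')
  obtain ⟨z, hz, hzz⟩ := ((MeasurableEmbedding.subtype_coe hA).prodMap
    (MeasurableEmbedding.id (α := Space d))).exists_measurable_extend hz'm fun _ => ⟨0⟩
  refine ⟨fun t ξ => z (t, ξ), hz, fun t ht => ?_⟩
  filter_upwards [IsUnifLocDoublingMeasure.ae_tendsto_average volume (hloc t ht) 1] with ξ hξ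
  have h1 : Tendsto (fun n => a n ⟨t, ht⟩ ξ) atTop (𝓝 (g t ξ)) := by
    refine hξ (fun _ => ξ) δ ?_ (Eventually.of_forall fun n => ?_)
    · exact tendsto_nhdsWithin_iff.2 ⟨tendsto_one_div_add_atTop_nhds_zero_nat,
        Eventually.of_forall fun n => hδ0 n⟩
    · exact Metric.mem_closedBall_self (by have := hδ0 n; linarith)
  have hp : ((⟨t, ht⟩ : A), ξ) ∈ S := ⟨_, h1⟩
  have h2 := hz' ((⟨t, ht⟩ : A), ξ)
  simp only [indicator_of_mem hp] at h2
  have h3 : z (t, ξ) = z' (⟨t, ht⟩, ξ) := congrFun hzz ((⟨t, ht⟩ : A), ξ)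
  rw [h3]
  exact tendsto_nhds_unique h2 h1

end joint

/-! ### The Fourier representation of a solution -/

section rep

lemma lintegral_closedBall_le_bs (d : ℕ) [NeZero d] {s : ℝ} (hs : s ≤ d / 2) (R : ℝ) :
    ∃ C : ℝ≥0∞, C ≠ ⊤ ∧ ∀ F : Space d → ℝ≥0∞, Measurable F →
      ∫⁻ ξ in Metric.closedBall 0 R, F ξ ≤ C * bs s F := by
  obtain ⟨C, hC, h⟩ := lintegral_le_bs d
  obtain ⟨J, hJ⟩ := pow_unbounded_of_one_lt R (by norm_num : (1 : ℝ) < 2)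
  have hJt : (2 : ℝ≥0∞) ^ ((J : ℝ) * (d / 2 - s)) ≠ ⊤ := two_rpow_ne_top _
  refine ⟨C * 2 ^ ((J : ℝ) * (d / 2 - s)), ENNReal.mul_ne_top hC hJt, fun F hF => ?_⟩
  rw [← lintegral_indicator measurableSet_closedBall]
  refine (h _ (hF.indicator measurableSet_closedBall)).trans ?_
  rw [mul_assoc]
  gcongr
  have := bs_le_of_shell_ae (F := (Metric.closedBall (0 : Space d) R).indicator F) (G := F) hJt
    (d / 2) (s - d / 2) fun j => Eventually.of_forall fun ξ hξ => ?_
  · simpa using this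
  by_cases hm : ξ ∈ Metric.closedBall (0 : Space d) R
  · rw [indicator_of_mem hm, ← two_rpow_add]
    refine le_mul_of_one_le_left' (one_le_two_rpow ?_)
    have h3 : (2 : ℝ) ^ j < 2 ^ (J : ℤ) := by
      refine hξ.1.trans_lt (lt_of_le_of_lt (by simpa using hm) ?_)
      exact_mod_cast hJ
    have h4 := (zpow_lt_zpow_iff_right₀ (by norm_num : (1 : ℝ) < 2)).1 h3
    have h5 : (j : ℝ) ≤ J := by exact_mod_cast h4.le
    nlinarith
  · simp [indicator_of_notMem hm]

/-- Interpolation, by the Cauchy-Schwarz inequality for the sum over the shells. -/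
lemma bs_sq_le (s : ℝ) (F : Space d → ℝ≥0∞) : bs s F ^ 2 ≤ bs (s - 1) F * bs (s + 1) F := by
  set n : ℤ → ℝ≥0∞ := fun j => n2 volume ((shell d j).indicator F)
  have hsq : ∀ x : ℝ≥0∞, (x ^ (1 / 2 : ℝ)) ^ 2 = x := fun x => by
    rw [← ENNReal.rpow_natCast, ← ENNReal.rpow_mul]; norm_num
  have h1 := lintegral_mul_le_n2 (μ := Measure.count)
    (F := fun j : ℤ => ((2 : ℝ≥0∞) ^ ((j : ℝ) * (s - 1)) * n j) ^ (1 / 2 : ℝ))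
    (G := fun j : ℤ => ((2 : ℝ≥0∞) ^ ((j : ℝ) * (s + 1)) * n j) ^ (1 / 2 : ℝ))
    (Measurable.of_discrete).aemeasurable (Measurable.of_discrete).aemeasurable
  have h2 : bs s F ≤ n2 Measure.count
      (fun j : ℤ => ((2 : ℝ≥0∞) ^ ((j : ℝ) * (s - 1)) * n j) ^ (1 / 2 : ℝ)) * n2 Measure.count
      (fun j : ℤ => ((2 : ℝ≥0∞) ^ ((j : ℝ) * (s + 1)) * n j) ^ (1 / 2 : ℝ)) := by
    refine le_trans (le_of_eq ?_) h1
    rw [lintegral_count, bs]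
    refine tsum_congr fun j => ?_
    rw [← ENNReal.mul_rpow_of_nonneg _ _ (by norm_num)]
    have : (2 : ℝ≥0∞) ^ ((j : ℝ) * (s - 1)) * n j * (2 ^ ((j : ℝ) * (s + 1)) * n j)
        = ((2 : ℝ≥0∞) ^ ((j : ℝ) * s) * n j) ^ (2 : ℝ) := by
      rw [ENNReal.mul_rpow_of_nonneg _ _ (by norm_num), ← ENNReal.rpow_mul,
        show (j : ℝ) * s * 2 = (j : ℝ) * (s - 1) + (j : ℝ) * (s + 1) by ring, two_rpow_add,
        ENNReal.rpow_two]
      ring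
    rw [this, ← ENNReal.rpow_mul]
    norm_num [n]
  refine (pow_le_pow_left' h2 2).trans (le_of_eq ?_)
  rw [mul_pow, n2_sq, n2_sq, lintegral_count, lintegral_count]
  simp only [hsq]
  rfl

lemma IsFT.bs_le [NeZero d] {f : TField d} {g : Space d → Vec d} (hφ : IsLittlewoodPaley φ)
    (h : IsFT f g) (s : ℝ) :
    bs s (fun ξ => ‖g ξ‖ₑ) ≤ (2 ^ s + 1 + 2 ^ (-s)) * besovNorm φ s f := by
  rw [h.besovNorm_eq hφ]
  exact bs_le_tsum_block hφ h.tame.meas s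

/-- A field which is continuous in time with values in a Besov space has a Fourier transform in
the space variables which is a jointly measurable function. -/
lemma MemCb.exists_measurable_isFT [NeZero d] (hφ : IsLittlewoodPaley φ) {s : ℝ} (hs : 0 ≤ s)
    (hsd : s ≤ d / 2) {u : ℝ → TField d} (h : MemCb φ T s u) :
    ∃ z : ℝ → Space d → Vec d, Measurable (Function.uncurry z) ∧
      ∀ t ∈ timeInterval T, IsFT (u t) (z t) := by
  have h1 : ∀ t, ∃ g : Space d → Vec d, t ∈ timeInterval T → Measurable g ∧ IsFT (u t) g := by
    intro t
    by_cases ht : t ∈ timeInterval T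
    · obtain ⟨g, hg⟩ := exists_isFT_of_memBesov hφ hs hsd (h.mem t ht)
      exact ⟨hg.tame.meas.aemeasurable.mk g, fun _ => ⟨hg.tame.meas.aemeasurable.measurable_mk,
        hg.congr hg.tame.meas.aemeasurable.ae_eq_mk⟩⟩
    · exact ⟨0, fun h => absurd h ht⟩
  choose g hg using h1
  -- the Besov norm controls the local `L¹` norms of the Fourier transform
  have hb : ∀ R : ℝ, ∃ C : ℝ≥0∞, C ≠ ⊤ ∧ ∀ (f : TField d) (w : Space d → Vec d), Measurable w →
      IsFT f w → ∫⁻ ξ in Metric.closedBall 0 R, ‖w ξ‖ₑ ≤ C * besovNorm φ s f := by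
    intro R
    obtain ⟨C, hC, h2⟩ := lintegral_closedBall_le_bs d hsd R
    refine ⟨C * (2 ^ s + 1 + 2 ^ (-s)), ENNReal.mul_ne_top hC (three_ne_top s),
      fun f w hw hfw => ?_⟩
    rw [mul_assoc]
    exact (h2 _ hw.enorm).trans (mul_le_mul_right (hfw.bs_le hφ s) C)
  have hloc : ∀ t ∈ timeInterval T, LocallyIntegrable (g t) := by
    intro t ht
    rw [MeasureTheory.locallyIntegrable_iff]
    intro K hK
    obtain ⟨R, hR⟩ := hK.isBounded.subset_closedBall 0
    refine IntegrableOn.mono_set ⟨(hg t ht).1.aestronglyMeasurable, ?_⟩ hR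
    rw [hasFiniteIntegral_iff_enorm]
    obtain ⟨C, hC, h2⟩ := hb R
    exact (h2 _ _ (hg t ht).1 (hg t ht).2).trans_lt
      (ENNReal.mul_lt_top hC.lt_top (h.mem t ht).2)
  have hc : ∀ t₀ ∈ timeInterval T, ∀ R : ℝ,
      Tendsto (fun t => ∫⁻ ξ in Metric.closedBall 0 R, ‖g t ξ - g t₀ ξ‖ₑ)
        (𝓝[timeInterval T] t₀) (𝓝 0) := by
    intro t₀ ht₀ R
    obtain ⟨C, hC, h2⟩ := hb R
    have h3 := ENNReal.Tendsto.const_mul (a := C) (h.continuous t₀ ht₀) (Or.inr hC)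
    rw [mul_zero] at h3
    refine tendsto_of_tendsto_of_tendsto_of_le_of_le' tendsto_const_nhds h3
      (Eventually.of_forall fun _ => zero_le) ?_
    filter_upwards [self_mem_nhdsWithin] with t ht
    exact h2 _ _ ((hg t ht).1.sub (hg t₀ ht₀).1) ((hg t ht).2.sub (hg t₀ ht₀).2)
  obtain ⟨z, hz, hzg⟩ := exists_measurable_uncurry (measurableSet_timeInterval T)
    (fun t ht => (hg t ht).1) hloc hc
  exact ⟨z, hz, fun t ht => (hg t ht).2.congr (hzg t ht).symm⟩

lemma enorm_pair_le (v : Pair d) : ‖v‖ₑ ≤ ‖v.1‖ₑ + ‖v.2‖ₑ := by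
  rw [← ofReal_norm, ← ofReal_norm, ← ofReal_norm,
    ← ENNReal.ofReal_add (norm_nonneg _) (norm_nonneg _), Prod.norm_def]
  exact ENNReal.ofReal_le_ofReal (max_le_add_of_nonneg (norm_nonneg _) (norm_nonneg _))

/-- By interpolation between the bounded and the integrable norm, the Fourier transform is square
integrable in time with values in `L¹`. -/
lemma lintegral_sq_lt_top [NeZero d] (hφ : IsLittlewoodPaley φ) {u : ℝ → TField d}
    {z : ℝ → Space d → Vec d} (hz : Measurable (Function.uncurry z))
    (hft : ∀ t ∈ timeInterval T, IsFT (u t) (z t)) (h : MemCb φ T (d / 2 - 1) u)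
    (h' : MemL1 φ T (d / 2 + 1) u) :
    ∫⁻ t in timeInterval T, (∫⁻ ξ, ‖z t ξ‖ₑ) ^ 2 < ⊤ := by
  obtain ⟨C, hC, hle⟩ := lintegral_le_bs d
  obtain ⟨M, hM⟩ := h.bounded
  set K : ℝ → ℝ≥0∞ := fun s => 2 ^ s + 1 + 2 ^ (-s)
  have hK : ∀ s, K s ≠ ⊤ := three_ne_top
  have h1 : ∀ t ∈ timeInterval T, (∫⁻ ξ, ‖z t ξ‖ₑ) ^ 2
      ≤ (C ^ 2 * (K (d / 2 - 1) * M) * K (d / 2 + 1)) * besovNorm φ (d / 2 + 1) (u t) := by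
    intro t ht
    have hm : Measurable fun ξ => ‖z t ξ‖ₑ := (hz.comp measurable_prodMk_left).enorm
    calc (∫⁻ ξ, ‖z t ξ‖ₑ) ^ 2 ≤ (C * bs (d / 2) fun ξ => ‖z t ξ‖ₑ) ^ 2 :=
          pow_le_pow_left' (hle _ hm) 2
      _ = C ^ 2 * (bs (d / 2) fun ξ => ‖z t ξ‖ₑ) ^ 2 := mul_pow _ _ _
      _ ≤ C ^ 2 * ((bs (d / 2 - 1) fun ξ => ‖z t ξ‖ₑ) * (bs (d / 2 + 1) fun ξ => ‖z t ξ‖ₑ)) :=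
          mul_le_mul_right (bs_sq_le _ _) _
      _ ≤ C ^ 2 * ((K (d / 2 - 1) * M) * (K (d / 2 + 1) * besovNorm φ (d / 2 + 1) (u t))) := by
          gcongr
          · exact ((hft t ht).bs_le hφ _).trans (mul_le_mul_right (hM t ht) _)
          · exact (hft t ht).bs_le hφ _
      _ = _ := by ring
  refine lt_of_le_of_lt (setLIntegral_mono' (measurableSet_timeInterval T) h1) ?_
  have hc : C ^ 2 * (K (d / 2 - 1) * M) * K (d / 2 + 1) ≠ ⊤ := by
    have h2 := hK (d / 2 - 1)
    have h3 := hK (d / 2 + 1)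
    finiteness
  rw [lintegral_const_mul' _ _ hc]
  exact ENNReal.mul_lt_top hc.lt_top h'.integrable

/-- A pair in the critical space has a representation by a jointly measurable Fourier transform
which is square integrable in time with values in `L¹`. -/
lemma MemF.exists_isRep [NeZero d] (hφ : IsLittlewoodPaley φ) (hd : 0 ≤ (d : ℝ) / 2 - 1)
    {u b : ℝ → TField d} (h : MemF φ T ((d : ℝ) / 2) u b) : ∃ z, IsRep T u b z := by
  obtain ⟨v, hv, hvu⟩ := h.1.1.exists_measurable_isFT hφ hd (by linarith)
  obtain ⟨w, hw, hwb⟩ := h.2.1.exists_measurable_isFT hφ hd (by linarith)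
  refine ⟨fun t ξ => (v t ξ, w t ξ), hv.prodMk hw, hvu, hwb, ?_⟩
  have h1 := lintegral_sq_lt_top hφ hv hvu h.1.1 h.1.2
  have h2 := lintegral_sq_lt_top hφ hw hwb h.2.1 h.2.2
  have m1 : Measurable fun t => ∫⁻ ξ, ‖v t ξ‖ₑ := hv.enorm.lintegral_prod_right'
  have hsq : ∀ a b : ℝ≥0∞, (a + b) ^ 2 ≤ 4 * (a ^ 2 + b ^ 2) := by
    intro a b
    rcases le_total a b with hab | hab
    · calc (a + b) ^ 2 ≤ (b + b) ^ 2 := by gcongr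
        _ = 4 * b ^ 2 := by ring
        _ ≤ _ := mul_le_mul_right le_add_self _
    · calc (a + b) ^ 2 ≤ (a + a) ^ 2 := by gcongr
        _ = 4 * a ^ 2 := by ring
        _ ≤ _ := mul_le_mul_right le_self_add _
  calc ∫⁻ t in timeInterval T, (∫⁻ ξ, ‖(v t ξ, w t ξ)‖ₑ) ^ 2
      ≤ ∫⁻ t in timeInterval T, 4 * ((∫⁻ ξ, ‖v t ξ‖ₑ) ^ 2 + (∫⁻ ξ, ‖w t ξ‖ₑ) ^ 2) := by
        refine lintegral_mono fun t => le_trans (pow_le_pow_left' ?_ 2) (hsq _ _)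
        have hm : Measurable fun ξ => ‖v t ξ‖ₑ := (hv.comp measurable_prodMk_left).enorm
        rw [← lintegral_add_left hm]
        refine lintegral_mono fun ξ => ?_
        exact enorm_pair_le _
    _ < ⊤ := by
        rw [lintegral_const_mul' _ _ (by simp), lintegral_add_left (m1.pow_const 2)]
        finiteness

end rep

end

section

/-! ### Functions of time with an integrable weak derivative -/

lemma exists_Icc_of_isCompact_subset_Ioo {K : Set ℝ} {b : ℝ} (hb : 0 < b) (hK : IsCompact K)
    (h : K ⊆ Ioo 0 b) : ∃ a₁ b₁, 0 < a₁ ∧ b₁ < b ∧ a₁ ≤ b₁ ∧ K ⊆ Icc a₁ b₁ := by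
  rcases K.eq_empty_or_nonempty with rfl | hne
  · exact ⟨b / 2, b / 2, by linarith, by linarith, le_rfl, empty_subset _⟩
  · obtain ⟨x, hx, hx'⟩ := hK.exists_isLeast hne
    obtain ⟨y, hy, hy'⟩ := hK.exists_isGreatest hne
    exact ⟨x, y, (h hx).1, (h hy).2, hx' hy, fun t ht => ⟨hx' ht, hy' ht⟩⟩

/-- A smooth function with compact support in an interval and vanishing integral is the derivative
of another one. -/
lemma exists_primitive_test {κ : ℝ → ℝ} {b : ℝ} (hb : 0 < b) (hκ : ContDiff ℝ ∞ κ)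
    (hc : HasCompactSupport κ) (hs : tsupport κ ⊆ Ioo 0 b) (h0 : ∫ t, κ t = 0) :
    ∃ χ : ℝ → ℝ, ContDiff ℝ ∞ χ ∧ HasCompactSupport χ ∧ tsupport χ ⊆ Ioo 0 b ∧
      ∀ t, HasDerivAt χ (κ t) t := by
  obtain ⟨a₁, b₁, ha, hb1, hab, hK⟩ := exists_Icc_of_isCompact_subset_Ioo hb hc hs
  have hz : ∀ t, t ∉ Icc a₁ b₁ → κ t = 0 := fun t ht =>
    image_eq_zero_of_notMem_tsupport fun h => ht (hK h)
  -- the primitive vanishes beyond the support of `κ` since the integral of `κ` is zero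
  set χ : ℝ → ℝ := fun x => ∫ t in a₁..x, κ t with hχ
  have hd : ∀ t, HasDerivAt χ (κ t) t := fun t =>
    intervalIntegral.integral_hasDerivAt_right (hκ.continuous.intervalIntegrable _ _)
      hκ.continuous.stronglyMeasurable.stronglyMeasurableAtFilter hκ.continuous.continuousAt
  have hder : deriv χ = κ := funext fun t => (hd t).deriv
  have hzero : ∀ x, x ∉ Icc a₁ b₁ → χ x = 0 := by
    intro x hx
    rcases lt_or_ge x a₁ with h | h
    · rw [hχ]
      refine intervalIntegral.integral_zero_ae ?_
      have hne : ∀ᵐ t : ℝ, t ≠ a₁ := by simp [ae_iff, measure_singleton]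
      filter_upwards [hne] with t hta ht
      rw [uIoc_of_ge h.le] at ht
      exact hz t fun h' => hta (le_antisymm ht.2 h'.1)
    · have hbx : b₁ < x := by
        by_contra h'
        exact hx ⟨h, not_lt.1 h'⟩
      rw [hχ]
      simp only
      rw [intervalIntegral.integral_of_le h, ← h0, ← integral_Icc_eq_integral_Ioc]
      exact setIntegral_eq_integral_of_forall_compl_eq_zero fun t ht =>
        hz t fun h' => ht ⟨h'.1, h'.2.trans hbx.le⟩
  have hsub : tsupport χ ⊆ Icc a₁ b₁ := closure_minimal (fun x hx => by
    by_contra h; exact hx (hzero x h)) isClosed_Icc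
  refine ⟨χ, ?_, HasCompactSupport.of_support_subset_isCompact isCompact_Icc
    (subset_closure.trans hsub), hsub.trans fun x hx => ⟨ha.trans_le hx.1, hx.2.trans_lt hb1⟩, hd⟩
  rw [contDiff_infty_iff_deriv, hder]
  exact ⟨fun t => (hd t).differentiableAt, hκ⟩

/-- A continuous function with weak derivative `Q` is a primitive of `Q`. -/
lemma eq_add_integral_of_weak_deriv {b : ℝ} (hb : 0 < b) {F Q : ℝ → ℂ}
    (hF : ContinuousOn F (Icc 0 b)) (hQ : IntegrableOn Q (Ioc 0 b))
    (h : ∀ χ κ : ℝ → ℝ, ContDiff ℝ ∞ χ → HasCompactSupport χ → tsupport χ ⊆ Ioo 0 b →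
      (∀ t, HasDerivAt χ (κ t) t) → ∫ t in Ioc 0 b, ((κ t : ℂ) * F t + χ t * Q t) = 0) :
    ∀ t ∈ Icc 0 b, F t = F 0 + ∫ s in Ioc 0 t, Q s := by
  -- it has to be shown that `H` is constant
  set H : ℝ → ℂ := fun t => F t - ∫ s in Ioc 0 t, Q s with hH
  have hprim : ContinuousOn (fun t => ∫ s in Ioc 0 t, Q s) (Icc 0 b) :=
    intervalIntegral.continuousOn_primitive
      ((integrableOn_Icc_iff_integrableOn_Ioc (by simp)).2 hQ)
  have hHc : ContinuousOn H (Icc 0 b) := hF.sub hprim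
  have hHi : IntegrableOn H (Ioc 0 b) :=
    (hHc.integrableOn_compact isCompact_Icc).mono_set Ioc_subset_Icc_self
  have hPi : IntegrableOn (fun t => ∫ s in Ioc 0 t, Q s) (Ioc 0 b) :=
    (hprim.integrableOn_compact isCompact_Icc).mono_set Ioc_subset_Icc_self
  have hFi : IntegrableOn F (Ioc 0 b) :=
    (hF.integrableOn_compact isCompact_Icc).mono_set Ioc_subset_Icc_self
  have hmul : ∀ (κ : ℝ → ℝ), Continuous κ → ∀ G : ℝ → ℂ, IntegrableOn G (Ioc 0 b) →
      IntegrableOn (fun t => (κ t : ℂ) * G t) (Ioc 0 b) := by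
    intro κ hκ G hG
    obtain ⟨C, hC⟩ := (isCompact_Icc (a := (0 : ℝ)) (b := b)).exists_bound_of_continuousOn
      hκ.continuousOn
    refine hG.bdd_mul (c := C) ?_ ?_
    · exact (Complex.continuous_ofReal.comp hκ).aestronglyMeasurable
    · filter_upwards [ae_restrict_mem measurableSet_Ioc] with t ht
      rw [Complex.norm_real]
      exact hC t ⟨ht.1.le, ht.2⟩
  -- `H` is orthogonal to the test functions of vanishing integral
  have h1 : ∀ κ : ℝ → ℝ, ContDiff ℝ ∞ κ → HasCompactSupport κ → tsupport κ ⊆ Ioo 0 b →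
      ∫ t, κ t = 0 → ∫ t in Ioc 0 b, (κ t : ℂ) * H t = 0 := by
    intro κ hκ hc hs h0
    obtain ⟨χ, hχ, hχc, hχs, hd⟩ := exists_primitive_test hb hκ hc hs h0
    have h2 := h χ κ hχ hχc hχs hd
    have hχb : χ b = 0 := image_eq_zero_of_notMem_tsupport fun h => lt_irrefl _ (hχs h).2
    have h3 := integral_deriv_mul_primitive (g := fun t => (χ t : ℂ)) (g' := fun t => (κ t : ℂ))
      (fun t => (hd t).ofReal_comp) (Complex.continuous_ofReal.comp hκ.continuous) hQ
    simp only [hχb, Complex.ofReal_zero, zero_sub, neg_mul, integral_neg] at h3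
    rw [integral_add (hmul κ hκ.continuous F hFi) (hmul χ hχ.continuous Q hQ)] at h2
    simp only [hH, mul_sub]
    rw [integral_sub (hmul κ hκ.continuous F hFi) (hmul κ hκ.continuous _ hPi), h3, sub_neg_eq_add,
      h2]
  -- a test function of integral one
  let f : ContDiffBump (b / 2) := ⟨b / 8, b / 4, by linarith, by linarith⟩
  set ρ₀ : ℝ → ℝ := f.normed volume with hρ₀
  have hρs : tsupport ρ₀ ⊆ Ioo 0 b := by
    rw [hρ₀, f.tsupport_normed_eq, Real.closedBall_eq_Icc]
    intro x hx
    have h1 : f.rOut = b / 4 := rfl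
    rw [h1] at hx
    exact ⟨by linarith [hx.1], by linarith [hx.2]⟩
  have hρd : ContDiff ℝ ∞ ρ₀ := f.contDiff_normed
  have hρc : HasCompactSupport ρ₀ := f.hasCompactSupport_normed
  have hρ1 : ∫ t, ρ₀ t = 1 := f.integral_normed
  set c : ℂ := ∫ t in Ioc 0 b, (ρ₀ t : ℂ) * H t with hc
  -- subtracting a multiple of `ρ₀` from a test function makes its integral zero
  have h4 : ∀ ρ : ℝ → ℝ, ContDiff ℝ ∞ ρ → HasCompactSupport ρ → tsupport ρ ⊆ Ioo 0 b →
      ∫ t, ρ t • (H t - c) = 0 := by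
    intro ρ hρ hρc' hρs'
    set a : ℝ := ∫ t, ρ t with ha
    have iρ := hρ.continuous.integrable_of_hasCompactSupport hρc' (μ := volume)
    have iρ₀ := hρd.continuous.integrable_of_hasCompactSupport hρc (μ := volume)
    have hsupp : tsupport (fun t => ρ t - a * ρ₀ t) ⊆ tsupport ρ ∪ tsupport ρ₀ := by
      refine closure_minimal (fun t ht => ?_) ((isClosed_tsupport _).union (isClosed_tsupport _))
      by_contra h'
      rw [mem_union, not_or] at h'
      exact ht (by simp [image_eq_zero_of_notMem_tsupport h'.1,
        image_eq_zero_of_notMem_tsupport h'.2])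
    have h5 := h1 (fun t => ρ t - a * ρ₀ t) (hρ.sub (contDiff_const.mul hρd))
      (HasCompactSupport.of_support_subset_isCompact (hρc'.isCompact.union hρc.isCompact)
        (subset_closure.trans hsupp)) (hsupp.trans (union_subset hρs' hρs)) (by
          rw [integral_sub iρ (iρ₀.const_mul a), integral_const_mul, hρ1, mul_one, ha, sub_self])
    simp only [Complex.ofReal_sub, Complex.ofReal_mul, sub_mul, mul_assoc] at h5
    rw [integral_sub (hmul ρ hρ.continuous H hHi) ((hmul ρ₀ hρd.continuous H hHi).const_mul _),
      integral_const_mul, ← hc] at h5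
    have h6 : ∀ G : ℝ → ℂ, ∫ t, ρ t • G t = ∫ t in Ioc 0 b, (ρ t : ℂ) * G t := fun G => by
      rw [← setIntegral_eq_integral_of_forall_compl_eq_zero (s := Ioc 0 b)]
      · rfl
      · intro t ht
        have : ρ t = 0 := image_eq_zero_of_notMem_tsupport fun h' =>
          ht ⟨(hρs' h').1, (hρs' h').2.le⟩
        rw [this, zero_smul]
    have h7 : ∫ t in Ioc 0 b, (ρ t : ℂ) * c = a * c := by
      have := h6 fun _ => c
      rw [integral_smul_const] at this
      rw [← this]
      rfl
    rw [h6]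
    simp only [mul_sub]
    rw [integral_sub (hmul ρ hρ.continuous H hHi)
      (hmul ρ hρ.continuous _ (integrableOn_const (by simp))), h7, h5]
  have h8 : ∀ᵐ t, t ∈ Ioo 0 b → H t - c = 0 := by
    refine isOpen_Ioo.ae_eq_zero_of_integral_contDiff_smul_eq_zero ?_ h4
    refine ContinuousOn.locallyIntegrableOn ?_ measurableSet_Ioo
    exact (hHc.mono Ioo_subset_Icc_self).sub continuousOn_const
  have h9 : EqOn H (fun _ => c) (Icc 0 b) := by
    refine Measure.eqOn_Icc_of_ae_eq volume hb.ne ?_ hHc continuousOn_const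
    rw [← Measure.restrict_congr_set Ioo_ae_eq_Icc]
    exact (ae_restrict_iff' measurableSet_Ioo).2 (h8.mono fun t h ht => sub_eq_zero.1 (h ht))
  intro t ht
  have e1 := h9 ht
  have e0 := h9 ⟨le_rfl, hb.le⟩
  simp only [hH, Ioc_self, Measure.restrict_empty, integral_zero_measure, sub_zero] at e0 e1
  rw [e0, ← e1, sub_add_cancel]

end

section

variable {d : ℕ} {T : ℝ≥0∞} {ψ ψ' : 𝓓(slab d T, ℝ)}
  {u b : ℝ → TField d} {z : ℝ → Space d → Pair d} {U B : ℝ → Space d → Space d}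

/-! ### Elimination of the pressure -/

lemma eq_of_tf_eq (h : ∀ t ξ, tf ψ t ξ = tf ψ' t ξ) : ψ = ψ' := by
  have h1 : ∀ t, slice ψ t = slice ψ' t := fun t => by
    have h2 : (𝓕⁻ (slice ψ t) : 𝓢(Space d, ℂ)) = 𝓕⁻ (slice ψ' t) := by
      ext ξ
      exact h t ξ
    have h3 := congrArg (fun f : 𝓢(Space d, ℂ) => (𝓕 f : 𝓢(Space d, ℂ))) h2
    simpa using h3
  ext p
  have h2 := congrArg (fun f : 𝓢(Space d, ℂ) => f p.2) (h1 p.1)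
  simp only [slice_apply] at h2
  exact_mod_cast h2

lemma tf_dt_of_tf_eq_mul {m : Space d → ℂ} (h : ∀ t ξ, tf ψ' t ξ = m ξ * tf ψ t ξ) (t : ℝ)
    (ξ : Space d) : tf (dt ψ') t ξ = m ξ * tf (dt ψ) t ξ := by
  have h1 := hasDerivAt_tf ψ' t ξ
  simp only [h] at h1
  exact h1.unique ((hasDerivAt_tf ψ t ξ).const_mul (m ξ))

lemma dx_lap_comm (i : Fin d) (ψ : 𝓓(slab d T, ℝ)) : dx i (lap ψ) = lap (dx i ψ) :=
  eq_of_tf_eq fun t ξ => by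
    rw [tf_dx, tf_lap, tf_lap, tf_dx]
    ring

lemma tf_lap_nu (ψ : 𝓓(slab d T, ℝ)) (t : ℝ) (ξ : Space d) :
    tf (lap ψ) t ξ = -((nu * ‖ξ‖ ^ 2 : ℝ) : ℂ) * tf ψ t ξ := tf_lap ψ t ξ

lemma tf_dx_dx (k i : Fin d) (ψ : 𝓓(slab d T, ℝ)) (t : ℝ) (ξ : Space d) :
    tf (dx k (dx i ψ)) t ξ = -(nu : ℂ) * (ξ k * ξ i) * tf ψ t ξ := by
  rw [tf_dx, tf_dx, nu]
  push_cast
  linear_combination (4 * (Real.pi : ℂ) ^ 2 * ξ k * ξ i * tf ψ t ξ) * Complex.I_sq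

lemma lineDeriv_dist_apply (P : 𝓓'(slab d T, ℝ)) (i : Fin d) (ψ : 𝓓(slab d T, ℝ)) :
    (∂_{((0, e i) : ℝ × Space d)} P : 𝓓'(slab d T, ℝ)) ψ = -P (dx i ψ) := by
  rw [Distribution.lineDerivOp_apply_apply, map_neg]
  rfl

/-- The curl of the curl kills the pressure. -/
lemma weakForm_lap_sub_eq_zero {w : Fin d → 𝓓(slab d T, ℝ) → ℝ} {P : 𝓓'(slab d T, ℝ)}
    (hP : ∀ (i : Fin d) (ψ : 𝓓(slab d T, ℝ)),
      w i ψ - (∂_{((0, e i) : ℝ × Space d)} P : 𝓓'(slab d T, ℝ)) ψ = 0) (i : Fin d)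
    (ψ : 𝓓(slab d T, ℝ)) : w i (lap ψ) - ∑ k, w k (dx k (dx i ψ)) = 0 := by
  have h1 : ∀ k χ, w k χ = -P (dx k χ) := fun k χ => by
    rw [← lineDeriv_dist_apply]; linarith [hP k χ]
  simp only [h1, Finset.sum_neg_distrib]
  rw [← map_sum, dx_lap_comm, lap]
  ring

/-- The evolution equation of the velocity on the Fourier side, tested against a Laplacian. -/
lemma IsRep.weak_fst [NeZero d] (hz : IsRep T u b z)
    (hU : ∀ t ∈ timeInterval T, IsGivenBy (u t) (U t) ∧ IsGivenBy (b t) (B t))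
    (hdiv : ∀ t ∈ timeInterval T, ∀ᵐ ξ, dotc ξ (z t ξ).1 = 0) {P : 𝓓'(slab d T, ℝ)}
    (hP : ∀ (i : Fin d) (ψ : 𝓓(slab d T, ℝ)), weakForm U U B B i ψ
      - (∂_{((0, e i) : ℝ × Space d)} P : 𝓓'(slab d T, ℝ)) ψ = 0) (i : Fin d)
    (ψ : 𝓓(slab d T, ℝ)) :
    ∫ t in timeInterval T,
      ((∫ ξ, tf (dt (lap ψ) + lap (lap ψ)) t ξ * coFst i (z t ξ))
        + ∫ ξ, tf (lap ψ) t ξ * coFst i (bconv mhdSym (z t) (z t) ξ)) = 0 := by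
  -- the test functions of the `k`-th equation in the curl of the curl
  set χ : Fin d → 𝓓(slab d T, ℝ) := fun k => dx k (dx i ψ) with hχ
  set w : Fin d → 𝓓(slab d T, ℝ) → ℝ → ℂ := fun k ψ t =>
    -(∫ ξ, tf (dt ψ + lap ψ) t ξ * coFst k (z t ξ))
      + 2 * Real.pi * Complex.I * ∫ ξ, tf ψ t ξ * coFst k (bconv nl (z t) (z t) ξ) with hw
  have j1 := fun k ψ => hz.integrable_tf_mul (coFst k) (dt ψ + lap ψ)
  have j2 := fun k ψ => hz.integrable_tf_mul_bconv (coFst k) isSymbol_nl ψ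
  have hwi : ∀ k ψ, IntegrableOn (w k ψ) (timeInterval T) := fun k ψ =>
    (j1 k ψ).integral_prod_left.neg.add ((j2 k ψ).integral_prod_left.const_mul _)
  have hwW : ∀ k ψ, ((weakForm U U B B k ψ : ℝ) : ℂ) = ∫ t in timeInterval T, w k ψ t :=
    fun k ψ => by
      rw [hz.weakForm_fst hU k ψ]
      simp only [hw, tf_dt_add_lap, coFst_apply]
  have h1 := congrArg (fun x : ℝ => (x : ℂ)) (weakForm_lap_sub_eq_zero hP i ψ)
  simp only [Complex.ofReal_sub, Complex.ofReal_sum, Complex.ofReal_zero, hwW] at h1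
  rw [← integral_finsetSum _ fun k _ => hwi k _, ← integral_sub (hwi _ _)
    (integrable_finsetSum _ fun k _ => hwi k _)] at h1
  rw [← neg_eq_zero, ← integral_neg, ← h1]
  refine integral_congr_ae ?_
  have a1 : ∀ᵐ t ∂(volume.restrict (timeInterval T)), ∀ k,
      Integrable fun ξ => tf (dt (χ k) + lap (χ k)) t ξ * coFst k (z t ξ) :=
    ae_all_iff.2 fun k => (j1 k (χ k)).prod_right_ae
  have a2 : ∀ᵐ t ∂(volume.restrict (timeInterval T)), ∀ k,
      Integrable fun ξ => tf (χ k) t ξ * coFst k (bconv nl (z t) (z t) ξ) :=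
    ae_all_iff.2 fun k => (j2 k (χ k)).prod_right_ae
  filter_upwards [hz.ae_bconv, (j1 i (lap ψ)).prod_right_ae, (j2 i (lap ψ)).prod_right_ae,
    a1, a2, ae_restrict_mem (measurableSet_timeInterval T)] with t ht k1 k2 k3 k4 htA
  simp only [Function.uncurry] at k1 k2
  have e1 : ∑ k, ∫ ξ, tf (dt (χ k) + lap (χ k)) t ξ * coFst k (z t ξ) = 0 := by
    rw [← integral_finsetSum _ fun k _ => k3 k]
    refine (integral_congr_ae ?_).trans (integral_zero _ _)
    filter_upwards [hdiv t htA] with ξ hξ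
    have h2 : ∀ k, tf (dt (χ k)) t ξ = -(nu : ℂ) * (ξ k * ξ i) * tf (dt ψ) t ξ := fun k =>
      tf_dt_of_tf_eq_mul (m := fun ξ => -(nu : ℂ) * (ξ k * ξ i)) (fun t ξ => tf_dx_dx k i ψ t ξ) t ξ
    have h3 : ∀ k, tf (dt (χ k) + lap (χ k)) t ξ * coFst k (z t ξ)
        = (-(nu : ℂ) * ξ i * (tf (dt ψ) t ξ - (nu * ‖ξ‖ ^ 2 : ℝ) * tf ψ t ξ))
          * (ξ k * (z t ξ).1 k) := fun k => by
      rw [tf_dt_add_lap, h2, tf_dx_dx, coFst_apply]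
      ring
    simp only [h3]
    rw [← Finset.mul_sum]
    change _ * dotc ξ (z t ξ).1 = 0
    rw [hξ, mul_zero]
  have e2 : 2 * Real.pi * Complex.I * (∫ ξ, tf (lap ψ) t ξ * coFst i (bconv nl (z t) (z t) ξ))
      - ∑ k, 2 * Real.pi * Complex.I * (∫ ξ, tf (χ k) t ξ * coFst k (bconv nl (z t) (z t) ξ))
      = -∫ ξ, tf (lap ψ) t ξ * coFst i (bconv mhdSym (z t) (z t) ξ) := by
    rw [← Finset.mul_sum, ← mul_sub, ← integral_finsetSum _ fun k _ => k4 k,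
      ← integral_sub k2 (integrable_finsetSum _ fun k _ => k4 k), ← integral_const_mul,
      ← integral_neg]
    refine integral_congr_ae ?_
    filter_upwards [ht, compl_mem_ae_iff.2 (measure_singleton (0 : Space d))] with ξ hξ hξ0
    have h0 : ((‖ξ‖ ^ 2 : ℝ) : ℂ) ≠ 0 := by
      exact_mod_cast pow_ne_zero 2 (norm_ne_zero_iff.2 hξ0)
    have h3 : ∑ k, tf (χ k) t ξ * coFst k (bconv nl (z t) (z t) ξ)
        = -(nu : ℂ) * ξ i * tf ψ t ξ * dotc ξ (bconv nl (z t) (z t) ξ).1 := by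
      rw [dotc, Finset.mul_sum]
      refine Finset.sum_congr rfl fun k _ => ?_
      rw [tf_dx_dx, coFst_apply]
      ring
    rw [h3, hξ, tf_lap_nu]
    simp only [coFst_apply, Prod.smul_fst, PiLp.smul_apply, smul_eq_mul, leray, PiLp.sub_apply,
      cvec_apply, Complex.ofReal_mul]
    field_simp
    ring
  simp only [hχ] at e1 e2
  simp only [hw, Finset.sum_add_distrib, Finset.sum_neg_distrib, e1]
  rw [neg_add, ← e2]
  ring

/-- The evolution equation of the magnetic field on the Fourier side. -/
lemma IsRep.weak_snd (hz : IsRep T u b z)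
    (hU : ∀ t ∈ timeInterval T, IsGivenBy (u t) (U t) ∧ IsGivenBy (b t) (B t))
    (hP : ∀ (i : Fin d) (ψ : 𝓓(slab d T, ℝ)), weakForm B U B U i ψ = 0) (i : Fin d)
    (ψ : 𝓓(slab d T, ℝ)) :
    ∫ t in timeInterval T,
      ((∫ ξ, tf (dt ψ + lap ψ) t ξ * coSnd i (z t ξ))
        + ∫ ξ, tf ψ t ξ * coSnd i (bconv mhdSym (z t) (z t) ξ)) = 0 := by
  have h1 := hz.weakForm_snd hU i ψ
  rw [hP, Complex.ofReal_zero] at h1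
  rw [← neg_eq_zero, ← integral_neg, h1]
  refine integral_congr_ae ?_
  filter_upwards [hz.ae_bconv] with t ht
  simp only [tf_dt_add_lap, neg_add, coSnd_apply]
  congr 1
  rw [← integral_const_mul, ← integral_neg]
  refine integral_congr_ae ?_
  filter_upwards [ht] with ξ hξ
  simp only [hξ, Prod.smul_snd, PiLp.smul_apply, smul_eq_mul]
  ring

end

section

variable {d : ℕ} {T : ℝ≥0∞} {φ : Space d → ℂ}

/-! ### Test functions with separated variables -/

/-- The Fourier transform of a real function of space. -/
def rft (θ : Space d → ℝ) (ξ : Space d) : ℂ := 𝓕⁻ (fun x => (θ x : ℂ)) ξ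

lemma rft_eq_integral (θ : Space d → ℝ) (ξ : Space d) :
    rft θ ξ = ∫ x, Complex.exp (↑(2 * Real.pi * inner ℝ x ξ) * Complex.I) * (θ x : ℂ) := by
  rw [rft, Real.fourierInv_eq']
  rfl

lemma rft_comp_sub (θ : Space d → ℝ) (x₀ ξ : Space d) : rft (fun x => θ (x - x₀)) ξ
    = Complex.exp (↑(2 * Real.pi * inner ℝ ξ x₀) * Complex.I) * rft θ ξ := by
  rw [rft_eq_integral, rft_eq_integral, ← integral_const_mul, ← integral_add_right_eq_self _ x₀]
  refine integral_congr_ae (Eventually.of_forall fun x => ?_)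
  simp only [add_sub_cancel_right]
  rw [← mul_assoc, ← Complex.exp_add, inner_add_left, real_inner_comm ξ x₀]
  congr 2
  push_cast
  ring

lemma rft_eq_schwartz {θ : Space d → ℝ} (hθ : ContDiff ℝ ∞ θ) (hc : HasCompactSupport θ) :
    ∃ g : 𝓢(Space d, ℂ), ∀ ξ, rft θ ξ = g ξ := by
  have h1 : HasCompactSupport (Complex.ofRealCLM ∘ θ) := hc.comp_left rfl
  have h2 : ContDiff ℝ ∞ (Complex.ofRealCLM ∘ θ) := by fun_prop
  refine ⟨𝓕⁻ (h1.toSchwartzMap h2), fun ξ => ?_⟩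
  rw [SchwartzMap.fourierInv_coe]
  rfl

/-- Approximations of unity have Fourier transforms which tend to `1`. -/
lemma exists_test_seq (d : ℕ) : ∃ θ : ℕ → Space d → ℝ, (∀ n, ContDiff ℝ ∞ (θ n)) ∧
    (∀ n, HasCompactSupport (θ n)) ∧ ∀ ξ, Tendsto (fun n => rft (θ n) ξ) atTop (𝓝 1) := by
  let f : ℕ → ContDiffBump (0 : Space d) := fun n =>
    ⟨1 / ((n : ℝ) + 1) / 2, 1 / ((n : ℝ) + 1), by positivity, half_lt_self (by positivity)⟩
  refine ⟨fun n => (f n).normed volume, fun n => (f n).contDiff_normed,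
    fun n => (f n).hasCompactSupport_normed, fun ξ => ?_⟩
  have hcont : Continuous fun x : Space d =>
      Complex.exp (↑(2 * Real.pi * inner ℝ (-x) ξ) * Complex.I) := by fun_prop
  have h1 := ContDiffBump.convolution_tendsto_right_of_continuous (μ := (volume : Measure (Space
      d)))
    (φ := f) (l := atTop) tendsto_one_div_add_atTop_nhds_zero_nat hcont 0
  simp only [neg_zero, inner_zero_left, mul_zero, Complex.ofReal_zero, zero_mul,
    Complex.exp_zero] at h1
  refine h1.congr fun n => ?_
  rw [rft_eq_integral, convolution]
  refine integral_congr_ae (Eventually.of_forall fun x => ?_)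
  simp only [zero_sub, neg_neg, ContinuousLinearMap.lsmul_apply, Complex.real_smul]
  ring

/-- Test functions separate the points, also after multiplication by a nonvanishing symbol `p`: the
translates of one of them only see the function through a Fourier transform. -/
lemma ae_eq_zero_of_forall_test {X p : Space d → ℂ} (hp : ∀ᵐ ξ, p ξ ≠ 0)
    (h : ∀ θ : Space d → ℝ, ContDiff ℝ ∞ θ → HasCompactSupport θ →
      Integrable (fun ξ => p ξ * rft θ ξ * X ξ) ∧ ∫ ξ, p ξ * rft θ ξ * X ξ = 0) :
    ∀ᵐ ξ, X ξ = 0 := by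
  have h1 : ∀ θ : Space d → ℝ, ContDiff ℝ ∞ θ → HasCompactSupport θ →
      ∀ᵐ ξ, p ξ * rft θ ξ * X ξ = 0 := by
    intro θ hθ hc
    have hi := (h θ hθ hc).1
    -- translations of `θ` give all values of the inverse Fourier transform
    have h2 : ∀ x₀, 𝓕⁻ (fun ξ => p ξ * rft θ ξ * X ξ) x₀ = 0 := by
      intro x₀
      have h3 := (h (fun x => θ (x - x₀)) (hθ.comp (contDiff_id.sub contDiff_const))
        (hc.comp_homeomorph (Homeomorph.subRight x₀))).2
      rw [Real.fourierInv_eq', ← h3]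
      refine integral_congr_ae (Eventually.of_forall fun ξ => ?_)
      simp only [rft_comp_sub, smul_eq_mul]
      ring
    refine ae_eq_zero_of_forall_schwartz hi.locallyIntegrable fun ψ _ => ?_
    have h3 := integral_fourierInv_smul (𝓕 ψ).integrable hi
    have h4 : 𝓕⁻ (⇑(𝓕 ψ : 𝓢(Space d, ℂ))) = ψ := by
      rw [← SchwartzMap.fourierInv_coe]; simp
    rw [h4] at h3
    rw [h3]
    simp [h2]
  obtain ⟨θ, hθ, hc, hlim⟩ := exists_test_seq d
  filter_upwards [hp, ae_all_iff.2 fun n => h1 (θ n) (hθ n) (hc n)] with ξ hpξ hξ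
  obtain ⟨n, hn⟩ := ((hlim ξ).eventually_ne one_ne_zero).exists
  have := hξ n
  rwa [mul_eq_zero, or_iff_right (mul_ne_zero hpξ hn)] at this

lemma exists_test_prod {χ : ℝ → ℝ} {θ : Space d → ℝ} {b : ℝ} (hb : b ∈ timeInterval T)
    (hχ : ContDiff ℝ ∞ χ) (hχc : HasCompactSupport χ) (hχs : tsupport χ ⊆ Ioo 0 b)
    (hθ : ContDiff ℝ ∞ θ) (hθc : HasCompactSupport θ) :
    ∃ ψ : 𝓓(slab d T, ℝ), ∀ t ξ, tf ψ t ξ = χ t * rft θ ξ := by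
  have hsub : tsupport (fun p : ℝ × Space d => χ p.1 * θ p.2) ⊆ tsupport χ ×ˢ tsupport θ := by
    refine closure_minimal (fun p hp => ?_) ((isClosed_tsupport χ).prod (isClosed_tsupport θ))
    have := mul_ne_zero_iff.1 hp
    exact ⟨subset_tsupport _ this.1, subset_tsupport _ this.2⟩
  let ψ : 𝓓(slab d T, ℝ) :=
    { toFun := fun p => χ p.1 * θ p.2
      contDiff' := (hχ.comp contDiff_fst).mul (hθ.comp contDiff_snd)
      hasCompactSupport' := HasCompactSupport.of_support_subset_isCompact
        (hχc.isCompact.prod hθc.isCompact) (subset_closure.trans hsub)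
      tsupport_subset' := fun p hp => by
        have h1 := hχs (hsub hp).1
        exact ⟨h1.1, ((ENNReal.ofReal_lt_ofReal_iff (h1.1.trans h1.2)).2 h1.2).trans_le hb.2⟩ }
  refine ⟨ψ, fun t ξ => ?_⟩
  rw [tf_eq_integral, rft_eq_integral, ← integral_const_mul]
  refine integral_congr_ae (Eventually.of_forall fun x => ?_)
  have : ψ (t, x) = χ t * θ x := rfl
  simp only [this, Complex.ofReal_mul]
  ring

/-! ### Continuity in time of the tested field -/

lemma bs_indicator_compl_le {s : ℝ} (hs : 0 ≤ s) (F : Space d → ℝ≥0∞) :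
    bs 0 ((Metric.closedBall (0 : Space d) 1)ᶜ.indicator F) ≤ bs s F := by
  have := bs_le_of_shell_ae (F := (Metric.closedBall (0 : Space d) 1)ᶜ.indicator F) (G := F) (c :=
      1)
    (by simp) 0 s fun j => Eventually.of_forall fun ξ hξ => ?_
  · simpa using this
  by_cases hm : ξ ∈ (Metric.closedBall (0 : Space d) 1)ᶜ
  · rw [indicator_of_mem hm, one_mul]
    refine le_mul_of_one_le_left' ?_
    have h3 : (2 : ℝ) ^ (0 : ℤ) < 2 ^ (j + 1) := by
      refine lt_trans ?_ hξ.2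
      simpa using hm
    have h4 : 0 < j + 1 := (zpow_lt_zpow_iff_right₀ (by norm_num : (1 : ℝ) < 2)).1 h3
    have h5 : (0 : ℝ) ≤ j := by exact_mod_cast (by omega : 0 ≤ j)
    exact one_le_two_rpow (by positivity)
  · simp [indicator_of_notMem hm]

/-- The low frequencies are integrable, the high frequencies square integrable. -/
lemma lintegral_mul_le_bs [NeZero d] (m : 𝓢(Space d, ℂ)) {s : ℝ} (hs : 0 ≤ s) (hsd : s ≤ d / 2) :
    ∃ C : ℝ≥0∞, C ≠ ⊤ ∧ ∀ F : Space d → ℝ≥0∞, Measurable F →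
      ∫⁻ ξ, ‖m ξ‖ₑ * F ξ ≤ C * bs s F := by
  obtain ⟨C, hC, h⟩ := lintegral_closedBall_le_bs d hsd 1
  obtain ⟨K, -, hK⟩ := m.decay 0 0
  simp only [pow_zero, norm_iteratedFDeriv_zero, one_mul] at hK
  have hm2 : n2 volume (fun ξ => ‖m ξ‖ₑ) ≠ ⊤ := by
    have := (m.memLp 2 volume).2
    rw [eLpNorm_eq_lintegral_rpow_enorm_toReal (by norm_num) (by norm_num)] at this
    simpa [n2] using this.ne
  refine ⟨ENNReal.ofReal K * C + n2 volume (fun ξ => ‖m ξ‖ₑ), by finiteness, fun F hF => ?_⟩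
  have hBm : MeasurableSet (Metric.closedBall (0 : Space d) 1) := measurableSet_closedBall
  rw [← lintegral_add_compl _ hBm, add_mul]
  refine add_le_add ?_ ?_
  · calc ∫⁻ ξ in Metric.closedBall 0 1, ‖m ξ‖ₑ * F ξ
        ≤ ∫⁻ ξ in Metric.closedBall 0 1, ENNReal.ofReal K * F ξ := by
          refine lintegral_mono fun ξ => mul_le_mul_left ?_ _
          rw [← ofReal_norm]
          exact ENNReal.ofReal_le_ofReal (hK ξ)
      _ ≤ _ := by
          rw [lintegral_const_mul' _ _ (by simp), mul_assoc]
          exact mul_le_mul_right (h F hF) _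
  · calc ∫⁻ ξ in (Metric.closedBall 0 1)ᶜ, ‖m ξ‖ₑ * F ξ
        = ∫⁻ ξ, ‖m ξ‖ₑ * (Metric.closedBall (0 : Space d) 1)ᶜ.indicator F ξ := by
          rw [← lintegral_indicator hBm.compl]
          refine lintegral_congr fun ξ => ?_
          rw [indicator_mul_right]
      _ ≤ n2 volume (fun ξ => ‖m ξ‖ₑ)
          * n2 volume ((Metric.closedBall (0 : Space d) 1)ᶜ.indicator F) :=
          lintegral_mul_le_n2 m.continuous.enorm.measurable.aemeasurable
            (hF.indicator hBm.compl).aemeasurable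
      _ ≤ _ := by
          gcongr
          exact (n2_le_bs_zero (hF.indicator hBm.compl)).trans (bs_indicator_compl_le hs F)

/-- Testing a field which is continuous with values in a Besov space gives a continuous function of
time. -/
lemma MemCb.continuousOn_integral [NeZero d] (hφ : IsLittlewoodPaley φ) {s : ℝ} (hs : 0 ≤ s)
    (hsd : s ≤ d / 2) {u : ℝ → TField d} (h : MemCb φ T s u) {z : ℝ → Space d → Vec d}
    (hz : Measurable (Function.uncurry z)) (hft : ∀ t ∈ timeInterval T, IsFT (u t) (z t))
    (m : 𝓢(Space d, ℂ)) : ContinuousOn (fun t => ∫ ξ, m ξ • z t ξ) (timeInterval T) := by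
  obtain ⟨C, hC, h1⟩ := lintegral_mul_le_bs m hs hsd
  intro t₀ ht₀
  rw [ContinuousWithinAt, tendsto_iff_edist_tendsto_0]
  have h3 := ENNReal.Tendsto.const_mul (a := C * (2 ^ s + 1 + 2 ^ (-s))) (h.continuous t₀ ht₀)
    (Or.inr (ENNReal.mul_ne_top hC (three_ne_top s)))
  rw [mul_zero] at h3
  refine tendsto_of_tendsto_of_tendsto_of_le_of_le' tendsto_const_nhds h3
    (Eventually.of_forall fun _ => zero_le) ?_
  filter_upwards [self_mem_nhdsWithin] with t ht
  have hd := (hft t ht).sub (hft t₀ ht₀)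
  have hm : Measurable fun ξ => ‖z t ξ - z t₀ ξ‖ₑ :=
    ((hz.comp measurable_prodMk_left).sub (hz.comp measurable_prodMk_left)).enorm
  rw [edist_eq_enorm_sub, ← integral_sub ((hft t ht).tame.integrable m)
    ((hft t₀ ht₀).tame.integrable m)]
  refine (enorm_integral_le_lintegral_enorm _).trans ?_
  simp only [← smul_sub, enorm_smul]
  refine (h1 _ hm).trans ?_
  rw [mul_assoc]
  exact mul_le_mul_right (hd.bs_le hφ s) C

end

section

variable {d : ℕ} {T : ℝ≥0∞} {φ : Space d → ℂ}
  {u b : ℝ → TField d} {z : ℝ → Space d → Pair d} {U B : ℝ → Space d → Space d}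

/-! ### From the weak formulation to the integral equation -/

/-- The right-hand side of the evolution equation on the Fourier side, read through `c`. -/
def drift (c : Pair d →L[ℂ] ℂ) (z : ℝ → Space d → Pair d) (s : ℝ) (ξ : Space d) : ℂ :=
  -((nu * ‖ξ‖ ^ 2 : ℝ) : ℂ) * c (z s ξ) + c (bconv mhdSym (z s) (z s) ξ)

section integrable

variable {m : Space d → ℂ} {C : ℝ≥0∞} {s : ℝ}

lemma IsRep.integrable_mul_prod (hz : IsRep T u b z) (c : Pair d →L[ℂ] ℂ)
    (hs : Ioc 0 s ⊆ timeInterval T) (hm : Measurable m) (hC : C ≠ ⊤) (hmC : ∀ ξ, ‖m ξ‖ₑ ≤ C) :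
    Integrable (Function.uncurry fun t ξ => m ξ * c (z t ξ))
      ((volume.restrict (Ioc 0 s)).prod volume) := by
  refine integrable_prod_of_lintegral (Measurable.aestronglyMeasurable ?_) ?_
  · exact (hm.comp measurable_snd).mul (c.continuous.measurable.comp hz.meas)
  · have hbd : ∀ t ξ, ‖m ξ * c (z t ξ)‖ₑ ≤ (C * ‖c‖ₑ) * ‖z t ξ‖ₑ := fun t ξ => by
      rw [enorm_mul, mul_assoc]
      exact mul_le_mul' (hmC ξ) (c.le_opENorm _)
    refine lt_of_le_of_lt (lintegral_mono fun t => lintegral_mono fun ξ => hbd t ξ) ?_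
    have hc : C * ‖c‖ₑ ≠ ⊤ := by finiteness
    simp_rw [lintegral_const_mul' _ _ hc]
    exact ENNReal.mul_lt_top hc.lt_top (hz.lintegral_lt_top hs (by simp))

lemma IsRep.integrable_mul_bconv_prod (hz : IsRep T u b z) (c : Pair d →L[ℂ] ℂ)
    (hs : Ioc 0 s ⊆ timeInterval T) (hm : Measurable m) (hC : C ≠ ⊤)
    (hmC : ∀ ξ, ‖ξ‖ₑ * ‖m ξ‖ₑ ≤ C) :
    Integrable (Function.uncurry fun t ξ => m ξ * c (bconv mhdSym (z t) (z t) ξ))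
      ((volume.restrict (Ioc 0 s)).prod volume) := by
  refine integrable_prod_of_lintegral (Measurable.aestronglyMeasurable ?_) ?_
  · exact (hm.comp measurable_snd).mul
      (c.continuous.measurable.comp (measurable_bconv isSymbol_mhdSym hz.meas hz.meas))
  · have hbd : ∀ t ξ, ‖m ξ * c (bconv mhdSym (z t) (z t) ξ)‖ₑ
        ≤ (C * ‖c‖ₑ * symK) * cv (fun ξ => ‖z t ξ‖ₑ) (fun ξ => ‖z t ξ‖ₑ) ξ := fun t ξ => by
      rw [enorm_mul]
      calc ‖m ξ‖ₑ * ‖c (bconv mhdSym (z t) (z t) ξ)‖ₑ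
          ≤ ‖m ξ‖ₑ * (‖c‖ₑ *
            (symK * ‖ξ‖ₑ * cv (fun ξ => ‖z t ξ‖ₑ) (fun ξ => ‖z t ξ‖ₑ) ξ)) := by
            refine mul_le_mul_right ((c.le_opENorm _).trans ?_) _
            exact mul_le_mul_right (enorm_bconv_le isSymbol_mhdSym _ _ _) _
        _ = (‖ξ‖ₑ * ‖m ξ‖ₑ) * ‖c‖ₑ * symK * cv (fun ξ => ‖z t ξ‖ₑ) (fun ξ => ‖z t ξ‖ₑ) ξ := by
            ring
        _ ≤ _ := by gcongr; exact hmC ξ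
    refine lt_of_le_of_lt (lintegral_mono fun t => lintegral_mono fun ξ => hbd t ξ) ?_
    have hc : C * ‖c‖ₑ * symK ≠ ⊤ := by finiteness
    simp_rw [lintegral_const_mul' _ _ hc]
    exact ENNReal.mul_lt_top hc.lt_top ((lintegral_mono_set hs).trans_lt hz.lintegral_cv)

end integrable

lemma exists_enorm_mul_le (m : 𝓢(Space d, ℂ)) (k : ℕ) :
    ∃ C : ℝ≥0∞, C ≠ ⊤ ∧ ∀ ξ, ‖ξ‖ₑ ^ k * ‖m ξ‖ₑ ≤ C := by
  obtain ⟨K, -, hK⟩ := m.decay k 0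
  refine ⟨ENNReal.ofReal K, by simp, fun ξ => ?_⟩
  have := hK ξ
  rw [norm_iteratedFDeriv_zero] at this
  rw [← ofReal_norm, ← ofReal_norm, ← ENNReal.ofReal_pow (norm_nonneg _),
    ← ENNReal.ofReal_mul (by positivity)]
  exact ENNReal.ofReal_le_ofReal this

/-- The equation tested against `m`, integrated in time. -/
lemma IsRep.integral_eq_of_weak (hz : IsRep T u b z) (c : Pair d →L[ℂ] ℂ) {s : ℝ} (hs0 : 0 < s)
    (hs : s ∈ timeInterval T) (m : 𝓢(Space d, ℂ))
    (hcont : ContinuousOn (fun t => ∫ ξ, m ξ * c (z t ξ)) (timeInterval T))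
    (hweak : ∀ χ κ : ℝ → ℝ, ContDiff ℝ ∞ χ → HasCompactSupport χ → tsupport χ ⊆ Ioo 0 s →
      (∀ t, HasDerivAt χ (κ t) t) → ∫ t in timeInterval T,
        ((∫ ξ, (κ t - (nu * ‖ξ‖ ^ 2 : ℝ) * χ t) * m ξ * c (z t ξ))
          + ∫ ξ, χ t * m ξ * c (bconv mhdSym (z t) (z t) ξ)) = 0) :
    ∀ t ∈ Icc 0 s, Integrable (fun ξ => m ξ * ∫ τ in Ioc 0 t, drift c z τ ξ) ∧
      ∫ ξ, m ξ * c (z t ξ)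
        = (∫ ξ, m ξ * c (z 0 ξ)) + ∫ ξ, m ξ * ∫ τ in Ioc 0 t, drift c z τ ξ := by
  have hsA : Ioc 0 s ⊆ timeInterval T := Ioc_subset_timeInterval hs
  obtain ⟨C0, hC0, h0⟩ := exists_enorm_mul_le m 0
  obtain ⟨C1, hC1, h1⟩ := exists_enorm_mul_le m 1
  obtain ⟨C2, hC2, h2⟩ := exists_enorm_mul_le m 2
  simp only [pow_zero, one_mul] at h0
  simp only [pow_one] at h1
  have hmm : Measurable m := m.continuous.measurable
  have i0 := hz.integrable_mul_prod c hsA hmm hC0 h0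
  have i1 := hz.integrable_mul_bconv_prod c hsA hmm hC1 h1
  have i2 := hz.integrable_mul_prod c hsA (m := fun ξ => -((nu * ‖ξ‖ ^ 2 : ℝ) : ℂ) * m ξ)
    (C := ENNReal.ofReal nu * C2) ((Continuous.measurable (by fun_prop)).mul hmm) (by finiteness)
    fun ξ => by
      rw [enorm_mul, enorm_neg, ← ofReal_norm, Complex.norm_real, norm_mul, norm_pow, norm_norm,
        Real.norm_of_nonneg nu_pos.le, ENNReal.ofReal_mul nu_pos.le,
        ENNReal.ofReal_pow (norm_nonneg _), ofReal_norm, mul_assoc]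
      exact mul_le_mul_right (h2 ξ) _
  have iD : Integrable (Function.uncurry fun t ξ => m ξ * drift c z t ξ)
      ((volume.restrict (Ioc 0 s)).prod volume) := by
    refine (i2.add i1).congr (Eventually.of_forall fun p => ?_)
    simp only [Pi.add_apply, Function.uncurry, drift]
    ring
  -- the weak derivative in time of the tested field
  set Q : ℝ → ℂ := fun t => ∫ ξ, m ξ * drift c z t ξ with hQ
  have hQi : IntegrableOn Q (Ioc 0 s) := iD.integral_prod_left
  have hIcc : Icc 0 s ⊆ timeInterval T := fun t ht =>
    ⟨ht.1, (ENNReal.ofReal_le_ofReal ht.2).trans hs.2⟩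
  have key := eq_add_integral_of_weak_deriv hs0 (hcont.mono hIcc) hQi fun χ κ hχ hχc hχs hd => by
    rw [← hweak χ κ hχ hχc hχs hd]
    have hz0 : ∀ t, t ∉ Ioc 0 s → χ t = 0 ∧ κ t = 0 := fun t ht => by
      have ht' : t ∉ tsupport χ := fun h => ht ⟨(hχs h).1, (hχs h).2.le⟩
      refine ⟨image_eq_zero_of_notMem_tsupport ht', ?_⟩
      rw [← (hd t).deriv]
      by_contra h
      exact ht' (support_deriv_subset h)
    rw [setIntegral_eq_of_subset_of_forall_sdiff_eq_zero (measurableSet_timeInterval T) hsA]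
    · refine integral_congr_ae ?_
      filter_upwards [i0.prod_right_ae, i1.prod_right_ae, i2.prod_right_ae] with t j0 j1 j2
      simp only [Function.uncurry] at j0 j1 j2
      have e1 : ∫ ξ, (κ t - (nu * ‖ξ‖ ^ 2 : ℝ) * χ t) * m ξ * c (z t ξ)
          = κ t * (∫ ξ, m ξ * c (z t ξ))
            + χ t * ∫ ξ, -((nu * ‖ξ‖ ^ 2 : ℝ) : ℂ) * m ξ * c (z t ξ) := by
        rw [← integral_const_mul, ← integral_const_mul,
          ← integral_add (j0.const_mul _) (j2.const_mul _)]
        refine integral_congr_ae (Eventually.of_forall fun ξ => ?_)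
        simp only
        ring
      have e2 : ∫ ξ, χ t * m ξ * c (bconv mhdSym (z t) (z t) ξ)
          = χ t * ∫ ξ, m ξ * c (bconv mhdSym (z t) (z t) ξ) := by
        rw [← integral_const_mul]
        simp only [mul_assoc]
      have e3 : Q t = (∫ ξ, -((nu * ‖ξ‖ ^ 2 : ℝ) : ℂ) * m ξ * c (z t ξ))
          + ∫ ξ, m ξ * c (bconv mhdSym (z t) (z t) ξ) := by
        rw [← integral_add j2 j1]
        refine integral_congr_ae (Eventually.of_forall fun ξ => ?_)
        simp only [drift]
        ring
      rw [e1, e2, e3]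
      ring
    · rintro t ⟨-, ht⟩
      simp [hz0 t ht]
  intro t ht
  have hle : volume.restrict (Ioc 0 t) ≤ volume.restrict (Ioc (0 : ℝ) s) :=
    Measure.restrict_mono_set _ (Ioc_subset_Ioc_right ht.2)
  have iDt : Integrable (Function.uncurry fun t ξ => m ξ * drift c z t ξ)
      ((volume.restrict (Ioc 0 t)).prod volume) := by
    refine iD.mono_measure ?_
    rw [← Measure.restrict_univ (μ := (volume : Measure (Space d))), Measure.prod_restrict,
      Measure.prod_restrict]
    exact Measure.restrict_mono_set _ (prod_mono_left (Ioc_subset_Ioc_right ht.2))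
  have h3 := iDt.integral_prod_right
  simp only [Function.uncurry, integral_const_mul] at h3
  refine ⟨h3, (key t ht).trans ?_⟩
  congr 1
  rw [hQ, integral_integral_swap iDt]
  simp only [integral_const_mul]

/-- The evolution equation holds at almost every frequency, in integrated form. -/
lemma IsRep.integral_equation [NeZero d] (hz : IsRep T u b z) (c : Pair d →L[ℂ] ℂ)
    (hcont : ∀ m : 𝓢(Space d, ℂ), ContinuousOn (fun t => ∫ ξ, m ξ * c (z t ξ)) (timeInterval T))
    (hint : ∀ m : 𝓢(Space d, ℂ), ∀ t ∈ timeInterval T, Integrable fun ξ => m ξ * c (z t ξ))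
    (hweak : ∀ ψ : 𝓓(slab d T, ℝ), ∫ t in timeInterval T,
      ((∫ ξ, tf (dt (lap ψ) + lap (lap ψ)) t ξ * c (z t ξ))
        + ∫ ξ, tf (lap ψ) t ξ * c (bconv mhdSym (z t) (z t) ξ)) = 0) :
    ∀ t ∈ timeInterval T, ∀ᵐ ξ, c (z t ξ) = c (z 0 ξ) + ∫ τ in Ioc 0 t, drift c z τ ξ := by
  intro s hs
  rcases hs.1.eq_or_lt with h0 | hs0
  · exact Eventually.of_forall fun ξ => by rw [← h0]; simp
  have h0A : (0 : ℝ) ∈ timeInterval T := ⟨le_rfl, by simp⟩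
  have hp : ∀ᵐ ξ : Space d, -((nu * ‖ξ‖ ^ 2 : ℝ) : ℂ) ≠ 0 := by
    filter_upwards [compl_mem_ae_iff.2 (measure_singleton (0 : Space d))] with ξ hξ
    have := mul_ne_zero nu_pos.ne' (pow_ne_zero 2 (norm_ne_zero_iff.2 hξ))
    exact neg_ne_zero.2 (by exact_mod_cast this)
  -- the factor `-ν |ξ|²` of a Laplacian vanishes at the origin only, so that test functions of the
  -- form `Δθ` are enough
  have hX := ae_eq_zero_of_forall_test (d := d)
    (X := fun ξ => c (z s ξ) - c (z 0 ξ) - ∫ τ in Ioc 0 s, drift c z τ ξ) hp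
    fun θ hθ hθc => by
    obtain ⟨g, hg⟩ := rft_eq_schwartz hθ hθc
    have ht : (fun ξ : Space d => -((nu * ‖ξ‖ ^ 2 : ℝ) : ℂ)).HasTemperateGrowth := by
      have h1 : (fun ξ : Space d => ‖ξ‖ ^ 2).HasTemperateGrowth :=
        Function.hasTemperateGrowth_norm_sq _
      exact (Function.HasTemperateGrowth.comp Function.Complex.hasTemperateGrowth_ofReal
        ((Function.HasTemperateGrowth.const nu).mul h1)).neg
    set m : 𝓢(Space d, ℂ) :=
      SchwartzMap.smulLeftCLM ℂ (fun ξ : Space d => -((nu * ‖ξ‖ ^ 2 : ℝ) : ℂ)) g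
    have hm : ∀ ξ, -((nu * ‖ξ‖ ^ 2 : ℝ) : ℂ) * rft θ ξ = m ξ := fun ξ => by
      rw [SchwartzMap.smulLeftCLM_apply_apply ht, smul_eq_mul, hg]
    have h1 := hz.integral_eq_of_weak c hs0 hs m (hcont m) (fun χ κ hχ hχc hχs hd => by
      obtain ⟨ψ, hψ⟩ := exists_test_prod hs hχ hχc hχs hθ hθc
      rw [← hweak ψ]
      have e1 : ∀ t ξ, tf (lap ψ) t ξ = χ t * m ξ := fun t ξ => by
        rw [tf_lap_nu, hψ, ← hm]; ring
      have e2 : ∀ t ξ, tf (dt (lap ψ)) t ξ = κ t * m ξ := fun t ξ => by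
        have h2 := hasDerivAt_tf (lap ψ) t ξ
        simp only [e1] at h2
        exact h2.unique ((hd t).ofReal_comp.mul_const (m ξ))
      simp only [tf_dt_add_lap, e1, e2]
      refine integral_congr_ae (Eventually.of_forall fun t => ?_)
      simp only
      congr 1
      refine integral_congr_ae (Eventually.of_forall fun ξ => ?_)
      simp only
      ring) s ⟨hs.1, le_rfl⟩
    simp only [hm, mul_sub]
    refine ⟨((hint m s hs).sub (hint m 0 h0A)).sub h1.1, ?_⟩
    have e3 := integral_sub ((hint m s hs).sub (hint m 0 h0A)) h1.1
    simp only [Pi.sub_apply] at e3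
    rw [e3,
      integral_sub (hint m s hs) (hint m 0 h0A), h1.2]
    ring
  filter_upwards [hX] with ξ hξ
  linear_combination hξ

end

section

variable {d : ℕ} {T : ℝ≥0∞} {φ : Space d → ℂ}
  {u b : ℝ → TField d} {z : ℝ → Space d → Pair d} {u₀ b₀ : TField d}

/-! ### Uniqueness of solutions -/

lemma Pair.ext_coord {v w : Pair d} (h1 : ∀ i, coFst i v = coFst i w)
    (h2 : ∀ i, coSnd i v = coSnd i w) : v = w :=
  Prod.ext (PiLp.ext h1) (PiLp.ext h2)

lemma measurable_drift (c : Pair d →L[ℂ] ℂ) (hz : Measurable (Function.uncurry z)) :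
    Measurable (Function.uncurry (drift c z)) := by
  refine Measurable.add (Measurable.mul (Continuous.measurable (by fun_prop))
    (c.continuous.measurable.comp hz)) ?_
  exact c.continuous.measurable.comp (measurable_bconv isSymbol_mhdSym hz hz)

lemma measurable_integral_drift (c : Pair d →L[ℂ] ℂ) (hz : Measurable (Function.uncurry z)) :
    Measurable fun p : ℝ × Space d => ∫ τ in Ioc 0 p.1, drift c z τ p.2 := by
  have e : (fun p : ℝ × Space d => ∫ τ in Ioc 0 p.1, drift c z τ p.2) = fun p : ℝ × Space d =>
      ∫ s, {q : (ℝ × Space d) × ℝ | 0 < q.2 ∧ q.2 ≤ q.1.1}.indicator (fun q =>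
        drift c z q.2 q.1.2) (p, s) := by
    ext ⟨t, ξ⟩
    simp only
    rw [← integral_indicator measurableSet_Ioc]
    refine integral_congr_ae (Eventually.of_forall fun s => ?_)
    simp [indicator, mem_Ioc]
  rw [e]
  refine StronglyMeasurable.measurable ?_
  refine StronglyMeasurable.integral_prod_right' (Measurable.stronglyMeasurable ?_)
  refine Measurable.indicator ?_ ?_
  · exact (measurable_drift c hz).comp (measurable_snd.prodMk measurable_fst.snd)
  · exact (measurableSet_lt measurable_const measurable_snd).inter
      (measurableSet_le measurable_snd measurable_fst.fst)

lemma IsRep.ae_integrableOn (hz : IsRep T u b z) {s : ℝ} (hs : Ioc 0 s ⊆ timeInterval T) :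
    ∀ᵐ ξ, IntegrableOn (fun t => z t ξ) (Ioc 0 s) ∧
      IntegrableOn (fun t => bconv mhdSym (z t) (z t) ξ) (Ioc 0 s) := by
  have h1 := hz.lintegral_lt_top hs (by simp)
  rw [lintegral_lintegral_swap hz.meas.enorm.aemeasurable] at h1
  have hcv := measurable_cv_enorm hz.meas hz.meas
  have h2 := (lintegral_mono_set hs).trans_lt hz.lintegral_cv
  rw [lintegral_lintegral_swap hcv.aemeasurable] at h2
  have m2 : Measurable fun ξ => ∫⁻ t in Ioc 0 s, cv (fun ξ => ‖z t ξ‖ₑ) (fun ξ => ‖z t ξ‖ₑ) ξ :=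
    hcv.lintegral_prod_left'
  have m1 : Measurable fun ξ => ∫⁻ t in Ioc 0 s, ‖z t ξ‖ₑ := hz.meas.enorm.lintegral_prod_left'
  filter_upwards [ae_lt_top m1 h1.ne, ae_lt_top m2 h2.ne] with ξ k1 k2
  refine ⟨⟨(hz.meas.comp measurable_prodMk_right).aestronglyMeasurable, k1⟩,
    ⟨((measurable_bconv isSymbol_mhdSym hz.meas hz.meas).comp
      measurable_prodMk_right).aestronglyMeasurable, ?_⟩⟩
  rw [hasFiniteIntegral_iff_enorm]
  refine (lintegral_mono fun t => enorm_bconv_le isSymbol_mhdSym (z t) (z t) ξ).trans_lt ?_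
  rw [lintegral_const_mul' _ _ (by finiteness)]
  exact ENNReal.mul_lt_top (by finiteness) k2

/-- A field which satisfies the integrated equation is given by Duhamel's formula. -/
lemma IsRep.mild (hz : IsRep T u b z)
    (hc : ∀ c : Pair d →L[ℂ] ℂ, (∃ i, c = coFst i ∨ c = coSnd i) → ∀ t ∈ timeInterval T,
      ∀ᵐ ξ, c (z t ξ) = c (z 0 ξ) + ∫ τ in Ioc 0 t, drift c z τ ξ) :
    ∀ t ∈ timeInterval T, ∀ᵐ ξ, z t ξ = heat nu (z 0) t ξ + duh nu mhdSym z z t ξ := by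
  intro s hs
  have hsA := Ioc_subset_timeInterval hs
  have hint := hz.ae_integrableOn hsA
  have key : ∀ c : Pair d →L[ℂ] ℂ, (∃ i, c = coFst i ∨ c = coSnd i) →
      ∀ᵐ ξ, c (z s ξ) = c (heat nu (z 0) s ξ + duh nu mhdSym z z s ξ) := by
    intro c hci
    have hms : MeasurableSet {p : ℝ × Space d |
        c (z p.1 p.2) = c (z 0 p.2) + ∫ τ in Ioc 0 p.1, drift c z τ p.2} := by
      refine measurableSet_eq_fun (c.continuous.measurable.comp hz.meas)
        (Measurable.add ?_ (measurable_integral_drift c hz.meas))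
      exact c.continuous.measurable.comp
        ((hz.meas.comp measurable_prodMk_left : Measurable (z 0)).comp measurable_snd)
    -- the exceptional frequencies depend on the time: exchange the quantifiers by Fubini
    have h1 : ∀ᵐ t ∂(volume.restrict (Ioc 0 s)), ∀ᵐ ξ,
        c (z t ξ) = c (z 0 ξ) + ∫ τ in Ioc 0 t, drift c z τ ξ := by
      filter_upwards [ae_restrict_mem measurableSet_Ioc] with t ht
      exact hc c hci t (hsA ht)
    filter_upwards [(Measure.ae_ae_comm hms).1 h1, hc c hci s hs, hint] with ξ k1 k2 ⟨k3, k4⟩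
    have h2 := duhamel_of_integral (a := nu * ‖ξ‖ ^ 2) (y := fun t => c (z t ξ))
      (D := fun t => c (bconv mhdSym (z t) (z t) ξ)) (y₀ := c (z 0 ξ)) (c.integrable_comp k4)
      (c.integrable_comp k3) hs.1 k1 k2
    rw [h2, map_add]
    congr 1
    · rw [heat, ← Complex.coe_smul, map_smul, smul_eq_mul]
    · rw [duh]
      have h3 : IntegrableOn (fun τ => Real.exp (-(nu * ‖ξ‖ ^ 2 * (s - τ)))
          • bconv mhdSym (z τ) (z τ) ξ) (Ioc 0 s) := by
        have hcont : Continuous fun τ : ℝ => Real.exp (-(nu * ‖ξ‖ ^ 2 * (s - τ))) := by fun_prop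
        obtain ⟨K, hK⟩ := (isCompact_Icc (a := (0 : ℝ)) (b := s)).exists_bound_of_continuousOn
          hcont.continuousOn
        refine Integrable.bdd_smul k4 K hcont.aestronglyMeasurable ?_
        filter_upwards [ae_restrict_mem measurableSet_Ioc] with t ht
        exact hK t ⟨ht.1.le, ht.2⟩
      rw [← c.integral_comp_comm h3]
      refine integral_congr_ae (Eventually.of_forall fun τ => ?_)
      simp only
      rw [← Complex.coe_smul, map_smul, smul_eq_mul]
  have k1 : ∀ᵐ ξ, ∀ i, coFst i (z s ξ) = coFst i (heat nu (z 0) s ξ + duh nu mhdSym z z s ξ) :=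
    ae_all_iff.2 fun i => key _ ⟨i, Or.inl rfl⟩
  have k2 : ∀ᵐ ξ, ∀ i, coSnd i (z s ξ) = coSnd i (heat nu (z 0) s ξ + duh nu mhdSym z z s ξ) :=
    ae_all_iff.2 fun i => key _ ⟨i, Or.inr rfl⟩
  filter_upwards [k1, k2] with ξ h1 h2
  exact Pair.ext_coord h1 h2

/-- Every solution in the critical space satisfies Duhamel's formula. -/
lemma IsSolution.mild [NeZero d] (hφ : IsLittlewoodPaley φ) (hd : 0 ≤ (d : ℝ) / 2 - 1)
    (h : IsSolution T u₀ b₀ u b) (hF : MemF φ T ((d : ℝ) / 2) u b) (hz : IsRep T u b z) :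
    ∀ t ∈ timeInterval T, ∀ᵐ ξ, z t ξ = heat nu (z 0) t ξ + duh nu mhdSym z z t ξ := by
  obtain ⟨U, B, hU, ⟨P, hP⟩, hB⟩ := h.equations
  have hdiv : ∀ t ∈ timeInterval T, ∀ᵐ ξ, dotc ξ (z t ξ).1 = 0 := fun t ht =>
    (hz.ft_fst t ht).isDivFree_iff.1 (h.div_u t ht)
  have hcu := fun m => hF.1.1.continuousOn_integral hφ hd (by linarith)
    (z := fun t ξ => (z t ξ).1) hz.meas.fst hz.ft_fst m
  have hcb := fun m => hF.2.1.continuousOn_integral hφ hd (by linarith)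
    (z := fun t ξ => (z t ξ).2) hz.meas.snd hz.ft_snd m
  refine hz.mild fun c hc => ?_
  obtain ⟨i, rfl | rfl⟩ := hc
  · have hi : ∀ m : 𝓢(Space d, ℂ), ∀ t ∈ timeInterval T,
        Integrable fun ξ => m ξ * coFst i (z t ξ) := fun m t ht =>
      integrable_coord ((hz.ft_fst t ht).tame.integrable m) i
    refine hz.integral_equation (coFst i) (fun m => ?_) hi fun ψ => hz.weak_fst hU hdiv hP i ψ
    refine ((EuclideanSpace.proj (𝕜 := ℂ) i).continuous.comp_continuousOn (hcu m)).congr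
      fun t ht => ?_
    exact (integral_apply ((hz.ft_fst t ht).tame.integrable m) i).symm
  · have hi : ∀ m : 𝓢(Space d, ℂ), ∀ t ∈ timeInterval T,
        Integrable fun ξ => m ξ * coSnd i (z t ξ) := fun m t ht =>
      integrable_coord ((hz.ft_snd t ht).tame.integrable m) i
    refine hz.integral_equation (coSnd i) (fun m => ?_) hi fun ψ => hz.weak_snd hU hB i (lap ψ)
    refine ((EuclideanSpace.proj (𝕜 := ℂ) i).continuous.comp_continuousOn (hcb m)).congr
      fun t ht => ?_
    exact (integral_apply ((hz.ft_snd t ht).tame.integrable m) i).symm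

/-- Solutions in the critical space coincide with the one which is small on the Fourier side. -/
theorem IsSolution.unique [NeZero d] (hφ : IsLittlewoodPaley φ) (hd : 0 ≤ (d : ℝ) / 2 - 1)
    {z₀ : Space d → Pair d} (hu₀ : IsFT u₀ fun ξ => (z₀ ξ).1) (hb₀ : IsFT b₀ fun ξ => (z₀ ξ).2)
    (hz₀ : Measurable z₀) (hfin : ∫⁻ ξ, timeNorm (timeInterval T) (heat nu z₀) ξ ≠ ⊤)
    (hz : IsRep T u b z) (hm : IsMild (timeInterval T) z₀ z)
    (hsmall : 4 * kap nu symK * ∫⁻ ξ, timeNorm (timeInterval T) z ξ ≤ 1)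
    {T₁ : ℝ≥0∞} (hT : T₁ ≤ T) {u₁ b₁ : ℝ → TField d} (h : IsSolution T₁ u₀ b₀ u₁ b₁)
    (hF : MemF φ T₁ ((d : ℝ) / 2) u₁ b₁) :
    ∀ t ∈ timeInterval T₁, u₁ t = u t ∧ b₁ t = b t := by
  obtain ⟨z₁, hz₁⟩ := hF.exists_isRep hφ hd
  have hsub : timeInterval T₁ ⊆ timeInterval T := fun t ht => ⟨ht.1, ht.2.trans hT⟩
  have h0 := zero_mem_timeInterval T₁
  have e0 : ∀ᵐ ξ, z₁ 0 ξ = z₀ ξ := by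
    have k1 := (hz₁.ft_fst 0 h0).unique (h.initial_u ▸ hu₀)
    have k2 := (hz₁.ft_snd 0 h0).unique (h.initial_b ▸ hb₀)
    filter_upwards [k1, k2] with ξ h1 h2
    exact Prod.ext h1 h2
  have hmild : ∀ t ∈ timeInterval T₁, ∀ᵐ ξ,
      z₁ t ξ = heat nu z₀ t ξ + duh nu mhdSym z₁ z₁ t ξ := fun t ht => by
    filter_upwards [h.mild hφ hd hF hz₁ t ht, e0] with ξ h1 h2
    rw [h1, heat, heat, h2]
  have hheat := measurable_heat (ν := nu) hz₀
  have hduh := measurable_duh nu isSymbol_mhdSym hz₁.meas hz₁.meas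
  -- the other solution need not be small, but its norm is finite
  have hfin₁ : ∫⁻ ξ, timeNorm (timeInterval T₁) z₁ ξ ≠ ⊤ := by
    have hms : MeasurableSet {p : ℝ × Space d | z₁ p.1 p.2
        = heat nu z₀ p.1 p.2 + duh nu mhdSym z₁ z₁ p.1 p.2} :=
      measurableSet_eq_fun hz₁.meas (hheat.add hduh)
    have h1 : ∀ᵐ t ∂(volume.restrict (timeInterval T₁)), ∀ᵐ ξ,
        z₁ t ξ = heat nu z₀ t ξ + duh nu mhdSym z₁ z₁ t ξ := by
      filter_upwards [ae_restrict_mem (measurableSet_timeInterval T₁)] with t ht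
      exact hmild t ht
    have h2 : ∀ᵐ ξ, timeNorm (timeInterval T₁) z₁ ξ ≤ timeNorm (timeInterval T₁) (heat nu z₀) ξ
        + timeNorm (timeInterval T₁) (duh nu mhdSym z₁ z₁) ξ := by
      filter_upwards [(Measure.ae_ae_comm hms).1 h1] with ξ hξ
      refine le_trans (le_of_eq ?_) (timeNorm_add_le _ hheat hduh ξ)
      exact n2_congr_ae (hξ.mono fun t ht => by rw [ht])
    refine ne_top_of_le_ne_top ?_ (lintegral_mono_ae h2)
    rw [lintegral_add_left (measurable_timeNorm _ hheat)]
    refine ENNReal.add_ne_top.2 ⟨ne_top_of_le_ne_top hfin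
      (lintegral_mono fun ξ => timeNorm_mono hsub _ ξ), ?_⟩
    exact (lintegral_timeNorm_duh_lt_top (measurableSet_timeInterval T₁)
      (fun t ht => Ioc_subset_timeInterval ht) hz₁.meas hz₁.sq).ne
  have key := mild_unique (T := T₁) rfl hz₁.meas hz.meas hfin₁
    (ne_top_of_le_ne_top hm.finite.ne (lintegral_mono fun ξ => timeNorm_mono hsub z ξ))
    ((mul_le_mul_right (lintegral_mono fun ξ => timeNorm_mono hsub z ξ) _).trans hsmall) hmild
    fun t ht => hm.eq.mono fun ξ h => h t (hsub ht)
  intro t ht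
  constructor
  · exact (hz₁.ft_fst t ht).ext (hz.ft_fst t (hsub ht)) ((key t ht).mono fun ξ h => congrArg
      Prod.fst h)
  · exact (hz₁.ft_snd t ht).ext (hz.ft_snd t (hsub ht)) ((key t ht).mono fun ξ h => congrArg
      Prod.snd h)

end

section

variable {d : ℕ} {T : ℝ≥0∞} {φ : Space d → ℂ} {z₀ : Space d → Pair d} {u₀ b₀ : TField d}

/-! ### The lifespan -/

lemma timeInterval_ofReal {T' : ℝ} (hT : 0 ≤ T') : timeInterval (ENNReal.ofReal T') = Icc 0 T' := by
  ext t
  exact and_congr_right fun _ => ENNReal.ofReal_le_ofReal_iff hT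

lemma lintegral_exp_Icc {a T' : ℝ} (ha : 0 < a) (hT : 0 ≤ T') :
    ∫⁻ t in Icc 0 T', ENNReal.ofReal (Real.exp (-(a * t)))
      = ENNReal.ofReal ((1 - Real.exp (-(a * T'))) / a) := by
  have hc : Continuous fun t : ℝ => Real.exp (-(a * t)) := by fun_prop
  rw [← ofReal_integral_eq_lintegral_ofReal (hc.continuousOn.integrableOn_compact isCompact_Icc)
    (Eventually.of_forall fun t => (Real.exp_pos _).le), integral_Icc_eq_integral_Ioc,
    ← intervalIntegral.integral_of_le hT]
  congr 1
  have hd : ∀ t : ℝ, HasDerivAt (fun t => -(Real.exp (-(a * t)) / a)) (Real.exp (-(a * t))) t := by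
    intro t
    have h1 : HasDerivAt (fun t : ℝ => -(a * t)) (-a) t := by
      simp only [← neg_mul]
      exact ((hasDerivAt_id' t).const_mul (-a)).congr_deriv (mul_one _)
    refine ((h1.exp.div_const a).neg).congr_deriv ?_
    field_simp
  rw [intervalIntegral.integral_eq_sub_of_hasDerivAt (fun t _ => hd t)
    (hc.intervalIntegrable _ _)]
  simp
  ring

/-- On the support of a dyadic block, the heat flow over `[0,T']` gains one derivative and the
factor which measures the lifespan. -/
lemma timeNorm_heat_block_le {T' : ℝ} (hT : 0 ≤ T') {k : ℤ} {ξ : Space d}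
    (h1 : (2 : ℝ) ^ (k - 1) ≤ ‖ξ‖) (h2 : ‖ξ‖ ≤ 2 ^ (k + 1)) :
    timeNorm (timeInterval (ENNReal.ofReal T')) (heat nu z₀) ξ
      ≤ ENNReal.ofReal (√(2 / nu)) * 2 ^ ((k : ℝ) * (-1)) *
        ENNReal.ofReal (√(1 - Real.exp (-(8 * nu * (2 : ℝ) ^ (2 * k) * T')))) * ‖z₀ ξ‖ₑ := by
  have hν := nu_pos
  have hk : (0 : ℝ) < 2 ^ k := by positivity
  have e1 : (2 : ℝ) ^ (k - 1) = 2 ^ k / 2 := by rw [zpow_sub₀ (by norm_num)]; norm_num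
  have e2 : (2 : ℝ) ^ (k + 1) = 2 ^ k * 2 := by rw [zpow_add₀ (by norm_num)]; norm_num
  have e3 : (2 : ℝ) ^ (2 * k) = (2 ^ k) ^ 2 := by rw [mul_comm, zpow_mul, zpow_ofNat]
  rw [e1] at h1
  rw [e2] at h2
  have hn : 0 < ‖ξ‖ := lt_of_lt_of_le (by positivity) h1
  set a : ℝ := 2 * (nu * ‖ξ‖ ^ 2) with ha
  have ha0 : 0 < a := by positivity
  have e : ∀ t, ‖heat nu z₀ t ξ‖ₑ
      = ‖z₀ ξ‖ₑ * ENNReal.ofReal (Real.exp (-(nu * ‖ξ‖ ^ 2 * t))) := by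
    intro t
    rw [heat, enorm_smul, Real.enorm_of_nonneg (Real.exp_pos _).le, mul_comm]
  have e4 : (2 : ℝ≥0∞) ^ ((k : ℝ) * (-1)) = ENNReal.ofReal ((2 : ℝ) ^ k)⁻¹ := by
    rw [← zpow_neg, ofReal_two_zpow]; simp
  set X : ℝ := 1 - Real.exp (-(8 * nu * (2 : ℝ) ^ (2 * k) * T')) with hX
  have hX0 : 0 ≤ X := by
    rw [hX, sub_nonneg]
    exact Real.exp_le_one_iff.2 (by rw [neg_nonpos]; positivity)
  simp only [timeNorm, e]
  rw [n2_const_mul _ (by finiteness), mul_comm _ ‖z₀ ξ‖ₑ, e4,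
    ← ENNReal.ofReal_mul (by positivity), ← ENNReal.ofReal_mul (by positivity)]
  gcongr
  rw [n2_le_iff]
  have e5 : ∀ t, ENNReal.ofReal (Real.exp (-(nu * ‖ξ‖ ^ 2 * t))) ^ 2
      = ENNReal.ofReal (Real.exp (-(a * t))) := by
    intro t
    rw [← ENNReal.ofReal_pow (Real.exp_pos _).le, ← Real.exp_nat_mul]
    congr 2; push_cast; rw [ha]; ring
  simp only [e5]
  rw [timeInterval_ofReal hT, lintegral_exp_Icc ha0 hT, ← ENNReal.ofReal_pow (by positivity)]
  refine ENNReal.ofReal_le_ofReal ?_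
  rw [mul_pow, mul_pow, Real.sq_sqrt (by positivity), Real.sq_sqrt hX0]
  -- upper bound of the frequency for the decay factor, lower bound for the gain of a derivative
  have h3 : 1 - Real.exp (-(a * T')) ≤ X := by
    rw [hX]
    refine sub_le_sub_left (Real.exp_le_exp.2 (neg_le_neg ?_)) 1
    refine mul_le_mul_of_nonneg_right ?_ hT
    rw [ha, e3]
    have : ‖ξ‖ ^ 2 ≤ (2 ^ k * 2) ^ 2 := pow_le_pow_left₀ hn.le h2 2
    nlinarith
  have h4 : a⁻¹ ≤ 2 / nu * ((2 : ℝ) ^ k)⁻¹ ^ 2 := by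
    have h5 : nu * (2 ^ k) ^ 2 / 2 ≤ a := by
      rw [ha]
      have : (2 ^ k / 2) ^ 2 ≤ ‖ξ‖ ^ 2 := pow_le_pow_left₀ (by positivity) h1 2
      nlinarith
    refine (inv_anti₀ (by positivity) h5).trans (le_of_eq ?_)
    field_simp
  rw [div_eq_mul_inv, mul_comm]
  exact mul_le_mul h4 h3 (by
    rw [sub_nonneg]
    exact Real.exp_le_one_iff.2 (by rw [neg_nonpos]; positivity)) (by positivity)

/-- The sum which measures the lifespan controls the heat flow of the data on the Fourier side. -/
lemma lintegral_timeNorm_heat_le (d : ℕ) [NeZero d] : ∃ K : ℝ≥0∞, K ≠ ⊤ ∧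
    ∀ (φ : Space d → ℂ) (z₀ : Space d → Pair d) (u₀ b₀ : TField d), IsLittlewoodPaley φ →
      Measurable z₀ → IsFT u₀ (fun ξ => (z₀ ξ).1) → IsFT b₀ (fun ξ => (z₀ ξ).2) →
      ∀ T' : ℝ, 0 ≤ T' → ∫⁻ ξ, timeNorm (timeInterval (ENNReal.ofReal T')) (heat nu z₀) ξ
        ≤ K * lifespanSum φ (8 * nu) T' u₀ b₀ := by
  obtain ⟨C, hC, hsupp⟩ := lintegral_le_of_support d
  refine ⟨ENNReal.ofReal (√(2 / nu)) * C, by finiteness,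
    fun φ z₀ u₀ b₀ hφ hz₀ hu₀ hb₀ T' hT => ?_⟩
  set N := timeNorm (timeInterval (ENNReal.ofReal T')) (heat nu z₀)
  have hNm : Measurable N := measurable_timeNorm _ (measurable_heat hz₀)
  have hdm : ∀ k, Measurable (dil φ k) := fun k => (hφ.contDiff_dil k).continuous.measurable
  -- insert the partition of unity, and use the Cauchy-Schwarz inequality on each block
  calc ∫⁻ ξ, N ξ ≤ ∫⁻ ξ, ∑' k, ‖dil φ k ξ‖ₑ * N ξ := by
        refine lintegral_mono_ae ?_
        filter_upwards [compl_mem_ae_iff.2 (measure_singleton (0 : Space d))] with ξ hξ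
        rw [ENNReal.tsum_mul_right]
        exact le_mul_of_one_le_left' (one_le_tsum_dil hφ hξ)
    _ = ∑' k, ∫⁻ ξ, ‖dil φ k ξ‖ₑ * N ξ :=
        lintegral_tsum fun k => ((hdm k).enorm.mul hNm).aemeasurable
    _ ≤ ∑' k : ℤ, ENNReal.ofReal (√(2 / nu)) * C * (2 ^ ((k : ℝ) * ((d : ℝ) / 2 - 1)) *
          ENNReal.ofReal (√(1 - Real.exp (-(8 * nu * (2 : ℝ) ^ (2 * k) * T')))) *
          (l2Norm (block φ k u₀) + l2Norm (block φ k b₀))) := ?_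
    _ = _ := by rw [ENNReal.tsum_mul_left, lifespanSum]
  refine ENNReal.tsum_le_tsum fun k => ?_
  set E := ENNReal.ofReal (√(1 - Real.exp (-(8 * nu * (2 : ℝ) ^ (2 * k) * T'))))
  set R := ENNReal.ofReal (√(2 / nu))
  have hfin : R * 2 ^ ((k : ℝ) * (-1)) * E ≠ ⊤ :=
    ENNReal.mul_ne_top (ENNReal.mul_ne_top (by simp [R]) (two_rpow_ne_top _)) (by simp [E])
  calc ∫⁻ ξ, ‖dil φ k ξ‖ₑ * N ξ
      ≤ ∫⁻ ξ, R * 2 ^ ((k : ℝ) * (-1)) * E * (‖dil φ k ξ‖ₑ * ‖z₀ ξ‖ₑ) := by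
        refine lintegral_mono fun ξ => ?_
        rcases eq_or_ne (dil φ k ξ) 0 with h0 | h0
        · simp [h0]
        · obtain ⟨h1, h2⟩ := hφ.norm_of_ne_zero h0
          refine (mul_le_mul_right (timeNorm_heat_block_le hT h1 h2) _).trans (le_of_eq ?_)
          ring
    _ = R * 2 ^ ((k : ℝ) * (-1)) * E * ∫⁻ ξ, ‖dil φ k ξ‖ₑ * ‖z₀ ξ‖ₑ :=
        lintegral_const_mul' _ _ hfin
    _ ≤ R * 2 ^ ((k : ℝ) * (-1)) * E * (C * 2 ^ ((k : ℝ) * (d / 2)) *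
          n2 volume fun ξ => ‖dil φ k ξ‖ₑ * ‖z₀ ξ‖ₑ) := by
        gcongr
        refine hsupp k _ ((hdm k).enorm.mul hz₀.enorm).aemeasurable fun ξ hξ => ?_
        refine (hφ.norm_of_ne_zero fun h0 => hξ ?_).2
        simp [h0]
    _ ≤ R * 2 ^ ((k : ℝ) * (-1)) * E * (C * 2 ^ ((k : ℝ) * (d / 2)) *
          (l2Norm (block φ k u₀) + l2Norm (block φ k b₀))) := by
        gcongr
        rw [(hu₀.block hφ k).l2Norm_eq, (hb₀.block hφ k).l2Norm_eq]
        have m1 : Measurable fun ξ => ‖dil φ k ξ • (z₀ ξ).1‖ₑ := ((hdm k).smul hz₀.fst).enorm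
        have m2 : Measurable fun ξ => ‖dil φ k ξ • (z₀ ξ).2‖ₑ := ((hdm k).smul hz₀.snd).enorm
        refine (n2_mono fun ξ => ?_).trans (n2_add_le m1.aemeasurable m2.aemeasurable)
        rw [enorm_smul, enorm_smul, ← mul_add]
        gcongr
        exact enorm_pair_le _
    _ = _ := by
        rw [show (k : ℝ) * ((d : ℝ) / 2 - 1) = (k : ℝ) * (-1) + (k : ℝ) * (d / 2) by ring,
          two_rpow_add]
        ring

/-- Dominated convergence for the sum over the dyadic blocks. -/
lemma tendsto_lifespanSum (c : ℝ)
    (hu : MemBesov φ ((d : ℝ) / 2 - 1) u₀) (hb : MemBesov φ ((d : ℝ) / 2 - 1) b₀) :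
    Tendsto (fun n : ℕ => lifespanSum φ c (1 / ((n : ℝ) + 1)) u₀ b₀) atTop (𝓝 0) := by
  set G : ℤ → ℝ≥0∞ := fun k => 2 ^ ((k : ℝ) * ((d : ℝ) / 2 - 1)) *
    (l2Norm (block φ k u₀) + l2Norm (block φ k b₀)) with hG
  have hGs : ∑' k, G k = besovNorm φ ((d : ℝ) / 2 - 1) u₀ + besovNorm φ ((d : ℝ) / 2 - 1) b₀ := by
    simp only [hG, mul_add]
    exact ENNReal.tsum_add
  have hGt : ∑' k, G k ≠ ⊤ := by
    rw [hGs]; exact ENNReal.add_ne_top.2 ⟨hu.2.ne, hb.2.ne⟩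
  have hE : ∀ (k : ℤ) (T' : ℝ), 0 ≤ T' →
      ENNReal.ofReal (√(1 - Real.exp (-(c * (2 : ℝ) ^ (2 * k) * T')))) ≤ 1 := by
    intro k T' hT
    rw [ENNReal.ofReal_le_one, Real.sqrt_le_one]
    linarith [Real.exp_pos (-(c * (2 : ℝ) ^ (2 * k) * T'))]
  have h1 := tendsto_lintegral_of_dominated_convergence (μ := Measure.count) (f := fun _ : ℤ => 0)
    (F := fun (n : ℕ) (k : ℤ) => (2 : ℝ≥0∞) ^ ((k : ℝ) * ((d : ℝ) / 2 - 1)) *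
      ENNReal.ofReal (√(1 - Real.exp (-(c * (2 : ℝ) ^ (2 * k) * (1 / ((n : ℝ) + 1)))))) *
      (l2Norm (block φ k u₀) + l2Norm (block φ k b₀))) G
    (fun n => Measurable.of_discrete) (fun n => Eventually.of_forall fun k => ?_)
    (by rwa [lintegral_count]) (Eventually.of_forall fun k => ?_)
  · simp only [lintegral_count, tsum_zero] at h1
    exact h1
  · simp only [hG]
    rw [mul_assoc]
    gcongr
    exact mul_le_of_le_one_left' (hE k _ (by positivity))
  · have hcont : Continuous fun T' : ℝ =>
        ENNReal.ofReal (√(1 - Real.exp (-(c * (2 : ℝ) ^ (2 * k) * T')))) :=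
      ENNReal.continuous_ofReal.comp (by fun_prop)
    have h2 := (hcont.tendsto 0).comp (tendsto_one_div_add_atTop_nhds_zero_nat (𝕜 := ℝ))
    simp only [mul_zero, neg_zero, Real.exp_zero, sub_self, Real.sqrt_zero,
      ENNReal.ofReal_zero] at h2
    have h3 : G k ≠ ⊤ := ne_top_of_le_ne_top hGt (ENNReal.le_tsum k)
    have h4 := ENNReal.Tendsto.const_mul h2 (Or.inr h3) (a := G k)
    rw [mul_zero] at h4
    refine h4.congr fun n => ?_
    simp only [hG, Function.comp_apply]
    ring

/-- Bounds on the norms over time intervals pass to the supremum of the times. -/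
lemma lintegral_timeNorm_le_of_sSup {S : Set ℝ≥0∞} (hS : S.Nonempty) {K : ℝ≥0∞}
    {f : ℝ → Space d → Pair d} (hf : Measurable (Function.uncurry f))
    (h : ∀ t ∈ S, ∫⁻ ξ, timeNorm (timeInterval t) f ξ ≤ K) :
    ∫⁻ ξ, timeNorm (timeInterval (sSup S)) f ξ ≤ K := by
  obtain ⟨t, htm, htl, htS⟩ := exists_seq_tendsto_sSup hS (OrderTop.bddAbove S)
  have hmono : Monotone fun n => timeInterval (t n) := fun m n hmn s hs =>
    ⟨hs.1, hs.2.trans (htm hmn)⟩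
  -- the intervals exhaust the limit interval up to its endpoint
  have hae : timeInterval (sSup S) ≤ᵐ[volume] ⋃ n, timeInterval (t n) := by
    have hne : ∀ᵐ s : ℝ, s ≠ (sSup S).toReal := by simp [ae_iff, measure_singleton]
    filter_upwards [hne] with s hs hsT
    have h1 : ENNReal.ofReal s < sSup S := by
      refine lt_of_le_of_ne hsT.2 fun h1 => hs ?_
      rw [← h1, ENNReal.toReal_ofReal hsT.1]
    obtain ⟨n, hn⟩ := (htl.eventually (lt_mem_nhds h1)).exists
    exact mem_iUnion.2 ⟨n, hsT.1, hn.le⟩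
  have hle : ∀ ξ, timeNorm (timeInterval (sSup S)) f ξ
      ≤ timeNorm (⋃ n, timeInterval (t n)) f ξ := fun ξ =>
    ENNReal.rpow_le_rpow (lintegral_mono' (Measure.restrict_mono' hae le_rfl) le_rfl) (by norm_num)
  have hlim : ∀ ξ, Tendsto (fun n => timeNorm (timeInterval (t n)) f ξ) atTop
      (𝓝 (timeNorm (⋃ n, timeInterval (t n)) f ξ)) := fun ξ => by
    refine Tendsto.ennrpow_const (1 / 2 : ℝ) ?_
    rw [setLIntegral_iUnion_of_directed _ hmono.directed_le]
    exact tendsto_atTop_iSup fun m n hmn => lintegral_mono_set (hmono hmn)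
  refine (lintegral_mono hle).trans ?_
  have h2 := lintegral_tendsto_of_tendsto_of_monotone (μ := (volume : Measure (Space d)))
    (fun n => (measurable_timeNorm (timeInterval (t n)) hf).aemeasurable)
    (Eventually.of_forall fun ξ m n hmn => timeNorm_mono (hmono hmn) f ξ)
    (Eventually.of_forall hlim)
  exact le_of_tendsto' h2 fun n => h _ (htS n)

/-- Data in the critical space have a Fourier transform, which is a function with the symmetries
of real divergence free fields. -/
lemma exists_initial [NeZero d] (hφ : IsLittlewoodPaley φ) (hd : 0 ≤ (d : ℝ) / 2 - 1)
    (hur : IsRealField u₀) (hbr : IsRealField b₀) (hud : IsDivFree u₀) (hbd : IsDivFree b₀)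
    (hu : MemBesov φ ((d : ℝ) / 2 - 1) u₀) (hb : MemBesov φ ((d : ℝ) / 2 - 1) b₀) :
    ∃ z₀ : Space d → Pair d, Measurable z₀ ∧ IsFT u₀ (fun ξ => (z₀ ξ).1) ∧
      IsFT b₀ (fun ξ => (z₀ ξ).2) ∧ HermP z₀ ∧ (∀ᵐ ξ, Transversal ξ (z₀ ξ)) ∧
      ∀ s, MemBesov φ s u₀ → MemBesov φ s b₀ → bs s (fun ξ => ‖z₀ ξ‖ₑ) < ⊤ := by
  obtain ⟨g, hg⟩ := exists_isFT_of_memBesov hφ hd (by linarith) hu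
  obtain ⟨k, hk⟩ := exists_isFT_of_memBesov hφ hd (by linarith) hb
  have hgm := hg.tame.meas.aemeasurable
  have hkm := hk.tame.meas.aemeasurable
  have hg' := hg.congr hgm.ae_eq_mk
  have hk' := hk.congr hkm.ae_eq_mk
  refine ⟨fun ξ => (hgm.mk g ξ, hkm.mk k ξ), hgm.measurable_mk.prodMk hkm.measurable_mk, hg', hk',
    ?_, ?_, fun s hus hbs => ?_⟩
  · filter_upwards [hg'.isRealField_iff.1 hur, hk'.isRealField_iff.1 hbr] with ξ h1 h2
    exact Prod.ext (PiLp.ext h1) (PiLp.ext h2)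
  · filter_upwards [hg'.isDivFree_iff.1 hud, hk'.isDivFree_iff.1 hbd] with ξ h1 h2
    exact ⟨h1, h2⟩
  · refine (bs_mono_ae (Eventually.of_forall fun ξ => enorm_pair_le _) s).trans_lt
      ((bs_add_le hgm.measurable_mk.enorm hkm.measurable_mk.enorm s).trans_lt ?_)
    exact ENNReal.add_lt_top.2 ⟨(memBesov_iff hφ hg' s).1 hus, (memBesov_iff hφ hk' s).1 hbs⟩

end

end MHD

end

theorem propositionB1 (d : ℕ) (hd : d = 2 ∨ d = 3) :
    ∃ c : ℝ, 0 < c ∧ ∃ C : ℝ, 0 < C ∧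
      ∀ φ : MHD.Space d → ℂ, MHD.IsLittlewoodPaley φ →
      ∀ α : ℝ, 0 ≤ α →
      ∀ u₀ b₀ : MHD.TField d,
        MHD.IsRealField u₀ → MHD.IsRealField b₀ →
        MHD.IsDivFree u₀ → MHD.IsDivFree b₀ →
        MHD.MemBesov φ ((d : ℝ) / 2 - 1) u₀ → MHD.MemBesov φ ((d : ℝ) / 2 + α - 1) u₀ →
        MHD.MemBesov φ ((d : ℝ) / 2 - 1) b₀ → MHD.MemBesov φ ((d : ℝ) / 2 + α - 1) b₀ →
        ∃ T : ℝ≥0∞, 0 < T ∧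
          sSup (ENNReal.ofReal ''
            {T' : ℝ | 0 < T' ∧ MHD.lifespanSum φ c T' u₀ b₀ ≤ ENNReal.ofReal C}) ≤ T ∧
          ∃ u b : ℝ → MHD.TField d,
            MHD.IsSolution T u₀ b₀ u b ∧
            MHD.MemF φ T ((d : ℝ) / 2) u b ∧ MHD.MemF φ T ((d : ℝ) / 2 + α) u b ∧
            ∀ T₁ : ℝ≥0∞, 0 < T₁ → T₁ ≤ T → ∀ u₁ b₁ : ℝ → MHD.TField d,
              MHD.IsSolution T₁ u₀ b₀ u₁ b₁ →
              MHD.MemF φ T₁ ((d : ℝ) / 2) u₁ b₁ → MHD.MemF φ T₁ ((d : ℝ) / 2 + α) u₁ b₁ →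
              ∀ t ∈ MHD.timeInterval T₁, u₁ t = u t ∧ b₁ t = b t := by
  have hd' : 0 ≤ (d : ℝ) / 2 - 1 := by rcases hd with rfl | rfl <;> norm_num
  have : NeZero d := ⟨by rcases hd with rfl | rfl <;> norm_num⟩
  obtain ⟨K, hK, hheat⟩ := MHD.lintegral_timeNorm_heat_le d
  set M : ℝ≥0∞ := 4 * MHD.kap MHD.nu MHD.symK * K with hM
  have hMt : M ≠ ⊤ := by
    have : MHD.kap MHD.nu MHD.symK ≠ ⊤ := MHD.kap_ne_top
    finiteness
  -- the constant for which the heat flow meets the smallness condition of the fixed point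
  have hC : M * ENNReal.ofReal (2 * (M.toReal + 1))⁻¹ ≤ 2⁻¹ := by
    have h0 : 0 ≤ M.toReal := ENNReal.toReal_nonneg
    rw [← ENNReal.ofReal_toReal hMt, ENNReal.toReal_ofReal h0, ← ENNReal.ofReal_mul h0,
      ← ENNReal.ofReal_ofNat 2, ← ENNReal.ofReal_inv_of_pos two_pos]
    refine ENNReal.ofReal_le_ofReal ?_
    rw [← div_eq_mul_inv, div_le_iff₀ (by positivity)]
    linarith
  refine ⟨8 * MHD.nu, mul_pos (by norm_num) MHD.nu_pos, (2 * (M.toReal + 1))⁻¹,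
    by have : 0 ≤ M.toReal := ENNReal.toReal_nonneg
       positivity, ?_⟩
  intro φ hφ α hα u₀ b₀ hur hbr hud hbd hu huα hb hbα
  have hC0 : 0 < ENNReal.ofReal (2 * (M.toReal + 1))⁻¹ := by
    have : 0 ≤ M.toReal := ENNReal.toReal_nonneg
    rw [ENNReal.ofReal_pos]
    positivity
  -- the Fourier transform of the data
  obtain ⟨z₀, hz₀, hu₀, hb₀, hherm, htr, hbs⟩ :=
    MHD.exists_initial hφ hd' hur hbr hud hbd hu hb
  set S := ENNReal.ofReal '' {T' : ℝ | 0 < T' ∧ MHD.lifespanSum φ (8 * MHD.nu) T' u₀ b₀ ≤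
    ENNReal.ofReal (2 * (M.toReal + 1))⁻¹} with hS
  -- the set of admissible times is not empty
  obtain ⟨n, hn⟩ := ((MHD.tendsto_lifespanSum (8 * MHD.nu) hu hb).eventually
    (ge_mem_nhds hC0)).exists
  have hnS : ENNReal.ofReal (1 / ((n : ℝ) + 1)) ∈ S := ⟨_, ⟨by positivity, hn⟩, rfl⟩
  have hheat' : ∫⁻ ξ, MHD.timeNorm (MHD.timeInterval (sSup S)) (MHD.heat MHD.nu z₀) ξ
      ≤ K * ENNReal.ofReal (2 * (M.toReal + 1))⁻¹ := by
    refine MHD.lintegral_timeNorm_le_of_sSup ⟨_, hnS⟩ (MHD.measurable_heat hz₀) ?_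
    rintro _ ⟨T', ⟨hT', hle⟩, rfl⟩
    exact (hheat φ z₀ u₀ b₀ hφ hz₀ hu₀ hb₀ T' hT'.le).trans (by gcongr)
  have hfin : ∫⁻ ξ, MHD.timeNorm (MHD.timeInterval (sSup S)) (MHD.heat MHD.nu z₀) ξ ≠ ⊤ :=
    ne_top_of_le_ne_top (by finiteness) hheat'
  have hsmall : 4 * MHD.kap MHD.nu MHD.symK *
      ∫⁻ ξ, MHD.timeNorm (MHD.timeInterval (sSup S)) (MHD.heat MHD.nu z₀) ξ ≤ 2⁻¹ := by
    refine le_trans ?_ hC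
    rw [hM, mul_assoc (4 * MHD.kap MHD.nu MHD.symK)]
    gcongr
  -- both regularities are obtained from the same solution
  obtain ⟨u, b, z, hsol, hrep, hmild, hz1, hreg⟩ :=
    MHD.exists_solution hφ hd' hz₀ hu₀ hb₀ hherm htr (hbs _ hu hb) hfin hsmall
  refine ⟨sSup S, lt_of_lt_of_le (ENNReal.ofReal_pos.2 (by positivity)) (le_sSup hnS), le_rfl,
    u, b, hsol, ?_, ?_, fun T₁ _ hT u₁ b₁ h₁ hF _ =>
      MHD.IsSolution.unique hφ hd' hu₀ hb₀ hz₀ hfin hrep hmild hz1 hT h₁ hF⟩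
  · have h := hreg _ hd' (hbs _ hu hb)
    rw [show (d : ℝ) / 2 - 1 + 2 = (d : ℝ) / 2 + 1 by ring] at h
    exact h
  · have h := hreg _ (by linarith) (hbs _ huα hbα)
    rw [show (d : ℝ) / 2 + α - 1 + 2 = (d : ℝ) / 2 + α + 1 by ring] at h
    exact h
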